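/- Let $\kappa>0$, let $u_0(x)=-2\kappa^2\operatorname{sech}^2(\kappa x)$ be the KPII one-line soliton, and for $\lambda\in\mathbb C$, $\lambda\neq i\kappa$, let $$\vartheta_-(x,\lambda)=1+\frac{2i\kappa}{\lambda-i\kappa}\,\frac{1}{1+e^{2\kappa x}} .$$ There is a constant $\varepsilon>0$, depending only on $\kappa$, such that the following holds. Let $v_0:\mathbb R^2\to\mathbb R$ be such that the distributional derivatives $\partial_y^j\partial_x^kv_0$ belong to $L^1(\mathbb R^2)\cap L^\infty(\mathbb R^2)$ for all $0\le j,k\le 2$, and $\|v_0\|_{L^1}+\|v_0\|_{L^\infty}\le\varepsilon$. Then for every $\lambda\in\mathbb C$ with $\lambda\ne\pm i\kappa$ there is a unique (up to equality almost everywhere) measurable function $m(x,y)=m(x,y,\lambda)$ such that $\Psi(x,y,\lambda)=m(x,y,\lambda)\,e^{-i\lambda x-\lambda^2y}$ is a locally integrable solution, in the sense of distributions, of $$\bigl(\partial_y-\partial_x^2+u_0(x)+v_0(x,y)\bigr)\Psi=0\quad\text{on }\mathbb R^2$$ and $$m(x,y,\lambda)-\vartheta_-(x,\lambda)\to0\quad\text{as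 }(x,y)\to\infty$$ (outside a null set). Moreover $\partial_y^j\partial_x^km\in L^\infty(\mathbb R^2)$ for all $0\le j,k\le2$, the derivatives being taken in the sense of distributions. -/

import Mathlib

open MeasureTheory Filter Topology

noncomputable section

namespace KPII

/-- The partial derivative with respect to the first variable `x`. -/
def dx (φ : ℝ × ℝ → ℝ) : ℝ × ℝ → ℝ := fun p => deriv (fun s => φ (s, p.2)) p.1

/-- The partial derivative with respect to the second variable `y`. -/
def dy (φ : ℝ × ℝ → ℝ) : ℝ × ℝ → ℝ := fun p => deriv (fun s => φ (p.1, s)) p.2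

/-- Real test functions on the plane: smooth with compact support. -/
def IsTest (φ : ℝ × ℝ → ℝ) : Prop := ContDiff ℝ ((⊤ : ℕ∞) : WithTop ℕ∞) φ ∧ HasCompactSupport φ

/-- `g` is the mixed derivative `∂_y ^ j ∂_x ^ k f` in the sense of distributions on the plane. -/
structure HasWeakPartial {E : Type*} [NormedAddCommGroup E] [NormedSpace ℝ E]
    (j k : ℕ) (f g : ℝ × ℝ → E) : Prop where
  locInt_left : LocallyIntegrable f volume
  locInt_right : LocallyIntegrable g volume
  integral_eq : ∀ φ : ℝ × ℝ → ℝ, IsTest φ →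
    ∫ p, (dy^[j] (dx^[k] φ)) p • f p = (-1 : ℝ) ^ (j + k) • ∫ p, φ p • g p

/-- The one-line soliton `u₀(x) = -2 κ² sech² (κ x)`. -/
def u0 (κ x : ℝ) : ℝ := -2 * κ ^ 2 / Real.cosh (κ * x) ^ 2

/-- `ϑ₋(x, lam) = 1 + (2 i κ / (lam - i κ)) / (1 + e ^ (2 κ x))`. -/
def thetaMinus (κ x : ℝ) (lam : ℂ) : ℂ :=
  1 + 2 * Complex.I * κ / (lam - Complex.I * κ) * (1 / (1 + Complex.exp (2 * κ * x)))

/-- The exponential `e ^ ((-i lam) x + (-i lam)² y)`. -/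
def planeWave (lam : ℂ) (p : ℝ × ℝ) : ℂ :=
  Complex.exp (-Complex.I * lam * p.1 + (-Complex.I * lam) ^ 2 * p.2)

/-- `Ψ` solves `(∂_y - ∂_x² + u₀(x) + v₀(x, y)) Ψ = 0` in the sense of distributions. -/
structure SolvesSpectralEq (κ : ℝ) (v₀ : ℝ × ℝ → ℝ) (Ψ : ℝ × ℝ → ℂ) : Prop where
  locInt : LocallyIntegrable Ψ volume
  integral_eq_zero : ∀ φ : ℝ × ℝ → ℝ, IsTest φ →
    ∫ p, (-dy φ p - dx (dx φ) p + (u0 κ p.1 + v₀ p) * φ p) • Ψ p = 0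

/-- The boundary condition for `m`: `m(x, y) - ϑ₋(x, lam) → 0` as `(x, y) → ∞` in the plane.
Functions are considered up to null sets, so the limit is taken off a null set. -/
def BoundaryCondition (κ : ℝ) (lam : ℂ) (m : ℝ × ℝ → ℂ) : Prop :=
  Tendsto (fun p => m p - thetaMinus κ p.1 lam) (cocompact (ℝ × ℝ) ⊓ ae volume) (𝓝 0)

/-- `m * planeWave lam` is a solution of the spectral equation, with the boundary condition. -/
def IsEigenfunction (κ : ℝ) (v₀ : ℝ × ℝ → ℝ) (lam : ℂ) (m : ℝ × ℝ → ℂ) : Prop :=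
  SolvesSpectralEq κ v₀ (fun p => m p * planeWave lam p) ∧ BoundaryCondition κ lam m

end KPII

end

/-! Writing Ψ = m e^{-iλx-λ²y} removes the exponential: m has to solve (∂_y - ∂_x² + 2iλ∂_x + u₀ +
v₀)m = 0 with m - ϑ₋ → 0, and ϑ₋ solves the same equation with v₀ = 0. If G inverts the operator
with potential u₀ alone and produces functions vanishing at infinity, the problem becomes the
integral equation m = ϑ₋ - G(v₀m). Everything rests on a bound for the kernel of G that is uniform
in λ.

The kernel is a superposition of generalized eigenfunctions of -∂_x² + 2iλ∂_x + u₀. The real part of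
the eigenvalue with parameter t is t² - (Re λ)²; modes with |t| > |Re λ| are propagated forward in y
and the others backward, so that no factor exceeds 1. Applied to such a kernel, the operator leaves
only the jump across y = 0 (`fundamental_identity`), and completeness of the modes turns it into a
delta function. With p = t + i Im λ the modes have amplitude (p - iκ tanh κx)(p + iκ tanh κx')/(p² +
κ²). For Im λ ≥ 0 the line of integration passes above iκ, through it or below it; a backward
bound-state term `greenD` with weight 0, 1/2 or 1 restores completeness (`integral_green`). The case
Im λ < 0 follows by reflection in x.

Pairing t with -t turns the kernel into oscillatory integrals in Z = x - x' + 2 Im λ (y - y'). Their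
pole terms are integrals of sin(tZ)/t and of Cauchy kernels against monotone weights. Abel's
inequality (`norm_integral_weight_le`) bounds them independently of the distance from the pole to
the line. Hence |G| ≤ 2 + 34κ + `prof`, where `prof` is an inverse square root singularity of total
mass 16 (`norm_green_le`, `integral_prof`). The operator G therefore maps L¹ ∩ L^∞ to L^∞ with
constants depending only on κ, and for small v₀ the integral equation is a contraction
(`norm_gop_mul_le`). Decay of the kernel (`van_green`) gives the boundary condition.

For uniqueness, the difference w of two solutions is locally integrable and tends to 0 off a null
set. Representing it twice by the heat kernel makes it bounded (`Sol.exists_bounded_rep`). Then w +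
G(v₀w) is a bounded vanishing solution of the soliton equation. The Darboux transformation ∂_x - iλ
+ κ tanh κx maps it to a free solution, which is zero by a Liouville theorem
(`Sol.eq_zero_of_free`), and the remaining first-order equations force it to vanish as well
(`Sol.eq_zero_of_soliton`). So w = -G(v₀w), and the contraction gives w = 0.

For regularity, the heat kernel with a zeroth-order term that makes it decay has an integrable
x-derivative, so bounded solutions gain one x-derivative. The equation supplies the y-derivatives,
and differentiating it repeatedly gives the rest (`Sol.regularity`). -/

noncomputable section

namespace KPII

open scoped ContDiff

/-! ### Complex test functions and directional derivatives -/

/-- The directional derivative of a function on the plane. -/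
def pd (e : ℝ × ℝ) (Φ : ℝ × ℝ → ℂ) : ℝ × ℝ → ℂ := fun p => fderiv ℝ Φ p e

/-- The first coordinate direction. -/
abbrev ex : ℝ × ℝ := (1, 0)

/-- The second coordinate direction. -/
abbrev ey : ℝ × ℝ := (0, 1)

/-- Complex test functions on the plane. -/
structure CTest (Φ : ℝ × ℝ → ℂ) : Prop where
  smooth : ContDiff ℝ ∞ Φ
  supp : HasCompactSupport Φ

lemma contDiff_pd {Φ : ℝ × ℝ → ℂ} (h : ContDiff ℝ ∞ Φ) (e : ℝ × ℝ) : ContDiff ℝ ∞ (pd e Φ) :=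
  (h.fderiv_right (m := ∞) le_rfl).clm_apply contDiff_const

namespace CTest

variable {Φ Ψ : ℝ × ℝ → ℂ}

lemma pd (h : CTest Φ) (e : ℝ × ℝ) : CTest (pd e Φ) :=
  ⟨contDiff_pd h.smooth e, h.supp.fderiv_apply (𝕜 := ℝ) e⟩

lemma add (h : CTest Φ) (h' : CTest Ψ) : CTest (fun p => Φ p + Ψ p) :=
  ⟨h.smooth.add h'.smooth, h.supp.add h'.supp⟩

lemma smooth_mul {g : ℝ × ℝ → ℂ} (h : CTest Φ) (hg : ContDiff ℝ ∞ g) :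
    CTest (fun p => g p * Φ p) :=
  ⟨hg.mul h.smooth, h.supp.mul_left⟩

lemma const_mul (h : CTest Φ) (c : ℂ) : CTest (fun p => c * Φ p) :=
  h.smooth_mul contDiff_const

lemma neg (h : CTest Φ) : CTest (fun p => -Φ p) := by
  simpa using h.const_mul (-1)

lemma sub (h : CTest Φ) (h' : CTest Ψ) : CTest (fun p => Φ p - Ψ p) := by
  simpa [sub_eq_add_neg] using h.add h'.neg

lemma continuous (h : CTest Φ) : Continuous Φ := h.smooth.continuous

lemma integrable (h : CTest Φ) : Integrable Φ :=
  h.continuous.integrable_of_hasCompactSupport h.supp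

lemma bounded (h : CTest Φ) : ∃ C, ∀ p, ‖Φ p‖ ≤ C :=
  h.continuous.bounded_above_of_compact_support h.supp

lemma differentiable (h : CTest Φ) : Differentiable ℝ Φ := h.smooth.differentiable (by simp)

lemma comp_add (h : CTest Φ) (a : ℝ × ℝ) : CTest (fun p => Φ (p + a)) :=
  ⟨h.smooth.comp (contDiff_id.add contDiff_const),
    h.supp.comp_homeomorph (Homeomorph.addRight a)⟩

lemma comp_sub_left (h : CTest Φ) (a : ℝ × ℝ) : CTest (fun p => Φ (a - p)) :=
  ⟨h.smooth.comp (contDiff_const.sub contDiff_id),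
    h.supp.comp_homeomorph (Homeomorph.subLeft a)⟩

/-- A test function vanishes outside a square. -/
lemma eq_zero_of_large (h : CTest Φ) :
    ∃ M : ℝ, 0 < M ∧ ∀ x y : ℝ, M ≤ |x| ∨ M ≤ |y| → Φ (x, y) = 0 := by
  obtain ⟨M, hM⟩ := h.supp.isBounded.subset_closedBall (0 : ℝ × ℝ)
  refine ⟨max M 0 + 1, by positivity, fun x y hxy => ?_⟩
  by_contra hne
  have := hM (subset_tsupport _ hne)
  rw [mem_closedBall_zero_iff, Prod.norm_def] at this
  simp only [Real.norm_eq_abs, sup_le_iff] at this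
  have h2 := le_max_left M 0
  rcases hxy with h1 | h1 <;> linarith [this.1, this.2]

lemma hasDerivAt_fst (h : CTest Φ) (x y : ℝ) :
    HasDerivAt (fun s => Φ (s, y)) (KPII.pd ex Φ (x, y)) x := by
  have h1 := (h.differentiable (x, y)).hasFDerivAt
  have h2 : HasDerivAt (fun s : ℝ => (s, y)) (ex) x :=
    (hasDerivAt_id x).prodMk (hasDerivAt_const x y)
  exact h1.comp_hasDerivAt x h2

lemma hasDerivAt_snd (h : CTest Φ) (x y : ℝ) :
    HasDerivAt (fun s => Φ (x, s)) (KPII.pd ey Φ (x, y)) y := by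
  have h1 := (h.differentiable (x, y)).hasFDerivAt
  have h2 : HasDerivAt (fun s : ℝ => (x, s)) (ey) y :=
    (hasDerivAt_const y x).prodMk (hasDerivAt_id y)
  exact h1.comp_hasDerivAt y h2

end CTest

lemma pd_comp_add (e a : ℝ × ℝ) (Φ : ℝ × ℝ → ℂ) :
    pd e (fun p => Φ (p + a)) = fun p => pd e Φ (p + a) := by
  ext p; simp [pd, fderiv_comp_add_right]

lemma pd_comp_sub_left (e a : ℝ × ℝ) {Φ : ℝ × ℝ → ℂ} (hΦ : Differentiable ℝ Φ) :
    pd e (fun p => Φ (a - p)) = fun p => -pd e Φ (a - p) := by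
  ext p
  have h2 : HasFDerivAt (fun q : ℝ × ℝ => a - q) (-ContinuousLinearMap.id ℝ (ℝ × ℝ)) p :=
    (hasFDerivAt_id p).const_sub a
  have := ((hΦ (a - p)).hasFDerivAt.comp p h2).fderiv
  change fderiv ℝ (Φ ∘ fun q => a - q) p e = _
  rw [this]; simp [pd]

lemma pd_add (e : ℝ × ℝ) {f g : ℝ × ℝ → ℂ} (hf : Differentiable ℝ f) (hg : Differentiable ℝ g) :
    pd e (fun p => f p + g p) = fun p => pd e f p + pd e g p := by
  ext p; simp [pd, fderiv_fun_add (hf p) (hg p)]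

lemma pd_mul (e : ℝ × ℝ) {f g : ℝ × ℝ → ℂ} (hf : Differentiable ℝ f) (hg : Differentiable ℝ g) :
    pd e (fun p => f p * g p) = fun p => pd e f p * g p + f p * pd e g p := by
  ext p; simp [pd, fderiv_fun_mul (hf p) (hg p)]; ring

lemma pd_const_mul (e : ℝ × ℝ) {f : ℝ × ℝ → ℂ} (hf : Differentiable ℝ f) (c : ℂ) :
    pd e (fun p => c * f p) = fun p => c * pd e f p := by
  ext p; simp [pd, fderiv_const_mul (hf p)]

lemma pd_comm {f : ℝ × ℝ → ℂ} (hf : ContDiff ℝ ∞ f) (a b : ℝ × ℝ) :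
    pd a (pd b f) = pd b (pd a f) := by
  ext p
  have hsym : IsSymmSndFDerivAt ℝ f p :=
    hf.contDiffAt.isSymmSndFDerivAt (by simpa using WithTop.coe_le_coe.2 (le_top (a := (2 : ℕ∞))))
  have hd : DifferentiableAt ℝ (fderiv ℝ f) p :=
    ((hf.fderiv_right (m := ∞) le_rfl).differentiable (by simp)) p
  have h1 : ∀ c d : ℝ × ℝ, pd c (pd d f) p = fderiv ℝ (fderiv ℝ f) p c d := by
    intro c d
    change fderiv ℝ (fun x => fderiv ℝ f x d) p c = _
    rw [fderiv_clm_apply hd (differentiableAt_const d)]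
    simp
  rw [h1, h1]
  exact hsym a b

lemma integral_pd {Φ : ℝ × ℝ → ℂ} (h : CTest Φ) (e : ℝ × ℝ) : ∫ p, pd e Φ p = 0 := by
  have := integral_mul_fderiv_eq_neg_fderiv_mul_of_integrable (𝕜 := ℂ) (μ := volume)
    (f := fun _ : ℝ × ℝ => (1 : ℂ)) (g := Φ) (v := e)
    (by simp) (by simp only [one_mul]; exact (h.pd e).integrable) (by simpa using h.integrable)
    (fun _ _ => differentiableAt_const _) (fun _ _ => h.differentiable _)
  simpa [pd] using this

lemma integral_mul_pd {f Φ : ℝ × ℝ → ℂ} (hf : ContDiff ℝ ∞ f) (h : CTest Φ) (e : ℝ × ℝ) :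
    ∫ p, f p * pd e Φ p = -∫ p, pd e f p * Φ p := by
  have h1 := integral_pd (h.smooth_mul hf) e
  rw [pd_mul e (hf.differentiable (by simp)) h.differentiable,
    integral_add ((h.smooth_mul (contDiff_pd hf e)).integrable)
      (((h.pd e).smooth_mul hf).integrable)] at h1
  exact eq_neg_of_add_eq_zero_right h1

/-! ### Bounded measurable functions, weak derivatives, weak solutions -/

/-- Bounded measurable functions. -/
structure BM (f : ℝ × ℝ → ℂ) : Prop where
  meas : Measurable f
  bdd : ∃ C, ∀ p, ‖f p‖ ≤ C

namespace BM

variable {f g : ℝ × ℝ → ℂ}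

lemma nonneg_bound (h : BM f) : ∃ C, 0 ≤ C ∧ ∀ p, ‖f p‖ ≤ C :=
  let ⟨C, hC⟩ := h.bdd
  ⟨C, (norm_nonneg _).trans (hC 0), hC⟩

lemma const (c : ℂ) : BM fun _ => c := ⟨measurable_const, ‖c‖, fun _ => le_rfl⟩

lemma add (hf : BM f) (hg : BM g) : BM fun p => f p + g p := by
  obtain ⟨C, hC⟩ := hf.bdd
  obtain ⟨D, hD⟩ := hg.bdd
  exact ⟨hf.meas.add hg.meas, C + D, fun p => (norm_add_le _ _).trans (add_le_add (hC p) (hD p))⟩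

lemma mul (hf : BM f) (hg : BM g) : BM fun p => f p * g p := by
  obtain ⟨C, h0, hC⟩ := hf.nonneg_bound
  obtain ⟨D, hD⟩ := hg.bdd
  exact ⟨hf.meas.mul hg.meas, C * D, fun p => by
    rw [norm_mul]; exact mul_le_mul (hC p) (hD p) (norm_nonneg _) h0⟩

lemma const_mul (hf : BM f) (c : ℂ) : BM fun p => c * f p := (const c).mul hf

lemma neg (hf : BM f) : BM fun p => -f p := by simpa using hf.const_mul (-1)

lemma sub (hf : BM f) (hg : BM g) : BM fun p => f p - g p := by
  simpa [sub_eq_add_neg] using hf.add hg.neg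

lemma integrable_mul (hf : BM f) (hg : Integrable g) : Integrable fun p => f p * g p := by
  obtain ⟨C, hC⟩ := hf.bdd
  exact hg.bdd_mul hf.meas.aestronglyMeasurable (ae_of_all _ hC)

lemma locallyIntegrable (hf : BM f) : LocallyIntegrable f := by
  obtain ⟨C, hC⟩ := hf.bdd
  exact (locallyIntegrable_const C).mono hf.meas.aestronglyMeasurable
    (ae_of_all _ fun p => (hC p).trans (le_abs_self C))

end BM

lemma CTest.bm {Φ : ℝ × ℝ → ℂ} (h : CTest Φ) : BM Φ := ⟨h.continuous.measurable, h.bounded⟩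

lemma CTest.integrable_locInt_mul {f Φ : ℝ × ℝ → ℂ} (hΦ : CTest Φ) (hf : LocallyIntegrable f) :
    Integrable fun p => f p * Φ p := by
  simpa [mul_comm] using hf.integrable_smul_left_of_hasCompactSupport hΦ.continuous hΦ.supp

/-- `g` is the weak derivative of `f` in direction `e`, with complex test functions. -/
def WD (e : ℝ × ℝ) (f g : ℝ × ℝ → ℂ) : Prop :=
  ∀ Φ, CTest Φ → ∫ p, f p * pd e Φ p = -∫ p, g p * Φ p

/-- The formal adjoint of `∂_y - ∂_x² + 2 i lam ∂_x`. -/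
def Lst (lam : ℂ) (Φ : ℝ × ℝ → ℂ) : ℝ × ℝ → ℂ :=
  fun p => -pd ey Φ p - pd ex (pd ex Φ) p - 2 * Complex.I * lam * pd ex Φ p

/-- `(∂_y - ∂_x² + 2 i lam ∂_x) W = F` in the sense of distributions. -/
def Sol (lam : ℂ) (W F : ℝ × ℝ → ℂ) : Prop :=
  ∀ Φ, CTest Φ → ∫ p, W p * Lst lam Φ p = ∫ p, F p * Φ p

lemma CTest.lst {Φ : ℝ × ℝ → ℂ} (h : CTest Φ) (lam : ℂ) : CTest (Lst lam Φ) :=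
  ((h.pd ey).neg.sub ((h.pd ex).pd ex)).sub ((h.pd ex).const_mul _)

lemma Lst_pd {Φ : ℝ × ℝ → ℂ} (h : CTest Φ) (lam : ℂ) (e : ℝ × ℝ) :
    Lst lam (KPII.pd e Φ) = KPII.pd e (Lst lam Φ) := by
  have h1 := (h.pd ey).differentiable
  have h2 := ((h.pd ex).pd ex).differentiable
  have h3 := (h.pd ex).differentiable
  have e1 : Lst lam Φ = fun p => -1 * KPII.pd ey Φ p + (-1 * KPII.pd ex (KPII.pd ex Φ) p +
      (-(2 * Complex.I * lam)) * KPII.pd ex Φ p) := by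
    ext p; simp only [Lst]; ring
  have e2 : KPII.pd e (Lst lam Φ) = fun p => -1 * KPII.pd e (KPII.pd ey Φ) p +
      (-1 * KPII.pd e (KPII.pd ex (KPII.pd ex Φ)) p +
      (-(2 * Complex.I * lam)) * KPII.pd e (KPII.pd ex Φ) p) := by
    rw [e1, pd_add e (h1.const_mul _) (g := fun p => _ + _) ((h2.const_mul _).add (h3.const_mul _)),
      pd_add e (h2.const_mul _) (h3.const_mul _), pd_const_mul e h1, pd_const_mul e h2,
      pd_const_mul e h3]
  rw [e2, pd_comm h.smooth e ey, pd_comm (h.pd ex).smooth e ex, pd_comm h.smooth e ex]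
  ext p; simp only [Lst]; ring

lemma Lst_comp_add (lam : ℂ) (a : ℝ × ℝ) (Φ : ℝ × ℝ → ℂ) :
    Lst lam (fun p => Φ (p + a)) = fun p => Lst lam Φ (p + a) := by
  ext p; simp [Lst, pd_comp_add]

/-! ### Calculus of weak derivatives and weak solutions. -/

section weak

variable {e : ℝ × ℝ} {lam : ℂ} {f f' g g' W F W' F' : ℝ × ℝ → ℂ}

lemma WD.add (hf : LocallyIntegrable f) (hf' : LocallyIntegrable f') (hg : LocallyIntegrable g)
    (hg' : LocallyIntegrable g') (h : WD e f f') (h' : WD e g g') :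
    WD e (fun p => f p + g p) (fun p => f' p + g' p) := by
  intro Φ hΦ
  simp only [add_mul]
  rw [integral_add ((hΦ.pd e).integrable_locInt_mul hf) ((hΦ.pd e).integrable_locInt_mul hg),
    integral_add (hΦ.integrable_locInt_mul hf') (hΦ.integrable_locInt_mul hg'), h Φ hΦ, h' Φ hΦ]
  ring

lemma WD.const_mul (h : WD e f f') (c : ℂ) : WD e (fun p => c * f p) (fun p => c * f' p) := by
  intro Φ hΦ
  simp only [mul_assoc]
  rw [integral_const_mul, integral_const_mul, h Φ hΦ]; ring

lemma WD.neg (h : WD e f f') : WD e (fun p => -f p) (fun p => -f' p) := by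
  simpa using h.const_mul (-1)

lemma WD.of_smooth (hf : ContDiff ℝ ∞ f) : WD e f (pd e f) :=
  fun _ hΦ => integral_mul_pd hf hΦ e

lemma Sol.add (hW : LocallyIntegrable W) (hF : LocallyIntegrable F) (hW' : LocallyIntegrable W')
    (hF' : LocallyIntegrable F') (h : Sol lam W F) (h' : Sol lam W' F') :
    Sol lam (fun p => W p + W' p) (fun p => F p + F' p) := by
  intro Φ hΦ
  simp only [add_mul]
  rw [integral_add ((hΦ.lst lam).integrable_locInt_mul hW)
    ((hΦ.lst lam).integrable_locInt_mul hW'), integral_add (hΦ.integrable_locInt_mul hF)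
    (hΦ.integrable_locInt_mul hF'), h Φ hΦ, h' Φ hΦ]

lemma Sol.const_mul (h : Sol lam W F) (c : ℂ) :
    Sol lam (fun p => c * W p) (fun p => c * F p) := by
  intro Φ hΦ
  simp only [mul_assoc]
  rw [integral_const_mul, integral_const_mul, h Φ hΦ]

lemma Sol.congr (h : Sol lam W F) (hW : W =ᵐ[volume] W') (hF : F =ᵐ[volume] F') :
    Sol lam W' F' := by
  intro Φ hΦ
  have h1 : ∫ p, W' p * Lst lam Φ p = ∫ p, W p * Lst lam Φ p :=
    integral_congr_ae (by filter_upwards [hW] with p hp; rw [hp])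
  have h2 : ∫ p, F' p * Φ p = ∫ p, F p * Φ p :=
    integral_congr_ae (by filter_upwards [hF] with p hp; rw [hp])
  rw [h1, h2, h Φ hΦ]

/-- Weak derivatives of a weak solution solve the differentiated equation. -/
lemma Sol.wd (h : Sol lam W F) (hW : WD e W W') (hF : WD e F F') : Sol lam W' F' := by
  intro Φ hΦ
  have h1 := hW _ (hΦ.lst lam)
  have h2 := hF _ hΦ
  have h3 := h _ (hΦ.pd e)
  rw [Lst_pd hΦ] at h3
  rw [h1] at h3
  rw [h2] at h3
  simpa using h3

/-- A locally integrable function that annihilates all test functions vanishes. -/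
lemma ae_eq_zero_of_test (hf : LocallyIntegrable f)
    (h : ∀ Φ, CTest Φ → ∫ p, f p * Φ p = 0) : f =ᵐ[volume] 0 := by
  refine ae_eq_zero_of_integral_contDiff_smul_eq_zero hf fun φ hφ hs => ?_
  have := h (fun p => (φ p : ℂ)) ⟨Complex.ofRealCLM.contDiff.comp hφ,
    hs.comp_left (g := ((↑) : ℝ → ℂ)) (by simp)⟩
  simpa [mul_comm] using this

lemma ae_eq_of_test (hf : LocallyIntegrable f) (hg : LocallyIntegrable g)
    (h : ∀ Φ, CTest Φ → ∫ p, f p * Φ p = ∫ p, g p * Φ p) : f =ᵐ[volume] g := by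
  have := ae_eq_zero_of_test (hf.sub hg) fun Φ hΦ => by
    simp only [Pi.sub_apply, sub_mul]
    rw [integral_sub (hΦ.integrable_locInt_mul hf) (hΦ.integrable_locInt_mul hg), h Φ hΦ, sub_self]
  filter_upwards [this] with p hp
  exact sub_eq_zero.1 hp

end weak

/-! ### The fundamental identity for spectral kernels -/

/-- The spectral integrand: modes in `S` propagate forward in `y`, the others backward. -/
def specMode (S : Set ℝ) (w : ℝ → ℂ) (q : ℝ → ℝ → ℂ) (t : ℝ) (p : ℝ × ℝ) : ℂ :=
  open Classical in
  if t ∈ S then (if 0 < p.2 then Complex.exp (-w t * p.2) * q t p.1 else 0)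
  else (if p.2 < 0 then -(Complex.exp (-w t * p.2) * q t p.1) else 0)

/-- The kernel assembled from the spectral modes. -/
def specKer (S : Set ℝ) (w : ℝ → ℂ) (q : ℝ → ℝ → ℂ) (p : ℝ × ℝ) : ℂ :=
  ∫ t, specMode S w q t p

lemma contDiff_exp_snd (c : ℂ) : ContDiff ℝ ∞ (fun p : ℝ × ℝ => Complex.exp (c * p.2)) :=
  (contDiff_const.mul (Complex.ofRealCLM.contDiff.comp contDiff_snd)).cexp

lemma contDiff_exp_fst (c : ℂ) : ContDiff ℝ ∞ (fun p : ℝ × ℝ => Complex.exp (c * p.1)) :=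
  (contDiff_const.mul (Complex.ofRealCLM.contDiff.comp contDiff_fst)).cexp

lemma pd_ex_of_hasDerivAt {f : ℝ × ℝ → ℂ} (hf : Differentiable ℝ f) {p : ℝ × ℝ} {c : ℂ}
    (h : HasDerivAt (fun s => f (s, p.2)) c p.1) : pd ex f p = c := by
  have h2 : HasDerivAt (fun s : ℝ => (s, p.2)) (ex) p.1 :=
    (hasDerivAt_id p.1).prodMk (hasDerivAt_const p.1 p.2)
  exact ((hf p).hasFDerivAt.comp_hasDerivAt p.1 h2).unique h

lemma pd_ey_of_hasDerivAt {f : ℝ × ℝ → ℂ} (hf : Differentiable ℝ f) {p : ℝ × ℝ} {c : ℂ}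
    (h : HasDerivAt (fun s => f (p.1, s)) c p.2) : pd ey f p = c := by
  have h2 : HasDerivAt (fun s : ℝ => (p.1, s)) (ey) p.2 :=
    (hasDerivAt_const p.2 p.1).prodMk (hasDerivAt_id p.2)
  exact ((hf p).hasFDerivAt.comp_hasDerivAt p.2 h2).unique h

lemma hasDerivAt_cexp_mul (c : ℂ) (s : ℝ) :
    HasDerivAt (fun s : ℝ => Complex.exp (c * s)) (c * Complex.exp (c * s)) s := by
  have h1 : HasDerivAt (fun s : ℝ => c * (s : ℂ)) c s := by
    simpa using (Complex.ofRealCLM.hasDerivAt (x := s)).const_mul c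
  simpa [mul_comm] using h1.cexp

lemma pd_exp_snd (c : ℂ) (p : ℝ × ℝ) :
    pd ey (fun p : ℝ × ℝ => Complex.exp (c * p.2)) p = c * Complex.exp (c * p.2) :=
  pd_ey_of_hasDerivAt ((contDiff_exp_snd c).differentiable (by simp)) (hasDerivAt_cexp_mul c p.2)

lemma pd_ex_exp_snd (c : ℂ) (p : ℝ × ℝ) :
    pd ex (fun p : ℝ × ℝ => Complex.exp (c * p.2)) p = 0 :=
  pd_ex_of_hasDerivAt ((contDiff_exp_snd c).differentiable (by simp))
    (hasDerivAt_const p.1 (Complex.exp (c * p.2)))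

/-- Multiplying a test function by `e ^ (c y)` shifts the adjoint operator by `c`. -/
lemma Lst_exp_snd_mul (lam c : ℂ) {Φ : ℝ × ℝ → ℂ} (hΦ : CTest Φ) (p : ℝ × ℝ) :
    Lst lam (fun p => Complex.exp (c * p.2) * Φ p) p =
      Complex.exp (c * p.2) * Lst lam Φ p - c * (Complex.exp (c * p.2) * Φ p) := by
  have he := (contDiff_exp_snd c).differentiable (by simp)
  have h0 : ∀ Ψ : ℝ × ℝ → ℂ, CTest Ψ → pd ex (fun p => Complex.exp (c * p.2) * Ψ p) =
      fun p => Complex.exp (c * p.2) * pd ex Ψ p := by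
    intro Ψ hΨ
    rw [pd_mul ex he hΨ.differentiable]
    ext p; rw [pd_ex_exp_snd]; ring
  simp only [Lst]
  rw [h0 Φ hΦ, h0 _ (hΦ.pd ex), pd_mul ey he hΦ.differentiable]
  simp only [pd_exp_snd]; ring

/-! ### A single mode paired with a test function. -/

section

variable {lam w : ℂ} {u : ℝ → ℂ} {q q' q'' : ℝ → ℂ} {Θ : ℝ × ℝ → ℂ}

/-- The integrand is the x-derivative of the Lagrange bilinear form -qΘ_x + q'Θ - 2iλqΘ, by the
equation for q, and this form has compact support in x. -/
lemma integral_mode_slice (hu : Continuous u) (h1 : ∀ x, HasDerivAt q (q' x) x)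
    (h2 : ∀ x, HasDerivAt q' (q'' x) x)
    (hode : ∀ x, -q'' x + 2 * Complex.I * lam * q' x + u x * q x = w * q x) (hΘ : CTest Θ) (y : ℝ) :
    ∫ x, q x * (-pd ex (pd ex Θ) (x, y) - 2 * Complex.I * lam * pd ex Θ (x, y)
      + (u x - w) * Θ (x, y)) = 0 := by
  obtain ⟨M, hM0, hM⟩ := hΘ.eq_zero_of_large
  obtain ⟨M', hM0', hM'⟩ := (hΘ.pd ex).eq_zero_of_large
  have hc : Continuous q := continuous_iff_continuousAt.2 fun x => (h1 x).continuousAt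
  have hy : Continuous fun x : ℝ => (x, y) := by fun_prop
  have hder : ∀ x, HasDerivAt (fun x => -(q x * pd ex Θ (x, y)) + q' x * Θ (x, y)
      - 2 * Complex.I * lam * (q x * Θ (x, y)))
      (q x * (-pd ex (pd ex Θ) (x, y) - 2 * Complex.I * lam * pd ex Θ (x, y)
      + (u x - w) * Θ (x, y))) x := by
    intro x
    have hA := ((h1 x).mul ((hΘ.pd ex).hasDerivAt_fst x y)).neg
    have hB := (h2 x).mul (hΘ.hasDerivAt_fst x y)
    have hC := ((h1 x).mul (hΘ.hasDerivAt_fst x y)).const_mul (2 * Complex.I * lam)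
    refine ((hA.add hB).sub hC).congr_deriv ?_
    linear_combination (-Θ (x, y)) * hode x
  have hcs : ∀ {Ψ : ℝ × ℝ → ℂ}, CTest Ψ → HasCompactSupport fun x => Ψ (x, y) := by
    intro Ψ hΨ
    obtain ⟨N, _, hN⟩ := hΨ.eq_zero_of_large
    refine HasCompactSupport.intro (isCompact_Icc (a := -N) (b := N)) fun x hx => hN x y (Or.inl ?_)
    by_contra hcon
    exact hx (abs_le.1 (not_le.1 hcon).le)
  have hint : Integrable fun x => q x * (-pd ex (pd ex Θ) (x, y)
      - 2 * Complex.I * lam * pd ex Θ (x, y) + (u x - w) * Θ (x, y)) := by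
    refine Continuous.integrable_of_hasCompactSupport ?_ ?_
    · have c1 := ((hΘ.pd ex).pd ex).continuous.comp hy
      have c2 := (hΘ.pd ex).continuous.comp hy
      have c3 := hΘ.continuous.comp hy
      exact hc.mul ((c1.neg.sub (continuous_const.mul c2)).add ((hu.sub continuous_const).mul c3))
    · refine HasCompactSupport.mul_left ?_
      refine HasCompactSupport.add ?_ ((hcs hΘ).mul_left)
      exact (hcs ((hΘ.pd ex).pd ex)).neg.sub ((hcs (hΘ.pd ex)).mul_left)
  have hlim : ∀ l : Filter ℝ, (∀ᶠ x in l, max M M' ≤ |x|) →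
      Tendsto (fun x => -(q x * pd ex Θ (x, y)) + q' x * Θ (x, y)
      - 2 * Complex.I * lam * (q x * Θ (x, y))) l (𝓝 0) := by
    intro l hl
    refine tendsto_const_nhds.congr' ?_
    filter_upwards [hl] with x hx
    rw [hM x y (Or.inl ((le_max_left _ _).trans hx)),
      hM' x y (Or.inl ((le_max_right _ _).trans hx))]
    simp
  have := integral_of_hasDerivAt_of_tendsto hder hint
    (hlim _ (tendsto_abs_atBot_atTop.eventually_ge_atTop _))
    (hlim _ (tendsto_abs_atTop_atTop.eventually_ge_atTop _))
  simpa using this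

lemma integral_pd_ey_Ioi (hΘ : CTest Θ) (x : ℝ) :
    ∫ y in Set.Ioi 0, pd ey Θ (x, y) = -Θ (x, 0) := by
  obtain ⟨M, hM0, hM⟩ := hΘ.eq_zero_of_large
  have hint : Integrable fun y => pd ey Θ (x, y) := by
    refine Continuous.integrable_of_hasCompactSupport ((hΘ.pd ey).continuous.comp (by fun_prop)) ?_
    obtain ⟨N, _, hN⟩ := (hΘ.pd ey).eq_zero_of_large
    refine HasCompactSupport.intro (isCompact_Icc (a := -N) (b := N)) fun y hy => hN x y (Or.inr ?_)
    by_contra hcon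
    exact hy (abs_le.1 (not_le.1 hcon).le)
  have := integral_Ioi_of_hasDerivAt_of_tendsto' (a := 0) (m := 0)
    (fun y _ => hΘ.hasDerivAt_snd x y) hint.integrableOn
    (tendsto_const_nhds.congr' (by
      filter_upwards [tendsto_abs_atTop_atTop.eventually_ge_atTop M] with y hy
      rw [hM x y (Or.inr hy)]))
  simpa using this

lemma integral_pd_ey_Iio (hΘ : CTest Θ) (x : ℝ) :
    ∫ y in Set.Iio 0, pd ey Θ (x, y) = Θ (x, 0) := by
  obtain ⟨M, hM0, hM⟩ := hΘ.eq_zero_of_large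
  have hint : Integrable fun y => pd ey Θ (x, y) := by
    refine Continuous.integrable_of_hasCompactSupport ((hΘ.pd ey).continuous.comp (by fun_prop)) ?_
    obtain ⟨N, _, hN⟩ := (hΘ.pd ey).eq_zero_of_large
    refine HasCompactSupport.intro (isCompact_Icc (a := -N) (b := N)) fun y hy => hN x y (Or.inr ?_)
    by_contra hcon
    exact hy (abs_le.1 (not_le.1 hcon).le)
  have := integral_Iic_of_hasDerivAt_of_tendsto' (a := 0) (m := 0)
    (fun y _ => hΘ.hasDerivAt_snd x y) hint.integrableOn
    (tendsto_const_nhds.congr' (by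
      filter_upwards [tendsto_abs_atBot_atTop.eventually_ge_atTop M] with y hy
      rw [hM x y (Or.inr hy)]))
  rw [← integral_Iic_eq_integral_Iio]
  simpa using this

/-- Integrating in x first, `integral_mode_slice` annihilates every term of the adjoint operator
except the y-derivative. -/
lemma integral_mode_strip (hu : Continuous u) {C : ℝ} (hq : ∀ x, ‖q x‖ ≤ C)
    (h1 : ∀ x, HasDerivAt q (q' x) x) (h2 : ∀ x, HasDerivAt q' (q'' x) x)
    (hode : ∀ x, -q'' x + 2 * Complex.I * lam * q' x + u x * q x = w * q x) (hΘ : CTest Θ)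
    {A : Set ℝ} (hA : MeasurableSet A) :
    ∫ p, Set.indicator A (fun _ => (1 : ℂ)) p.2 * (q p.1 * (Lst lam Θ p + (u p.1 - w) * Θ p)) =
      -∫ x, q x * ∫ y in A, pd ey Θ (x, y) := by
  have hc : Continuous q := continuous_iff_continuousAt.2 fun x => (h1 x).continuousAt
  have hb : BM fun p : ℝ × ℝ => Set.indicator A (fun _ => (1 : ℂ)) p.2 * q p.1 := by
    refine BM.mul ⟨(measurable_const.indicator hA).comp measurable_snd, 1, fun p => ?_⟩
      ⟨hc.measurable.comp measurable_fst, C, fun p => hq _⟩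
    by_cases h : p.2 ∈ A <;> simp [h]
  have hI1 : Integrable fun p : ℝ × ℝ => Set.indicator A (fun _ => (1 : ℂ)) p.2 * q p.1 *
      (-pd ex (pd ex Θ) p - 2 * Complex.I * lam * pd ex Θ p + (u p.1 - w) * Θ p) := by
    refine hb.integrable_mul (Integrable.add (Integrable.sub ((hΘ.pd ex).pd ex).integrable.neg
      ((hΘ.pd ex).integrable.const_mul _)) ?_)
    exact Continuous.integrable_of_hasCompactSupport
      (((hu.comp continuous_fst).sub continuous_const).mul hΘ.continuous) hΘ.supp.mul_left
  have hI2 : Integrable fun p : ℝ × ℝ => Set.indicator A (fun _ => (1 : ℂ)) p.2 * q p.1 *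
      (-pd ey Θ p) := hb.integrable_mul (hΘ.pd ey).integrable.neg
  have hsplit : (fun p : ℝ × ℝ => Set.indicator A (fun _ => (1 : ℂ)) p.2 *
      (q p.1 * (Lst lam Θ p + (u p.1 - w) * Θ p))) = fun p =>
      (Set.indicator A (fun _ => (1 : ℂ)) p.2 * q p.1 *
      (-pd ex (pd ex Θ) p - 2 * Complex.I * lam * pd ex Θ p + (u p.1 - w) * Θ p)) +
      Set.indicator A (fun _ => (1 : ℂ)) p.2 * q p.1 * (-pd ey Θ p) := by
    ext p; simp only [Lst]; ring
  rw [hsplit, integral_add hI1 hI2]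
  have e1 : ∫ p : ℝ × ℝ, Set.indicator A (fun _ => (1 : ℂ)) p.2 * q p.1 *
      (-pd ex (pd ex Θ) p - 2 * Complex.I * lam * pd ex Θ p + (u p.1 - w) * Θ p) = 0 := by
    rw [Measure.volume_eq_prod] at hI1 ⊢
    rw [integral_prod_symm _ hI1]
    simp only [mul_assoc]
    simp only [integral_const_mul]
    simp only [← mul_assoc]
    simp [integral_mode_slice hu h1 h2 hode hΘ]
  have e2 : ∫ p : ℝ × ℝ, Set.indicator A (fun _ => (1 : ℂ)) p.2 * q p.1 * (-pd ey Θ p) =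
      -∫ x, q x * ∫ y in A, pd ey Θ (x, y) := by
    rw [Measure.volume_eq_prod] at hI2 ⊢
    rw [integral_prod _ hI2, ← integral_neg]
    congr 1; ext x
    rw [← integral_indicator hA, ← mul_neg, ← integral_neg, ← integral_const_mul]
    congr 1; ext y
    by_cases h : y ∈ A <;> simp [h]
  rw [e1, e2, zero_add]

end

/-! ### Superposition of the modes. -/

section

variable {lam : ℂ} {u : ℝ → ℂ} {S : Set ℝ} {w : ℝ → ℂ} {q q' q'' : ℝ → ℝ → ℂ} {Φ : ℝ × ℝ → ℂ}

lemma measurable_specMode (hS : MeasurableSet S) (hw : Measurable w)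
    (hq : Measurable (Function.uncurry q)) :
    Measurable fun z : ℝ × (ℝ × ℝ) => specMode S w q z.1 z.2 := by
  have hm : Measurable fun z : ℝ × (ℝ × ℝ) => Complex.exp (-w z.1 * z.2.2) * q z.1 z.2.1 := by
    refine Measurable.mul ?_ (hq.comp (measurable_fst.prodMk (measurable_fst.comp measurable_snd)))
    exact Complex.measurable_exp.comp ((hw.comp measurable_fst).neg.mul
      (Complex.measurable_ofReal.comp (measurable_snd.comp measurable_snd)))
  refine Measurable.ite (measurable_fst hS) (Measurable.ite ?_ hm measurable_const)
    (Measurable.ite ?_ hm.neg measurable_const)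
  · exact measurableSet_lt measurable_const (measurable_snd.comp measurable_snd)
  · exact measurableSet_lt (measurable_snd.comp measurable_snd) measurable_const

/-- Majorant for the forward modes: the integral over the spectral variable equals √(π/y), which is
integrable up to y = 0. -/
lemma integrable_gauss_strip (M : ℝ) :
    Integrable fun z : ℝ × (ℝ × ℝ) => Set.indicator (Set.Icc (-M) M) (fun _ => (1 : ℝ)) z.2.1 *
      (Set.indicator (Set.Ioc 0 M) (fun _ => (1 : ℝ)) z.2.2 * Real.exp (-z.2.2 * z.1 ^ 2)) := by
  have hm : Measurable fun z : ℝ × (ℝ × ℝ) =>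
      Set.indicator (Set.Icc (-M) M) (fun _ => (1 : ℝ)) z.2.1 *
      (Set.indicator (Set.Ioc 0 M) (fun _ => (1 : ℝ)) z.2.2 * Real.exp (-z.2.2 * z.1 ^ 2)) := by
    refine Measurable.mul ?_ (Measurable.mul ?_ (by fun_prop))
    · exact (measurable_const.indicator measurableSet_Icc).comp
        (measurable_fst.comp measurable_snd)
    · exact (measurable_const.indicator measurableSet_Ioc).comp
        (measurable_snd.comp measurable_snd)
  have hn : ∀ z : ℝ × (ℝ × ℝ), 0 ≤ Set.indicator (Set.Icc (-M) M) (fun _ => (1 : ℝ)) z.2.1 *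
      (Set.indicator (Set.Ioc 0 M) (fun _ => (1 : ℝ)) z.2.2 * Real.exp (-z.2.2 * z.1 ^ 2)) :=
    fun z => mul_nonneg (Set.indicator_nonneg (by simp) _)
      (mul_nonneg (Set.indicator_nonneg (by simp) _) (Real.exp_nonneg _))
  rw [Measure.volume_eq_prod, integrable_prod_iff' hm.aestronglyMeasurable]
  constructor
  · refine ae_of_all _ fun p => ?_
    by_cases h : p.2 ∈ Set.Ioc 0 M
    · exact ((integrable_exp_neg_mul_sq h.1).const_mul
        (Set.indicator (Set.Ioc 0 M) (fun _ => (1 : ℝ)) p.2)).const_mul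
        (Set.indicator (Set.Icc (-M) M) (fun _ => (1 : ℝ)) p.1)
    · simp [Set.indicator_of_notMem h]
  · have e : (fun p : ℝ × ℝ => ∫ t : ℝ, ‖Set.indicator (Set.Icc (-M) M) (fun _ => (1 : ℝ)) p.1 *
        (Set.indicator (Set.Ioc 0 M) (fun _ => (1 : ℝ)) p.2 * Real.exp (-p.2 * t ^ 2))‖) =
        fun p => Set.indicator (Set.Icc (-M) M) (fun _ => (1 : ℝ)) p.1 *
        Set.indicator (Set.Ioc 0 M) (fun y => Real.sqrt (Real.pi / y)) p.2 := by
      ext p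
      have : ∀ t : ℝ, ‖Set.indicator (Set.Icc (-M) M) (fun _ => (1 : ℝ)) p.1 *
        (Set.indicator (Set.Ioc 0 M) (fun _ => (1 : ℝ)) p.2 * Real.exp (-p.2 * t ^ 2))‖ =
        Set.indicator (Set.Icc (-M) M) (fun _ => (1 : ℝ)) p.1 *
        (Set.indicator (Set.Ioc 0 M) (fun _ => (1 : ℝ)) p.2 * Real.exp (-p.2 * t ^ 2)) :=
        fun t => Real.norm_of_nonneg (hn (t, p))
      simp only [this]
      rw [integral_const_mul, integral_const_mul, integral_gaussian]
      by_cases h : p.2 ∈ Set.Ioc 0 M <;> simp [h]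
    rw [e, Measure.volume_eq_prod]
    refine Integrable.mul_prod ?_ ?_
    · exact (integrable_indicator_iff measurableSet_Icc).2 (by simp)
    · rw [integrable_indicator_iff measurableSet_Ioc]
      rcases le_or_gt M 0 with hM | hM
      · simp [Set.Ioc_eq_empty (not_lt.2 hM)]
      have h1 : IntervalIntegrable (fun y : ℝ => y ^ (-(1 / 2) : ℝ)) volume 0 M :=
        intervalIntegral.intervalIntegrable_rpow' (by norm_num)
      rw [intervalIntegrable_iff_integrableOn_Ioc_of_le hM.le] at h1
      refine IntegrableOn.congr_fun (h1.const_mul (Real.sqrt Real.pi)) (fun y hy => ?_)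
        measurableSet_Ioc
      rw [Real.sqrt_div Real.pi_pos.le, Real.sqrt_eq_rpow y, Real.rpow_neg hy.1.le]
      exact (div_eq_mul_inv _ _).symm

/-- Forward modes carry a Gaussian factor in t, handled by `integrable_gauss_strip`. Backward modes
may grow with |t|, but they occupy only the bounded range [-R, R]. This joint integrability
justifies exchanging the spectral and the space integrals. -/
lemma integrable_specMode_mul (hS : MeasurableSet S) {R : ℝ} (hR : Sᶜ ⊆ Set.Icc (-R) R)
    (hw : Measurable w) {d : ℝ} (hre : ∀ t, (w t).re = t ^ 2 + d)
    (hqm : Measurable (Function.uncurry q)) {C : ℝ} (hq : ∀ t x, ‖q t x‖ ≤ C)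
    (hΦ : BM Φ) {M : ℝ} (hM : ∀ x y : ℝ, M ≤ |x| ∨ M ≤ |y| → Φ (x, y) = 0) :
    Integrable fun z : ℝ × (ℝ × ℝ) => specMode S w q z.1 z.2 * Φ z.2 := by
  obtain ⟨D, hD0, hD⟩ := hΦ.nonneg_bound
  have hC0 : 0 ≤ C := (norm_nonneg _).trans (hq 0 0)
  have hI2 : Integrable fun z : ℝ × (ℝ × ℝ) => Set.indicator (Set.Icc (-R) R)
      (fun _ => (1 : ℝ)) z.1 * Set.indicator (Set.Icc (-M) M ×ˢ Set.Icc (-M) M)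
      (fun _ => (1 : ℝ)) z.2 := by
    rw [Measure.volume_eq_prod]
    refine Integrable.mul_prod (f := Set.indicator (Set.Icc (-R) R) (fun _ => (1 : ℝ)))
      (g := Set.indicator (Set.Icc (-M) M ×ˢ Set.Icc (-M) M) (fun _ => (1 : ℝ))) ?_ ?_
    · exact (integrable_indicator_iff measurableSet_Icc).2 (by simp)
    · refine (integrable_indicator_iff (measurableSet_Icc.prod measurableSet_Icc)).2 ?_
      exact integrableOn_const (hs := (isCompact_Icc.prod isCompact_Icc).measure_lt_top.ne)
  refine Integrable.mono' (((integrable_gauss_strip M).const_mul (D * C * Real.exp (|d| * M))).add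
    (hI2.const_mul (D * C * Real.exp ((R ^ 2 + |d|) * M))))
    ((measurable_specMode hS hw hqm).mul (hΦ.meas.comp measurable_snd)).aestronglyMeasurable
    (ae_of_all _ ?_)
  rintro ⟨t, x, y⟩
  simp only [Pi.add_apply]
  have n1 : 0 ≤ Set.indicator (Set.Icc (-M) M) (fun _ => (1 : ℝ)) x :=
    Set.indicator_nonneg (by simp) _
  have n2 : 0 ≤ Set.indicator (Set.Ioc 0 M) (fun _ => (1 : ℝ)) y :=
    Set.indicator_nonneg (by simp) _
  have n3 : 0 ≤ Set.indicator (Set.Icc (-R) R) (fun _ => (1 : ℝ)) t :=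
    Set.indicator_nonneg (by simp) _
  have n4 : 0 ≤ Set.indicator (Set.Icc (-M) M ×ˢ Set.Icc (-M) M) (fun _ => (1 : ℝ)) (x, y) :=
    Set.indicator_nonneg (by simp) _
  by_cases hxy : M ≤ |x| ∨ M ≤ |y|
  · rw [hM x y hxy]; simp only [mul_zero, norm_zero]; positivity
  push Not at hxy
  have hx := abs_le.1 hxy.1.le
  have hy := abs_le.1 hxy.2.le
  have hnorm : ‖Complex.exp (-w t * y) * q t x‖ ≤ Real.exp (-(t ^ 2 + d) * y) * C := by
    rw [norm_mul, Complex.norm_exp]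
    have : (-w t * (y : ℂ)).re = -(t ^ 2 + d) * y := by simp [hre]; ring
    rw [this]
    exact mul_le_mul_of_nonneg_left (hq t x) (Real.exp_nonneg _)
  have hdy : |d * y| ≤ |d| * M := by
    rw [abs_mul]; exact mul_le_mul_of_nonneg_left hxy.2.le (abs_nonneg d)
  have hdy' := abs_le.1 hdy
  unfold specMode
  by_cases ht : t ∈ S
  · rw [if_pos ht]
    by_cases hy0 : 0 < y
    · rw [if_pos hy0, norm_mul]
      have hb : Real.exp (-(t ^ 2 + d) * y) ≤ Real.exp (|d| * M) * Real.exp (-y * t ^ 2) := by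
        rw [← Real.exp_add]; apply Real.exp_le_exp.2; nlinarith
      calc _ ≤ (Real.exp (-(t ^ 2 + d) * y) * C) * D :=
            mul_le_mul hnorm (hD _) (norm_nonneg _) (by positivity)
        _ ≤ (Real.exp (|d| * M) * Real.exp (-y * t ^ 2)) * C * D := by gcongr
        _ = D * C * Real.exp (|d| * M) * (1 * (1 * Real.exp (-y * t ^ 2))) := by ring
        _ ≤ _ := by
          rw [Set.indicator_of_mem (show x ∈ Set.Icc (-M) M from hx),
            Set.indicator_of_mem (show y ∈ Set.Ioc 0 M from ⟨hy0, hy.2⟩)]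
          exact le_add_of_nonneg_right (by positivity)
    · rw [if_neg hy0]; simp only [zero_mul, norm_zero]; positivity
  · rw [if_neg ht]
    have htR : t ∈ Set.Icc (-R) R := hR ht
    by_cases hy0 : y < 0
    · rw [if_pos hy0, norm_mul, norm_neg]
      have hb : Real.exp (-(t ^ 2 + d) * y) ≤ Real.exp ((R ^ 2 + |d|) * M) := by
        apply Real.exp_le_exp.2
        have h1 : t ^ 2 ≤ R ^ 2 := sq_le_sq' htR.1 htR.2
        have h2 : t ^ 2 * (-y) ≤ R ^ 2 * M :=
          mul_le_mul h1 (by linarith) (by linarith) (sq_nonneg R)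
        nlinarith
      calc _ ≤ (Real.exp (-(t ^ 2 + d) * y) * C) * D :=
            mul_le_mul hnorm (hD _) (norm_nonneg _) (by positivity)
        _ ≤ Real.exp ((R ^ 2 + |d|) * M) * C * D := by gcongr
        _ = D * C * Real.exp ((R ^ 2 + |d|) * M) * (1 * 1) := by ring
        _ ≤ _ := by
          rw [Set.indicator_of_mem htR,
            Set.indicator_of_mem (show (x, y) ∈ Set.Icc (-M) M ×ˢ Set.Icc (-M) M from ⟨hx, hy⟩)]
          exact le_add_of_nonneg_left (by positivity)
    · rw [if_neg hy0]; simp only [zero_mul, norm_zero]; positivity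

/-- Absorbing e^{-wy} into the test function shifts the adjoint operator by w, so the mode equation
applies and only the boundary term at y = 0 survives. Forward and backward modes both jump by q at y
= 0, which is why the answer does not depend on S. -/
lemma integral_specMode (hu : Continuous u) {C : ℝ} (hq : ∀ t x, ‖q t x‖ ≤ C)
    (h1 : ∀ t x, HasDerivAt (q t) (q' t x) x) (h2 : ∀ t x, HasDerivAt (q' t) (q'' t x) x)
    (hode : ∀ t x, -q'' t x + 2 * Complex.I * lam * q' t x + u x * q t x = w t * q t x)
    (hΦ : CTest Φ) (t : ℝ) :
    ∫ p, specMode S w q t p * (Lst lam Φ p + u p.1 * Φ p) = ∫ x, q t x * Φ (x, 0) := by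
  set Θ : ℝ × ℝ → ℂ := fun p => Complex.exp (-w t * p.2) * Φ p with hΘdef
  have hΘ : CTest Θ := hΦ.smooth_mul (contDiff_exp_snd _)
  have hkey : ∀ p : ℝ × ℝ, Complex.exp (-w t * p.2) * q t p.1 * (Lst lam Φ p + u p.1 * Φ p) =
      q t p.1 * (Lst lam Θ p + (u p.1 - w t) * Θ p) := by
    intro p
    rw [hΘdef, Lst_exp_snd_mul lam _ hΦ]; ring
  have hzero : ∀ x, Θ (x, 0) = Φ (x, 0) := by intro x; simp [hΘdef]
  by_cases ht : t ∈ S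
  · have e : (fun p : ℝ × ℝ => specMode S w q t p * (Lst lam Φ p + u p.1 * Φ p)) = fun p =>
        Set.indicator (Set.Ioi 0) (fun _ => (1 : ℂ)) p.2 *
        (q t p.1 * (Lst lam Θ p + (u p.1 - w t) * Θ p)) := by
      ext p
      rw [← hkey, specMode, if_pos ht]
      by_cases hp : 0 < p.2
      · simp [hp]
      · simp [hp]
    rw [e, integral_mode_strip hu (hq t) (h1 t) (h2 t) (hode t) hΘ measurableSet_Ioi]
    simp only [integral_pd_ey_Ioi hΘ, hzero, mul_neg]
    rw [integral_neg, neg_neg]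
  · have e : (fun p : ℝ × ℝ => specMode S w q t p * (Lst lam Φ p + u p.1 * Φ p)) = fun p =>
        -(Set.indicator (Set.Iio 0) (fun _ => (1 : ℂ)) p.2 *
        (q t p.1 * (Lst lam Θ p + (u p.1 - w t) * Θ p))) := by
      ext p
      rw [← hkey, specMode, if_neg ht]
      by_cases hp : p.2 < 0
      · simp [hp]
      · simp [hp]
    rw [e, integral_neg, integral_mode_strip hu (hq t) (h1 t) (h2 t) (hode t) hΘ measurableSet_Iio]
    simp only [integral_pd_ey_Iio hΘ, hzero, neg_neg]

/-- A kernel assembled from spectral modes acts on test functions as the sum over its modes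
of the traces at `y = 0`. -/
theorem fundamental_identity (hu : Continuous u) (hS : MeasurableSet S) {R : ℝ}
    (hR : Sᶜ ⊆ Set.Icc (-R) R) (hw : Measurable w) {d : ℝ} (hre : ∀ t, (w t).re = t ^ 2 + d)
    (hqm : Measurable (Function.uncurry q)) {C : ℝ} (hq : ∀ t x, ‖q t x‖ ≤ C)
    (h1 : ∀ t x, HasDerivAt (q t) (q' t x) x) (h2 : ∀ t x, HasDerivAt (q' t) (q'' t x) x)
    (hode : ∀ t x, -q'' t x + 2 * Complex.I * lam * q' t x + u x * q t x = w t * q t x)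
    (hΦ : CTest Φ) :
    ∫ p, specKer S w q p * (Lst lam Φ p + u p.1 * Φ p) = ∫ t, ∫ x, q t x * Φ (x, 0) := by
  have hcont : Continuous fun p : ℝ × ℝ => Lst lam Φ p + u p.1 * Φ p :=
    (hΦ.lst lam).continuous.add ((hu.comp continuous_fst).mul hΦ.continuous)
  have hsupp : HasCompactSupport fun p : ℝ × ℝ => Lst lam Φ p + u p.1 * Φ p :=
    (hΦ.lst lam).supp.add hΦ.supp.mul_left
  obtain ⟨M1, _, hM1⟩ := hΦ.eq_zero_of_large
  obtain ⟨M2, _, hM2⟩ := (hΦ.lst lam).eq_zero_of_large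
  have hM : ∀ x y : ℝ, max M1 M2 ≤ |x| ∨ max M1 M2 ≤ |y| →
      Lst lam Φ (x, y) + u x * Φ (x, y) = 0 := by
    intro x y h
    rw [hM1 x y (h.imp (le_max_left _ _).trans (le_max_left _ _).trans),
      hM2 x y (h.imp (le_max_right _ _).trans (le_max_right _ _).trans)]
    simp
  have hint := integrable_specMode_mul hS hR hw hre hqm hq
    (Φ := fun p : ℝ × ℝ => Lst lam Φ p + u p.1 * Φ p)
    ⟨hcont.measurable, hcont.bounded_above_of_compact_support hsupp⟩ hM
  rw [← integral_congr_ae (ae_of_all _ fun t => integral_specMode (S := S) hu hq h1 h2 hode hΦ t)]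
  rw [Measure.volume_eq_prod] at hint
  rw [integral_integral_swap hint]
  simp only [specKer, integral_mul_const]

end

/-! ### Fourier inversion on the line -/

-- Inversion without 2π in the exponent, obtained from the normalized transform by s = 2πw.
-- Integrability of the transform comes from viewing φ as a Schwartz function.
open scoped FourierTransform in
lemma fourier_line {φ : ℝ → ℂ} (hφ : ContDiff ℝ ∞ φ) (hs : HasCompactSupport φ) :
    Integrable (fun s : ℝ => ∫ x : ℝ, Complex.exp (-Complex.I * s * x) * φ x) ∧
    ∀ a : ℝ, ∫ s : ℝ, Complex.exp (Complex.I * s * a) *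
      (∫ x : ℝ, Complex.exp (-Complex.I * s * x) * φ x) = 2 * Real.pi * φ a := by
  set f := hs.toSchwartzMap hφ with hf
  have hcoe : (f : ℝ → ℂ) = φ := by ext x; rfl
  have hFT : ∀ s : ℝ, ∫ x : ℝ, Complex.exp (-Complex.I * s * x) * φ x =
      𝓕 φ (s / (2 * Real.pi)) := by
    intro s
    rw [Real.fourier_real_eq_integral_exp_smul]
    refine integral_congr_ae (ae_of_all _ fun x => ?_)
    simp only [smul_eq_mul]
    congr 2
    push_cast
    field_simp
  have hint : Integrable (𝓕 φ) := by
    rw [← hcoe, ← SchwartzMap.fourier_coe]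
    exact (𝓕 f).integrable
  have hφi : Integrable φ := hφ.continuous.integrable_of_hasCompactSupport hs
  have hpi : (2 * Real.pi) ≠ 0 := by positivity
  simp only [hFT]
  refine ⟨hint.comp_div hpi, fun a => ?_⟩
  have h1 : ∀ s : ℝ, Complex.exp (Complex.I * s * a) * 𝓕 φ (s / (2 * Real.pi)) =
      (fun w : ℝ => Complex.exp (Complex.I * (2 * Real.pi * w) * a) * 𝓕 φ w)
        (s / (2 * Real.pi)) := by
    intro s; simp only; congr 3; push_cast; field_simp
  simp only [h1]
  rw [Measure.integral_comp_div (fun w : ℝ => Complex.exp (Complex.I * (2 * Real.pi * w) * a) * 𝓕 φ w)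
    (2 * Real.pi)]
  have h2 := congrFun (hφ.continuous.fourierInv_fourier_eq hφi hint) a
  rw [Real.fourierInv_eq'] at h2
  rw [abs_of_pos (by positivity)]
  have h3 : ∫ w : ℝ, Complex.exp (Complex.I * (2 * Real.pi * w) * a) * 𝓕 φ w = φ a := by
    rw [← h2]
    refine integral_congr_ae (ae_of_all _ fun x => ?_)
    simp only [smul_eq_mul]
    congr 2
    simp
    ring
  rw [h3]
  simp

/-! ### The free modes -/

/-- The dispersion relation along the line through `lam` parallel to the real axis. -/
def disp (lam : ℂ) (c : ℝ) (t : ℝ) : ℂ := (t + Complex.I * lam.im) ^ 2 - lam ^ 2 + c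

/-- Free modes along the line through `lam` parallel to the real axis. -/
def freeMode (lam : ℂ) (t x : ℝ) : ℂ := Complex.exp (-Complex.I * (t - lam.re) * x)

lemma disp_re (lam : ℂ) (c t : ℝ) : (disp lam c t).re = t ^ 2 + (c - lam.re ^ 2) := by
  simp [disp, sq]; ring

lemma continuous_disp (lam : ℂ) (c : ℝ) : Continuous (disp lam c) := by
  unfold disp; fun_prop

lemma norm_freeMode (lam : ℂ) (t x : ℝ) : ‖freeMode lam t x‖ = 1 := by
  rw [freeMode, Complex.norm_exp]; simp

lemma continuous_freeMode (lam : ℂ) : Continuous (Function.uncurry (freeMode lam)) := by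
  unfold freeMode Function.uncurry; fun_prop

lemma freeMode_hasDerivAt (lam : ℂ) (t x : ℝ) :
    HasDerivAt (freeMode lam t) (-Complex.I * (t - lam.re) * freeMode lam t x) x :=
  hasDerivAt_cexp_mul _ x

/-- Completing the square: with p = t + i Im λ, the symbol of -∂_x² + 2iλ∂_x at this frequency is p²
- λ². -/
lemma freeMode_ode (lam : ℂ) (c t : ℝ) :
    -((-Complex.I * (t - lam.re)) * (-Complex.I * (t - lam.re))) +
      2 * Complex.I * lam * (-Complex.I * (t - lam.re)) + c = disp lam c t := by
  have h := (Complex.re_add_im lam).symm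
  rw [disp]
  linear_combination (-(t - lam.re : ℂ) ^ 2 - 2 * lam * (t - lam.re)) * Complex.I_sq +
    ((t - lam.re + lam) + (t + Complex.I * lam.im)) * h

/-- The free kernel with forward modes in `S`. -/
def freeKer (lam : ℂ) (c : ℝ) (S : Set ℝ) (p : ℝ × ℝ) : ℂ :=
  (2 * Real.pi : ℂ)⁻¹ * specKer S (disp lam c) (freeMode lam) p

lemma integral_freeMode (lam : ℂ) {Φ : ℝ × ℝ → ℂ} (hΦ : CTest Φ) :
    ∫ t, ∫ x, freeMode lam t x * Φ (x, 0) = 2 * Real.pi * Φ (0, 0) := by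
  have hsm : ContDiff ℝ ∞ fun x : ℝ => Φ (x, 0) :=
    hΦ.smooth.comp (contDiff_id.prodMk contDiff_const)
  have hcs : HasCompactSupport fun x : ℝ => Φ (x, 0) := by
    obtain ⟨N, _, hN⟩ := hΦ.eq_zero_of_large
    refine HasCompactSupport.intro (isCompact_Icc (a := -N) (b := N)) fun x hx => hN x 0 (Or.inl ?_)
    by_contra hcon
    exact hx (abs_le.1 (not_le.1 hcon).le)
  have h := (fourier_line hsm hcs).2 0
  rw [← integral_sub_right_eq_self _ lam.re] at h
  simp only [Complex.ofReal_zero, mul_zero, Complex.exp_zero, one_mul] at h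
  rw [← h]
  simp only [freeMode, Complex.ofReal_sub]

/-- The free kernel is a fundamental solution. -/
theorem freeKer_fundamental (lam : ℂ) (c : ℝ) {S : Set ℝ} (hS : MeasurableSet S) {R : ℝ}
    (hR : Sᶜ ⊆ Set.Icc (-R) R) {Φ : ℝ × ℝ → ℂ} (hΦ : CTest Φ) :
    ∫ p, freeKer lam c S p * (Lst lam Φ p + c * Φ p) = Φ (0, 0) := by
  have h := fundamental_identity (lam := lam) (u := fun _ => (c : ℂ)) (w := disp lam c)
    (q := freeMode lam) continuous_const hS hR (continuous_disp lam c).measurable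
    (disp_re lam c) (continuous_freeMode lam).measurable (C := 1)
    (fun t x => (norm_freeMode lam t x).le) (freeMode_hasDerivAt lam)
    (fun t x => (freeMode_hasDerivAt lam t x).const_mul _)
    (fun t x => by linear_combination (freeMode lam t x) * freeMode_ode lam c t) hΦ
  rw [integral_freeMode lam hΦ] at h
  simp only [freeKer, mul_assoc]
  rw [integral_const_mul, h]
  have : (Real.pi : ℂ) ≠ 0 := by exact_mod_cast Real.pi_ne_zero
  field_simp

/-! ### The heat kernel with complex drift -/

/-- The Gaussian fundamental solution of `∂_y - ∂_x² + 2 i lam ∂_x + c`. -/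
def heatKer (lam : ℂ) (c : ℝ) (p : ℝ × ℝ) : ℂ :=
  if 0 < p.2 then
    ((Real.sqrt (4 * Real.pi * p.2))⁻¹ : ℝ) *
      Complex.exp (-(p.1 + 2 * lam.im * p.2) ^ 2 / (4 * p.2) + Complex.I * lam.re * p.1 +
        (lam.im ^ 2 + lam ^ 2 - c) * p.2)
  else 0

/-- When every mode goes forward the spectral integral is an explicit Gaussian. This makes the
fundamental solution property of the heat kernel a case of the spectral identity, with no separate
limit y → 0. -/
lemma freeKer_univ (lam : ℂ) (c : ℝ) : freeKer lam c Set.univ = heatKer lam c := by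
  ext p
  obtain ⟨x, y⟩ := p
  rw [freeKer, specKer, heatKer]
  by_cases hy : 0 < y
  · have hyc : (y : ℂ) ≠ 0 := by exact_mod_cast hy.ne'
    have e : ∀ t : ℝ, specMode Set.univ (disp lam c) (freeMode lam) t (x, y) =
        Complex.exp (-y * (t : ℂ) ^ 2 + (-Complex.I * (x + 2 * lam.im * y)) * t +
          (Complex.I * lam.re * x + (lam.im ^ 2 + lam ^ 2 - c) * y)) := by
      intro t
      simp only [specMode, Set.mem_univ, if_true, hy, disp, freeMode]
      rw [← Complex.exp_add]
      congr 1
      linear_combination (-(lam.im : ℂ) ^ 2 * y) * Complex.I_sq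
    simp only [e, hy, if_true]
    rw [integral_cexp_quadratic (by simpa using hy), neg_neg]
    have hs : ((Real.pi : ℂ) / y) ^ (1 / 2 : ℂ) = ((Real.sqrt (Real.pi / y) : ℝ) : ℂ) := by
      rw [Real.sqrt_eq_rpow, Complex.ofReal_cpow (by positivity)]
      push_cast; rfl
    rw [hs]
    have hr : (2 * Real.pi)⁻¹ * Real.sqrt (Real.pi / y) = (Real.sqrt (4 * Real.pi * y))⁻¹ := by
      rw [Real.sqrt_div Real.pi_pos.le, Real.sqrt_mul (by positivity), Real.sqrt_mul (by norm_num),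
        show (4 : ℝ) = 2 ^ 2 by norm_num, Real.sqrt_sq (by norm_num)]
      have h1 := Real.sq_sqrt Real.pi_pos.le
      have h2 : Real.sqrt y ≠ 0 := (Real.sqrt_pos.2 hy).ne'
      have h3 : Real.sqrt Real.pi ≠ 0 := (Real.sqrt_pos.2 Real.pi_pos).ne'
      have h4 := Real.pi_ne_zero
      field_simp
      exact h1
    rw [← mul_assoc, ← hr]
    push_cast
    congr 2
    field_simp
    linear_combination (((x : ℂ) + 2 * lam.im * y) ^ 2) * Complex.I_sq
  · simp [specMode, hy]

theorem heatKer_fundamental (lam : ℂ) (c : ℝ) {Φ : ℝ × ℝ → ℂ} (hΦ : CTest Φ) :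
    ∫ p, heatKer lam c p * (Lst lam Φ p + c * Φ p) = Φ (0, 0) := by
  rw [← freeKer_univ]
  exact freeKer_fundamental lam c MeasurableSet.univ (R := 0) (by simp) hΦ

lemma norm_heatKer (lam : ℂ) (c : ℝ) {p : ℝ × ℝ} (hp : 0 < p.2) : ‖heatKer lam c p‖ =
    (Real.sqrt (4 * Real.pi * p.2))⁻¹ * Real.exp (-(p.1 + 2 * lam.im * p.2) ^ 2 / (4 * p.2)) *
      Real.exp (-(c - lam.re ^ 2) * p.2) := by
  rw [heatKer, if_pos hp, norm_mul, Complex.norm_exp, Complex.norm_real, Real.norm_of_nonneg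
    (by positivity), mul_assoc (Real.sqrt (4 * Real.pi * p.2))⁻¹, ← Real.exp_add]
  congr 2
  have h1 : (-((p.1 : ℂ) + 2 * lam.im * p.2) ^ 2 / (4 * p.2)) =
      ((-(p.1 + 2 * lam.im * p.2) ^ 2 / (4 * p.2) : ℝ) : ℂ) := by push_cast; ring
  rw [h1, Complex.add_re, Complex.add_re, Complex.ofReal_re]
  simp [sq]

lemma measurable_heatKer (lam : ℂ) (c : ℝ) : Measurable (heatKer lam c) := by
  unfold heatKer
  refine Measurable.ite (measurableSet_lt measurable_const measurable_snd) ?_ measurable_const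
  fun_prop

lemma integral_shifted_gauss {y γ : ℝ} (hy : 0 < y) (hγ : 0 < γ) (b : ℝ) :
    Integrable (fun x : ℝ => (Real.sqrt y)⁻¹ * Real.exp (-(x + b) ^ 2 / (γ * y))) ∧
    ∫ x : ℝ, (Real.sqrt y)⁻¹ * Real.exp (-(x + b) ^ 2 / (γ * y)) =
      Real.sqrt (Real.pi * γ) := by
  have hb : 0 < (γ * y)⁻¹ := by positivity
  have e : ∀ x : ℝ, -(x + b) ^ 2 / (γ * y) = -(γ * y)⁻¹ * (x + b) ^ 2 := by
    intro x; field_simp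
  simp only [e]
  constructor
  · exact ((integrable_exp_neg_mul_sq hb).comp_add_right b).const_mul _
  · rw [integral_const_mul, integral_add_right_eq_self (fun x => Real.exp (-(γ * y)⁻¹ * x ^ 2)),
      integral_gaussian, div_inv_eq_mul, ← mul_assoc, Real.sqrt_mul (by positivity)]
    have := (Real.sqrt_pos.2 hy).ne'
    field_simp

/-- Kernels dominated by moving Gaussians of width `√y` with an integrable weight in `y`. -/
lemma gauss_dominated {K : ℝ × ℝ → ℂ} (hK : Measurable K) {a : ℝ → ℝ} {γ b : ℝ} (hγ : 0 < γ)
    (ha : IntegrableOn a (Set.Ioi 0)) (h0 : ∀ p : ℝ × ℝ, p.2 ≤ 0 → K p = 0)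
    (hb : ∀ p : ℝ × ℝ, 0 < p.2 → ‖K p‖ ≤
      a p.2 * ((Real.sqrt p.2)⁻¹ * Real.exp (-(p.1 + b * p.2) ^ 2 / (γ * p.2)))) :
    Integrable K ∧ ∫ p, ‖K p‖ ≤ Real.sqrt (Real.pi * γ) * ∫ y in Set.Ioi 0, a y := by
  have hslice : ∀ y, Integrable fun x => K (x, y) := by
    intro y
    rcases le_or_gt y 0 with hy | hy
    · simp [h0 (_, y) hy]
    · exact Integrable.mono' (((integral_shifted_gauss hy hγ (b * y)).1).const_mul (a y))
        (hK.comp (by fun_prop)).aestronglyMeasurable (ae_of_all _ fun x => hb (x, y) hy)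
  have hle : ∀ y, ∫ x, ‖K (x, y)‖ ≤
      Set.indicator (Set.Ioi 0) (fun y => Real.sqrt (Real.pi * γ) * a y) y := by
    intro y
    rcases le_or_gt y 0 with hy | hy
    · simp [h0 (_, y) hy, hy]
    · rw [Set.indicator_of_mem (show y ∈ Set.Ioi 0 from hy)]
      calc _ ≤ ∫ x, a y * ((Real.sqrt y)⁻¹ * Real.exp (-(x + b * y) ^ 2 / (γ * y))) :=
            integral_mono (hslice y).norm
              (((integral_shifted_gauss hy hγ (b * y)).1).const_mul (a y)) fun x => hb (x, y) hy
        _ = _ := by rw [integral_const_mul, (integral_shifted_gauss hy hγ (b * y)).2, mul_comm]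
  have hI : Integrable (Set.indicator (Set.Ioi 0) (fun y => Real.sqrt (Real.pi * γ) * a y)) :=
    (integrable_indicator_iff measurableSet_Ioi).2 (ha.const_mul _)
  have hmeas : AEStronglyMeasurable (fun y => ∫ x, ‖K (x, y)‖) volume :=
    (hK.norm.stronglyMeasurable.integral_prod_left').aestronglyMeasurable
  have hIK : Integrable fun y => ∫ x, ‖K (x, y)‖ :=
    hI.mono' hmeas (ae_of_all _ fun y => by
      rw [Real.norm_of_nonneg (integral_nonneg fun _ => norm_nonneg _)]; exact hle y)
  have hint : Integrable K := by
    rw [Measure.volume_eq_prod, integrable_prod_iff' hK.aestronglyMeasurable]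
    exact ⟨ae_of_all _ hslice, hIK⟩
  refine ⟨hint, ?_⟩
  have h1 := hint.norm
  rw [Measure.volume_eq_prod] at h1 ⊢
  rw [integral_prod_symm _ h1]
  calc _ ≤ ∫ y, Set.indicator (Set.Ioi 0) (fun y => Real.sqrt (Real.pi * γ) * a y) y :=
        integral_mono hIK hI hle
    _ = _ := by rw [integral_indicator measurableSet_Ioi, integral_const_mul]

lemma integrableOn_exp_neg_Ioi : IntegrableOn (fun y : ℝ => Real.exp (-y)) (Set.Ioi 0) := by
  simpa using exp_neg_integrableOn_Ioi 0 (zero_lt_one' ℝ)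

lemma integrableOn_inv_sqrt_mul_exp :
    IntegrableOn (fun y : ℝ => (Real.sqrt y)⁻¹ * Real.exp (-y)) (Set.Ioi 0) := by
  have h := Real.GammaIntegral_convergent (s := 1 / 2) (by norm_num)
  refine h.congr_fun (fun y hy => ?_) measurableSet_Ioi
  have hy' : (0 : ℝ) ≤ y := le_of_lt hy
  simp only
  rw [mul_comm, Real.sqrt_eq_rpow, ← Real.rpow_neg hy']
  norm_num

lemma inv_sqrt_four_pi_le {y : ℝ} (hy : 0 < y) :
    (Real.sqrt (4 * Real.pi * y))⁻¹ ≤ (Real.sqrt y)⁻¹ := by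
  apply inv_anti₀ (Real.sqrt_pos.2 hy)
  apply Real.sqrt_le_sqrt
  nlinarith [Real.pi_gt_three]

section

variable (lam : ℂ)

/-- The `x`-derivative of the heat kernel. -/
def heatKerX (c : ℝ) (p : ℝ × ℝ) : ℂ :=
  (-(p.1 + 2 * lam.im * p.2) / (2 * p.2) + Complex.I * lam.re) * heatKer lam c p

lemma measurable_heatKerX (c : ℝ) : Measurable (heatKerX lam c) := by
  unfold heatKerX
  exact Measurable.mul (by fun_prop) (measurable_heatKer lam c)

lemma heatKer_of_nonpos (c : ℝ) {p : ℝ × ℝ} (hp : p.2 ≤ 0) : heatKer lam c p = 0 := by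
  rw [heatKer, if_neg (not_lt.2 hp)]

lemma heatKer_hasDerivAt (c : ℝ) {y : ℝ} (hy : 0 < y) (x : ℝ) :
    HasDerivAt (fun x => heatKer lam c (x, y)) (heatKerX lam c (x, y)) x := by
  have hyc : (y : ℂ) ≠ 0 := by exact_mod_cast hy.ne'
  have h0 : HasDerivAt (fun x : ℝ => (x : ℂ)) 1 x := Complex.ofRealCLM.hasDerivAt
  have h1 : HasDerivAt (fun x : ℝ => -((x : ℂ) + 2 * lam.im * y) ^ 2 / (4 * y) +
      Complex.I * lam.re * x + (lam.im ^ 2 + lam ^ 2 - c) * y)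
      (-(2 * ((x : ℂ) + 2 * lam.im * y)) / (4 * y) + Complex.I * lam.re) x := by
    have := ((((h0.add_const (2 * lam.im * y : ℂ)).pow 2).neg.div_const (4 * y : ℂ)).add
      (h0.const_mul (Complex.I * lam.re))).add_const ((lam.im ^ 2 + lam ^ 2 - c) * y : ℂ)
    refine this.congr_deriv ?_
    simp
  simp only [heatKer, hy, if_true]
  refine (h1.cexp.const_mul (((Real.sqrt (4 * Real.pi * y))⁻¹ : ℝ) : ℂ)).congr_deriv ?_
  simp only [heatKerX, heatKer, hy, if_true]
  rw [show -(2 * ((x : ℂ) + 2 * lam.im * y)) / (4 * y) = -((x : ℂ) + 2 * lam.im * y) / (2 * y) by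
    field_simp; ring]
  ring

lemma integrable_heatKer : Integrable (heatKer lam (lam.re ^ 2 + 1)) := by
  refine (gauss_dominated (measurable_heatKer lam _) (a := fun y => Real.exp (-y)) (γ := 4)
    (b := 2 * lam.im) (by norm_num) integrableOn_exp_neg_Ioi
    (fun p hp => heatKer_of_nonpos lam _ hp) fun p hp => ?_).1
  rw [norm_heatKer lam _ hp, add_sub_cancel_left, neg_one_mul, mul_comm]
  gcongr
  nlinarith [Real.pi_gt_three]

/-- Squaring costs one more factor y^{-1/2}, still integrable at 0. Square integrability is what
bounds the kernel composed with itself in `cvl_cvl_bound`. -/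
lemma integrable_heatKer_sq : Integrable fun p => heatKer lam (lam.re ^ 2 + 1) p ^ 2 := by
  refine (gauss_dominated ((measurable_heatKer lam _).pow_const 2)
    (a := fun y => (Real.sqrt y)⁻¹ * Real.exp (-y)) (γ := 4)
    (b := 2 * lam.im) (by norm_num) integrableOn_inv_sqrt_mul_exp
    (fun p hp => by simp [heatKer_of_nonpos lam _ hp]) fun p hp => ?_).1
  rw [norm_pow, norm_heatKer lam _ hp, add_sub_cancel_left, neg_one_mul]
  have h1 := inv_sqrt_four_pi_le hp
  have h2 : Real.exp (-(p.1 + 2 * lam.im * p.2) ^ 2 / (4 * p.2)) ≤ 1 :=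
    Real.exp_le_one_iff.2 (div_nonpos_of_nonpos_of_nonneg (by nlinarith) (by positivity))
  have h3 : Real.exp (-p.2) ≤ 1 := Real.exp_le_one_iff.2 (by linarith)
  set A := Real.exp (-(p.1 + 2 * lam.im * p.2) ^ 2 / (4 * p.2))
  set B := Real.exp (-p.2)
  set s := (Real.sqrt p.2)⁻¹
  set s' := (Real.sqrt (4 * Real.pi * p.2))⁻¹
  have hs' : 0 ≤ s' := by positivity
  have hA : 0 ≤ A := Real.exp_nonneg _
  have hB : 0 ≤ B := Real.exp_nonneg _
  calc (s' * A * B) ^ 2 = (s' * s') * (A * A) * (B * B) := by ring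
    _ ≤ (s * s) * (A * 1) * (B * 1) := by gcongr
    _ = s * B * (s * A) := by ring

/-- Half of the Gaussian pays for the linear factor: |z|/(2√y) ≤ 1 + z²/(8y) ≤ e^{z²/(8y)}. -/
lemma abs_mul_exp_le {y : ℝ} (hy : 0 < y) (z : ℝ) :
    |z| / (2 * y) * Real.exp (-z ^ 2 / (4 * y)) ≤
      (Real.sqrt y)⁻¹ * Real.exp (-z ^ 2 / (8 * y)) := by
  have hs := Real.sqrt_pos.2 hy
  have hsq := Real.sq_sqrt hy.le
  set s := Real.sqrt y
  have h1 : Real.exp (-z ^ 2 / (4 * y)) =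
      Real.exp (-z ^ 2 / (8 * y)) * Real.exp (-(z ^ 2 / (8 * y))) := by
    rw [← Real.exp_add]; congr 1; ring
  have h2 : |z| / (2 * y) ≤ s⁻¹ * Real.exp (z ^ 2 / (8 * y)) := by
    have h3 := Real.add_one_le_exp (z ^ 2 / (8 * y))
    have h4 : |z| / (2 * s) ≤ z ^ 2 / (8 * y) + 1 := by
      have h5 : z ^ 2 / (8 * y) = (|z| / s) ^ 2 / 8 := by
        rw [div_pow, sq_abs, hsq]; field_simp
      have h6 : |z| / (2 * s) = (|z| / s) / 2 := by field_simp
      rw [h5, h6]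
      nlinarith [sq_nonneg (|z| / s - 2)]
    calc |z| / (2 * y) = s⁻¹ * (|z| / (2 * s)) := by rw [← hsq]; field_simp
      _ ≤ _ := by gcongr; linarith
  rw [h1, Real.exp_neg]
  have h7 := Real.exp_pos (z ^ 2 / (8 * y))
  calc _ ≤ s⁻¹ * Real.exp (z ^ 2 / (8 * y)) *
        (Real.exp (-z ^ 2 / (8 * y)) * (Real.exp (z ^ 2 / (8 * y)))⁻¹) := by gcongr
    _ = _ := by field_simp

/-- The derivative costs y^{-1/2} and a wider Gaussian, both harmless. This integrability is the
gain of one x-derivative in the interior regularity. -/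
lemma integrable_heatKerX : Integrable (heatKerX lam (lam.re ^ 2 + 1)) := by
  have ha : IntegrableOn (fun y : ℝ => (Real.sqrt y)⁻¹ * Real.exp (-y) +
      |lam.re| * Real.exp (-y)) (Set.Ioi 0) :=
    integrableOn_inv_sqrt_mul_exp.add (integrableOn_exp_neg_Ioi.const_mul _)
  refine (gauss_dominated (measurable_heatKerX lam _) (γ := 8) (b := 2 * lam.im) (by norm_num) ha
    (fun p hp => by simp [heatKerX, heatKer_of_nonpos lam _ hp]) fun p hp => ?_).1
  rw [heatKerX, norm_mul, norm_heatKer lam _ hp, add_sub_cancel_left, neg_one_mul]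
  set z := p.1 + 2 * lam.im * p.2 with hz
  have h1 := inv_sqrt_four_pi_le hp
  have h2 := abs_mul_exp_le hp z
  have h3 : ‖-((p.1 : ℂ) + 2 * lam.im * p.2) / (2 * p.2) + Complex.I * lam.re‖ ≤
      |z| / (2 * p.2) + |lam.re| := by
    refine (norm_add_le _ _).trans (add_le_add ?_ (by simp))
    rw [show -((p.1 : ℂ) + 2 * lam.im * p.2) / (2 * p.2) = ((-z / (2 * p.2) : ℝ) : ℂ) by
      rw [hz]; push_cast; ring, Complex.norm_real, Real.norm_eq_abs, abs_div, abs_neg,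
      abs_of_pos (show 0 < 2 * p.2 by positivity)]
  have h4 : Real.exp (-z ^ 2 / (4 * p.2)) ≤ Real.exp (-z ^ 2 / (8 * p.2)) := by
    apply Real.exp_le_exp.2
    rw [div_le_div_iff₀ (by positivity) (by positivity)]
    nlinarith [mul_nonneg (sq_nonneg z) hp.le]
  set A := Real.exp (-z ^ 2 / (4 * p.2))
  set A' := Real.exp (-z ^ 2 / (8 * p.2))
  set B := Real.exp (-p.2)
  set s := (Real.sqrt p.2)⁻¹
  set s' := (Real.sqrt (4 * Real.pi * p.2))⁻¹
  have hs' : 0 ≤ s' := by positivity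
  have hA : 0 ≤ A := Real.exp_nonneg _
  have hB : 0 ≤ B := Real.exp_nonneg _
  calc _ ≤ (|z| / (2 * p.2) + |lam.re|) * (s' * A * B) := by gcongr
    _ = s' * B * (|z| / (2 * p.2) * A + |lam.re| * A) := by ring
    _ ≤ s * B * (s * A' + |lam.re| * A') := by gcongr
    _ = _ := by ring

lemma integral_slice_by_parts {f f' : ℝ → ℂ} (hf : ∀ x, HasDerivAt f (f' x) x)
    (hf' : Continuous f') {Φ : ℝ × ℝ → ℂ} (hΦ : CTest Φ) (y : ℝ) :
    ∫ x, (f x * pd ex Φ (x, y) + f' x * Φ (x, y)) = 0 := by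
  have hc : Continuous f := continuous_iff_continuousAt.2 fun x => (hf x).continuousAt
  have hcs : ∀ {Ψ : ℝ × ℝ → ℂ}, CTest Ψ → HasCompactSupport fun x => Ψ (x, y) := by
    intro Ψ hΨ
    obtain ⟨N, _, hN⟩ := hΨ.eq_zero_of_large
    refine HasCompactSupport.intro (isCompact_Icc (a := -N) (b := N)) fun x hx => hN x y (Or.inl ?_)
    by_contra hcon
    exact hx (abs_le.1 (not_le.1 hcon).le)
  have hy' : Continuous fun x : ℝ => (x, y) := by fun_prop
  have s1 := hcs (hΦ.pd ex)
  have s2 := hcs hΦ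
  have c1 : Continuous fun x => pd ex Φ (x, y) := (hΦ.pd ex).continuous.comp hy'
  have c2 : Continuous fun x => Φ (x, y) := hΦ.continuous.comp hy'
  have J1 : Integrable fun x => f x * pd ex Φ (x, y) + f' x * Φ (x, y) :=
    ((hc.mul c1).integrable_of_hasCompactSupport s1.mul_left).add
      ((hf'.mul c2).integrable_of_hasCompactSupport s2.mul_left)
  have J2 : Integrable fun x => f x * Φ (x, y) :=
    (hc.mul c2).integrable_of_hasCompactSupport s2.mul_left
  refine integral_eq_zero_of_hasDerivAt_of_integrable (f := fun x => f x * Φ (x, y))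
    (fun x => ?_) J1 J2
  exact ((hf x).mul (hΦ.hasDerivAt_fst x y)).congr_deriv (add_comm _ _)

lemma integral_heatKer_mul_pd {Φ : ℝ × ℝ → ℂ} (hΦ : CTest Φ) :
    ∫ p, heatKer lam (lam.re ^ 2 + 1) p * pd ex Φ p =
      -∫ p, heatKerX lam (lam.re ^ 2 + 1) p * Φ p := by
  have I1 : Integrable fun p => heatKer lam (lam.re ^ 2 + 1) p * pd ex Φ p := by
    simpa [mul_comm] using (hΦ.pd ex).bm.integrable_mul (integrable_heatKer lam)
  have I2 : Integrable fun p => heatKerX lam (lam.re ^ 2 + 1) p * Φ p := by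
    simpa [mul_comm] using hΦ.bm.integrable_mul (integrable_heatKerX lam)
  rw [eq_neg_iff_add_eq_zero, ← integral_add I1 I2]
  have I3 : Integrable fun p => heatKer lam (lam.re ^ 2 + 1) p * pd ex Φ p +
    heatKerX lam (lam.re ^ 2 + 1) p * Φ p := I1.add I2
  clear I1 I2
  rw [Measure.volume_eq_prod] at I3 ⊢
  rw [integral_prod_symm _ I3]
  refine (integral_congr_ae (ae_of_all _ fun y => ?_)).trans (integral_zero _ _)
  rcases le_or_gt y 0 with hy | hy
  · simp [heatKerX, heatKer_of_nonpos lam _ (show ((_, y) : ℝ × ℝ).2 ≤ 0 from hy)]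
  have hc1 : Continuous fun x => heatKer lam (lam.re ^ 2 + 1) (x, y) :=
    continuous_iff_continuousAt.2 fun x => (heatKer_hasDerivAt lam _ hy x).continuousAt
  have hc2 : Continuous fun x => heatKerX lam (lam.re ^ 2 + 1) (x, y) := by
    have h0 : Continuous fun x : ℝ =>
        -((x : ℂ) + 2 * lam.im * y) / (2 * y) + Complex.I * lam.re := by
      simp only [div_eq_mul_inv]; fun_prop
    exact h0.mul hc1
  exact integral_slice_by_parts (fun x => heatKer_hasDerivAt lam _ hy x) hc2 hΦ y

end

/-! ### Convolutions with test functions -/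

/-- Convolution of a kernel with a test function. -/
def cv (K Φ : ℝ × ℝ → ℂ) (q : ℝ × ℝ) : ℂ := ∫ p, K p * Φ (q - p)

/-- Adjoint convolution of a kernel with a test function. -/
def adj (K Φ : ℝ × ℝ → ℂ) (q : ℝ × ℝ) : ℂ := ∫ p, K p * Φ (q + p)

section

variable {K Φ : ℝ × ℝ → ℂ}

open scoped Convolution

lemma cv_eq_convolution (K Φ : ℝ × ℝ → ℂ) :
    cv K Φ = (K ⋆[ContinuousLinearMap.mul ℝ ℂ, volume] Φ) := by
  ext q; simp [cv, convolution_def]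

lemma adj_eq_cv (K Φ : ℝ × ℝ → ℂ) : adj K Φ = cv (fun p => K (-p)) Φ := by
  ext q
  rw [adj, cv, ← integral_neg_eq_self]
  simp [sub_eq_add_neg]

lemma contDiff_cv (hK : LocallyIntegrable K) (hΦ : CTest Φ) : ContDiff ℝ ∞ (cv K Φ) := by
  rw [cv_eq_convolution]
  exact hΦ.supp.contDiff_convolution_right _ hK hΦ.smooth

lemma pd_cv (hK : LocallyIntegrable K) (hΦ : CTest Φ) (e : ℝ × ℝ) :
    pd e (cv K Φ) = cv K (pd e Φ) := by
  ext q
  have h1 : ContDiff ℝ 1 Φ := hΦ.smooth.of_le (by exact_mod_cast le_top)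
  have h := hΦ.supp.hasFDerivAt_convolution_right (ContinuousLinearMap.mul ℝ ℂ) hK h1 q
  rw [cv_eq_convolution K Φ]
  unfold pd
  rw [h.fderiv, convolution_precompR_apply _ hK (hΦ.supp.fderiv (𝕜 := ℝ))
    (h1.continuous_fderiv one_ne_zero)]
  simp [cv, convolution_def]

lemma locallyIntegrable_comp_neg (hK : LocallyIntegrable K) :
    LocallyIntegrable fun p => K (-p) := by
  rw [locallyIntegrable_iff] at hK ⊢
  intro s hs
  have h := hK (-s) hs.neg
  have h2 := (Measure.measurePreserving_neg (volume : Measure (ℝ × ℝ))).integrableOn_comp_preimage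
    (Homeomorph.neg (ℝ × ℝ)).measurableEmbedding (f := K) (s := -s)
  have h3 := h2.2 h
  simpa [Function.comp_def] using h3

lemma contDiff_adj (hK : LocallyIntegrable K) (hΦ : CTest Φ) : ContDiff ℝ ∞ (adj K Φ) := by
  rw [adj_eq_cv]; exact contDiff_cv (locallyIntegrable_comp_neg hK) hΦ

lemma pd_adj (hK : LocallyIntegrable K) (hΦ : CTest Φ) (e : ℝ × ℝ) :
    pd e (adj K Φ) = adj K (pd e Φ) := by
  rw [adj_eq_cv, adj_eq_cv]; exact pd_cv (locallyIntegrable_comp_neg hK) hΦ e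

lemma integrable_cv (hK : Integrable K) (hΦ : Integrable Φ) : Integrable (cv K Φ) := by
  rw [cv_eq_convolution]
  exact hK.integrable_convolution _ hΦ

lemma integrable_adj (hK : Integrable K) (hΦ : Integrable Φ) : Integrable (adj K Φ) := by
  rw [adj_eq_cv]; exact integrable_cv hK.comp_neg hΦ

lemma norm_integral_mul_le {f g : ℝ × ℝ → ℂ} (hf : Integrable f) {C : ℝ} (hg : ∀ p, ‖g p‖ ≤ C) :
    ‖∫ p, f p * g p‖ ≤ (∫ p, ‖f p‖) * C := by
  rw [← integral_mul_const]
  refine norm_integral_le_of_norm_le (hf.norm.mul_const C) (ae_of_all _ fun p => ?_)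
  rw [norm_mul]; exact mul_le_mul_of_nonneg_left (hg p) (norm_nonneg _)

lemma bm_adj (hK : Integrable K) (hΦ : CTest Φ) : BM (adj K Φ) := by
  obtain ⟨C, hC⟩ := hΦ.bounded
  exact ⟨(contDiff_adj hK.locallyIntegrable hΦ).continuous.measurable, (∫ p, ‖K p‖) * C,
    fun q => norm_integral_mul_le hK fun p => hC _⟩

/-! ### Cutoffs -/

lemma exists_cutoff : ∃ χ : ℝ × ℝ → ℂ, CTest χ ∧ (∀ p, ‖p‖ < 1 → χ p = 1) ∧
    (∀ p, 2 ≤ ‖p‖ → χ p = 0) := by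
  let f : ContDiffBump (0 : ℝ × ℝ) := ⟨1, 2, one_pos, one_lt_two⟩
  refine ⟨fun p => (f p : ℂ), ⟨Complex.ofRealCLM.contDiff.comp f.contDiff,
    f.hasCompactSupport.comp_left (g := ((↑) : ℝ → ℂ)) (by simp)⟩, fun p hp => ?_, fun p hp => ?_⟩
  · simp only [f.one_of_mem_closedBall (show p ∈ Metric.closedBall 0 f.rIn by simpa using hp.le),
      Complex.ofReal_one]
  · simp only [f.zero_of_le_dist (show f.rOut ≤ dist p 0 by simpa using hp), Complex.ofReal_zero]

lemma CTest.comp_smul (hΦ : CTest Φ) {ρ : ℝ} (hρ : ρ ≠ 0) : CTest (fun p => Φ (ρ • p)) :=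
  ⟨hΦ.smooth.comp (contDiff_const_smul ρ), hΦ.supp.comp_homeomorph (Homeomorph.smulOfNeZero ρ hρ)⟩

lemma pd_comp_smul (e : ℝ × ℝ) (ρ : ℝ) (hΦ : Differentiable ℝ Φ) :
    pd e (fun p => Φ (ρ • p)) = fun p => ρ * pd e Φ (ρ • p) := by
  ext p
  have h2 : HasFDerivAt (fun q : ℝ × ℝ => ρ • q) (ρ • ContinuousLinearMap.id ℝ (ℝ × ℝ)) p :=
    (hasFDerivAt_id p).const_smul ρ
  have := ((hΦ (ρ • p)).hasFDerivAt.comp p h2).fderiv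
  change fderiv ℝ (Φ ∘ fun q => ρ • q) p e = _
  rw [this]; simp [pd]

lemma Lst_mul (lam : ℂ) {f g : ℝ × ℝ → ℂ} (hf : ContDiff ℝ ∞ f) (hg : ContDiff ℝ ∞ g) (p : ℝ × ℝ) :
    Lst lam (fun p => f p * g p) p =
      f p * Lst lam g p + Lst lam f p * g p - 2 * (pd ex f p * pd ex g p) := by
  have df := hf.differentiable (by simp)
  have dg := hg.differentiable (by simp)
  have dfx := (contDiff_pd hf ex).differentiable (by simp)
  have dgx := (contDiff_pd hg ex).differentiable (by simp)
  have h1 : pd ex (pd ex fun p => f p * g p) p = pd ex (pd ex f) p * g p +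
      2 * (pd ex f p * pd ex g p) + f p * pd ex (pd ex g) p := by
    rw [pd_mul ex df dg, pd_add ex (f := fun p => pd ex f p * g p)
      (g := fun p => f p * pd ex g p) (dfx.mul dg) (df.mul dgx)]
    simp only [pd_mul ex dfx dg, pd_mul ex df dgx]; ring
  simp only [Lst]
  rw [h1, pd_mul ex df dg, pd_mul ey df dg]
  ring

/-- Each derivative of a dilated cutoff χ(ρp) brings a factor ρ. The first-order terms prevent a
better rate than ρ, which later has to be matched by a kernel of linear growth. -/
lemma Lst_comp_smul_bound (lam : ℂ) (hΦ : CTest Φ) : ∃ C, 0 ≤ C ∧ ∀ ρ : ℝ, 0 < ρ → ρ ≤ 1 → ∀ p,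
    ‖Lst lam (fun p => Φ (ρ • p)) p‖ ≤ C * ρ ∧ ‖pd ex (fun p => Φ (ρ • p)) p‖ ≤ C * ρ := by
  obtain ⟨A, hA0, hA⟩ := (hΦ.pd ey).bm.nonneg_bound
  obtain ⟨B, hB0, hB⟩ := ((hΦ.pd ex).pd ex).bm.nonneg_bound
  obtain ⟨D, hD0, hD⟩ := (hΦ.pd ex).bm.nonneg_bound
  refine ⟨A + B + (2 * ‖lam‖ + 1) * D, by positivity, fun ρ h0 h1 p => ?_⟩
  have e1 := pd_comp_smul ex ρ hΦ.differentiable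
  have e2 := pd_comp_smul ey ρ hΦ.differentiable
  have e3 : pd ex (pd ex fun p => Φ (ρ • p)) p = ρ * (ρ * pd ex (pd ex Φ) (ρ • p)) := by
    rw [e1, pd_const_mul ex ((hΦ.pd ex).comp_smul h0.ne').differentiable,
      pd_comp_smul ex ρ (hΦ.pd ex).differentiable]
  have nx : ‖pd ex (fun p => Φ (ρ • p)) p‖ ≤ D * ρ := by
    rw [e1, norm_mul, Complex.norm_real, Real.norm_of_nonneg h0.le, mul_comm]
    exact mul_le_mul_of_nonneg_right (hD _) h0.le
  have ny : ‖pd ey (fun p => Φ (ρ • p)) p‖ ≤ A * ρ := by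
    rw [e2, norm_mul, Complex.norm_real, Real.norm_of_nonneg h0.le, mul_comm]
    exact mul_le_mul_of_nonneg_right (hA _) h0.le
  have nxx : ‖pd ex (pd ex fun p => Φ (ρ • p)) p‖ ≤ B * ρ := by
    rw [e3, norm_mul, norm_mul, Complex.norm_real, Real.norm_of_nonneg h0.le]
    have := hB (ρ • p)
    have h3 : ρ * ‖pd ex (pd ex Φ) (ρ • p)‖ ≤ 1 * B :=
      mul_le_mul h1 this (norm_nonneg _) zero_le_one
    nlinarith
  constructor
  · have : ‖2 * Complex.I * lam * pd ex (fun p => Φ (ρ • p)) p‖ ≤ 2 * ‖lam‖ * (D * ρ) := by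
      rw [norm_mul]
      have : ‖2 * Complex.I * lam‖ = 2 * ‖lam‖ := by simp
      rw [this]
      exact mul_le_mul_of_nonneg_left nx (by positivity)
    have h4 : ‖Lst lam (fun p => Φ (ρ • p)) p‖ ≤ A * ρ + B * ρ + 2 * ‖lam‖ * (D * ρ) := by
      unfold Lst
      refine (norm_sub_le _ _).trans (add_le_add ((norm_sub_le _ _).trans (add_le_add ?_ nxx)) this)
      rwa [norm_neg]
    have : 0 ≤ D * ρ := by positivity
    nlinarith
  · have : 0 ≤ (A + B + 2 * ‖lam‖ * D) * ρ := by positivity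
    nlinarith

end

/-! ### Representation of weak solutions by the heat kernel -/

/-- Sums of an integrable and a bounded function. -/
def Tame (f : ℝ × ℝ → ℂ) : Prop :=
  ∃ f₁ f₂ : ℝ × ℝ → ℂ, Integrable f₁ ∧ BM f₂ ∧ ∀ p, f p = f₁ p + f₂ p

section

variable {f g H W F K Φ : ℝ × ℝ → ℂ} {lam : ℂ}

lemma BM.tame (h : BM f) : Tame f := ⟨0, f, integrable_zero _ _ _, h, by simp⟩

lemma Tame.bm_mul (hg : BM g) (hf : Tame f) : Tame fun p => g p * f p := by
  obtain ⟨f₁, f₂, h1, h2, h3⟩ := hf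
  exact ⟨fun p => g p * f₁ p, fun p => g p * f₂ p, hg.integrable_mul h1, hg.mul h2,
    fun p => by simp only [h3]; ring⟩

lemma Tame.integrable_mul (hf : Tame f) (hg : Integrable g) (hb : BM g) :
    Integrable fun p => f p * g p := by
  obtain ⟨f₁, f₂, h1, h2, h3⟩ := hf
  have : (fun p => f p * g p) = fun p => g p * f₁ p + f₂ p * g p := by
    ext p; rw [h3]; ring
  rw [this]
  exact (hb.integrable_mul h1).add (h2.integrable_mul hg)

lemma Tame.locallyIntegrable (hf : Tame f) : LocallyIntegrable f := by
  obtain ⟨f₁, f₂, h1, h2, h3⟩ := hf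
  rw [funext h3]
  exact h1.locallyIntegrable.add h2.locallyIntegrable

lemma Tame.integrable_kernel (hH : Tame H) (hK : Integrable K) (hΦ : CTest Φ) :
    Integrable fun z : (ℝ × ℝ) × (ℝ × ℝ) => H z.2 * K (z.1 - z.2) * Φ z.1 := by
  obtain ⟨H₁, H₂, h1, h2, h3⟩ := hH
  obtain ⟨C, hC⟩ := hΦ.bounded
  obtain ⟨D, hD⟩ := h2.bdd
  have i1 : Integrable fun z : (ℝ × ℝ) × (ℝ × ℝ) => Φ z.1 * (H₁ z.2 * K (z.1 - z.2)) := by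
    refine Integrable.bdd_mul ?_
      (hΦ.continuous.measurable.comp measurable_fst).aestronglyMeasurable
      (ae_of_all _ fun z => hC z.1)
    exact h1.convolution_integrand (ContinuousLinearMap.mul ℝ ℂ) hK
  have i2 : Integrable fun z : (ℝ × ℝ) × (ℝ × ℝ) => H₂ z.2 * (Φ z.1 * K (z.1 - z.2)) := by
    refine Integrable.bdd_mul ?_
      (h2.meas.comp measurable_snd).aestronglyMeasurable (ae_of_all _ fun z => hD z.2)
    have := (hΦ.integrable.convolution_integrand (ContinuousLinearMap.mul ℝ ℂ) hK.comp_neg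
      (μ := volume) (ν := volume)).swap
    rw [Measure.volume_eq_prod]
    simpa [Function.comp_def] using this
  refine (i1.add i2).congr (ae_of_all _ fun z => ?_)
  simp only [Pi.add_apply, h3]; ring

lemma integral_mul_adj (hH : Tame H) (hK : Integrable K) (hΦ : CTest Φ) :
    ∫ q, H q * adj K Φ q = ∫ r, (∫ q, H q * K (r - q)) * Φ r := by
  have hint := hH.integrable_kernel hK hΦ
  have e1 : ∀ q, H q * adj K Φ q = ∫ r, H q * K (r - q) * Φ r := by
    intro q
    rw [adj, ← integral_const_mul, ← integral_sub_right_eq_self _ q]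
    refine integral_congr_ae (ae_of_all _ fun r => ?_)
    simp only [add_sub_cancel]; ring
  simp only [e1]
  rw [Measure.volume_eq_prod] at hint
  rw [← integral_integral_swap (μ := volume) (ν := volume) hint]
  simp only [integral_mul_const]

lemma integral_lin_comb {a b c d : ℝ × ℝ → ℂ} {k l : ℂ} (ha : Integrable a) (hb : Integrable b)
    (hc : Integrable c) (hd : Integrable d) :
    ∫ p, (-a p - b p - k * c p + l * d p) =
      -(∫ p, a p) - (∫ p, b p) - k * (∫ p, c p) + l * ∫ p, d p := by
  rw [integral_add (f := fun p => -a p - b p - k * c p) ((ha.neg.sub hb).sub (hc.const_mul k))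
    (hd.const_mul l), integral_sub (f := fun p => -a p - b p) (ha.neg.sub hb) (hc.const_mul k),
    integral_sub (f := fun p => -a p) ha.neg hb, integral_neg, integral_const_mul,
    integral_const_mul]

/-- The order-zero coefficient making the heat kernel decay. -/
abbrev cc (lam : ℂ) : ℝ := lam.re ^ 2 + 1

/-- The fundamental solution identity applied to the translate of Φ by q; derivatives pass to Φ
under the integral. -/
lemma Lst_adj_heatKer (hΦ : CTest Φ) (q : ℝ × ℝ) :
    Lst lam (adj (heatKer lam (cc lam)) Φ) q + cc lam * adj (heatKer lam (cc lam)) Φ q = Φ q := by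
  have hK := (integrable_heatKer lam).locallyIntegrable
  have h := heatKer_fundamental lam (cc lam) (hΦ.comp_add q)
  rw [Lst_comp_add] at h
  simp only [zero_add, Prod.mk_zero_zero] at h
  rw [← h]
  have hm : ∀ {Ψ}, CTest Ψ → Integrable fun p => heatKer lam (cc lam) p * Ψ (q + p) := by
    intro Ψ hΨ
    have := (hΨ.comp_add q).bm.integrable_mul (integrable_heatKer lam)
    simpa [mul_comm, add_comm] using this
  simp only [Lst]
  rw [pd_adj hK hΦ, pd_adj hK hΦ, pd_adj hK (hΦ.pd ex)]
  simp only [adj]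
  have i1 := hm (hΦ.pd ey)
  have i2 := hm ((hΦ.pd ex).pd ex)
  have i3 := hm (hΦ.pd ex)
  have i4 := hm hΦ
  rw [← integral_lin_comb i1 i2 i3 i4]
  refine integral_congr_ae (ae_of_all _ fun p => ?_)
  simp only [add_comm p q]
  ring

/-- The function ψ = `adj` K Φ solves the adjoint equation with right-hand side Φ, so testing the
equation with ψ would give the formula. As ψ is smooth and integrable but not compactly supported,
it is cut off by χ(ρₙp) and ρₙ → 0; W and F need only be sums of integrable and bounded functions.
-/
theorem Sol.integral_eq (hW : Tame W) (hF : Tame F) (h : Sol lam W F) (hΦ : CTest Φ) :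
    ∫ p, W p * Φ p = ∫ q, (F q + cc lam * W q) * adj (heatKer lam (cc lam)) Φ q := by
  set ψ := adj (heatKer lam (cc lam)) Φ with hψ
  have hKi := integrable_heatKer lam
  have hK := hKi.locallyIntegrable
  have sψ : ContDiff ℝ ∞ ψ := contDiff_adj hK hΦ
  have bψ : BM ψ := bm_adj hKi hΦ
  have iψ : Integrable ψ := integrable_adj hKi hΦ.integrable
  have eψx : pd ex ψ = adj (heatKer lam (cc lam)) (pd ex Φ) := pd_adj hK hΦ ex
  have bψx : BM (pd ex ψ) := eψx ▸ bm_adj hKi (hΦ.pd ex)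
  have iψx : Integrable (pd ex ψ) := eψx ▸ integrable_adj hKi (hΦ.pd ex).integrable
  have eL : Lst lam ψ = fun q => Φ q - cc lam * ψ q := by
    ext q; rw [← Lst_adj_heatKer (lam := lam) hΦ q]; ring
  have bL : BM (Lst lam ψ) := eL ▸ hΦ.bm.sub (bψ.const_mul _)
  have iL : Integrable (Lst lam ψ) := eL ▸ hΦ.integrable.sub (iψ.const_mul _)
  obtain ⟨χ, hχ, hχ1, -⟩ := exists_cutoff
  obtain ⟨B, hB0, hB⟩ := hχ.bm.nonneg_bound
  obtain ⟨C, hC0, hC⟩ := Lst_comp_smul_bound lam hχ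
  let ρ : ℕ → ℝ := fun n => ((n : ℝ) + 1)⁻¹
  have hρ0 : ∀ n, 0 < ρ n := fun n => by positivity
  have hρ1 : ∀ n, ρ n ≤ 1 := fun n => inv_le_one_of_one_le₀ (by simp)
  have hχn : ∀ n, CTest fun p => χ (ρ n • p) := fun n => hχ.comp_smul (hρ0 n).ne'
  -- Near each point the cutoff is eventually identically 1, so all derivatives of the truncated
  -- function eventually agree with those of ψ there.
  have hloc : ∀ p, ∀ᶠ n in atTop, (fun p => χ (ρ n • p) * ψ p) =ᶠ[𝓝 p] ψ := by
    intro p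
    have ht : Tendsto ρ atTop (𝓝 0) := tendsto_inv_atTop_zero.comp
      (tendsto_atTop_add_const_right _ _ tendsto_natCast_atTop_atTop)
    have ht2 : Tendsto (fun n => ‖ρ n • p‖) atTop (𝓝 0) := by
      simpa using (ht.smul_const p).norm
    filter_upwards [ht2.eventually_lt_const one_pos] with n hn
    have hop : ∀ᶠ q in 𝓝 p, ‖ρ n • q‖ < 1 :=
      (continuous_const_smul (ρ n)).norm.continuousAt.eventually_lt continuousAt_const hn
    filter_upwards [hop] with q hq
    rw [hχ1 _ hq, one_mul]
  have key : ∀ n, ∫ p, W p * Lst lam (fun p => χ (ρ n • p) * ψ p) p =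
      ∫ p, F p * (χ (ρ n • p) * ψ p) := by
    intro n
    have ht : CTest fun p => χ (ρ n • p) * ψ p := by
      simpa [mul_comm] using (hχn n).smooth_mul sψ
    exact h _ ht
  have lim1 : Tendsto (fun n => ∫ p, W p * Lst lam (fun p => χ (ρ n • p) * ψ p) p) atTop
      (𝓝 (∫ p, W p * Lst lam ψ p)) := by
    refine tendsto_integral_of_dominated_convergence
      (fun p => ‖W p * Lst lam ψ p‖ * B + ‖W p * ψ p‖ * C + ‖W p * pd ex ψ p‖ * (2 * C)) ?_ ?_ ?_ ?_
    · intro n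
      have ht : CTest fun p => χ (ρ n • p) * ψ p := by
        simpa [mul_comm] using (hχn n).smooth_mul sψ
      exact ((ht.lst lam).integrable_locInt_mul hW.locallyIntegrable).aestronglyMeasurable
    · exact (((hW.integrable_mul iL bL).norm.mul_const _).add
        ((hW.integrable_mul iψ bψ).norm.mul_const _)).add
        ((hW.integrable_mul iψx bψx).norm.mul_const _)
    · intro n
      refine ae_of_all _ fun p => ?_
      rw [Lst_mul lam (hχn n).smooth sψ, norm_mul, norm_mul, norm_mul, norm_mul]
      obtain ⟨c1, c2⟩ := hC (ρ n) (hρ0 n) (hρ1 n) p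
      have c1' := c1.trans (mul_le_of_le_one_right hC0 (hρ1 n))
      have c2' := c2.trans (mul_le_of_le_one_right hC0 (hρ1 n))
      have : ‖χ (ρ n • p) * Lst lam ψ p + Lst lam (fun p => χ (ρ n • p)) p * ψ p -
          2 * (pd ex (fun p => χ (ρ n • p)) p * pd ex ψ p)‖ ≤
          B * ‖Lst lam ψ p‖ + C * ‖ψ p‖ + 2 * (C * ‖pd ex ψ p‖) := by
        refine (norm_sub_le _ _).trans (add_le_add ((norm_add_le _ _).trans (add_le_add ?_ ?_)) ?_)
        · rw [norm_mul]; exact mul_le_mul_of_nonneg_right (hB _) (norm_nonneg _)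
        · rw [norm_mul]; exact mul_le_mul_of_nonneg_right c1' (norm_nonneg _)
        · rw [norm_mul, norm_mul, Complex.norm_ofNat]
          exact mul_le_mul_of_nonneg_left (mul_le_mul_of_nonneg_right c2' (norm_nonneg _)) two_pos.le
      calc _ ≤ ‖W p‖ * _ := mul_le_mul_of_nonneg_left this (norm_nonneg _)
        _ = _ := by ring
    · refine ae_of_all _ fun p => ?_
      refine tendsto_const_nhds.congr' ?_
      filter_upwards [hloc p] with n hn
      have e : ∀ e', pd e' (fun p => χ (ρ n • p) * ψ p) =ᶠ[𝓝 p] pd e' ψ := fun e' => by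
        filter_upwards [hn.fderiv (𝕜 := ℝ)] with q hq
        simp only [pd, hq]
      have e2 : pd ex (pd ex fun p => χ (ρ n • p) * ψ p) p = pd ex (pd ex ψ) p := by
        simp only [pd]
        exact congrArg (fun L : (ℝ × ℝ) →L[ℝ] ℂ => L ex) (e ex).fderiv_eq
      simp only [Lst]
      rw [e2, (e ex).eq_of_nhds, (e ey).eq_of_nhds]
  have lim2 : Tendsto (fun n => ∫ p, F p * (χ (ρ n • p) * ψ p)) atTop (𝓝 (∫ p, F p * ψ p)) := by
    refine tendsto_integral_of_dominated_convergence (fun p => ‖F p * ψ p‖ * B) ?_ ?_ ?_ ?_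
    · intro n
      have ht : CTest fun p => χ (ρ n • p) * ψ p := by
        simpa [mul_comm] using (hχn n).smooth_mul sψ
      exact (ht.integrable_locInt_mul hF.locallyIntegrable).aestronglyMeasurable
    · exact (hF.integrable_mul iψ bψ).norm.mul_const _
    · intro n
      refine ae_of_all _ fun p => ?_
      rw [norm_mul, norm_mul, norm_mul]
      calc _ = ‖F p‖ * ‖ψ p‖ * ‖χ (ρ n • p)‖ := by ring
        _ ≤ _ := mul_le_mul_of_nonneg_left (hB _) (by positivity)
    · refine ae_of_all _ fun p => tendsto_const_nhds.congr' ?_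
      filter_upwards [hloc p] with n hn
      simp only [hn.eq_of_nhds]
  simp only [key] at lim1
  have hfin := tendsto_nhds_unique lim1 lim2
  rw [eL] at hfin
  have i1 := hW.integrable_mul hΦ.integrable hΦ.bm
  have i2 := hW.integrable_mul iψ bψ
  have i3 := hF.integrable_mul iψ bψ
  have e3 : ∫ p, W p * (Φ p - cc lam * ψ p) = (∫ p, W p * Φ p) - cc lam * ∫ p, W p * ψ p := by
    rw [← integral_const_mul, ← integral_sub i1 (i2.const_mul _)]
    refine integral_congr_ae (ae_of_all _ fun p => ?_)
    simp only; ring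
  have e4 : ∫ p, (F p + cc lam * W p) * ψ p = (∫ p, F p * ψ p) + cc lam * ∫ p, W p * ψ p := by
    rw [← integral_const_mul, ← integral_add i3 (i2.const_mul _)]
    refine integral_congr_ae (ae_of_all _ fun p => ?_)
    simp only; ring
  rw [e3] at hfin
  rw [e4, ← hfin]; ring

end

/-! ### Convolution of bounded functions with integrable kernels -/

/-- Dominated convergence along the filter at infinity requires this filter to be countably
generated. -/
instance cocompact_isCountablyGenerated : (cocompact (ℝ × ℝ)).IsCountablyGenerated := by
  rw [← Metric.cobounded_eq_cocompact, ← comap_norm_atTop]; infer_instance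

/-- Convolution of a function with a kernel. -/
def cvl (K H : ℝ × ℝ → ℂ) (r : ℝ × ℝ) : ℂ := ∫ q, H q * K (r - q)

/-- Functions tending to zero at infinity. -/
def Van (f : ℝ × ℝ → ℂ) : Prop := Tendsto f (cocompact (ℝ × ℝ)) (𝓝 0)

section

variable {e : ℝ × ℝ} {lam : ℂ} {K H W W' F f f' g g' Φ : ℝ × ℝ → ℂ}

lemma cvl_eq (K H : ℝ × ℝ → ℂ) (r : ℝ × ℝ) : cvl K H r = ∫ p, K p * H (r - p) := by
  rw [cvl, ← integral_sub_left_eq_self _ _ r]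
  refine integral_congr_ae (ae_of_all _ fun p => ?_)
  simp only [sub_sub_cancel]; ring

lemma bm_cvl (hKm : Measurable K) (hK : Integrable K) (hH : BM H) : BM (cvl K H) := by
  obtain ⟨C, hC⟩ := hH.bdd
  refine ⟨?_, (∫ p, ‖K p‖) * C, fun r => ?_⟩
  · have hm : Measurable fun z : (ℝ × ℝ) × (ℝ × ℝ) => H z.2 * K (z.1 - z.2) :=
      (hH.meas.comp measurable_snd).mul (hKm.comp (measurable_fst.sub measurable_snd))
    exact (hm.stronglyMeasurable.integral_prod_right' (ν := volume)).measurable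
  · rw [cvl_eq]; exact norm_integral_mul_le hK fun p => hC _

lemma tendsto_sub_cocompact (p : ℝ × ℝ) :
    Tendsto (fun r : ℝ × ℝ => r - p) (cocompact (ℝ × ℝ)) (cocompact (ℝ × ℝ)) :=
  (Homeomorph.subRight p).isClosedEmbedding.tendsto_cocompact

lemma van_cvl (hKm : Measurable K) (hK : Integrable K) (hH : BM H) (hv : Van H) :
    Van (cvl K H) := by
  obtain ⟨C, hC⟩ := hH.bdd
  unfold Van
  rw [funext (cvl_eq K H), show (0 : ℂ) = ∫ p : ℝ × ℝ, (0 : ℂ) by simp]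
  refine tendsto_integral_filter_of_dominated_convergence (fun p => ‖K p‖ * C)
    (Eventually.of_forall fun r => ?_) (Eventually.of_forall fun r => ae_of_all _ fun p => ?_)
    (hK.norm.mul_const C) (ae_of_all _ fun p => ?_)
  · exact (hKm.mul (hH.meas.comp (measurable_const.sub measurable_id))).aestronglyMeasurable
  · rw [norm_mul]; exact mul_le_mul_of_nonneg_left (hC _) (norm_nonneg _)
  · simpa using (hv.comp (tendsto_sub_cocompact p)).const_mul (K p)

lemma Van.add (hf : Van f) (hg : Van g) : Van fun p => f p + g p := by
  simpa [Van] using Tendsto.add hf hg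

lemma Van.bm_mul (hf : BM f) (hg : Van g) : Van fun p => f p * g p := by
  obtain ⟨C, hC⟩ := hf.bdd
  refine squeeze_zero_norm (a := fun p => C * ‖g p‖) (fun p => ?_) ?_
  · rw [norm_mul]; exact mul_le_mul_of_nonneg_right (hC p) (norm_nonneg _)
  · simpa using hg.norm.const_mul C

/-! ### Interior regularity -/

lemma adj_heatKer_pd (hΦ : CTest Φ) :
    adj (heatKer lam (cc lam)) (pd ex Φ) = fun q => -adj (heatKerX lam (cc lam)) Φ q := by
  ext q
  have := integral_heatKer_mul_pd lam (hΦ.comp_add q)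
  rw [pd_comp_add] at this
  simp only [adj, add_comm q]
  exact this

/-- Bounded weak solutions with bounded right-hand side have a bounded `x`-derivative. -/
theorem Sol.exists_wd_ex (hW : BM W) (hF : BM F) (h : Sol lam W F) :
    ∃ W', BM W' ∧ WD ex W W' ∧ (Van W → Van F → Van W') := by
  have hH : BM fun q => F q + cc lam * W q := hF.add (hW.const_mul _)
  -- By `Sol.integral_eq`, W is the heat kernel convolved with F + `cc lam` W; the derivative is put
  -- on the kernel.
  refine ⟨cvl (heatKerX lam (cc lam)) fun q => F q + cc lam * W q,
    bm_cvl (measurable_heatKerX _ _) (integrable_heatKerX lam) hH, fun Φ hΦ => ?_, fun h1 h2 =>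
    van_cvl (measurable_heatKerX _ _) (integrable_heatKerX lam) hH
      (h2.add (Van.bm_mul (BM.const _) h1))⟩
  rw [h.integral_eq hW.tame hF.tame (hΦ.pd ex), adj_heatKer_pd hΦ]
  simp only [mul_neg]
  rw [integral_neg, integral_mul_adj hH.tame (integrable_heatKerX lam) hΦ]
  rfl

/-- Once two x-derivatives are known, the equation itself expresses the y-derivative. -/
lemma Sol.wd_ey {W₁ W₂ : ℝ × ℝ → ℂ} (h : Sol lam W F) (hW₁ : BM W₁) (hF : BM F) (hW : BM W)
    (hW₂ : BM W₂) (h1 : WD ex W W₁) (h2 : WD ex W₁ W₂) :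
    WD ey W (fun p => W₂ p - 2 * Complex.I * lam * W₁ p + F p) := by
  intro Φ hΦ
  have e := h Φ hΦ
  have i1 := hW.integrable_mul (hΦ.pd ey).integrable
  have i2 := hW.integrable_mul ((hΦ.pd ex).pd ex).integrable
  have i3 := hW.integrable_mul (hΦ.pd ex).integrable
  have j1 := hW₂.integrable_mul hΦ.integrable
  have j2 := hW₁.integrable_mul hΦ.integrable
  have j3 := hF.integrable_mul hΦ.integrable
  have a1 : ∫ p, W p * Lst lam Φ p = -(∫ p, W p * pd ey Φ p) - (∫ p, W p * pd ex (pd ex Φ) p)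
      - 2 * Complex.I * lam * (∫ p, W p * pd ex Φ p) + 0 * ∫ p, W p * pd ex Φ p := by
    rw [← integral_lin_comb i1 i2 i3 i3]
    refine integral_congr_ae (ae_of_all _ fun p => ?_)
    simp only [Lst]; ring
  have a2 : ∫ p, (W₂ p - 2 * Complex.I * lam * W₁ p + F p) * Φ p =
      -(∫ p, 0 * Φ p) - (∫ p, -(W₂ p * Φ p)) - 2 * Complex.I * lam * (∫ p, W₁ p * Φ p)
      + 1 * ∫ p, F p * Φ p := by
    rw [← integral_lin_comb (a := fun p => 0 * Φ p) (b := fun p => -(W₂ p * Φ p))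
      (by simp) j1.neg j2 j3]
    refine integral_congr_ae (ae_of_all _ fun p => ?_)
    simp only; ring
  have b1 := h1 _ (hΦ.pd ex)
  have b2 := h2 _ hΦ
  have b3 := h1 _ hΦ
  rw [a2, ← e, a1, b1, b2, b3, integral_neg]
  simp

/-- If moreover the right-hand side is differentiable in `x`, two `x`-derivatives and the
`y`-derivative of the solution are bounded. -/
theorem Sol.exists_wd_all {F' : ℝ × ℝ → ℂ} (hW : BM W) (hF : BM F) (h : Sol lam W F)
    (hW' : BM W') (hWx : WD ex W W') (hF' : BM F') (hFx : WD ex F F') :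
    ∃ W₂ Wy, BM W₂ ∧ WD ex W' W₂ ∧ BM Wy ∧ WD ey W Wy := by
  obtain ⟨W₂, hW₂, hWxx, -⟩ := (h.wd hWx hFx).exists_wd_ex hW' hF'
  exact ⟨W₂, _, hW₂, hWxx, (hW₂.sub (hW'.const_mul _)).add hF,
    h.wd_ey hW' hF hW hW₂ hWx hWxx⟩

/-! ### The product rule for weak derivatives -/

lemma pd_cv_of_wd (hg : BM g) (h : WD e g g') {ρ : ℝ × ℝ → ℂ} (hρ : CTest ρ) :
    pd e (cv g ρ) = cv g' ρ := by
  rw [pd_cv hg.locallyIntegrable hρ]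
  ext q
  have := h _ (hρ.comp_sub_left q)
  rw [pd_comp_sub_left e q hρ.differentiable] at this
  simp only [mul_neg, integral_neg, neg_inj] at this
  exact this

/-- Smooth approximations of a bounded function and its bounded weak derivative. -/
lemma WD.exists_approx (hg : BM g) (hg' : BM g') (h : WD e g g') :
    ∃ (G : ℕ → ℝ × ℝ → ℂ) (C : ℝ), (∀ n, ContDiff ℝ ∞ (G n)) ∧
      (∀ n p, ‖G n p‖ ≤ C ∧ ‖pd e (G n) p‖ ≤ C) ∧
      (∀ᵐ p, Tendsto (fun n => G n p) atTop (𝓝 (g p))) ∧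
      (∀ᵐ p, Tendsto (fun n => pd e (G n) p) atTop (𝓝 (g' p))) := by
  obtain ⟨C, hC⟩ := hg.bdd
  obtain ⟨C', hC'⟩ := hg'.bdd
  -- The outer radius is twice the inner one for every n: almost everywhere convergence of the
  -- mollifications requires a bounded ratio of radii, here K = 2.
  let φ : ℕ → ContDiffBump (0 : ℝ × ℝ) := fun n =>
    ⟨((n : ℝ) + 1)⁻¹, 2 * ((n : ℝ) + 1)⁻¹, by positivity, by
      have : 0 < ((n : ℝ) + 1)⁻¹ := by positivity
      linarith⟩
  let ρ : ℕ → ℝ × ℝ → ℂ := fun n p => ((φ n).normed volume p : ℂ)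
  have hρ : ∀ n, CTest (ρ n) := fun n =>
    ⟨Complex.ofRealCLM.contDiff.comp (φ n).contDiff_normed,
      (φ n).hasCompactSupport_normed.comp_left (g := ((↑) : ℝ → ℂ)) (by simp)⟩
  have hlim : Tendsto (fun n => (φ n).rOut) atTop (𝓝 0) := by
    have ht : Tendsto (fun n : ℕ => ((n : ℝ) + 1)⁻¹) atTop (𝓝 0) := tendsto_inv_atTop_zero.comp
      (tendsto_atTop_add_const_right _ _ tendsto_natCast_atTop_atTop)
    simpa using ht.const_mul 2
  have hcv : ∀ (k : ℝ × ℝ → ℂ) n p, cv k (ρ n) p =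
      MeasureTheory.convolution ((φ n).normed volume) k (ContinuousLinearMap.lsmul ℝ ℝ) volume p := by
    intro k n p
    rw [cv, MeasureTheory.convolution_def, ← integral_sub_left_eq_self _ _ p]
    refine integral_congr_ae (ae_of_all _ fun t => ?_)
    simp [ρ, mul_comm]
  have hae : ∀ k : ℝ × ℝ → ℂ, BM k →
      ∀ᵐ p, Tendsto (fun n => cv k (ρ n) p) atTop (𝓝 (k p)) := by
    intro k hk
    filter_upwards [ContDiffBump.ae_convolution_tendsto_right_of_locallyIntegrable (K := 2) hlim
      (Eventually.of_forall fun n => le_rfl) hk.locallyIntegrable] with p hp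
    simpa only [hcv] using hp
  have hbd : ∀ (k : ℝ × ℝ → ℂ) (D : ℝ), (∀ p, ‖k p‖ ≤ D) → ∀ n p, ‖cv k (ρ n) p‖ ≤ D := by
    intro k D hD n p
    have h1 : cv k (ρ n) p = ∫ t, ρ n t * k (p - t) := by
      rw [cv, ← integral_sub_left_eq_self _ _ p]
      refine integral_congr_ae (ae_of_all _ fun t => ?_)
      simp only [sub_sub_cancel]; ring
    rw [h1]
    refine (norm_integral_mul_le (hρ n).integrable fun t => hD _).trans ?_
    have h2 : ∫ t, ‖ρ n t‖ = 1 := by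
      rw [← (φ n).integral_normed (μ := volume)]
      refine integral_congr_ae (ae_of_all _ fun t => ?_)
      simp only [ρ, Complex.norm_real, Real.norm_of_nonneg ((φ n).nonneg_normed t)]
    rw [h2, one_mul]
  refine ⟨fun n => cv g (ρ n), max C C', fun n => contDiff_cv hg.locallyIntegrable (hρ n),
    fun n p => ⟨(hbd g C hC n p).trans (le_max_left _ _), ?_⟩, hae g hg, ?_⟩
  · rw [pd_cv_of_wd hg h (hρ n)]
    exact (hbd g' C' hC' n p).trans (le_max_right _ _)
  · simp only [fun n => pd_cv_of_wd hg h (hρ n)]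
    exact hae g' hg'

/-- The weak derivative of f is tested against GₙΦ with Gₙ the mollifications of g. These and their
derivatives are uniformly bounded and converge almost everywhere, so dominated convergence gives the
product rule for two merely bounded functions. -/
theorem WD.mul (hf : BM f) (hf' : BM f') (hg : BM g) (hg' : BM g') (h : WD e f f')
    (h' : WD e g g') : WD e (fun p => f p * g p) (fun p => f' p * g p + f p * g' p) := by
  obtain ⟨G, C, hG, hC, hl, hl'⟩ := h'.exists_approx hg hg'
  intro Φ hΦ
  have hC0 : 0 ≤ C := (norm_nonneg _).trans (hC 0 0).1
  have key : ∀ n, ∫ p, f p * (pd e (G n) p * Φ p + G n p * pd e Φ p) =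
      -∫ p, f' p * (G n p * Φ p) := by
    intro n
    have := h _ (hΦ.smooth_mul (hG n))
    rwa [pd_mul e ((hG n).differentiable (by simp)) hΦ.differentiable] at this
  have hi1 := (hf.integrable_mul hΦ.integrable)
  have hi2 := (hf.integrable_mul (hΦ.pd e).integrable)
  have hi3 := (hf'.integrable_mul hΦ.integrable)
  have lim1 : Tendsto (fun n => ∫ p, f p * (pd e (G n) p * Φ p + G n p * pd e Φ p)) atTop
      (𝓝 (∫ p, f p * (g' p * Φ p + g p * pd e Φ p))) := by
    refine tendsto_integral_of_dominated_convergence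
      (fun p => ‖f p * Φ p‖ * C + ‖f p * pd e Φ p‖ * C) ?_ ?_ ?_ ?_
    · intro n
      exact (hf.meas.mul (((contDiff_pd (hG n) e).continuous.measurable.mul
        hΦ.continuous.measurable).add ((hG n).continuous.measurable.mul
        (hΦ.pd e).continuous.measurable))).aestronglyMeasurable
    · exact (hi1.norm.mul_const _).add (hi2.norm.mul_const _)
    · intro n
      refine ae_of_all _ fun p => ?_
      have : ‖pd e (G n) p * Φ p + G n p * pd e Φ p‖ ≤ C * ‖Φ p‖ + C * ‖pd e Φ p‖ := by
        refine (norm_add_le _ _).trans (add_le_add ?_ ?_)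
        · rw [norm_mul]; exact mul_le_mul_of_nonneg_right (hC n p).2 (norm_nonneg _)
        · rw [norm_mul]; exact mul_le_mul_of_nonneg_right (hC n p).1 (norm_nonneg _)
      rw [norm_mul, norm_mul, norm_mul]
      calc _ ≤ ‖f p‖ * _ := mul_le_mul_of_nonneg_left this (norm_nonneg _)
        _ = _ := by ring
    · filter_upwards [hl, hl'] with p h1 h2
      exact ((h2.mul_const _).add (h1.mul_const _)).const_mul _
  have lim2 : Tendsto (fun n => -∫ p, f' p * (G n p * Φ p)) atTop
      (𝓝 (-∫ p, f' p * (g p * Φ p))) := by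
    refine Tendsto.neg ?_
    refine tendsto_integral_of_dominated_convergence (fun p => ‖f' p * Φ p‖ * C) ?_ ?_ ?_ ?_
    · intro n
      exact (hf'.meas.mul ((hG n).continuous.measurable.mul
        hΦ.continuous.measurable)).aestronglyMeasurable
    · exact hi3.norm.mul_const _
    · intro n
      refine ae_of_all _ fun p => ?_
      rw [norm_mul, norm_mul, norm_mul]
      calc _ = ‖f' p‖ * ‖Φ p‖ * ‖G n p‖ := by ring
        _ ≤ _ := mul_le_mul_of_nonneg_left (hC n p).1 (by positivity)
    · filter_upwards [hl] with p h1
      exact (h1.mul_const _).const_mul _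
  simp only [key] at lim1
  have hfin := tendsto_nhds_unique lim1 lim2
  have j1 := (hf.mul hg').integrable_mul hΦ.integrable
  have j2 := (hf.mul hg).integrable_mul (hΦ.pd e).integrable
  have j3 := (hf'.mul hg).integrable_mul hΦ.integrable
  have e1 : ∫ p, f p * (g' p * Φ p + g p * pd e Φ p) =
      (∫ p, f p * g' p * Φ p) + ∫ p, f p * g p * pd e Φ p := by
    rw [← integral_add j1 j2]
    refine integral_congr_ae (ae_of_all _ fun p => ?_)
    simp only; ring
  have e2 : ∫ p, (f' p * g p + f p * g' p) * Φ p =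
      (∫ p, f' p * g p * Φ p) + ∫ p, f p * g' p * Φ p := by
    rw [← integral_add j3 j1]
    refine integral_congr_ae (ae_of_all _ fun p => ?_)
    simp only; ring
  rw [e1] at hfin
  simp only [← mul_assoc] at hfin
  rw [e2, eq_neg_iff_add_eq_zero]
  linear_combination hfin

end

/-! ### Regularity of bounded solutions -/

/-- A family of bounded functions `f j k = ∂_y ^ j ∂_x ^ k f 0 0`, `j, k ≤ 2`. -/
structure Grid (f : ℕ → ℕ → ℝ × ℝ → ℂ) : Prop where
  bm : ∀ j k, j ≤ 2 → k ≤ 2 → BM (f j k)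
  wx : ∀ j k, j ≤ 2 → k < 2 → WD ex (f j k) (f j (k + 1))
  wy : ∀ j k, j < 2 → k ≤ 2 → WD ey (f j k) (f (j + 1) k)

lemma WD.add_bm {e : ℝ × ℝ} {f f' g g' : ℝ × ℝ → ℂ} (h : WD e f f') (h' : WD e g g')
    (hf : BM f) (hf' : BM f') (hg : BM g) (hg' : BM g') :
    WD e (fun p => f p + g p) (fun p => f' p + g' p) :=
  WD.add hf.locallyIntegrable hf'.locallyIntegrable hg.locallyIntegrable hg'.locallyIntegrable h h'

/-- A bootstrap on the number of y-derivatives. Each ∂_y^j m solves the equation with a right-hand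
side involving V and lower derivatives. `exists_wd_ex` yields its first x-derivative, which makes
the right-hand side differentiable in x, and `exists_wd_all` then yields the second x-derivative and
one more y-derivative. Weak y-derivatives are needed only in the column k = 0, since mixed
derivatives are reached by going up in y first and then along x. -/
theorem Sol.regularity {lam : ℂ} {m : ℝ × ℝ → ℂ} {V : ℕ → ℕ → ℝ × ℝ → ℂ} (hV : Grid V)
    (hm : BM m) (h : Sol lam m (fun p => -(V 0 0 p * m p))) :
    ∃ M : ℕ → ℕ → ℝ × ℝ → ℂ, M 0 0 = m ∧ (∀ j k, j ≤ 2 → k ≤ 2 → BM (M j k)) ∧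
      (∀ j k, j ≤ 2 → k < 2 → WD ex (M j k) (M j (k + 1))) ∧
      (∀ j, j < 2 → WD ey (M j 0) (M (j + 1) 0)) := by
  have b00 := hV.bm 0 0 (by norm_num) (by norm_num)
  have b01 := hV.bm 0 1 (by norm_num) (by norm_num)
  have b10 := hV.bm 1 0 (by norm_num) (by norm_num)
  have b11 := hV.bm 1 1 (by norm_num) (by norm_num)
  have b20 := hV.bm 2 0 (by norm_num) (by norm_num)
  have b21 := hV.bm 2 1 (by norm_num) (by norm_num)
  have x00 := hV.wx 0 0 (by norm_num) (by norm_num)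
  have x10 := hV.wx 1 0 (by norm_num) (by norm_num)
  have x20 := hV.wx 2 0 (by norm_num) (by norm_num)
  have y00 := hV.wy 0 0 (by norm_num) (by norm_num)
  have y10 := hV.wy 1 0 (by norm_num) (by norm_num)
  -- no `y`-derivative
  have hF := (b00.mul hm).neg
  obtain ⟨m₁, bm₁, wm₁, -⟩ := h.exists_wd_ex hm hF
  obtain ⟨m₂, n₀, bm₂, wm₂, bn₀, wn₀⟩ := h.exists_wd_all hm hF bm₁ wm₁
    ((b01.mul hm).add (b00.mul bm₁)).neg ((x00.mul b00 b01 hm bm₁ wm₁).neg)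
  -- one `y`-derivative
  have h1 := h.wd wn₀ (y00.mul b00 b10 hm bn₀ wn₀).neg
  have hF1 := ((b10.mul hm).add (b00.mul bn₀)).neg
  obtain ⟨n₁, bn₁, wn₁, -⟩ := h1.exists_wd_ex bn₀ hF1
  have hFx1 := ((x10.mul b10 b11 hm bm₁ wm₁).add_bm (x00.mul b00 b01 bn₀ bn₁ wn₁)
    (b10.mul hm) ((b11.mul hm).add (b10.mul bm₁)) (b00.mul bn₀)
    ((b01.mul bn₀).add (b00.mul bn₁))).neg
  obtain ⟨n₂, o₀, bn₂, wn₂, bo₀, wo₀⟩ := h1.exists_wd_all bn₀ hF1 bn₁ wn₁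
    ((((b11.mul hm).add (b10.mul bm₁))).add ((b01.mul bn₀).add (b00.mul bn₁))).neg hFx1
  -- two `y`-derivatives
  have h2 := h1.wd wo₀ ((y10.mul b10 b20 hm bn₀ wn₀).add_bm (y00.mul b00 b10 bn₀ bo₀ wo₀)
    (b10.mul hm) ((b20.mul hm).add (b10.mul bn₀)) (b00.mul bn₀)
    ((b10.mul bn₀).add (b00.mul bo₀))).neg
  have hF2 := ((((b20.mul hm).add (b10.mul bn₀))).add ((b10.mul bn₀).add (b00.mul bo₀))).neg
  obtain ⟨o₁, bo₁, wo₁, -⟩ := h2.exists_wd_ex bo₀ hF2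
  have c1 := (b20.mul hm).add (b10.mul bn₀)
  have c2 := (b10.mul bn₀).add (b00.mul bo₀)
  have d1 := (x20.mul b20 b21 hm bm₁ wm₁).add_bm (x10.mul b10 b11 bn₀ bn₁ wn₁)
    (b20.mul hm) ((b21.mul hm).add (b20.mul bm₁)) (b10.mul bn₀)
    ((b11.mul bn₀).add (b10.mul bn₁))
  have d2 := (x10.mul b10 b11 bn₀ bn₁ wn₁).add_bm (x00.mul b00 b01 bo₀ bo₁ wo₁)
    (b10.mul bn₀) ((b11.mul bn₀).add (b10.mul bn₁)) (b00.mul bo₀)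
    ((b01.mul bo₀).add (b00.mul bo₁))
  have k1 := ((b21.mul hm).add (b20.mul bm₁)).add ((b11.mul bn₀).add (b10.mul bn₁))
  have k2 := ((b11.mul bn₀).add (b10.mul bn₁)).add ((b01.mul bo₀).add (b00.mul bo₁))
  obtain ⟨o₂, -, bo₂, wo₂, -, -⟩ := h2.exists_wd_all bo₀ hF2 bo₁ wo₁ (k1.add k2).neg
    (d1.add_bm d2 c1 k1 c2 k2).neg
  refine ⟨fun j k => match j, k with
    | 0, 0 => m | 0, 1 => m₁ | 0, _ => m₂
    | 1, 0 => n₀ | 1, 1 => n₁ | 1, _ => n₂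
    | _, 0 => o₀ | _, 1 => o₁ | _, _ => o₂, rfl, ?_, ?_, ?_⟩
  · intro j k hj hk
    interval_cases j <;> interval_cases k <;> assumption
  · intro j k hj hk
    interval_cases j <;> interval_cases k <;> assumption
  · intro j hj
    interval_cases j <;> assumption

/-! ### Real and complex test functions -/

lemma CTest.ofReal {φ : ℝ × ℝ → ℝ} (h : IsTest φ) : CTest fun p => (φ p : ℂ) :=
  ⟨Complex.ofRealCLM.contDiff.comp h.1, h.2.comp_left (g := ((↑) : ℝ → ℂ)) (by simp)⟩

lemma CTest.re {Φ : ℝ × ℝ → ℂ} (h : CTest Φ) : IsTest fun p => (Φ p).re :=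
  ⟨Complex.reCLM.contDiff.comp h.smooth, h.supp.comp_left (g := Complex.re) (by simp)⟩

lemma CTest.im {Φ : ℝ × ℝ → ℂ} (h : CTest Φ) : IsTest fun p => (Φ p).im :=
  ⟨Complex.imCLM.contDiff.comp h.smooth, h.supp.comp_left (g := Complex.im) (by simp)⟩

lemma IsTest.of_ofReal {φ : ℝ × ℝ → ℝ} (h : CTest fun p => (φ p : ℂ)) : IsTest φ := by
  simpa using h.re

lemma ofReal_dx {φ : ℝ × ℝ → ℝ} (h : IsTest φ) (p : ℝ × ℝ) :
    (dx φ p : ℂ) = pd ex (fun p => (φ p : ℂ)) p := by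
  have h1 := (CTest.ofReal h).hasDerivAt_fst p.1 p.2
  have hd : DifferentiableAt ℝ (fun s => φ (s, p.2)) p.1 :=
    ((h.1.differentiable (by simp)) (p.1, p.2)).comp p.1 (by fun_prop)
  exact (hd.hasDerivAt.ofReal_comp).unique h1

lemma ofReal_dy {φ : ℝ × ℝ → ℝ} (h : IsTest φ) (p : ℝ × ℝ) :
    (dy φ p : ℂ) = pd ey (fun p => (φ p : ℂ)) p := by
  have h1 := (CTest.ofReal h).hasDerivAt_snd p.1 p.2
  have hd : DifferentiableAt ℝ (fun s => φ (p.1, s)) p.2 :=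
    ((h.1.differentiable (by simp)) (p.1, p.2)).comp p.2 (by fun_prop)
  exact (hd.hasDerivAt.ofReal_comp).unique h1

lemma IsTest.dx {φ : ℝ × ℝ → ℝ} (h : IsTest φ) : IsTest (dx φ) := by
  refine IsTest.of_ofReal ?_
  rw [funext (ofReal_dx h)]; exact (CTest.ofReal h).pd ex

lemma IsTest.dy {φ : ℝ × ℝ → ℝ} (h : IsTest φ) : IsTest (dy φ) := by
  refine IsTest.of_ofReal ?_
  rw [funext (ofReal_dy h)]; exact (CTest.ofReal h).pd ey

lemma IsTest.iterate_dx {φ : ℝ × ℝ → ℝ} (h : IsTest φ) (k : ℕ) : IsTest (KPII.dx^[k] φ) := by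
  induction k with
  | zero => exact h
  | succ k ih => rw [Function.iterate_succ_apply']; exact ih.dx

lemma dx_dy_comm {φ : ℝ × ℝ → ℝ} (h : IsTest φ) : dx (dy φ) = dy (dx φ) := by
  ext p
  have : ((dx (dy φ) p : ℝ) : ℂ) = ((dy (dx φ) p : ℝ) : ℂ) := by
    rw [ofReal_dx h.dy, ofReal_dy h.dx, funext (ofReal_dy h), funext (ofReal_dx h),
      pd_comm (CTest.ofReal h).smooth]
  exact_mod_cast this

lemma iterate_dx_dy {φ : ℝ × ℝ → ℝ} (h : IsTest φ) (k : ℕ) :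
    KPII.dx^[k] (dy φ) = dy (KPII.dx^[k] φ) := by
  induction k with
  | zero => rfl
  | succ k ih => rw [Function.iterate_succ_apply', ih, dx_dy_comm (h.iterate_dx k),
      ← Function.iterate_succ_apply' KPII.dx]

lemma eq_re_add_im (Φ : ℝ × ℝ → ℂ) :
    Φ = fun p => ((Φ p).re : ℂ) + Complex.I * ((Φ p).im : ℂ) := by
  ext p; rw [mul_comm]; exact (Complex.re_add_im _).symm

/-- Weak derivatives can be tested on real test functions. -/
lemma WD.of_real {e : ℝ × ℝ} {f g : ℝ × ℝ → ℂ} (hf : LocallyIntegrable f)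
    (hg : LocallyIntegrable g)
    (h : ∀ φ : ℝ × ℝ → ℝ, IsTest φ → ∫ p, f p * pd e (fun p => (φ p : ℂ)) p = -∫ p, g p * φ p) :
    WD e f g := by
  intro Φ hΦ
  have t1 := CTest.ofReal hΦ.re
  have t2 := CTest.ofReal hΦ.im
  have e1 : pd e Φ = fun p => pd e (fun p => ((Φ p).re : ℂ)) p +
      Complex.I * pd e (fun p => ((Φ p).im : ℂ)) p := by
    conv_lhs => rw [eq_re_add_im Φ]
    rw [pd_add e t1.differentiable (t2.differentiable.const_mul _),
      pd_const_mul e t2.differentiable]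
  have a1 : ∫ p, f p * pd e Φ p = (∫ p, f p * pd e (fun p => ((Φ p).re : ℂ)) p) +
      Complex.I * ∫ p, f p * pd e (fun p => ((Φ p).im : ℂ)) p := by
    rw [← integral_const_mul, ← integral_add ((t1.pd e).integrable_locInt_mul hf)
      (((t2.pd e).integrable_locInt_mul hf).const_mul _), e1]
    refine integral_congr_ae (ae_of_all _ fun p => ?_)
    simp only; ring
  have a2 : ∫ p, g p * Φ p = (∫ p, g p * ((Φ p).re : ℂ)) +
      Complex.I * ∫ p, g p * ((Φ p).im : ℂ) := by
    rw [← integral_const_mul, ← integral_add (t1.integrable_locInt_mul hg)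
      ((t2.integrable_locInt_mul hg).const_mul _)]
    refine integral_congr_ae (ae_of_all _ fun p => ?_)
    simp only
    conv_lhs => rw [eq_re_add_im Φ]
    ring
  rw [a1, a2, h _ hΦ.re, h _ hΦ.im]; ring

lemma BM.memLp_top {f : ℝ × ℝ → ℂ} (h : BM f) : MemLp f ⊤ volume := by
  obtain ⟨C, hC⟩ := h.bdd
  exact memLp_top_of_bound h.meas.aestronglyMeasurable C (ae_of_all _ hC)

lemma HasWeakPartial.refl {f : ℝ × ℝ → ℂ} (h : BM f) : HasWeakPartial 0 0 f f :=
  ⟨h.locallyIntegrable, h.locallyIntegrable, fun φ _ => by simp⟩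

lemma HasWeakPartial.step_x {f g h : ℝ × ℝ → ℂ} {j k : ℕ} (hg : HasWeakPartial j k f g)
    (hb : BM h) (hw : WD ex g h) : HasWeakPartial j (k + 1) f h := by
  refine ⟨hg.locInt_left, hb.locallyIntegrable, fun φ hφ => ?_⟩
  have h1 := hg.integral_eq _ hφ.dx
  rw [← Function.iterate_succ_apply] at h1
  rw [h1]
  have h2 := hw _ (CTest.ofReal hφ)
  have e1 : ∫ p, KPII.dx φ p • g p = ∫ p, g p * pd ex (fun p => (φ p : ℂ)) p := by
    refine integral_congr_ae (ae_of_all _ fun p => ?_)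
    simp only [← ofReal_dx hφ, Complex.real_smul, mul_comm]
  have e2 : ∫ p, φ p • h p = ∫ p, h p * φ p := by
    refine integral_congr_ae (ae_of_all _ fun p => ?_)
    simp only [Complex.real_smul, mul_comm]
  rw [e1, e2, h2, ← add_assoc, pow_succ]
  simp

lemma HasWeakPartial.step_y {f g h : ℝ × ℝ → ℂ} {j k : ℕ} (hg : HasWeakPartial j k f g)
    (hb : BM h) (hw : WD ey g h) : HasWeakPartial (j + 1) k f h := by
  refine ⟨hg.locInt_left, hb.locallyIntegrable, fun φ hφ => ?_⟩
  have h1 := hg.integral_eq _ hφ.dy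
  rw [iterate_dx_dy hφ, ← Function.iterate_succ_apply] at h1
  rw [h1]
  have h2 := hw _ (CTest.ofReal hφ)
  have e1 : ∫ p, KPII.dy φ p • g p = ∫ p, g p * pd ey (fun p => (φ p : ℂ)) p := by
    refine integral_congr_ae (ae_of_all _ fun p => ?_)
    simp only [← ofReal_dy hφ, Complex.real_smul, mul_comm]
  have e2 : ∫ p, φ p • h p = ∫ p, h p * φ p := by
    refine integral_congr_ae (ae_of_all _ fun p => ?_)
    simp only [Complex.real_smul, mul_comm]
  rw [e1, e2, h2, add_right_comm, pow_succ]
  simp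

/-- Bounded potentials with bounded weak derivatives give a grid. -/
lemma exists_grid {v : ℝ × ℝ → ℝ} (hv : ∀ j k : ℕ, j ≤ 2 → k ≤ 2 → ∃ g : ℝ × ℝ → ℝ,
    HasWeakPartial j k v g ∧ MemLp g ⊤ volume) :
    ∃ V : ℕ → ℕ → ℝ × ℝ → ℂ, Grid V ∧ (fun p => (v p : ℂ)) =ᵐ[volume] V 0 0 := by
  choose! g hg hb using hv
  have hrep : ∀ j k, ∃ G : ℝ × ℝ → ℂ, j ≤ 2 → k ≤ 2 →
      BM G ∧ (fun p => (g j k p : ℂ)) =ᵐ[volume] G := by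
    intro j k
    by_cases hjk : j ≤ 2 ∧ k ≤ 2
    · have hm := hb j k hjk.1 hjk.2
      have hs := hm.1
      obtain ⟨C, hC⟩ : ∃ C : ℝ, ∀ᵐ p, ‖g j k p‖ ≤ C := by
        refine ⟨(eLpNorm (g j k) ⊤ volume).toReal, ?_⟩
        filter_upwards [ae_le_eLpNormEssSup (f := g j k) (μ := volume)] with p hp
        have h2 := hm.2
        rw [eLpNorm_exponent_top] at h2 ⊢
        rw [← toReal_enorm]
        exact ENNReal.toReal_mono h2.ne hp
      -- A measurable representative, clipped to [-C, C] so that the bound holds everywhere instead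
      -- of almost everywhere.
      refine ⟨fun p => ((max (-C) (min (hs.mk _ p) C) : ℝ) : ℂ), fun _ _ => ⟨⟨?_, |C|, ?_⟩, ?_⟩⟩
      · exact Complex.measurable_ofReal.comp (measurable_const.max
          (hs.stronglyMeasurable_mk.measurable.min measurable_const))
      · intro p
        rw [Complex.norm_real, Real.norm_eq_abs]
        refine abs_le.2 ⟨(neg_le_neg (le_abs_self C)).trans (le_max_left _ _), max_le ?_ ?_⟩
        · exact neg_le_abs C
        · exact (min_le_right _ _).trans (le_abs_self C)
      · filter_upwards [hC, hs.ae_eq_mk] with p h1 h2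
        rw [← h2]
        have h3 := abs_le.1 (by simpa using h1)
        rw [min_eq_left h3.2, max_eq_right h3.1]
    · exact ⟨0, fun h1 h2 => absurd ⟨h1, h2⟩ hjk⟩
  choose V hV using hrep
  have hcongr : ∀ j k, j ≤ 2 → k ≤ 2 → ∀ Ψ : ℝ × ℝ → ℂ,
      ∫ p, V j k p * Ψ p = ∫ p, (g j k p : ℂ) * Ψ p := by
    intro j k hj hk Ψ
    refine integral_congr_ae ?_
    filter_upwards [(hV j k hj hk).2] with p hp
    rw [← hp]
  have hreal : ∀ j k, ∀ φ : ℝ × ℝ → ℝ, ∫ p, (g j k p : ℂ) * (φ p : ℂ) =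
      ((∫ p, φ p • g j k p : ℝ) : ℂ) := by
    intro j k φ
    rw [← integral_complex_ofReal]
    refine integral_congr_ae (ae_of_all _ fun p => ?_)
    simp [mul_comm]
  refine ⟨V, ⟨fun j k hj hk => (hV j k hj hk).1, fun j k hj hk => ?_, fun j k hj hk => ?_⟩, ?_⟩
  · refine WD.of_real (hV j k hj hk.le).1.locallyIntegrable
      (hV j (k + 1) hj hk).1.locallyIntegrable fun φ hφ => ?_
    simp only [← ofReal_dx hφ]
    rw [hcongr j k hj hk.le, hcongr j (k + 1) hj hk, hreal, hreal]
    have h1 := (hg j k hj hk.le).integral_eq _ hφ.dx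
    have h2 := (hg j (k + 1) hj hk).integral_eq _ hφ
    rw [← Function.iterate_succ_apply, h2, ← add_assoc, pow_succ] at h1
    have h3 : ((-1 : ℝ) ^ (j + k)) ≠ 0 := pow_ne_zero _ (by norm_num)
    simp only [smul_eq_mul] at h1 ⊢
    have h4 := mul_left_cancel₀ h3 (a := (-1 : ℝ) ^ (j + k))
      (b := -∫ p, φ p * g j (k + 1) p) (c := ∫ p, KPII.dx φ p * g j k p) (by linarith)
    rw [← h4]; push_cast; rfl
  · refine WD.of_real (hV j k hj.le hk).1.locallyIntegrable
      (hV (j + 1) k hj hk).1.locallyIntegrable fun φ hφ => ?_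
    simp only [← ofReal_dy hφ]
    rw [hcongr j k hj.le hk, hcongr (j + 1) k hj hk, hreal, hreal]
    have h1 := (hg j k hj.le hk).integral_eq _ hφ.dy
    have h2 := (hg (j + 1) k hj hk).integral_eq _ hφ
    rw [iterate_dx_dy hφ, ← Function.iterate_succ_apply, h2, add_right_comm, pow_succ] at h1
    have h3 : ((-1 : ℝ) ^ (j + k)) ≠ 0 := pow_ne_zero _ (by norm_num)
    simp only [smul_eq_mul] at h1 ⊢
    have h4 := mul_left_cancel₀ h3 (a := (-1 : ℝ) ^ (j + k))
      (b := -∫ p, φ p * g (j + 1) k p) (c := ∫ p, KPII.dy φ p * g j k p) (by linarith)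
    rw [← h4]; push_cast; rfl
  · have h0 : v =ᵐ[volume] g 0 0 := by
      have h := hg 0 0 (by norm_num) (by norm_num)
      refine ae_eq_of_integral_contDiff_smul_eq h.locInt_left h.locInt_right fun φ hφ hs => ?_
      simpa using h.integral_eq φ ⟨hφ, hs⟩
    filter_upwards [h0, (hV 0 0 (by norm_num) (by norm_num)).2] with p h1 h2
    rw [h1, h2]

/-! ### Oscillatory integrals with monotone weights -/

/-- Abel's inequality: integration against a monotone weight with values in `[0, H]` is bounded
by `H` times the largest integral over an interval. -/
lemma norm_integral_weight_le {I : Set ℝ} {h : ℝ → ℝ} {φ : ℝ → ℂ} {H M : ℝ} (hI : I.OrdConnected)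
    (hmono : MonotoneOn h I ∨ AntitoneOn h I) (hhm : Measurable h) (hφm : Measurable φ)
    (h0 : ∀ t ∈ I, 0 ≤ h t) (hH : ∀ t ∈ I, h t ≤ H) (hH0 : 0 ≤ H)
    (hbd : ∀ c, 0 < c → Bornology.IsBounded {t ∈ I | c < h t}) (hM0 : 0 ≤ M)
    (hM : ∀ a b, a ≤ b → Set.Ioo a b ⊆ I → ‖∫ t in Set.Ioo a b, φ t‖ ≤ M) :
    ‖∫ t in I, (h t : ℂ) * φ t‖ ≤ H * M := by
  have hIm : MeasurableSet I := hI.measurableSet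
  -- If the product is not integrable, its integral is 0 by convention and the bound is trivial.
  by_cases hint : IntegrableOn (fun t => (h t : ℂ) * φ t) I
  swap
  · rw [integral_undef hint, norm_zero]; positivity
  -- A superlevel set of a monotone weight on an interval is again an interval, bounded by
  -- hypothesis, hence almost everywhere equal to an open interval where M applies.
  have hlev : ∀ c, 0 < c → ‖∫ t in {t ∈ I | c < h t}, φ t‖ ≤ M := by
    intro c hc
    set J := {t ∈ I | c < h t} with hJ
    have hJc : J.OrdConnected := by
      refine ⟨fun a ha b hb t ht => ⟨hI.out ha.1 hb.1 ht, ?_⟩⟩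
      rcases hmono with hm | hm
      · exact ha.2.trans_le (hm ha.1 (hI.out ha.1 hb.1 ht) ht.1)
      · exact hb.2.trans_le (hm (hI.out ha.1 hb.1 ht) hb.1 ht.2)
    rcases J.eq_empty_or_nonempty with he | hne
    · rw [he]; simpa using hM0
    have hb := hbd c hc
    have hsub : Set.Ioo (sInf J) (sSup J) ⊆ J :=
      IsConnected.Ioo_csInf_csSup_subset ⟨hne, hJc.isPreconnected⟩ hb.bddBelow hb.bddAbove
    have hsup : J ⊆ Set.Icc (sInf J) (sSup J) := fun t ht =>
      ⟨csInf_le hb.bddBelow ht, le_csSup hb.bddAbove ht⟩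
    have hae : J =ᵐ[volume] Set.Ioo (sInf J) (sSup J) :=
      (hsup.eventuallyLE.trans Ioo_ae_eq_Icc.symm.le).antisymm hsub.eventuallyLE
    rw [setIntegral_congr_set hae]
    exact hM _ _ (csInf_le_csSup hne hb.bddBelow hb.bddAbove) (hsub.trans fun t ht => ht.1)
  -- Layer-cake formula: h(t) is the length of {c : 0 < c < h(t)}. After exchanging the integrals,
  -- each level c in (0, H) contributes at most M.
  let g : ℝ → ℝ → ℂ := fun t c => Set.indicator (Set.Ioo 0 (h t)) (fun _ => φ t) c
  have hgm : Measurable (Function.uncurry g) := by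
    have : Function.uncurry g = Set.indicator {z : ℝ × ℝ | 0 < z.2 ∧ z.2 < h z.1}
        (fun z => φ z.1) := by
      ext ⟨t, c⟩; simp [g, Set.indicator]
    rw [this]
    exact (hφm.comp measurable_fst).indicator ((measurableSet_lt measurable_const
      measurable_snd).inter (measurableSet_lt measurable_snd (hhm.comp measurable_fst)))
  have hgi : ∀ t ∈ I, ∫ c, g t c = h t * φ t := by
    intro t ht
    rw [integral_indicator measurableSet_Ioo]
    simp [h0 t ht]
  have hprod : Integrable (Function.uncurry g) ((volume.restrict I).prod volume) := by
    rw [integrable_prod_iff hgm.aestronglyMeasurable]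
    constructor
    · refine ae_of_all _ fun t => ?_
      simp only [Function.uncurry, g]
      exact (integrable_indicator_iff measurableSet_Ioo).2 (by simp [IntegrableOn])
    · refine hint.norm.congr ?_
      filter_upwards [ae_restrict_mem hIm] with t ht
      simp only [Function.uncurry, g, norm_indicator_eq_indicator_norm]
      rw [integral_indicator measurableSet_Ioo]
      simp [h0 t ht, abs_of_nonneg]
  have hswap := integral_integral_swap hprod
  rw [setIntegral_congr_fun hIm fun t ht => (hgi t ht).symm, hswap]
  have hsl : ∀ c, ‖∫ t in I, g t c‖ ≤ Set.indicator (Set.Ioo 0 H) (fun _ => M) c := by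
    intro c
    by_cases hc : 0 < c
    · have e : ∫ t in I, g t c = ∫ t in {t ∈ I | c < h t}, φ t := by
        have hm : MeasurableSet {t | c < h t} := measurableSet_lt measurable_const hhm
        rw [show {t ∈ I | c < h t} = I ∩ {t | c < h t} from rfl, ← setIntegral_indicator hm]
        refine setIntegral_congr_fun hIm fun t _ => ?_
        simp [g, Set.indicator, hc]
      by_cases hcH : c < H
      · rw [e, Set.indicator_of_mem (show c ∈ Set.Ioo 0 H from ⟨hc, hcH⟩)]
        exact hlev c hc
      · rw [e, show {t ∈ I | c < h t} = ∅ from ?_]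
        · simp only [Measure.restrict_empty, integral_zero_measure, norm_zero]
          exact Set.indicator_nonneg (fun _ _ => hM0) _
        · ext t
          simp only [Set.mem_ofPred_eq, Set.mem_empty_iff_false, iff_false, not_and, not_lt]
          exact fun ht => (hH t ht).trans (not_lt.1 hcH)
    · have : (fun t => g t c) = fun _ => 0 := by ext t; simp [g, hc]
      rw [this]
      simp only [integral_zero, norm_zero]
      exact Set.indicator_nonneg (fun _ _ => hM0) _
  refine (norm_integral_le_of_norm_le ((integrable_indicator_iff measurableSet_Ioo).2
    (by simp [IntegrableOn])) (ae_of_all _ hsl)).trans ?_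
  rw [integral_indicator measurableSet_Ioo]
  simp [hH0]

lemma norm_integral_cos_le {Z : ℝ} (hZ : Z ≠ 0) {a b : ℝ} (hab : a ≤ b) :
    ‖∫ t in Set.Ioo a b, (Real.cos (t * Z) : ℂ)‖ ≤ 2 / |Z| := by
  rw [integral_complex_ofReal, ← integral_Ioc_eq_integral_Ioo,
    ← intervalIntegral.integral_of_le hab, intervalIntegral.integral_comp_mul_right _ hZ,
    integral_cos, Complex.norm_real, norm_smul, norm_inv, Real.norm_eq_abs, Real.norm_eq_abs,
    div_eq_inv_mul]
  gcongr
  exact (abs_sub _ _).trans (by linarith [Real.abs_sin_le_one (b * Z), Real.abs_sin_le_one (a * Z)])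

lemma norm_integral_sin_le {Z : ℝ} (hZ : Z ≠ 0) {a b : ℝ} (hab : a ≤ b) :
    ‖∫ t in Set.Ioo a b, (Real.sin (t * Z) : ℂ)‖ ≤ 2 / |Z| := by
  rw [integral_complex_ofReal, ← integral_Ioc_eq_integral_Ioo,
    ← intervalIntegral.integral_of_le hab, intervalIntegral.integral_comp_mul_right _ hZ,
    integral_sin, Complex.norm_real, norm_smul, norm_inv, Real.norm_eq_abs, Real.norm_eq_abs,
    div_eq_inv_mul]
  gcongr
  exact (abs_sub _ _).trans (by linarith [Real.abs_cos_le_one (b * Z), Real.abs_cos_le_one (a * Z)])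

/-- Partial integrals of `sin (t Z) / t` are uniformly bounded. -/
lemma norm_integral_sinc_le (Z : ℝ) {a b : ℝ} (ha : 0 ≤ a) :
    ‖∫ t in Set.Ioo a b, (Real.sin (t * Z) / t : ℂ)‖ ≤ 3 := by
  rcases eq_or_ne Z 0 with rfl | hZ
  · simp
  have hZ' : 0 < |Z| := abs_pos.2 hZ
  -- Below 1/|Z| the integrand is at most |Z|, contributing at most 1. Above it, the decreasing
  -- weight 1/t ≤ |Z| is played against integrals of sin(tZ) bounded by 2/|Z|, contributing at most
  -- 2.
  set k := |Z|⁻¹ with hk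
  have hk0 : 0 < k := inv_pos.2 hZ'
  have hpt : ∀ t : ℝ, 0 < t → ‖(Real.sin (t * Z) / t : ℂ)‖ ≤ |Z| := by
    intro t ht
    rw [norm_div, Complex.norm_real, Complex.norm_real, Real.norm_eq_abs, Real.norm_eq_abs,
      abs_of_pos ht, div_le_iff₀ ht]
    refine Real.abs_sin_le_abs.trans ?_
    rw [abs_mul, abs_of_pos ht, mul_comm]
  have hm : Measurable fun t : ℝ => (Real.sin (t * Z) / t : ℂ) := by fun_prop
  have hi : IntegrableOn (fun t : ℝ => (Real.sin (t * Z) / t : ℂ)) (Set.Ioo a b) := by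
    refine Integrable.mono' (g := fun _ => |Z|) (by simp) hm.aestronglyMeasurable ?_
    filter_upwards [ae_restrict_mem measurableSet_Ioo] with t ht
    exact hpt t (ha.trans_lt ht.1)
  rw [← integral_inter_add_sdiff (s := Set.Ioo a b) (t := Set.Iio k) measurableSet_Iio hi]
  have h1 : ‖∫ t in Set.Ioo a b ∩ Set.Iio k, (Real.sin (t * Z) / t : ℂ)‖ ≤ 1 := by
    have hv : volume (Set.Ioo a b ∩ Set.Iio k) ≤ ENNReal.ofReal k := by
      refine (measure_mono (t := Set.Ioo 0 k) fun t ht => ⟨ha.trans_lt ht.1.1, ht.2⟩).trans ?_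
      simp
    have := norm_setIntegral_le_of_norm_le_const (hv.trans_lt ENNReal.ofReal_lt_top)
      (f := fun t : ℝ => (Real.sin (t * Z) / t : ℂ)) (C := |Z|)
      (fun t ht => hpt t (ha.trans_lt ht.1.1))
    refine this.trans ?_
    have h2 : volume.real (Set.Ioo a b ∩ Set.Iio k) ≤ k :=
      ENNReal.toReal_le_of_le_ofReal hk0.le hv
    calc |Z| * _ ≤ |Z| * k := by gcongr
      _ = 1 := mul_inv_cancel₀ hZ'.ne'
  have h2 : ‖∫ t in Set.Ioo a b \ Set.Iio k, (Real.sin (t * Z) / t : ℂ)‖ ≤ 2 := by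
    have hpos : ∀ t ∈ Set.Ioo a b \ Set.Iio k, k ≤ t := fun t ht => not_lt.1 ht.2
    have e : ∀ t : ℝ, (Real.sin (t * Z) / t : ℂ) = ((t⁻¹ : ℝ) : ℂ) * Real.sin (t * Z) := by
      intro t; push_cast; ring
    simp only [e]
    have := norm_integral_weight_le (I := Set.Ioo a b \ Set.Iio k) (h := fun t => t⁻¹)
      (φ := fun t => (Real.sin (t * Z) : ℂ)) (H := |Z|) (M := 2 / |Z|) ?_ (Or.inr ?_)
      (by fun_prop) (by fun_prop) ?_ ?_ hZ'.le ?_ (by positivity) ?_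
    · refine this.trans (le_of_eq ?_)
      field_simp
    · rw [Set.sdiff_eq, Set.compl_Iio]; exact Set.ordConnected_Ioo.inter Set.ordConnected_Ici
    · intro s hs t ht hst
      exact inv_anti₀ (hk0.trans_le (hpos s hs)) hst
    · exact fun t ht => inv_nonneg.2 (hk0.le.trans (hpos t ht))
    · intro t ht
      rw [inv_le_comm₀ (hk0.trans_le (hpos t ht)) hZ']
      exact hpos t ht
    · exact fun c _ => (Metric.isBounded_Ioo a b).subset fun t ht => ht.1.1
    · exact fun c d hcd _ => norm_integral_sin_le hZ hcd
  exact (norm_add_le _ _).trans (by linarith)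

/-! ### The weight of the Green kernel -/

/-- The weight in the spectral integrals. -/
def wt (r Y t : ℝ) : ℝ := Real.exp (-((t ^ 2 - r ^ 2) * Y))

/-- Range of the folded spectral parameter. -/
def reg (r Y : ℝ) : Set ℝ := if 0 < Y then Set.Ioi r else Set.Ioo 0 r

/-- Folded spectral integral of `φ`. -/
def osc (r Y : ℝ) (φ : ℝ → ℂ) : ℂ := (SignType.sign Y : ℂ) * ∫ t in reg r Y, (wt r Y t : ℂ) * φ t

lemma measurableSet_reg (r Y : ℝ) : MeasurableSet (reg r Y) := by
  unfold reg; split_ifs <;> measurability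

lemma pos_of_mem_reg {r Y t : ℝ} (hr : 0 ≤ r) (ht : t ∈ reg r Y) : 0 < t := by
  unfold reg at ht; split_ifs at ht
  · exact hr.trans_lt ht
  · exact ht.1

lemma wt_pos (r Y t : ℝ) : 0 < wt r Y t := Real.exp_pos _

/-- On `reg` the factor t² - r² never has the sign opposite to Y. This is the reason for splitting
forward and backward modes at |t| = |Re λ|. -/
lemma wt_le_one {r Y t : ℝ} (hr : 0 ≤ r) (ht : t ∈ reg r Y) : wt r Y t ≤ 1 := by
  have h0 := pos_of_mem_reg hr ht
  rw [wt, Real.exp_le_one_iff, neg_nonpos]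
  unfold reg at ht; split_ifs at ht with hY
  · have : r < t := ht
    have : 0 ≤ t ^ 2 - r ^ 2 := by nlinarith
    positivity
  · have := ht.2
    exact mul_nonneg_of_nonpos_of_nonpos (by nlinarith) (not_lt.1 hY)

lemma ordConnected_reg (r Y : ℝ) : (reg r Y).OrdConnected := by
  unfold reg; split_ifs
  · exact Set.ordConnected_Ioi
  · exact Set.ordConnected_Ioo

lemma wt_monotone {r Y : ℝ} (hr : 0 ≤ r) :
    (0 < Y ∧ AntitoneOn (wt r Y) (reg r Y)) ∨ (Y ≤ 0 ∧ MonotoneOn (wt r Y) (reg r Y)) := by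
  rcases lt_or_ge 0 Y with hY | hY
  · refine Or.inl ⟨hY, fun s hs t ht hst => Real.exp_le_exp.2 (neg_le_neg ?_)⟩
    have := pos_of_mem_reg hr hs
    gcongr
  · refine Or.inr ⟨hY, fun s hs t ht hst => Real.exp_le_exp.2 (neg_le_neg ?_)⟩
    have := pos_of_mem_reg hr hs
    exact mul_le_mul_of_nonpos_right (by gcongr) hY

lemma reg_level_bounded {r Y : ℝ} (c : ℝ) (hc : 0 < c) :
    Bornology.IsBounded {t ∈ reg r Y | c < wt r Y t} := by
  unfold reg; split_ifs with hY
  · have ht : Tendsto (wt r Y) atTop (𝓝 0) := by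
      unfold wt
      refine Real.tendsto_exp_neg_atTop_nhds_zero.comp (Tendsto.atTop_mul_const hY ?_)
      exact tendsto_atTop_add_const_right _ _ (tendsto_pow_atTop two_ne_zero)
    obtain ⟨N, hN⟩ := eventually_atTop.1 (ht.eventually_lt_const hc)
    refine (Metric.isBounded_Icc r N).subset fun t ht => ⟨le_of_lt ht.1, ?_⟩
    by_contra hcon
    exact (hN t (not_le.1 hcon).le).not_gt ht.2
  · exact (Metric.isBounded_Ioo 0 r).subset fun t ht => ht.1

lemma norm_sign_le (Y : ℝ) : ‖((SignType.sign Y : SignType) : ℂ)‖ ≤ 1 := by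
  rcases lt_trichotomy Y 0 with h | h | h <;> simp [h]

/-- Spectral integrals are bounded by partial integrals of the oscillating factor. -/
lemma norm_osc_le {r Y M : ℝ} (hr : 0 ≤ r) {φ : ℝ → ℂ} (hφ : Measurable φ) (hM0 : 0 ≤ M)
    (hM : ∀ a b, 0 ≤ a → a ≤ b → ‖∫ t in Set.Ioo a b, φ t‖ ≤ M) : ‖osc r Y φ‖ ≤ M := by
  rw [osc, norm_mul]
  have h := norm_integral_weight_le (I := reg r Y) (h := wt r Y) (φ := φ) (H := 1) (M := M)
    (ordConnected_reg r Y) ((wt_monotone hr).symm.imp And.right And.right)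
    (by unfold wt; fun_prop) hφ
    (fun t _ => (wt_pos r Y t).le) (fun t ht => wt_le_one hr ht) zero_le_one
    reg_level_bounded hM0 ?_
  · rw [one_mul] at h
    exact (mul_le_of_le_one_left (norm_nonneg _) (norm_sign_le Y)).trans h
  · intro a b hab hsub
    rcases hab.eq_or_lt with rfl | hlt
    · simpa using hM0
    · refine hM a b ?_ hab
      by_contra hcon
      rw [not_le] at hcon
      obtain ⟨t, ht⟩ := exists_between (lt_min hlt hcon)
      exact (pos_of_mem_reg hr (hsub ⟨ht.1, ht.2.trans_le (min_le_left _ _)⟩)).not_gt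
        (ht.2.trans_le (min_le_right _ _))

lemma integrableOn_wt (r Y : ℝ) : IntegrableOn (wt r Y) (reg r Y) := by
  unfold reg; split_ifs with h
  · have : wt r Y = fun t => Real.exp (r ^ 2 * Y) * Real.exp (-Y * t ^ 2) := by
      ext t; rw [wt, ← Real.exp_add]; congr 1; ring
    rw [this]
    exact ((integrable_exp_neg_mul_sq h).const_mul _).integrableOn
  · refine (Continuous.integrableOn_Icc (by unfold wt; fun_prop)).mono_set Set.Ioo_subset_Icc_self

/-- Since |t² - r²| ≥ r|t - r| for t > 0, the weight lies below an exponential of rate r|Y| that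
equals 1 at t = r. -/
lemma integral_wt_le_inv {r Y : ℝ} (hr : 0 < r) (hY : Y ≠ 0) :
    ∫ t in reg r Y, wt r Y t ≤ (r * |Y|)⁻¹ := by
  have hi := integrableOn_wt r Y
  have hc : 0 < r * |Y| := mul_pos hr (abs_pos.2 hY)
  rcases lt_or_gt_of_ne hY with h | h
  · have hreg : reg r Y = Set.Ioo 0 r := if_neg h.not_gt
    rw [hreg] at hi ⊢
    have hint : IntegrableOn (fun t => Real.exp (-(r * |Y| * r)) * Real.exp (r * |Y| * t))
        (Set.Iic r) := (integrableOn_exp_mul_Iic hc r).const_mul _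
    calc ∫ t in Set.Ioo 0 r, wt r Y t
        ≤ ∫ t in Set.Ioo 0 r, Real.exp (-(r * |Y| * r)) * Real.exp (r * |Y| * t) := by
          refine setIntegral_mono_on hi (hint.mono_set fun t ht => ht.2.le) measurableSet_Ioo
            fun t ht => ?_
          rw [wt, abs_of_neg h, ← Real.exp_add]
          refine Real.exp_le_exp.2 ?_
          nlinarith [mul_pos (mul_pos ht.1 (sub_pos.2 ht.2)) (neg_pos.2 h)]
      _ ≤ ∫ t in Set.Iic r, Real.exp (-(r * |Y| * r)) * Real.exp (r * |Y| * t) :=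
          setIntegral_mono_set hint (ae_of_all _ fun t => by positivity)
            (LE.le.eventuallyLE fun t ht => ht.2.le)
      _ = (r * |Y|)⁻¹ := by
          rw [integral_const_mul, integral_exp_mul_Iic hc, ← mul_div_assoc, ← Real.exp_add]
          simp
  · have hreg : reg r Y = Set.Ioi r := if_pos h
    rw [hreg] at hi ⊢
    have hint : IntegrableOn (fun t => Real.exp (r * |Y| * r) * Real.exp (-(r * |Y|) * t))
        (Set.Ioi r) := (integrableOn_exp_mul_Ioi (neg_lt_zero.2 hc) r).const_mul _
    calc ∫ t in Set.Ioi r, wt r Y t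
        ≤ ∫ t in Set.Ioi r, Real.exp (r * |Y| * r) * Real.exp (-(r * |Y|) * t) := by
          refine setIntegral_mono_on hi hint measurableSet_Ioi fun t ht => ?_
          have ht' : r < t := ht
          rw [wt, abs_of_pos h, ← Real.exp_add]
          refine Real.exp_le_exp.2 ?_
          nlinarith [mul_pos (mul_pos (hr.trans ht') (sub_pos.2 ht')) h]
      _ = (r * |Y|)⁻¹ := by
          rw [integral_const_mul, integral_exp_mul_Ioi (neg_lt_zero.2 hc), neg_div_neg_eq,
            ← mul_div_assoc, ← Real.exp_add]
          simp

/-- The point is uniformity in r. For Y > 0, t² - r² ≥ (t - r)² gives a Gaussian. For Y < 0, either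
the interval has length r ≤ |Y|^{-1/2}, or r > |Y|^{-1/2} and `integral_wt_le_inv` is good enough.
-/
lemma integral_wt_le {r Y : ℝ} (hr : 0 ≤ r) (hY : Y ≠ 0) :
    ∫ t in reg r Y, wt r Y t ≤ 2 * |Y| ^ (-(1 / 2) : ℝ) := by
  have hi := integrableOn_wt r Y
  have hYp := abs_pos.2 hY
  have hs := Real.sqrt_pos.2 hYp
  rw [Real.rpow_neg hYp.le, ← Real.sqrt_eq_rpow]
  rcases lt_or_gt_of_ne hY with h | h
  · suffices ∫ t in reg r Y, wt r Y t ≤ (Real.sqrt |Y|)⁻¹ by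
      refine this.trans ?_
      have := inv_pos.2 hs
      linarith
    have hreg : reg r Y = Set.Ioo 0 r := if_neg h.not_gt
    rcases le_or_gt r (Real.sqrt |Y|)⁻¹ with hrY | hrY
    · have := setIntegral_mono_on hi (hreg ▸ integrableOn_const (C := (1 : ℝ)) (by simp))
        (measurableSet_reg r Y) fun t ht => wt_le_one hr ht
      refine (this.trans (le_of_eq ?_)).trans hrY
      simp [hreg, hr]
    · have hr0 : 0 < r := (inv_pos.2 hs).trans hrY
      refine (integral_wt_le_inv hr0 hY).trans (inv_anti₀ hs ?_)
      calc Real.sqrt |Y| = (Real.sqrt |Y|)⁻¹ * (Real.sqrt |Y| * Real.sqrt |Y|) := by field_simp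
        _ = (Real.sqrt |Y|)⁻¹ * |Y| := by rw [Real.mul_self_sqrt hYp.le]
        _ ≤ r * |Y| := by gcongr
  · have hreg : reg r Y = Set.Ioi r := if_pos h
    rw [hreg] at hi ⊢
    have hint : Integrable fun t => Real.exp (-Y * (t - r) ^ 2) :=
      (integrable_exp_neg_mul_sq h).comp_sub_right r
    calc ∫ t in Set.Ioi r, wt r Y t ≤ ∫ t in Set.Ioi r, Real.exp (-Y * (t - r) ^ 2) := by
          refine setIntegral_mono_on hi hint.integrableOn measurableSet_Ioi fun t ht => ?_
          have ht' : r < t := ht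
          refine Real.exp_le_exp.2 ?_
          nlinarith [mul_nonneg (mul_nonneg hr (sub_pos.2 ht').le) h.le]
      _ ≤ ∫ t, Real.exp (-Y * (t - r) ^ 2) :=
          setIntegral_le_integral hint (ae_of_all _ fun t => by positivity)
      _ = Real.sqrt (Real.pi / Y) := by
          rw [integral_sub_right_eq_self (fun t => Real.exp (-Y * t ^ 2)), integral_gaussian]
      _ ≤ 2 * (Real.sqrt |Y|)⁻¹ := by
          rw [abs_of_pos h, Real.sqrt_div Real.pi_pos.le, div_eq_mul_inv]
          gcongr
          exact Real.sqrt_le_iff.2 ⟨by norm_num, by linarith [Real.pi_lt_four]⟩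

/-- Spectral integrals are bounded by the mass of the weight. -/
lemma norm_osc_le_mass {r Y C : ℝ} (hr : 0 ≤ r) {φ : ℝ → ℂ} (hC : ∀ t, 0 < t → ‖φ t‖ ≤ C) :
    ‖osc r Y φ‖ ≤ C * ∫ t in reg r Y, wt r Y t := by
  rw [osc, norm_mul, ← integral_const_mul]
  refine (mul_le_of_le_one_left (norm_nonneg _) (norm_sign_le Y)).trans ?_
  refine norm_integral_le_of_norm_le ((integrableOn_wt r Y).const_mul C) ?_
  filter_upwards [ae_restrict_mem (measurableSet_reg r Y)] with t ht
  rw [norm_mul, Complex.norm_real, Real.norm_eq_abs, abs_of_pos (wt_pos _ _ _), mul_comm]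
  exact mul_le_mul_of_nonneg_right (hC t (pos_of_mem_reg hr ht)) (wt_pos _ _ _).le

lemma osc_zero (r : ℝ) (φ : ℝ → ℂ) : osc r 0 φ = 0 := by simp [osc]

/-- The size of the diagonal singularity of the kernels. -/
def sing (Z Y : ℝ) : ℝ :=
  open Classical in if |Z| < 1 ∧ |Y| < 1 then 2 * |Y| ^ (-(1 / 2) : ℝ) else 0

lemma sing_nonneg (Z Y : ℝ) : 0 ≤ sing Z Y := by unfold sing; split_ifs <;> positivity

/-- For |Z| ≥ 1 the oscillation gives 2/|Z| ≤ 2, and for |Y| ≥ 1 the mass of the weight is at most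
2. Only the unit square in (Z, Y) retains the singularity |Y|^{-1/2}. -/
lemma norm_osc_cos_le {r : ℝ} (hr : 0 ≤ r) (Z Y : ℝ) :
    ‖osc r Y fun t => (Real.cos (t * Z) : ℂ)‖ ≤ 2 + sing Z Y := by
  rcases eq_or_ne Y 0 with rfl | hY
  · rw [osc_zero, norm_zero]; linarith [sing_nonneg Z 0]
  have h1 : ‖osc r Y fun t => (Real.cos (t * Z) : ℂ)‖ ≤ 2 * |Y| ^ (-(1 / 2) : ℝ) := by
    refine (norm_osc_le_mass hr (C := 1) fun t _ => ?_).trans ?_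
    · rw [Complex.norm_real]; exact Real.abs_cos_le_one _
    · rw [one_mul]; exact integral_wt_le hr hY
  by_cases hZY : |Z| < 1 ∧ |Y| < 1
  · rw [sing, if_pos hZY]; linarith
  · rw [sing, if_neg hZY, add_zero]
    rw [not_and_or, not_lt, not_lt] at hZY
    rcases hZY with h | h
    · have hZ : Z ≠ 0 := by rintro rfl; simp at h; linarith
      refine (norm_osc_le hr (by fun_prop) (by positivity) fun a b _ hab =>
        norm_integral_cos_le hZ hab).trans ?_
      rw [div_le_iff₀ (by linarith)]; linarith
    · refine h1.trans ?_
      have := Real.rpow_le_one_of_one_le_of_nonpos h (z := (-(1 / 2) : ℝ)) (by norm_num)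
      linarith

/-- The odd folded multiplier with pole at distance `m`. -/
def oddM (m Z t : ℝ) : ℂ := (t * Real.sin (t * Z) / (t ^ 2 + m ^ 2) : ℝ)

/-- The even folded multiplier with pole at distance `m`. -/
def evenM (m Z t : ℝ) : ℂ := (m * Real.cos (t * Z) / (t ^ 2 + m ^ 2) : ℝ)

/-- Splitting t/(t² + m²) = 1/t - (m²/(t² + m²))/t leaves the sine integral and the same integral
against a decreasing weight at most 1, hence 3 + 3. The bound involves neither m nor Z, so it
survives when the pole reaches the line of integration, and it makes the kernel estimate uniform in
λ. -/
lemma norm_integral_oddM_le (m Z : ℝ) {a b : ℝ} (ha : 0 ≤ a) :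
    ‖∫ t in Set.Ioo a b, oddM m Z t‖ ≤ 6 := by
  have hm : Measurable fun t : ℝ => (Real.sin (t * Z) / t : ℂ) := by fun_prop
  have hpt : ∀ t : ℝ, 0 < t → ‖(Real.sin (t * Z) / t : ℂ)‖ ≤ |Z| := by
    intro t ht
    rw [norm_div, Complex.norm_real, Complex.norm_real, Real.norm_eq_abs, Real.norm_eq_abs,
      abs_of_pos ht, div_le_iff₀ ht]
    refine Real.abs_sin_le_abs.trans ?_
    rw [abs_mul, abs_of_pos ht, mul_comm]
  have hi : IntegrableOn (fun t : ℝ => (Real.sin (t * Z) / t : ℂ)) (Set.Ioo a b) := by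
    refine Integrable.mono' (g := fun _ => |Z|) (by simp) hm.aestronglyMeasurable ?_
    filter_upwards [ae_restrict_mem measurableSet_Ioo] with t ht
    exact hpt t (ha.trans_lt ht.1)
  have hw : ∀ t, 0 < t → 0 ≤ m ^ 2 / (t ^ 2 + m ^ 2) ∧ m ^ 2 / (t ^ 2 + m ^ 2) ≤ 1 := by
    intro t ht
    refine ⟨by positivity, (div_le_one (by positivity)).2 (by nlinarith)⟩
  have hi2 : IntegrableOn (fun t : ℝ => ((m ^ 2 / (t ^ 2 + m ^ 2) : ℝ) : ℂ) *
      (Real.sin (t * Z) / t : ℂ)) (Set.Ioo a b) := by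
    refine Integrable.mono hi (by fun_prop) ?_
    filter_upwards [ae_restrict_mem measurableSet_Ioo] with t ht
    rw [norm_mul, Complex.norm_real, Real.norm_eq_abs]
    obtain ⟨h1, h2⟩ := hw t (ha.trans_lt ht.1)
    rw [abs_of_nonneg h1]
    exact mul_le_of_le_one_left (norm_nonneg _) h2
  have e : ∫ t in Set.Ioo a b, oddM m Z t = (∫ t in Set.Ioo a b, (Real.sin (t * Z) / t : ℂ)) -
      ∫ t in Set.Ioo a b, ((m ^ 2 / (t ^ 2 + m ^ 2) : ℝ) : ℂ) * (Real.sin (t * Z) / t : ℂ) := by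
    rw [← integral_sub hi hi2]
    refine setIntegral_congr_fun measurableSet_Ioo fun t ht => ?_
    have h0 : 0 < t := ha.trans_lt ht.1
    have h1 : (t : ℂ) ≠ 0 := by exact_mod_cast h0.ne'
    have h2 : (t ^ 2 + m ^ 2 : ℂ) ≠ 0 := by
      have : (t ^ 2 + m ^ 2 : ℝ) ≠ 0 := by positivity
      exact_mod_cast this
    simp only [oddM]; push_cast; field_simp; ring
  rw [e]
  refine (norm_sub_le _ _).trans ?_
  have h1 := norm_integral_sinc_le Z (b := b) ha
  have h2 := norm_integral_weight_le (I := Set.Ioo a b) (h := fun t => m ^ 2 / (t ^ 2 + m ^ 2))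
    (φ := fun t : ℝ => (Real.sin (t * Z) / t : ℂ)) (H := 1) (M := 3) Set.ordConnected_Ioo
    (Or.inr ?_) (by fun_prop) hm (fun t ht => (hw t (ha.trans_lt ht.1)).1)
    (fun t ht => (hw t (ha.trans_lt ht.1)).2) zero_le_one
    (fun c _ => (Metric.isBounded_Ioo a b).subset fun t ht => ht.1) (by norm_num) ?_
  · linarith
  · intro s hs t ht hst
    have h0 : 0 < s := ha.trans_lt hs.1
    simp only
    gcongr
  · intro c d hcd hsub
    rcases hcd.eq_or_lt with rfl | hlt
    · simp
    · exact norm_integral_sinc_le Z (ha.trans ((Set.Ioo_subset_Ioo_iff hlt).1 hsub).1)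

lemma integral_cauchy_le (m : ℝ) : IntegrableOn (fun t => |m| / (t ^ 2 + m ^ 2)) (Set.Ioi 0) ∧
    ∫ t in Set.Ioi 0, |m| / (t ^ 2 + m ^ 2) ≤ 2 := by
  rcases eq_or_ne m 0 with rfl | hm
  · simp
  have hm' := abs_pos.2 hm
  have e : ∀ t : ℝ, |m| / (t ^ 2 + m ^ 2) = |m|⁻¹ * (1 + (|m|⁻¹ * t) ^ 2)⁻¹ := by
    intro t
    rw [mul_pow, inv_pow, ← sq_abs m]
    field_simp
    ring
  simp only [e]
  have hi : Integrable fun t : ℝ => (1 + (|m|⁻¹ * t) ^ 2)⁻¹ :=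
    integrable_inv_one_add_sq.comp_mul_left' (inv_pos.2 hm').ne'
  refine ⟨(hi.const_mul _).integrableOn, ?_⟩
  rw [integral_const_mul, integral_comp_mul_left_Ioi (fun t => (1 + t ^ 2)⁻¹) 0 (inv_pos.2 hm'),
    mul_zero, integral_Ioi_inv_one_add_sq, Real.arctan_zero, smul_eq_mul, inv_inv, ← mul_assoc,
    inv_mul_cancel₀ hm'.ne']
  linarith [Real.pi_lt_four]

lemma norm_osc_evenM_le {r : ℝ} (hr : 0 ≤ r) (m Z Y : ℝ) : ‖osc r Y (evenM m Z)‖ ≤ 2 := by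
  refine norm_osc_le hr (by unfold evenM; fun_prop) (by norm_num) fun a b ha _ => ?_
  obtain ⟨hi, hle⟩ := integral_cauchy_le m
  have hs : Set.Ioo a b ⊆ Set.Ioi 0 := fun t ht => ha.trans_lt ht.1
  refine (norm_integral_le_of_norm_le (hi.mono_set hs) (ae_of_all _ fun t => ?_)).trans
    ((setIntegral_mono_set hi (ae_of_all _ fun t => by positivity) hs.eventuallyLE).trans hle)
  rw [evenM, Complex.norm_real, norm_div, norm_mul, Real.norm_eq_abs, Real.norm_eq_abs,
    Real.norm_eq_abs, abs_of_nonneg (by positivity : 0 ≤ t ^ 2 + m ^ 2)]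
  gcongr
  exact mul_le_of_le_one_right (abs_nonneg _) (Real.abs_cos_le_one _)

lemma norm_osc_oddM_le {r : ℝ} (hr : 0 ≤ r) (m Z Y : ℝ) : ‖osc r Y (oddM m Z)‖ ≤ 6 :=
  norm_osc_le hr (by unfold oddM; fun_prop) (by norm_num) fun _ _ ha _ =>
    norm_integral_oddM_le m Z ha

/-! ### Folding the spectral integral -/

/-- The oscillation variable. -/
abbrev zed (lam : ℂ) (X Y : ℝ) : ℝ := X + 2 * lam.im * Y

/-- The forward modes. -/
def fwd (lam : ℂ) : Set ℝ := {t | |lam.re| < |t|}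

lemma measurableSet_fwd (lam : ℂ) : MeasurableSet (fwd lam) :=
  measurableSet_lt measurable_const (by fun_prop)

lemma fwd_compl (lam : ℂ) : (fwd lam)ᶜ ⊆ Set.Icc (-|lam.re|) |lam.re| := fun _ ht =>
  abs_le.1 (not_lt.1 ht)

/-- Expanding (t + i Im λ)² - λ² = t² - (Re λ)² + 2i Im λ (t - Re λ): the imaginary part combines
with X into Z = X + 2 Im λ Y, leaving a unimodular phase, the real weight and a pure oscillation. -/
lemma exp_disp_mul_freeMode (lam : ℂ) (t X Y : ℝ) :
    Complex.exp (-disp lam 0 t * Y) * freeMode lam t X =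
      Complex.exp (Complex.I * lam.re * zed lam X Y) *
        ((wt |lam.re| Y t : ℂ) * Complex.exp (-Complex.I * t * zed lam X Y)) := by
  rw [disp, freeMode, wt, Complex.ofReal_exp, ← Complex.exp_add, ← Complex.exp_add,
    ← Complex.exp_add]
  congr 1
  have h := (Complex.re_add_im lam).symm
  rw [sq_abs]
  push_cast
  linear_combination (lam + lam.re + lam.im * Complex.I) * Y * h

/-- The modes t and -t have the same weight, so the spectral integral folds onto t > 0: onto t > r
for Y > 0, and onto 0 < t < r for Y < 0, where the minus sign of backward modes becomes `sign Y`. -/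
lemma specKer_fold (lam : ℂ) {q : ℝ → ℝ → ℂ} {f : ℝ → ℂ} {C x X Y : ℝ} (hf : Measurable f)
    (hC : ∀ t, ‖f t‖ ≤ C) (hq : ∀ t, q t x = freeMode lam t X * f t) :
    specKer (fwd lam) (disp lam 0) q (x, Y) = Complex.exp (Complex.I * lam.re * zed lam X Y) *
      osc |lam.re| Y (fun t => Complex.exp (-Complex.I * t * zed lam X Y) * f t +
        Complex.exp (Complex.I * t * zed lam X Y) * f (-t)) := by
  rcases eq_or_ne Y 0 with rfl | hY
  · rw [osc_zero, mul_zero, specKer]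
    simp [specMode]
  set r := |lam.re| with hr
  have hr0 : 0 ≤ r := abs_nonneg _
  set Z := zed lam X Y with hZ
  set P := Complex.exp (Complex.I * lam.re * Z) with hP
  let h : ℝ → ℂ := Set.indicator (reg r Y) fun t => (wt r Y t : ℂ)
  have hh : Integrable h :=
    (integrable_indicator_iff (measurableSet_reg r Y)).2 (integrableOn_wt r Y).ofReal
  have hbd : ∀ c : ℂ, c.re = 0 → ∀ t : ℝ, ‖Complex.exp (c * t * Z) * f t‖ ≤ C := by
    intro c hc t
    rw [norm_mul, Complex.norm_exp]
    simp [hc, hC]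
  have hfm : Measurable fun t : ℝ => Complex.exp (-Complex.I * t * Z) * f t := by fun_prop
  have i1 : Integrable fun t => h t * (Complex.exp (-Complex.I * t * Z) * f t) := by
    simp only [mul_comm (h _)]
    exact Integrable.bdd_mul hh hfm.aestronglyMeasurable
      (ae_of_all _ fun t => hbd _ (by simp) t)
  have i2 : Integrable fun t => h (-t) * (Complex.exp (-Complex.I * t * Z) * f t) := by
    simp only [mul_comm (h _)]
    exact Integrable.bdd_mul hh.comp_neg hfm.aestronglyMeasurable
      (ae_of_all _ fun t => hbd _ (by simp) t)
  have hsplit : (fun t => specMode (fwd lam) (disp lam 0) q t (x, Y)) =ᵐ[volume] fun t =>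
      P * (SignType.sign Y : ℂ) * (h t * (Complex.exp (-Complex.I * t * Z) * f t) +
        h (-t) * (Complex.exp (-Complex.I * t * Z) * f t)) := by
    -- At these three points the closed and open conditions in `fwd` and `reg` disagree; they form a
    -- null set.
    have hfin : volume ({0, r, -r} : Set ℝ) = 0 := (Set.toFinite _).measure_zero _
    filter_upwards [measure_eq_zero_iff_ae_notMem.1 hfin] with t ht
    simp only [Set.mem_insert_iff, Set.mem_singleton_iff, not_or] at ht
    obtain ⟨h0, h1, h2⟩ := ht
    have hE : Complex.exp (-disp lam 0 t * Y) * q t x =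
        P * ((wt r Y t : ℂ) * (Complex.exp (-Complex.I * t * Z) * f t)) := by
      rw [hq, ← mul_assoc, exp_disp_mul_freeMode]; ring
    have hwt : wt r Y (-t) = wt r Y t := by simp [wt]
    have hmem : (t ∈ fwd lam ↔ r < |t|) := Iff.rfl
    simp only [specMode, hmem, hE, h, reg, Set.indicator, hwt]
    rcases lt_or_gt_of_ne hY with hY' | hY'
    · rw [if_neg hY'.not_gt]
      simp only [hY'.not_gt, hY', if_false, if_true, Set.mem_Ioo, sign_neg hY']
      rcases lt_or_gt_of_ne h0 with ht | ht
      · rw [abs_of_neg ht]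
        by_cases hrt : r < -t
        · simp [hrt, ht.not_gt, hrt.not_gt]
        · have : -t < r := lt_of_le_of_ne (not_lt.1 hrt) fun hc => h2 (by linarith)
          simp [hrt, ht.not_gt, ht, this]
      · rw [abs_of_pos ht]
        by_cases hrt : r < t
        · simp [hrt, ht.not_gt, hrt.not_gt]
        · have : t < r := lt_of_le_of_ne (not_lt.1 hrt) h1
          simp [hrt, ht.not_gt, ht, this]
    · simp only [hY', hY'.not_gt, if_true, if_false, Set.mem_Ioi, sign_pos hY']
      rcases lt_or_gt_of_ne h0 with ht | ht
      · rw [abs_of_neg ht]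
        have : ¬ r < t := by linarith
        by_cases hrt : r < -t <;> simp [hrt, this]
      · rw [abs_of_pos ht]
        have : ¬ r < -t := by linarith
        by_cases hrt : r < t <;> simp [hrt, this]
  rw [specKer, integral_congr_ae hsplit, integral_const_mul, integral_add i1 i2,
    ← integral_neg_eq_self fun t => h (-t) * _, osc]
  simp only [neg_neg]
  have i3 : Integrable fun t : ℝ => h t * (Complex.exp (-Complex.I * (-t : ℝ) * Z) * f (-t)) := by
    simpa using i2.comp_neg
  rw [← integral_add i1 i3, mul_assoc, ← integral_indicator (measurableSet_reg r Y)]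
  congr 3
  ext t
  simp only [h, Set.indicator]
  split_ifs
  · push_cast; simp only [neg_mul, mul_neg, neg_neg]; ring
  · simp

lemma norm_exp_I_mul (a b : ℝ) : ‖Complex.exp (Complex.I * a * b)‖ = 1 := by
  rw [Complex.norm_exp]; simp

lemma exp_add_exp_neg (t Z : ℝ) :
    Complex.exp (-Complex.I * t * Z) + Complex.exp (Complex.I * t * Z) = 2 * (Real.cos (t * Z) : ℂ) := by
  rw [Complex.ofReal_cos, Complex.cos]; push_cast
  rw [show -Complex.I * t * Z = -(t * Z) * Complex.I by ring,
    show Complex.I * t * Z = (t * Z) * Complex.I by ring]; ring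

lemma exp_sub_exp_neg (t Z : ℝ) :
    Complex.exp (-Complex.I * t * Z) - Complex.exp (Complex.I * t * Z) =
      -2 * Complex.I * (Real.sin (t * Z) : ℂ) := by
  rw [Complex.ofReal_sin, Complex.sin]; push_cast
  rw [show -Complex.I * t * Z = -(t * Z) * Complex.I by ring,
    show Complex.I * t * Z = (t * Z) * Complex.I by ring]
  linear_combination (Complex.exp (-(t * Z) * Complex.I) - Complex.exp (t * Z * Complex.I)) *
    Complex.I_sq

lemma osc_const_mul (r Y : ℝ) (c : ℂ) (φ : ℝ → ℂ) :
    osc r Y (fun t => c * φ t) = c * osc r Y φ := by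
  simp only [osc, mul_left_comm _ c, integral_const_mul]

/-- The free kernel vanishing at infinity. -/
def freeG (lam : ℂ) (p : ℝ × ℝ) : ℂ := Complex.exp (Complex.I * lam.re * zed lam p.1 p.2) *
  ((Real.pi : ℂ)⁻¹ * osc |lam.re| p.2 fun t => (Real.cos (t * zed lam p.1 p.2) : ℂ))

lemma freeKer_fwd (lam : ℂ) : freeKer lam 0 (fwd lam) = freeG lam := by
  ext ⟨X, Y⟩
  rw [freeKer, specKer_fold lam (f := fun _ => 1) (C := 1) (X := X) measurable_const (by simp)
    (by simp), freeG]
  simp only [mul_one, exp_add_exp_neg, osc_const_mul]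
  rw [mul_inv]; ring

lemma norm_freeG_le_osc (lam : ℂ) (X Y : ℝ) :
    ‖freeG lam (X, Y)‖ ≤ ‖osc |lam.re| Y fun t => (Real.cos (t * zed lam X Y) : ℂ)‖ := by
  rw [freeG, norm_mul, norm_mul, norm_exp_I_mul, one_mul, norm_inv, Complex.norm_real,
    Real.norm_eq_abs, abs_of_pos Real.pi_pos]
  refine mul_le_of_le_one_left (norm_nonneg _) (inv_le_one_of_one_le₀ ?_)
  linarith [Real.pi_gt_three]

lemma norm_freeG_le_zed (lam : ℂ) {X Y : ℝ} (hZ : zed lam X Y ≠ 0) :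
    ‖freeG lam (X, Y)‖ ≤ 2 / |zed lam X Y| :=
  (norm_freeG_le_osc lam X Y).trans (norm_osc_le (abs_nonneg _) (by fun_prop) (by positivity)
    fun _ _ _ hab => norm_integral_cos_le hZ hab)

lemma norm_freeG_le_mass (lam : ℂ) (X Y : ℝ) :
    ‖freeG lam (X, Y)‖ ≤ ∫ t in reg |lam.re| Y, wt |lam.re| Y t := by
  refine (norm_freeG_le_osc lam X Y).trans ((norm_osc_le_mass (abs_nonneg _) (C := 1)
    fun t _ => ?_).trans (one_mul _).le)
  rw [Complex.norm_real]; exact Real.abs_cos_le_one _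

lemma measurable_freeKer (lam : ℂ) (c : ℝ) {S : Set ℝ} (hS : MeasurableSet S) :
    Measurable (freeKer lam c S) := by
  have hm := measurable_specMode hS (continuous_disp lam c).measurable
    (continuous_freeMode lam).measurable
  have : Measurable (specKer S (disp lam c) (freeMode lam)) := by
    have h := hm.stronglyMeasurable.integral_prod_left' (μ := volume)
    exact h.measurable
  exact measurable_const.mul this

lemma measurable_freeG (lam : ℂ) : Measurable (freeG lam) := by
  rw [← freeKer_fwd]; exact measurable_freeKer lam 0 (measurableSet_fwd lam)

/-! ### Local integrals -/

lemma integral_inv_sqrt_abs {a : ℝ} (ha : 0 ≤ a) :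
    Integrable (Set.indicator (Set.Ioo (-a) a) fun z : ℝ => |z| ^ (-(1 / 2) : ℝ)) ∧
    ∫ z, Set.indicator (Set.Ioo (-a) a) (fun z : ℝ => |z| ^ (-(1 / 2) : ℝ)) z =
      4 * Real.sqrt a := by
  have hm : Measurable (Set.indicator (Set.Ioo (-a) a) fun z : ℝ => |z| ^ (-(1 / 2) : ℝ)) :=
    (by fun_prop : Measurable fun z : ℝ => |z| ^ (-(1 / 2) : ℝ)).indicator measurableSet_Ioo
  have h0 : ∫ z in Set.Ioi (0 : ℝ), Set.indicator (Set.Iio a) (fun z : ℝ => z ^ (-(1 / 2) : ℝ)) z =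
      2 * Real.sqrt a := by
    rw [setIntegral_indicator measurableSet_Iio, Set.Ioi_inter_Iio,
      ← integral_Ioc_eq_integral_Ioo, ← intervalIntegral.integral_of_le ha,
      integral_rpow (Or.inl (by norm_num))]
    rw [Real.sqrt_eq_rpow]; norm_num; ring
  have e : (Set.indicator (Set.Ioo (-a) a) fun z : ℝ => |z| ^ (-(1 / 2) : ℝ)) = fun z =>
      Set.indicator (Set.Iio a) (fun z : ℝ => z ^ (-(1 / 2) : ℝ)) |z| := by
    ext z
    simp only [Set.indicator, Set.mem_Ioo, Set.mem_Iio, abs_lt]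
  have hi : ∫ z, Set.indicator (Set.Ioo (-a) a) (fun z : ℝ => |z| ^ (-(1 / 2) : ℝ)) z =
      4 * Real.sqrt a := by
    rw [e, integral_comp_abs (f := Set.indicator (Set.Iio a) fun z : ℝ => z ^ (-(1 / 2) : ℝ)), h0]
    ring
  refine ⟨?_, hi⟩
  rcases ha.eq_or_lt with rfl | hpos
  · simp
  -- A non-integrable function has integral 0 by convention, which contradicts the positive value
  -- already computed.
  · by_contra hcon
    rw [integral_undef hcon] at hi
    have := Real.sqrt_pos.2 hpos
    linarith

lemma integral_shear {f g : ℝ → ℝ} (hfm : Measurable f) (hgm : Measurable g) (hf : Integrable f)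
    (hg : Integrable g) (b : ℝ) :
    Integrable (fun p : ℝ × ℝ => f (p.1 + b * p.2) * g p.2) ∧
    ∫ p : ℝ × ℝ, f (p.1 + b * p.2) * g p.2 = (∫ z, f z) * ∫ y, g y := by
  have hm : Measurable fun p : ℝ × ℝ => f (p.1 + b * p.2) * g p.2 := by fun_prop
  have e : ∀ (h : ℝ → ℝ) (y : ℝ), ∫ x, h (x + b * y) = ∫ x, h x := fun h y =>
    integral_add_right_eq_self h (b * y)
  have hi : Integrable (fun p : ℝ × ℝ => f (p.1 + b * p.2) * g p.2) (volume.prod volume) := by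
    rw [integrable_prod_iff' hm.aestronglyMeasurable]
    constructor
    · exact ae_of_all _ fun y => (hf.comp_add_right (b * y)).mul_const (g y)
    · simp only [norm_mul, integral_mul_const, e fun x => ‖f x‖]
      exact hg.norm.const_mul _
  refine ⟨hi, ?_⟩
  rw [Measure.volume_eq_prod, integral_prod_symm _ hi]
  simp only [integral_mul_const, e f]
  rw [integral_const_mul]

/-! ### Liouville theorem for the free operator -/

lemma ae_zed_ne_zero (lam : ℂ) : ∀ᵐ p : ℝ × ℝ, zed lam p.1 p.2 ≠ 0 := by
  let L : ℝ × ℝ →ₗ[ℝ] ℝ := LinearMap.fst ℝ ℝ ℝ + (2 * lam.im) • LinearMap.snd ℝ ℝ ℝ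
  have hL : LinearMap.ker L ≠ ⊤ := by
    intro h
    have : ((1, 0) : ℝ × ℝ) ∈ LinearMap.ker L := h ▸ Submodule.mem_top
    simp [L] at this
  have h0 := Measure.addHaar_submodule volume _ hL
  filter_upwards [measure_eq_zero_iff_ae_notMem.1 h0] with p hp
  simpa [L, zed] using hp

lemma le_sqrt_mul_of_le {x a b : ℝ} (hx : 0 ≤ x) (ha : x ≤ a) (hb : x ≤ b) :
    x ≤ Real.sqrt a * Real.sqrt b := by
  rw [← Real.sqrt_mul (hx.trans ha)]
  exact Real.le_sqrt_of_sq_le (by nlinarith)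

/-- A fundamental solution with linear growth of its integrals over boxes. -/
lemma exists_small_kernel (lam : ℂ) : ∃ k : ℝ × ℝ → ℂ,
    (∀ Φ, CTest Φ → ∫ p, k p * Lst lam Φ p = Φ (0, 0)) ∧ ∃ C, 0 ≤ C ∧ ∀ R : ℝ, 1 ≤ R →
      Integrable (fun p => Set.indicator (Metric.closedBall 0 R) (fun _ => (1 : ℝ)) p * ‖k p‖) ∧
      ∫ p, Set.indicator (Metric.closedBall 0 R) (fun _ => (1 : ℝ)) p * ‖k p‖ ≤ C * R := by
  have hball : ∀ {R : ℝ} {p : ℝ × ℝ}, p ∈ Metric.closedBall 0 R → |p.1| ≤ R ∧ |p.2| ≤ R := by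
    intro R p hp
    have := (norm_prod_le_iff (x := p) (r := R)).1 (by simpa using hp)
    simpa using this
  -- For Re λ = 0 the heat kernel without zeroth-order term has a bounded integral over each
  -- y-slice, so its mass over a box of size R is O(R). For Re λ ≠ 0 the y-slices of the heat kernel
  -- would grow exponentially, and `freeG` is used.
  rcases eq_or_ne lam.re 0 with hr | hr
  · refine ⟨heatKer lam 0, fun Φ hΦ => ?_, Real.sqrt (Real.pi * 4), by positivity, fun R hR => ?_⟩
    · simpa using heatKer_fundamental lam 0 hΦ
    have hR0 : 0 ≤ R := zero_le_one.trans hR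
    let K : ℝ × ℝ → ℂ := fun p => Set.indicator (Metric.closedBall 0 R) (fun _ => (1 : ℂ)) p *
      heatKer lam 0 p
    have hK : Measurable K :=
      (measurable_const.indicator Metric.isClosed_closedBall.measurableSet).mul
        (measurable_heatKer lam 0)
    have hn : ∀ p, ‖K p‖ =
        Set.indicator (Metric.closedBall 0 R) (fun _ => (1 : ℝ)) p * ‖heatKer lam 0 p‖ := by
      intro p; simp only [K, norm_mul, Set.indicator]; split_ifs <;> simp
    have hb : ∀ p : ℝ × ℝ, 0 < p.2 → ‖K p‖ ≤ Set.indicator (Set.Ioc 0 R) (fun _ => (1 : ℝ)) p.2 *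
        ((Real.sqrt p.2)⁻¹ * Real.exp (-(p.1 + 2 * lam.im * p.2) ^ 2 / (4 * p.2))) := by
      intro p hp
      rw [hn]
      by_cases hpR : p ∈ Metric.closedBall 0 R
      · rw [Set.indicator_of_mem hpR, Set.indicator_of_mem
          (show p.2 ∈ Set.Ioc 0 R from ⟨hp, (le_abs_self _).trans (hball hpR).2⟩), one_mul, one_mul,
          norm_heatKer lam 0 hp, hr]
        simp only [ne_eq, OfNat.ofNat_ne_zero, not_false_eq_true, zero_pow, sub_zero, neg_zero,
          zero_mul, Real.exp_zero, mul_one]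
        exact mul_le_mul_of_nonneg_right (inv_sqrt_four_pi_le hp) (Real.exp_nonneg _)
      · rw [Set.indicator_of_notMem hpR, zero_mul]
        exact mul_nonneg (Set.indicator_nonneg (fun _ _ => zero_le_one) _) (by positivity)
    obtain ⟨h1, h2⟩ := gauss_dominated hK (a := Set.indicator (Set.Ioc 0 R) fun _ => (1 : ℝ))
      (γ := 4) (b := 2 * lam.im) (by norm_num)
      ((integrable_indicator_iff measurableSet_Ioc).2 (by simp [IntegrableOn])).integrableOn
      (fun p hp => by simp [K, heatKer_of_nonpos lam 0 hp]) hb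
    refine ⟨h1.norm.congr (ae_of_all _ hn), ?_⟩
    simp only [← hn]
    refine h2.trans (le_of_eq ?_)
    rw [setIntegral_indicator measurableSet_Ioc, Set.inter_eq_right.2 fun t ht => ht.1]
    simp [hR0]
  · have hr0 : 0 < |lam.re| := abs_pos.2 hr
    set a := 2 + 2 * |lam.im| with ha
    set c := Real.sqrt 2 * Real.sqrt |lam.re|⁻¹ with hc
    refine ⟨freeG lam, fun Φ hΦ => ?_, c * (16 * (Real.sqrt a * Real.sqrt 2)), by positivity,
      fun R hR => ?_⟩
    · rw [← freeKer_fwd]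
      simpa using freeKer_fundamental lam 0 (measurableSet_fwd lam) (fwd_compl lam) hΦ
    have hR0 : 0 < R := zero_lt_one.trans_le hR
    have haR : 0 ≤ a * R := by positivity
    obtain ⟨f1, f2⟩ := integral_inv_sqrt_abs haR
    obtain ⟨g1, g2⟩ := integral_inv_sqrt_abs (a := 2 * R) (by positivity)
    have hmeas : ∀ s : ℝ, Measurable
        (Set.indicator (Set.Ioo (-s) s) fun z : ℝ => |z| ^ (-(1 / 2) : ℝ)) := fun s =>
      (by fun_prop : Measurable fun z : ℝ => |z| ^ (-(1 / 2) : ℝ)).indicator measurableSet_Ioo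
    obtain ⟨s1, s2⟩ := integral_shear (hmeas (a * R)) (hmeas (2 * R)) f1 g1 (2 * lam.im)
    have hm : Measurable fun p => Set.indicator (Metric.closedBall 0 R) (fun _ => (1 : ℝ)) p *
        ‖freeG lam p‖ :=
      (measurable_const.indicator Metric.isClosed_closedBall.measurableSet).mul
        (measurable_freeG lam).norm
    have hle : ∀ᵐ p : ℝ × ℝ, ‖Set.indicator (Metric.closedBall 0 R) (fun _ => (1 : ℝ)) p *
        ‖freeG lam p‖‖ ≤ c *
        (Set.indicator (Set.Ioo (-(a * R)) (a * R)) (fun z : ℝ => |z| ^ (-(1 / 2) : ℝ))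
          (p.1 + 2 * lam.im * p.2) *
        Set.indicator (Set.Ioo (-(2 * R)) (2 * R)) (fun z : ℝ => |z| ^ (-(1 / 2) : ℝ)) p.2) := by
      filter_upwards [ae_zed_ne_zero lam] with ⟨X, Y⟩ hZ
      have hrhs : 0 ≤ c *
          (Set.indicator (Set.Ioo (-(a * R)) (a * R)) (fun z : ℝ => |z| ^ (-(1 / 2) : ℝ))
            (X + 2 * lam.im * Y) *
          Set.indicator (Set.Ioo (-(2 * R)) (2 * R)) (fun z : ℝ => |z| ^ (-(1 / 2) : ℝ)) Y) := by
        refine mul_nonneg (by positivity) (mul_nonneg ?_ ?_) <;>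
        exact Set.indicator_nonneg (fun _ _ => by positivity) _
      by_cases hp : ((X, Y) : ℝ × ℝ) ∈ Metric.closedBall 0 R
      swap
      · rw [Set.indicator_of_notMem hp, zero_mul, norm_zero]; exact hrhs
      obtain ⟨hX, hY⟩ := hball hp
      simp only at hX hY hZ
      rw [Set.indicator_of_mem hp, one_mul, norm_norm]
      rcases eq_or_ne Y 0 with rfl | hY0
      · rw [show freeG lam (X, 0) = 0 by simp [freeG, osc_zero], norm_zero]; exact hrhs
      have hZle : |X + 2 * lam.im * Y| < a * R := by
        calc |X + 2 * lam.im * Y| ≤ |X| + |2 * lam.im * Y| := abs_add_le _ _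
          _ = |X| + 2 * |lam.im| * |Y| := by rw [abs_mul, abs_mul]; simp
          _ ≤ R + 2 * |lam.im| * R := by gcongr
          _ < a * R := by rw [ha]; nlinarith
      have hYle : |Y| < 2 * R := by linarith
      simp only
      rw [Set.indicator_of_mem (show X + 2 * lam.im * Y ∈ Set.Ioo (-(a * R)) (a * R) from abs_lt.1 hZle),
        Set.indicator_of_mem (show Y ∈ Set.Ioo (-(2 * R)) (2 * R) from abs_lt.1 hYle)]
      -- The geometric mean of the bounds 2/|Z| and 1/(|Re λ||Y|) is a product of two inverse square
      -- roots, whose integral over a box of size R is of order R.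
      have b1 := norm_freeG_le_zed lam hZ
      have b2 := (norm_freeG_le_mass lam X Y).trans (integral_wt_le_inv hr0 hY0)
      refine (le_sqrt_mul_of_le (norm_nonneg _) b1 b2).trans (le_of_eq ?_)
      rw [hc, mul_inv, Real.sqrt_mul (by positivity), Real.sqrt_div (by positivity), Real.sqrt_inv |Y|,
        Real.rpow_neg (abs_nonneg _), Real.rpow_neg (abs_nonneg _), ← Real.sqrt_eq_rpow,
        ← Real.sqrt_eq_rpow]
      ring
    have hint := s1.const_mul c
    refine ⟨hint.mono' hm.aestronglyMeasurable hle, ?_⟩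
    refine (integral_mono_of_nonneg (ae_of_all _ fun p => mul_nonneg
      (Set.indicator_nonneg (fun _ _ => zero_le_one) _) (norm_nonneg _)) hint
      (hle.mono fun p hp => (le_abs_self _).trans hp)).trans (le_of_eq ?_)
    rw [integral_const_mul, s2, f2, g2, Real.sqrt_mul (by positivity), Real.sqrt_mul (by positivity)]
    linear_combination 16 * c * Real.sqrt a * Real.sqrt 2 * Real.mul_self_sqrt hR0.le

section

variable {lam : ℂ} {b w W F W₁ Φ : ℝ × ℝ → ℂ}

lemma adj_eq_swap (b Φ : ℝ × ℝ → ℂ) (q : ℝ × ℝ) : adj b Φ q = ∫ p, Φ p * b (p - q) := by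
  rw [adj, ← integral_sub_right_eq_self _ q]
  refine integral_congr_ae (ae_of_all _ fun p => ?_)
  simp only [add_sub_cancel]; ring

lemma tendsto_sub_left_cocompact (p : ℝ × ℝ) :
    Tendsto (fun q : ℝ × ℝ => p - q) (cocompact (ℝ × ℝ)) (cocompact (ℝ × ℝ)) :=
  (Homeomorph.subLeft p).isClosedEmbedding.tendsto_cocompact

lemma van_adj (hb : BM b) (hv : Van b) (hΦ : CTest Φ) : Van (adj b Φ) := by
  obtain ⟨C, hC⟩ := hb.bdd
  unfold Van
  rw [funext (adj_eq_swap b Φ), show (0 : ℂ) = ∫ p : ℝ × ℝ, (0 : ℂ) by simp]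
  refine tendsto_integral_filter_of_dominated_convergence (fun p => ‖Φ p‖ * C)
    (Eventually.of_forall fun r => ?_) (Eventually.of_forall fun r => ae_of_all _ fun p => ?_)
    (hΦ.integrable.norm.mul_const C) (ae_of_all _ fun p => ?_)
  · exact (hΦ.continuous.measurable.mul
      (hb.meas.comp (measurable_id.sub measurable_const))).aestronglyMeasurable
  · rw [norm_mul]; exact mul_le_mul_of_nonneg_left (hC _) (norm_nonneg _)
  · simpa using (hv.comp (tendsto_sub_left_cocompact p)).const_mul (Φ p)

lemma Van.eventually_le (h : Van b) {ε : ℝ} (hε : 0 < ε) : ∃ N, ∀ p, N ≤ ‖p‖ → ‖b p‖ ≤ ε := by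
  have h1 : ∀ᶠ p in cocompact (ℝ × ℝ), ‖b p‖ < ε := by
    simpa using h.norm.eventually_lt_const (by simpa using hε)
  rw [← Metric.cobounded_eq_cocompact, ← comap_norm_atTop, eventually_comap] at h1
  obtain ⟨N, hN⟩ := eventually_atTop.1 h1
  exact ⟨N, fun p hp => (hN _ hp p rfl).le⟩

lemma Lst_adj (hb : BM b) (h : Sol lam b fun _ => 0) (hΦ : CTest Φ) (p : ℝ × ℝ) :
    Lst lam (adj b Φ) p = 0 := by
  have h1 := h _ (hΦ.comp_add p)
  rw [Lst_comp_add] at h1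
  simp only [zero_mul, integral_zero] at h1
  rw [← h1]
  have hm : ∀ {Ψ}, CTest Ψ → Integrable fun q => b q * Ψ (p + q) := by
    intro Ψ hΨ
    have := hb.integrable_mul (hΨ.comp_add p).integrable
    simpa [add_comm] using this
  simp only [Lst]
  rw [pd_adj hb.locallyIntegrable hΦ, pd_adj hb.locallyIntegrable hΦ,
    pd_adj hb.locallyIntegrable (hΦ.pd ex)]
  simp only [adj]
  have i1 := hm (hΦ.pd ey)
  have i2 := hm ((hΦ.pd ex).pd ex)
  have i3 := hm (hΦ.pd ex)
  have := integral_lin_comb (k := 2 * Complex.I * lam) (l := 0) i1 i2 i3 i3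
  rw [zero_mul, add_zero] at this
  rw [← this]
  refine integral_congr_ae (ae_of_all _ fun q => ?_)
  simp only [add_comm p q]
  ring

/-- A bounded weak solution of the free equation that vanishes at infinity is zero. -/
theorem Sol.eq_zero_of_free (hb : BM b) (hv : Van b) (h : Sol lam b fun _ => 0) :
    b =ᵐ[volume] 0 := by
  refine ae_eq_zero_of_test hb.locallyIntegrable fun Φ hΦ => ?_
  set β := adj b Φ with hβ
  have sβ : ContDiff ℝ ∞ β := contDiff_adj hb.locallyIntegrable hΦ
  have vβ : Van β := van_adj hb hv hΦ
  have vβx : Van (pd ex β) := by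
    rw [hβ, pd_adj hb.locallyIntegrable hΦ]; exact van_adj hb hv (hΦ.pd ex)
  have e0 : ∫ p, b p * Φ p = β (0, 0) := by
    rw [hβ, adj, Prod.mk_zero_zero]; simp only [zero_add]
  rw [e0]
  obtain ⟨k, hk, C, hC0, hC⟩ := exists_small_kernel lam
  obtain ⟨χ, hχ, hχ1, hχ2⟩ := exists_cutoff
  obtain ⟨D, hD0, hD⟩ := Lst_comp_smul_bound lam hχ
  -- The smooth function β is a solution of the adjoint equation vanishing at infinity together with
  -- its x-derivative. Multiplied by a cutoff at radius R and tested with the fundamental solution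
  -- k, it gives back β(0). Only derivatives of the cutoff survive; they live where R ≤ ‖p‖ ≤ 2R and
  -- are O(1/R), while k has mass O(R) there.
  have key : ∀ ε, 0 < ε → ‖β (0, 0)‖ ≤ 6 * D * C * ε := by
    intro ε hε
    obtain ⟨N1, hN1⟩ := vβ.eventually_le hε
    obtain ⟨N2, hN2⟩ := vβx.eventually_le hε
    set R := max 1 (max N1 N2) with hR
    have hR1 : 1 ≤ R := le_max_left _ _
    have hR0 : 0 < R := zero_lt_one.trans_le hR1
    have hρ0 : 0 < R⁻¹ := inv_pos.2 hR0
    have hρ1 : R⁻¹ ≤ 1 := inv_le_one_of_one_le₀ hR1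
    have hχR : CTest fun p => χ (R⁻¹ • p) := hχ.comp_smul hρ0.ne'
    have ht : CTest fun p => χ (R⁻¹ • p) * β p := by
      simpa [mul_comm] using hχR.smooth_mul sβ
    have h1 := hk _ ht
    rw [show χ (R⁻¹ • ((0, 0) : ℝ × ℝ)) = 1 from hχ1 _ (by simp), one_mul] at h1
    rw [← h1]
    obtain ⟨i1, i2⟩ := hC (2 * R) (by linarith)
    -- The factor 3 counts the term with the adjoint operator on the cutoff once and the cross term
    -- 2χ_xβ_x twice.
    refine (norm_integral_le_of_norm_le (i1.mul_const (3 * D * R⁻¹ * ε)) (ae_of_all _ fun p => ?_)).trans ?_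
    · rw [Lst_mul lam hχR.smooth sβ, Lst_adj hb h hΦ, mul_zero, zero_add, norm_mul]
      obtain ⟨d1, d2⟩ := hD _ hρ0 hρ1 p
      have hnorm : ‖R⁻¹ • p‖ = R⁻¹ * ‖p‖ := by
        rw [norm_smul, Real.norm_of_nonneg hρ0.le]
      rcases lt_or_ge ‖p‖ R with hp | hp
      · have hop : ∀ᶠ q in 𝓝 p, ‖R⁻¹ • q‖ < 1 := by
          refine (continuous_const_smul R⁻¹).norm.continuousAt.eventually_lt continuousAt_const ?_
          rw [hnorm, inv_mul_lt_iff₀ hR0]; linarith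
        have hone : (fun q => χ (R⁻¹ • q)) =ᶠ[𝓝 p] fun _ => 1 := by
          filter_upwards [hop] with q hq using hχ1 _ hq
        have e : ∀ e', pd e' (fun q => χ (R⁻¹ • q)) =ᶠ[𝓝 p] fun _ => 0 := fun e' => by
          filter_upwards [hone.fderiv (𝕜 := ℝ)] with q hq
          simp only [pd, hq]; simp
        have e2 : pd ex (pd ex fun q => χ (R⁻¹ • q)) p = 0 := by
          have := congrArg (fun L : (ℝ × ℝ) →L[ℝ] ℂ => L ex) (e ex).fderiv_eq
          simpa [pd] using this
        simp only [Lst]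
        rw [e2, (e ex).eq_of_nhds, (e ey).eq_of_nhds]
        simp only [neg_zero, sub_zero, mul_zero, zero_mul, norm_zero]
        exact mul_nonneg (mul_nonneg (Set.indicator_nonneg (fun _ _ => zero_le_one) _)
          (norm_nonneg _)) (by positivity)
      · have c1 := hN1 p (((le_max_left _ _).trans (le_max_right _ _)).trans hp)
        have c2 := hN2 p (((le_max_right _ _).trans (le_max_right _ _)).trans hp)
        by_cases hp2 : p ∈ Metric.closedBall (0 : ℝ × ℝ) (2 * R)
        · rw [Set.indicator_of_mem hp2, one_mul]
          refine mul_le_mul_of_nonneg_left ?_ (norm_nonneg _)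
          refine (norm_sub_le _ _).trans ?_
          rw [norm_mul, norm_mul, norm_mul, Complex.norm_ofNat]
          have a1 := mul_le_mul d1 c1 (norm_nonneg _) (by positivity)
          have a2 := mul_le_mul d2 c2 (norm_nonneg _) (by positivity)
          linarith
        · have hgt : 2 * R < ‖p‖ := by simpa using hp2
          have hop : ∀ᶠ q in 𝓝 p, 2 < ‖R⁻¹ • q‖ := by
            refine continuousAt_const.eventually_lt (continuous_const_smul R⁻¹).norm.continuousAt ?_
            rw [hnorm, lt_inv_mul_iff₀ hR0]; linarith
          have hz : (fun q => χ (R⁻¹ • q)) =ᶠ[𝓝 p] fun _ => 0 := by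
            filter_upwards [hop] with q hq using hχ2 _ hq.le
          have e : ∀ e', pd e' (fun q => χ (R⁻¹ • q)) =ᶠ[𝓝 p] fun _ => 0 := fun e' => by
            filter_upwards [hz.fderiv (𝕜 := ℝ)] with q hq
            simp only [pd, hq]; simp
          have e2 : pd ex (pd ex fun q => χ (R⁻¹ • q)) p = 0 := by
            have := congrArg (fun L : (ℝ × ℝ) →L[ℝ] ℂ => L ex) (e ex).fderiv_eq
            simpa [pd] using this
          simp only [Lst]
          rw [e2, (e ex).eq_of_nhds, (e ey).eq_of_nhds, Set.indicator_of_notMem hp2]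
          simp
    · rw [integral_mul_const]
      calc _ ≤ C * (2 * R) * (3 * D * R⁻¹ * ε) := by gcongr
        _ = 6 * D * C * ε := by field_simp; ring
  have h0 : ‖β (0, 0)‖ ≤ 0 := by
    refine le_of_forall_pos_le_add fun δ hδ => ?_
    have hpos : 0 < 6 * D * C + 1 := by positivity
    refine (key (δ / (6 * D * C + 1)) (by positivity)).trans ?_
    rw [zero_add, ← mul_div_assoc, div_le_iff₀ hpos]
    nlinarith
  exact norm_le_zero_iff.1 h0

end

/-! ### The soliton potential -/

/-- The scaled hyperbolic tangent. -/
def th (κ x : ℝ) : ℝ := Real.tanh (κ * x)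

/-- The scaled hyperbolic tangent of `x` as a complex function on the plane. -/
def tc (κ : ℝ) (p : ℝ × ℝ) : ℂ := th κ p.1

/-- The soliton as a complex function of `x`. -/
def uc (κ x : ℝ) : ℂ := -2 * κ ^ 2 * (1 - (th κ x : ℂ) ^ 2)

lemma hasDerivAt_th (κ x : ℝ) : HasDerivAt (th κ) (κ * (1 - th κ x ^ 2)) x := by
  have hc : Real.cosh (κ * x) ≠ 0 := (Real.cosh_pos _).ne'
  have h1 : HasDerivAt (fun x : ℝ => κ * x) κ x := by simpa using (hasDerivAt_id x).const_mul κ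
  have h := h1.sinh.div h1.cosh hc
  have e : th κ = fun x => Real.sinh (κ * x) / Real.cosh (κ * x) := by
    ext x; rw [th, Real.tanh_eq_sinh_div_cosh]
  rw [e]
  refine h.congr_deriv ?_
  field_simp

lemma hasDerivAt_thc (κ x : ℝ) :
    HasDerivAt (fun x => (th κ x : ℂ)) (κ * (1 - (th κ x : ℂ) ^ 2)) x := by
  simpa using (hasDerivAt_th κ x).ofReal_comp

lemma abs_th_le (κ x : ℝ) : |th κ x| ≤ 1 := (Real.abs_tanh_lt_one _).le

lemma norm_thc_le (κ x : ℝ) : ‖(th κ x : ℂ)‖ ≤ 1 := by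
  rw [Complex.norm_real]; exact abs_th_le κ x

lemma continuous_th (κ : ℝ) : Continuous (th κ) :=
  continuous_iff_continuousAt.2 fun x => (hasDerivAt_th κ x).continuousAt

lemma contDiff_tc (κ : ℝ) : ContDiff ℝ ∞ (tc κ) := by
  have e : tc κ = fun p : ℝ × ℝ => ((Real.sinh (κ * p.1) / Real.cosh (κ * p.1) : ℝ) : ℂ) := by
    ext p; rw [tc, th, Real.tanh_eq_sinh_div_cosh]
  rw [e]
  refine Complex.ofRealCLM.contDiff.comp (ContDiff.div ?_ ?_ fun p => (Real.cosh_pos _).ne')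
  · exact Real.contDiff_sinh.comp (contDiff_const.mul contDiff_fst)
  · exact Real.contDiff_cosh.comp (contDiff_const.mul contDiff_fst)

lemma bm_tc (κ : ℝ) : BM (tc κ) :=
  ⟨(contDiff_tc κ).continuous.measurable, 1, fun _ => norm_thc_le κ _⟩

lemma u0_eq (κ x : ℝ) : u0 κ x = -2 * κ ^ 2 * (1 - th κ x ^ 2) := by
  have hc : Real.cosh (κ * x) ≠ 0 := (Real.cosh_pos _).ne'
  rw [u0, th, Real.tanh_eq_sinh_div_cosh]
  field_simp
  rw [Real.cosh_sq]; ring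

lemma ofReal_u0 (κ x : ℝ) : (u0 κ x : ℂ) = uc κ x := by
  rw [u0_eq, uc]; push_cast; ring

lemma continuous_uc (κ : ℝ) : Continuous (uc κ) := by
  have := continuous_th κ
  unfold uc; fun_prop

lemma uc_eq_tc (κ : ℝ) : (fun p : ℝ × ℝ => uc κ p.1) = fun p => -2 * κ ^ 2 * (1 - tc κ p ^ 2) := rfl

lemma contDiff_uc (κ : ℝ) : ContDiff ℝ ∞ (fun p : ℝ × ℝ => uc κ p.1) := by
  have := contDiff_tc κ
  rw [uc_eq_tc]; fun_prop

lemma bm_uc (κ : ℝ) : BM (fun p : ℝ × ℝ => uc κ p.1) := by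
  rw [uc_eq_tc]
  simp only [sq (tc κ _)]
  exact ((BM.const 1).sub ((bm_tc κ).mul (bm_tc κ))).const_mul _

lemma pd_ex_tc (κ : ℝ) : pd ex (tc κ) = fun p => κ * (1 - tc κ p ^ 2) := by
  ext p
  exact pd_ex_of_hasDerivAt ((contDiff_tc κ).differentiable (by simp)) (hasDerivAt_thc κ p.1)

lemma pd_ey_tc (κ : ℝ) : pd ey (tc κ) = fun _ => 0 := by
  ext p
  exact pd_ey_of_hasDerivAt ((contDiff_tc κ).differentiable (by simp))
    (by simpa [tc] using hasDerivAt_const p.2 (th κ p.1 : ℂ))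

lemma pd_ex_ex_tc (κ : ℝ) : pd ex (pd ex (tc κ)) = fun p => -2 * κ ^ 2 * tc κ p * (1 - tc κ p ^ 2) := by
  ext p
  refine pd_ex_of_hasDerivAt ((contDiff_pd (contDiff_tc κ) ex).differentiable (by simp)) ?_
  rw [pd_ex_tc]
  have := (((hasDerivAt_thc κ p.1).pow 2).const_sub 1).const_mul (κ : ℂ)
  refine this.congr_deriv ?_
  simp only [tc]; push_cast; ring

lemma pd_ex_uc (κ : ℝ) : pd ex (fun p : ℝ × ℝ => uc κ p.1) =
    fun p => 4 * κ ^ 3 * tc κ p * (1 - tc κ p ^ 2) := by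
  ext p
  refine pd_ex_of_hasDerivAt ((contDiff_uc κ).differentiable (by simp)) ?_
  have := (((hasDerivAt_thc κ p.1).pow 2).const_sub 1).const_mul (-2 * κ ^ 2 : ℂ)
  refine this.congr_deriv ?_
  simp only [tc]; push_cast; ring

section

variable {e : ℝ × ℝ} {lam : ℂ} {f f' g g' b w W F W₁ Φ τ : ℝ × ℝ → ℂ}

lemma WD.congr (h : WD e f f') (hf : f =ᵐ[volume] g) (hf' : f' =ᵐ[volume] g') : WD e g g' := by
  intro Φ hΦ
  rw [← integral_congr_ae (hf.mono fun p hp => by simp only [hp] :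
      (fun p => f p * pd e Φ p) =ᵐ[volume] fun p => g p * pd e Φ p), h Φ hΦ,
    integral_congr_ae (hf'.mono fun p hp => by simp only [hp] :
      (fun p => f' p * Φ p) =ᵐ[volume] fun p => g' p * Φ p)]

/-- Multiplication of a weak solution by a smooth function. -/
lemma Sol.smooth_mul (hW : BM W) (hF : BM F) (hW₁ : BM W₁) (h : Sol lam W F) (h1 : WD ex W W₁)
    (hτ : ContDiff ℝ ∞ τ) : Sol lam (fun p => τ p * W p) (fun p => τ p * F p - Lst lam τ p * W p -
      2 * (pd ex τ p * W₁ p) - 2 * (pd ex (pd ex τ) p * W p)) := by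
  intro Φ hΦ
  have sx := contDiff_pd hτ ex
  have sxx := contDiff_pd sx ex
  have sL : ContDiff ℝ ∞ (Lst lam τ) := by
    have := contDiff_pd hτ ey
    unfold Lst; fun_prop
  have e1 := h _ (hΦ.smooth_mul hτ)
  have e2 := h1 _ (hΦ.smooth_mul sx)
  rw [pd_mul ex (sx.differentiable (by simp)) hΦ.differentiable] at e2
  have j1 := hW.integrable_mul ((hΦ.lst lam).smooth_mul hτ).integrable
  have j2 := hW.integrable_mul (hΦ.smooth_mul sL).integrable
  have j3 := hW.integrable_mul ((hΦ.pd ex).smooth_mul sx).integrable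
  have j4 := hW.integrable_mul (hΦ.smooth_mul sxx).integrable
  have j5 := hF.integrable_mul (hΦ.smooth_mul hτ).integrable
  have j6 := hW₁.integrable_mul (hΦ.smooth_mul sx).integrable
  have a1 : ∫ p, W p * Lst lam (fun p => τ p * Φ p) p = (∫ p, W p * (τ p * Lst lam Φ p)) +
      (∫ p, W p * (Lst lam τ p * Φ p)) - 2 * ∫ p, W p * (pd ex τ p * pd ex Φ p) := by
    rw [← integral_const_mul, ← integral_add j1 j2, ← integral_sub
      (f := fun p => W p * (τ p * Lst lam Φ p) + W p * (Lst lam τ p * Φ p)) (j1.add j2)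
      (j3.const_mul 2)]
    refine integral_congr_ae (ae_of_all _ fun p => ?_)
    simp only [Lst_mul lam hτ hΦ.smooth]; ring
  have a2 : ∫ p, W p * (pd ex (pd ex τ) p * Φ p + pd ex τ p * pd ex Φ p) =
      (∫ p, W p * (pd ex (pd ex τ) p * Φ p)) + ∫ p, W p * (pd ex τ p * pd ex Φ p) := by
    rw [← integral_add j4 j3]
    refine integral_congr_ae (ae_of_all _ fun p => ?_)
    simp only; ring
  have a3 : ∫ p, (τ p * F p - Lst lam τ p * W p - 2 * (pd ex τ p * W₁ p) -
      2 * (pd ex (pd ex τ) p * W p)) * Φ p = (∫ p, F p * (τ p * Φ p)) -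
      (∫ p, W p * (Lst lam τ p * Φ p)) - 2 * (∫ p, W₁ p * (pd ex τ p * Φ p)) -
      2 * ∫ p, W p * (pd ex (pd ex τ) p * Φ p) := by
    rw [← integral_const_mul, ← integral_const_mul, ← integral_sub j5 j2,
      ← integral_sub (f := fun p => F p * (τ p * Φ p) - W p * (Lst lam τ p * Φ p)) (j5.sub j2)
        (j6.const_mul 2),
      ← integral_sub (f := fun p => F p * (τ p * Φ p) - W p * (Lst lam τ p * Φ p) -
        2 * (W₁ p * (pd ex τ p * Φ p))) ((j5.sub j2).sub (j6.const_mul 2)) (j4.const_mul 2)]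
    refine integral_congr_ae (ae_of_all _ fun p => ?_)
    simp only; ring
  have a4 : ∫ p, τ p * W p * Lst lam Φ p = ∫ p, W p * (τ p * Lst lam Φ p) :=
    integral_congr_ae (ae_of_all _ fun p => by simp only; ring)
  rw [a1] at e1
  rw [a2] at e2
  rw [a3, a4]
  linear_combination e1 + 2 * e2

/-- A bounded function vanishing at infinity whose `y`-derivative is proportional to it is zero. -/
lemma eq_zero_of_wd_ey (hw : BM w) (hv : Van w) (c : ℂ) (h : WD ey w fun p => c * w p) :
    w =ᵐ[volume] 0 := by
  refine ae_eq_zero_of_test hw.locallyIntegrable fun Φ hΦ => ?_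
  set β := adj w Φ with hβ
  have sβ : ContDiff ℝ ∞ β := contDiff_adj hw.locallyIntegrable hΦ
  have vβ : Van β := van_adj hw hv hΦ
  have e0 : ∫ p, w p * Φ p = β (0, 0) := by
    rw [hβ, adj, Prod.mk_zero_zero]; simp only [zero_add]
  rw [e0]
  have hode : ∀ p, pd ey β p = -(c * β p) := by
    intro p
    rw [hβ, pd_adj hw.locallyIntegrable hΦ]
    have := h _ (hΦ.comp_add p)
    rw [pd_comp_add] at this
    simp only [adj, add_comm p]
    rw [this, ← integral_const_mul]
    simp only [mul_assoc]
  have hd : ∀ s : ℝ, HasDerivAt (fun s : ℝ => Complex.exp (c * s) * β (0, s)) 0 s := by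
    intro s
    have h1 := hasDerivAt_cexp_mul c s
    have h2 : HasDerivAt (fun s : ℝ => ((0 : ℝ), s)) ey s :=
      (hasDerivAt_const s (0 : ℝ)).prodMk (hasDerivAt_id s)
    have h3 : HasDerivAt (fun s : ℝ => β (0, s)) (pd ey β (0, s)) s :=
      ((sβ.differentiable (by simp) (0, s)).hasFDerivAt).comp_hasDerivAt s h2
    refine (h1.mul h3).congr_deriv ?_
    rw [hode]; ring
  have hconst : ∀ s : ℝ, Complex.exp (c * s) * β (0, s) = β (0, 0) := by
    intro s
    have := is_const_of_deriv_eq_zero (fun s => (hd s).differentiableAt) (fun s => (hd s).deriv) s 0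
    simpa using this
  have hle : ∀ ε, 0 < ε → ‖β (0, 0)‖ ≤ 0 + ε := by
    intro ε hε
    obtain ⟨N, hN⟩ := vβ.eventually_le hε
    -- The constant e^{cs}β(0, s) is evaluated far away in the direction of y where the exponential
    -- does not grow.
    obtain ⟨s, hs, hcs⟩ : ∃ s : ℝ, N ≤ |s| ∧ c.re * s ≤ 0 := by
      rcases le_total 0 c.re with h | h
      · exact ⟨-|N|, by simp [le_abs_self], by nlinarith [abs_nonneg N]⟩
      · exact ⟨|N|, by simp [le_abs_self], by nlinarith [abs_nonneg N]⟩
    rw [← hconst s, norm_mul, Complex.norm_exp, zero_add]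
    have h1 : Real.exp (c * s).re ≤ 1 := by
      rw [Real.exp_le_one_iff]; simpa using hcs
    refine (mul_le_of_le_one_left (norm_nonneg _) h1).trans (hN _ ?_)
    simpa [Prod.norm_def] using hs
  exact norm_le_zero_iff.1 (le_of_forall_pos_le_add hle)

/-- A bounded weak solution of the soliton equation that vanishes at infinity is zero. -/
theorem Sol.eq_zero_of_soliton (κ : ℝ) (hw : BM w) (hv : Van w)
    (h : Sol lam w fun p => -(uc κ p.1 * w p)) : w =ᵐ[volume] 0 := by
  have bu := bm_uc κ
  have bt := bm_tc κ
  have hF : BM fun p => -(uc κ p.1 * w p) := (bu.mul hw).neg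
  have vF : Van fun p => -(uc κ p.1 * w p) := by simpa [Van] using (Van.bm_mul bu hv).neg
  obtain ⟨w₁, b₁, wd₁, v₁⟩ := h.exists_wd_ex hw hF
  replace v₁ := v₁ hv vF
  have bux : BM (pd ex fun p : ℝ × ℝ => uc κ p.1) := by
    rw [pd_ex_uc]
    simp only [sq (tc κ _)]
    exact (bt.const_mul _).mul ((BM.const 1).sub (bt.mul bt))
  have hFx : WD ex (fun p => -(uc κ p.1 * w p))
      (fun p => -(pd ex (fun p : ℝ × ℝ => uc κ p.1) p * w p + uc κ p.1 * w₁ p)) :=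
    ((WD.of_smooth (contDiff_uc κ)).mul bu bux hw b₁ wd₁).neg
  have bFx : BM (fun p => -(pd ex (fun p : ℝ × ℝ => uc κ p.1) p * w p + uc κ p.1 * w₁ p)) :=
    ((bux.mul hw).add (bu.mul b₁)).neg
  -- Darboux transformation. With T = tanh κx one has (-∂ + κT)(∂ + κT) = -∂² + κ² + u₀ and (∂ +
  -- κT)(-∂ + κT) = -∂² + κ². After the gauge ∂ ↦ ∂ - iλ, the function w_x - iλw + κTw therefore
  -- solves the free equation; the three summands are treated separately and added.
  have s1 := h.wd wd₁ hFx
  have s2 := h.const_mul (-(Complex.I * lam))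
  have s3 := (h.smooth_mul hw hF b₁ wd₁ (contDiff_tc κ)).const_mul κ
  have btx : BM (pd ex (tc κ)) := by
    rw [pd_ex_tc]; simp only [sq (tc κ _)]
    exact ((BM.const 1).sub (bt.mul bt)).const_mul _
  have btxx : BM (pd ex (pd ex (tc κ))) := by
    rw [pd_ex_ex_tc]; simp only [sq (tc κ _)]
    exact (bt.const_mul _).mul ((BM.const 1).sub (bt.mul bt))
  have bL : BM (Lst lam (tc κ)) := by
    unfold Lst; rw [pd_ey_tc]
    exact ((BM.const 0).neg.sub btxx).sub (btx.const_mul _)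
  have b3F : BM (fun p => (κ : ℂ) * (tc κ p * -(uc κ p.1 * w p) - Lst lam (tc κ) p * w p -
      2 * (pd ex (tc κ) p * w₁ p) - 2 * (pd ex (pd ex (tc κ)) p * w p))) :=
    ((((bt.mul hF).sub (bL.mul hw)).sub ((btx.mul b₁).const_mul 2)).sub
      ((btxx.mul hw).const_mul 2)).const_mul _
  have b2 := hw.const_mul (-(Complex.I * lam))
  have b3 := (bt.mul hw).const_mul κ
  have s12 := Sol.add b₁.locallyIntegrable bFx.locallyIntegrable b2.locallyIntegrable
    (hF.const_mul _).locallyIntegrable s1 s2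
  have s := Sol.add (b₁.add b2).locallyIntegrable (bFx.add (hF.const_mul _)).locallyIntegrable
    b3.locallyIntegrable b3F.locallyIntegrable s12 s3
  have s0 := s.congr (EventuallyEq.refl _ _) (F' := fun _ => 0) (ae_of_all _ fun p => by
    simp only [Lst]
    rw [pd_ex_uc, pd_ex_ex_tc, pd_ex_tc, pd_ey_tc]
    simp only [uc, tc]
    ring)
  have hb0 := s0.eq_zero_of_free ((b₁.add b2).add b3)
    ((v₁.add (by simpa [Van] using (hv.const_mul (-(Complex.I * lam))))).add
      (by simpa [Van] using (Van.bm_mul bt hv).const_mul (κ : ℂ)))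
  set a : ℝ × ℝ → ℂ := fun p => Complex.I * lam - κ * tc κ p with ha
  have hw1 : w₁ =ᵐ[volume] fun p => a p * w p := by
    filter_upwards [hb0] with p hp
    simp only [Pi.zero_apply] at hp
    simp only [ha]
    linear_combination hp
  have sa : ContDiff ℝ ∞ a := by have := contDiff_tc κ; fun_prop
  have ba : BM a := (BM.const _).sub (bt.const_mul _)
  have pda : pd ex a = fun p => -(κ * (κ * (1 - tc κ p ^ 2))) := by
    ext p
    refine pd_ex_of_hasDerivAt (sa.differentiable (by simp)) ?_
    exact ((hasDerivAt_thc κ p.1).const_mul (κ : ℂ)).const_sub _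
  have bpa : BM (pd ex a) := by
    rw [pda]; simp only [sq (tc κ _)]
    exact ((((BM.const 1).sub (bt.mul bt)).const_mul _).const_mul _).neg
  have bw2 := ((bpa.mul hw).add (ba.mul b₁))
  have wd₂ : WD ex w₁ fun p => pd ex a p * w p + a p * w₁ p :=
    ((WD.of_smooth sa).mul ba bpa hw b₁ wd₁).congr hw1.symm (EventuallyEq.refl _ _)
  -- Now w_x = aw with a = iλ - κT. Substituted in the equation, a_x + a² - 2iλa - u₀ = λ² + κ², so
  -- w_y is a constant multiple of w.
  have wdy := h.wd_ey b₁ hF hw bw2 wd₁ wd₂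
  refine eq_zero_of_wd_ey hw hv (lam ^ 2 + κ ^ 2) (wdy.congr (EventuallyEq.refl _ _) ?_)
  filter_upwards [hw1] with p hp
  simp only [hp, pda]
  simp only [ha, uc, tc]
  linear_combination (-lam ^ 2 * w p) * Complex.I_sq

end

/-! ### Boundedness of weak solutions that vanish at infinity off a null set -/

section

variable {lam : ℂ} {w V H : ℝ × ℝ → ℂ}

/-- A representative that vanishes at infinity everywhere. -/
lemma exists_van_rep {f : ℝ × ℝ → ℂ} (hf : AEStronglyMeasurable f volume)
    (hv : Tendsto f (cocompact (ℝ × ℝ) ⊓ ae volume) (𝓝 0)) :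
    ∃ g, Measurable g ∧ f =ᵐ[volume] g ∧ Van g := by
  set g₀ := hf.mk f with hg₀
  have hg₀m : Measurable g₀ := hf.stronglyMeasurable_mk.measurable
  have hae : f =ᵐ[volume] g₀ := hf.ae_eq_mk
  have hv₀ : Tendsto g₀ (cocompact (ℝ × ℝ) ⊓ ae volume) (𝓝 0) :=
    hv.congr' (hae.filter_mono inf_le_right)
  have hn : ∀ n : ℕ, ∃ s ∈ cocompact (ℝ × ℝ), ∃ t ∈ ae (volume : Measure (ℝ × ℝ)),
      ∀ p ∈ s, p ∈ t → ‖g₀ p‖ < ((n : ℝ) + 1)⁻¹ := by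
    intro n
    have h1 : ∀ᶠ p in cocompact (ℝ × ℝ) ⊓ ae volume, ‖g₀ p‖ < ((n : ℝ) + 1)⁻¹ := by
      have h0 : (0 : ℝ) < ((n : ℝ) + 1)⁻¹ := by positivity
      have := hv₀.norm
      rw [norm_zero] at this
      exact this.eventually_lt_const h0
    obtain ⟨s, hs, t, ht, hst⟩ := mem_inf_iff_superset.1 h1
    exact ⟨s, hs, t, ht, fun p h1 h2 => hst ⟨h1, h2⟩⟩
  choose s hs t ht hst using hn
  -- One exceptional null set for each tolerance 1/(n + 1); countably many suffice, and the
  -- representative is set to 0 on a measurable null set containing their union.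
  set N := toMeasurable volume (⋃ n, (t n)ᶜ) with hN
  have hN0 : volume N = 0 := by
    rw [hN, measure_toMeasurable]
    exact measure_iUnion_null fun n => mem_ae_iff.1 (ht n)
  have hNm : MeasurableSet N := measurableSet_toMeasurable _ _
  refine ⟨Nᶜ.indicator g₀, hg₀m.indicator hNm.compl, ?_, ?_⟩
  · filter_upwards [hae, measure_eq_zero_iff_ae_notMem.1 hN0] with p h1 h2
    rw [h1, Set.indicator_of_mem (by exact h2)]
  · unfold Van
    rw [tendsto_zero_iff_norm_tendsto_zero, Metric.tendsto_nhds]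
    intro ε hε
    obtain ⟨n, hn⟩ := exists_nat_one_div_lt hε
    filter_upwards [hs n] with p hp
    rw [dist_zero_right, norm_norm]
    by_cases hpN : p ∈ N
    · rw [Set.indicator_of_notMem (Set.notMem_compl_iff.2 hpN), norm_zero]; exact hε
    · rw [Set.indicator_of_mem (by exact hpN)]
      have hpt : p ∈ t n := by
        by_contra hcon
        exact hpN (subset_toMeasurable _ _ (Set.mem_iUnion.2 ⟨n, hcon⟩))
      exact (hst n p hp hpt).trans (by rwa [one_div] at hn)

lemma Van.tame {g : ℝ × ℝ → ℂ} (hm : Measurable g) (hl : LocallyIntegrable g) (hv : Van g) :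
    ∃ g₁ g₂, Measurable g₁ ∧ Integrable g₁ ∧ BM g₂ ∧ ∀ p, g p = g₁ p + g₂ p := by
  obtain ⟨N, hN⟩ := hv.eventually_le one_pos
  have hB : MeasurableSet (Metric.closedBall (0 : ℝ × ℝ) N) := Metric.isClosed_closedBall.measurableSet
  refine ⟨(Metric.closedBall 0 N).indicator g, (Metric.closedBall 0 N)ᶜ.indicator g,
    hm.indicator hB, (integrable_indicator_iff hB).2
      (hl.integrableOn_isCompact (isCompact_closedBall _ _)),
    ⟨hm.indicator hB.compl, 1, fun p => ?_⟩, fun p => ?_⟩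
  · by_cases hp : p ∈ Metric.closedBall (0 : ℝ × ℝ) N
    · rw [Set.indicator_of_notMem (Set.notMem_compl_iff.2 hp), norm_zero]; exact zero_le_one
    · rw [Set.indicator_of_mem (by exact hp)]
      exact hN p (not_le.1 (by simpa using hp)).le
  · exact (congrFun (Set.indicator_self_add_compl (Metric.closedBall 0 N) g) p).symm

lemma locallyIntegrable_cvl {K : ℝ × ℝ → ℂ} (hH : Tame H) (hK : Integrable K) (hKm : Measurable K) :
    LocallyIntegrable (cvl K H) := by
  obtain ⟨H₁, H₂, h1, h2, h3⟩ := hH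
  have i1 : Integrable (cvl K H₁) :=
    h1.integrable_convolution (ContinuousLinearMap.mul ℝ ℂ) hK (μ := volume)
  have e : cvl K H =ᵐ[volume] fun r => cvl K H₁ r + cvl K H₂ r := by
    have hp := (h1.convolution_integrand (ContinuousLinearMap.mul ℝ ℂ) hK (μ := volume)
      (ν := volume)).prod_right_ae
    filter_upwards [hp] with r hr
    have h2r : Integrable fun q => H₂ q * K (r - q) :=
      h2.integrable_mul (hK.comp_sub_left r)
    simp only [cvl, h3, add_mul]
    exact integral_add hr h2r
  exact (i1.locallyIntegrable.add (bm_cvl hKm hK h2).locallyIntegrable).congr e.symm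

/-- Two convolutions with the heat kernel turn integrable functions into bounded ones. -/
lemma cvl_cvl_bound {K a h : ℝ × ℝ → ℂ} (hKm : Measurable K) (hK2 : Integrable fun p => K p ^ 2)
    (ha : BM a) (hhm : Measurable h) (hh : Integrable h) :
    ∃ C, ∀ r, Integrable (fun q => a q * cvl K h q * K (r - q)) ∧
      ‖∫ q, a q * cvl K h q * K (r - q)‖ ≤ C := by
  obtain ⟨A, hA0, hA⟩ := ha.nonneg_bound
  have hcm : Measurable (cvl K h) := by
    have hm : Measurable fun z : (ℝ × ℝ) × (ℝ × ℝ) => h z.2 * K (z.1 - z.2) :=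
      (hhm.comp measurable_snd).mul (hKm.comp (measurable_fst.sub measurable_snd))
    exact (hm.stronglyMeasurable.integral_prod_right' (ν := volume)).measurable
  set B := ∫⁻ p, ‖K p‖ₑ ^ 2 with hB
  have hBfin : B ≠ ⊤ := by
    have := hK2.hasFiniteIntegral
    simp only [HasFiniteIntegral, enorm_pow] at this
    exact this.ne
  set D := ∫⁻ p, ‖h p‖ₑ with hD
  have hDfin : D ≠ ⊤ := hh.hasFiniteIntegral.ne
  -- By 2xy ≤ x² + y², the composition of |K| with itself is bounded pointwise by the integral of
  -- |K|².
  have hKK : ∀ r s : ℝ × ℝ, ∫⁻ q, ‖K (q - s)‖ₑ * ‖K (r - q)‖ₑ ≤ B := by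
    intro r s
    have e1 : ∫⁻ q, ‖K (q - s)‖ₑ ^ 2 = B := lintegral_sub_right_eq_self (fun q => ‖K q‖ₑ ^ 2) s
    have e2 : ∫⁻ q, ‖K (r - q)‖ₑ ^ 2 = B := lintegral_sub_left_eq_self (fun q => ‖K q‖ₑ ^ 2) r
    have hle : ∀ x y : ENNReal, 2 * (x * y) ≤ x ^ 2 + y ^ 2 := by
      intro x y
      rcases eq_or_ne x ⊤ with rfl | hx
      · simp
      rcases eq_or_ne y ⊤ with rfl | hy
      · simp
      lift x to NNReal using hx
      lift y to NNReal using hy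
      have := two_mul_le_add_sq (x : ℝ) y
      have h2 : (2 * (x * y) : NNReal) ≤ x ^ 2 + y ^ 2 := by
        rw [← NNReal.coe_le_coe]; push_cast; linarith
      exact_mod_cast h2
    have h1 : ∫⁻ q, 2 * (‖K (q - s)‖ₑ * ‖K (r - q)‖ₑ) ≤
        ∫⁻ q, (‖K (q - s)‖ₑ ^ 2 + ‖K (r - q)‖ₑ ^ 2) := lintegral_mono fun q => hle _ _
    rw [lintegral_add_left (by fun_prop), e1, e2, lintegral_const_mul _ (by fun_prop), ← two_mul] at h1
    exact (ENNReal.mul_le_mul_iff_right two_ne_zero ENNReal.ofNat_ne_top).1 h1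
  have key : ∀ r, ∫⁻ q, ‖a q * cvl K h q * K (r - q)‖ₑ ≤ ENNReal.ofReal A * (D * B) := by
    intro r
    calc ∫⁻ q, ‖a q * cvl K h q * K (r - q)‖ₑ
        ≤ ∫⁻ q, ENNReal.ofReal A * ∫⁻ s, ‖h s‖ₑ * (‖K (q - s)‖ₑ * ‖K (r - q)‖ₑ) := by
          refine lintegral_mono fun q => ?_
          simp only [enorm_mul, mul_assoc]
          refine mul_le_mul' ?_ ?_
          · rw [← ofReal_norm]; exact ENNReal.ofReal_le_ofReal (hA q)
          · simp only [← mul_assoc]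
            rw [lintegral_mul_const _ (by fun_prop)]
            refine mul_le_mul_left ?_ _
            refine (enorm_integral_le_lintegral_enorm _).trans (le_of_eq ?_)
            simp only [enorm_mul]
      _ = ENNReal.ofReal A * ∫⁻ s, ∫⁻ q, ‖h s‖ₑ * (‖K (q - s)‖ₑ * ‖K (r - q)‖ₑ) := by
          rw [lintegral_const_mul' _ _ ENNReal.ofReal_ne_top, lintegral_lintegral_swap]
          exact Measurable.aemeasurable (by unfold Function.uncurry; fun_prop)
      _ ≤ ENNReal.ofReal A * ∫⁻ s, ‖h s‖ₑ * B := by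
          refine mul_le_mul_right (lintegral_mono fun s => ?_) _
          rw [lintegral_const_mul _ (by fun_prop)]
          exact mul_le_mul_right (hKK r s) _
      _ = ENNReal.ofReal A * (D * B) := by rw [lintegral_mul_const _ (by fun_prop)]
  have hfin : ENNReal.ofReal A * (D * B) ≠ ⊤ :=
    ENNReal.mul_ne_top ENNReal.ofReal_ne_top (ENNReal.mul_ne_top hDfin hBfin)
  refine ⟨(ENNReal.ofReal A * (D * B)).toReal, fun r => ?_⟩
  have hi : Integrable (fun q => a q * cvl K h q * K (r - q)) := by
    refine ⟨Measurable.aestronglyMeasurable ?_, (key r).trans_lt hfin.lt_top⟩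
    exact (ha.meas.mul hcm).mul (hKm.comp (measurable_const.sub measurable_id))
  refine ⟨hi, ?_⟩
  refine (norm_integral_le_integral_norm _).trans ?_
  rw [integral_norm_eq_lintegral_enorm hi.aestronglyMeasurable]
  exact ENNReal.toReal_mono hfin (key r)

/-- Weak solutions that vanish at infinity off a null set have a bounded representative that
vanishes at infinity. -/
theorem Sol.exists_bounded_rep (hw : LocallyIntegrable w)
    (hv : Tendsto w (cocompact (ℝ × ℝ) ⊓ ae volume) (𝓝 0)) (hV : BM V)
    (h : Sol lam w fun p => -(V p * w p)) : ∃ w', BM w' ∧ Van w' ∧ w =ᵐ[volume] w' := by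
  obtain ⟨g, hgm, hwg, hgv⟩ := exists_van_rep hw.aestronglyMeasurable hv
  obtain ⟨g₁, g₂, m₁, i₁, b₂, hg⟩ := hgv.tame hgm (hw.congr hwg)
  have hgt : Tame g := ⟨g₁, g₂, i₁, b₂, hg⟩
  set K := heatKer lam (cc lam) with hK
  have hKm : Measurable K := measurable_heatKer _ _
  have hKi : Integrable K := integrable_heatKer lam
  have hg' : Sol lam g fun p => -(V p * g p) :=
    h.congr hwg (hwg.mono fun p hp => by simp only [hp])
  set a : ℝ × ℝ → ℂ := fun p => cc lam - V p with ha
  have ba : BM a := (BM.const _).sub hV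
  have hFt : Tame fun p => -(V p * g p) := by simpa using Tame.bm_mul hV.neg hgt
  have hat : Tame fun p => a p * g p := Tame.bm_mul ba hgt
  -- The equation is read as heat operator plus `cc lam` applied to g, equal to ag with a bounded.
  have hrep : g =ᵐ[volume] cvl K fun p => a p * g p := by
    refine ae_eq_of_test hgt.locallyIntegrable (locallyIntegrable_cvl hat hKi hKm) fun Φ hΦ => ?_
    rw [hg'.integral_eq hgt hFt hΦ, ← hK]
    have : (fun q => (-(V q * g q) + cc lam * g q) * adj K Φ q) =
        fun q => (a q * g q) * adj K Φ q := by ext q; simp only [ha]; ring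
    rw [this, integral_mul_adj hat hKi hΦ]
    rfl
  have i₁' : Integrable fun p => a p * g₁ p := ba.integrable_mul i₁
  set c := cvl K (fun p => a p * g₁ p) with hc
  set d := cvl K (fun p => a p * g₂ p) with hd
  have bd : BM d := bm_cvl hKm hKi (ba.mul b₂)
  have hsplit : (cvl K fun p => a p * g p) =ᵐ[volume] fun r => c r + d r := by
    have hp := (i₁'.convolution_integrand (ContinuousLinearMap.mul ℝ ℂ) hKi (μ := volume)
      (ν := volume)).prod_right_ae
    filter_upwards [hp] with r hr
    have h2r : Integrable fun q => a q * g₂ q * K (r - q) :=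
      (ba.mul b₂).integrable_mul (hKi.comp_sub_left r)
    rw [hc, hd]
    simp only [cvl, hg, mul_add, add_mul]
    exact integral_add hr h2r
  have hgcd := hrep.trans hsplit
  obtain ⟨C₁, hC₁⟩ := cvl_cvl_bound (h := fun p => a p * g₁ p) hKm (integrable_heatKer_sq lam) ba
    (ba.meas.mul m₁) i₁'
  rw [← hc] at hC₁
  obtain ⟨C₂, hC₂⟩ := (bm_cvl hKm hKi (ba.mul bd)).bdd
  -- Inserting the representation into itself once: the integrable part of g passes through two heat
  -- kernels and becomes bounded by `cvl_cvl_bound`, while the bounded part was bounded after the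
  -- first.
  have hbound : ∀ r, ‖cvl K (fun p => a p * g p) r‖ ≤ C₁ + C₂ := by
    intro r
    have e : cvl K (fun p => a p * g p) r = (∫ q, a q * c q * K (r - q)) +
        cvl K (fun p => a p * d p) r := by
      rw [cvl, cvl, ← integral_add (hC₁ r).1 ((ba.mul bd).integrable_mul (hKi.comp_sub_left r))]
      refine integral_congr_ae ?_
      filter_upwards [hgcd] with q hq
      simp only [hq]; ring
    rw [e]
    exact (norm_add_le _ _).trans (add_le_add (hC₁ r).2 (hC₂ r))
  set S : Set (ℝ × ℝ) := {p | ‖g p‖ ≤ C₁ + C₂} with hS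
  have hSm : MeasurableSet S := measurableSet_le hgm.norm measurable_const
  have hC0 : 0 ≤ C₁ + C₂ := (norm_nonneg _).trans (hbound 0)
  refine ⟨S.indicator g, ⟨hgm.indicator hSm, C₁ + C₂, fun p => ?_⟩, ?_, ?_⟩
  · by_cases hp : p ∈ S
    · rw [Set.indicator_of_mem hp]; exact hp
    · rw [Set.indicator_of_notMem hp, norm_zero]; exact hC0
  · refine squeeze_zero_norm (a := fun p => ‖g p‖) (fun p => ?_) (by simpa using hgv.norm)
    exact norm_indicator_le_norm_self _ _
  · filter_upwards [hwg, hrep] with p h1 h2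
    have : p ∈ S := by
      change ‖g p‖ ≤ _
      rw [h2]; exact hbound p
    rw [h1, Set.indicator_of_mem this]

end

/-! ### The Dirichlet integral -/

lemma integral_exp_neg_mul_Ioi {t : ℝ} (ht : 0 < t) :
    IntegrableOn (fun s => Real.exp (-(t * s))) (Set.Ioi 0) ∧
    ∫ s in Set.Ioi 0, Real.exp (-(t * s)) = t⁻¹ := by
  have e : ∀ s, Real.exp (-(t * s)) = Real.exp (-t * s) := fun s => by ring_nf
  simp only [e]
  refine ⟨integrableOn_exp_mul_Ioi (neg_lt_zero.2 ht) 0, ?_⟩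
  rw [integral_exp_mul_Ioi (neg_lt_zero.2 ht)]
  simp [neg_div_neg_eq]

lemma integral_sin_mul_exp (s A : ℝ) : ∫ t in (0 : ℝ)..A, Real.sin t * Real.exp (-(t * s)) =
    (1 + s ^ 2)⁻¹ - Real.exp (-(A * s)) * (Real.cos A + s * Real.sin A) * (1 + s ^ 2)⁻¹ := by
  have hs : (1 + s ^ 2) ≠ 0 := by positivity
  have hd : ∀ t ∈ Set.uIcc 0 A, HasDerivAt
      (fun t => -(Real.exp (-(t * s)) * (Real.cos t + s * Real.sin t) * (1 + s ^ 2)⁻¹))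
      (Real.sin t * Real.exp (-(t * s))) t := by
    intro t _
    have h1 : HasDerivAt (fun t => Real.exp (-(t * s))) (Real.exp (-(t * s)) * -(1 * s)) t :=
      ((hasDerivAt_id t).mul_const s).neg.exp
    have h2 : HasDerivAt (fun t => Real.cos t + s * Real.sin t) (-Real.sin t + s * Real.cos t) t :=
      (Real.hasDerivAt_cos t).add ((Real.hasDerivAt_sin t).const_mul s)
    refine ((h1.mul h2).mul_const _).neg.congr_deriv ?_
    field_simp
    ring
  rw [intervalIntegral.integral_eq_sub_of_hasDerivAt hd
    (Continuous.intervalIntegrable (by fun_prop) _ _)]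
  simp
  ring

/-- The sine integral approaches `π / 2` at the rate `1 / A`. -/
lemma abs_integral_sinc_sub_le {A : ℝ} (hA : 0 < A) :
    |(∫ t in Set.Ioo 0 A, Real.sin t / t) - Real.pi / 2| ≤ 2 / A := by
  have hmeas : Measurable (Function.uncurry fun t s : ℝ => Real.sin t * Real.exp (-(t * s))) := by
    unfold Function.uncurry; fun_prop
  have hprod : Integrable (Function.uncurry fun t s : ℝ => Real.sin t * Real.exp (-(t * s)))
      ((volume.restrict (Set.Ioo 0 A)).prod (volume.restrict (Set.Ioi 0))) := by
    rw [integrable_prod_iff hmeas.aestronglyMeasurable]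
    constructor
    · filter_upwards [ae_restrict_mem measurableSet_Ioo] with t ht
      exact (integral_exp_neg_mul_Ioi ht.1).1.const_mul (Real.sin t)
    · have hle : IntegrableOn (fun _ : ℝ => (1 : ℝ)) (Set.Ioo 0 A) := integrableOn_const (by simp)
      refine Integrable.mono' hle
        (hmeas.norm.stronglyMeasurable.integral_prod_right' (ν := volume.restrict (Set.Ioi 0))
          ).aestronglyMeasurable ?_
      filter_upwards [ae_restrict_mem measurableSet_Ioo] with t ht
      simp only [Function.uncurry, norm_mul, Real.norm_eq_abs, Real.abs_exp]
      rw [integral_const_mul, (integral_exp_neg_mul_Ioi ht.1).2, abs_mul, abs_abs, abs_inv,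
        abs_of_pos ht.1, mul_inv_le_iff₀ ht.1, one_mul]
      exact Real.abs_sin_le_abs.trans (abs_of_pos ht.1).le
  -- Writing 1/t as the Laplace integral of e^{-ts}, the t-integral becomes elementary. Its limiting
  -- term integrates to π/2, and the remainder carries e^{-As}.
  have h1 : ∫ t in Set.Ioo 0 A, Real.sin t / t =
      ∫ t in Set.Ioo 0 A, ∫ s in Set.Ioi 0, Real.sin t * Real.exp (-(t * s)) := by
    refine setIntegral_congr_fun measurableSet_Ioo fun t ht => ?_
    rw [integral_const_mul, (integral_exp_neg_mul_Ioi ht.1).2, div_eq_mul_inv]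
  have h2 : ∀ s : ℝ, ∫ t in Set.Ioo 0 A, Real.sin t * Real.exp (-(t * s)) = (1 + s ^ 2)⁻¹ -
      Real.exp (-(A * s)) * (Real.cos A + s * Real.sin A) * (1 + s ^ 2)⁻¹ := by
    intro s
    rw [← integral_sin_mul_exp, intervalIntegral.integral_of_le hA.le, integral_Ioc_eq_integral_Ioo]
  rw [h1, integral_integral_swap hprod]
  simp only [h2]
  have hbd : ∀ s ∈ Set.Ioi (0 : ℝ),
      ‖Real.exp (-(A * s)) * (Real.cos A + s * Real.sin A) * (1 + s ^ 2)⁻¹‖ ≤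
        Real.exp (-(A * s)) * 2 := by
    intro s hs
    have hs0 : 0 < s := hs
    rw [norm_mul, norm_mul, Real.norm_eq_abs, Real.abs_exp, mul_assoc]
    refine mul_le_mul_of_nonneg_left ?_ (Real.exp_nonneg _)
    rw [norm_inv, Real.norm_of_nonneg (by positivity : 0 ≤ 1 + s ^ 2), mul_inv_le_iff₀ (by positivity),
      Real.norm_eq_abs]
    calc |Real.cos A + s * Real.sin A| ≤ |Real.cos A| + |s * Real.sin A| := abs_add_le _ _
      _ ≤ 1 + s * 1 := by
          rw [abs_mul, abs_of_pos hs0]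
          gcongr
          · exact Real.abs_cos_le_one A
          · exact Real.abs_sin_le_one A
      _ ≤ 2 * (1 + s ^ 2) := by nlinarith [sq_nonneg (s - 1)]
  obtain ⟨i1, i2⟩ := integral_exp_neg_mul_Ioi hA
  have hint : IntegrableOn (fun s => Real.exp (-(A * s)) * (Real.cos A + s * Real.sin A) *
      (1 + s ^ 2)⁻¹) (Set.Ioi 0) := by
    refine Integrable.mono' (i1.mul_const 2) (by fun_prop) ?_
    filter_upwards [ae_restrict_mem measurableSet_Ioi] with s hs using hbd s hs
  rw [integral_sub integrable_inv_one_add_sq.integrableOn hint, integral_Ioi_inv_one_add_sq,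
    Real.arctan_zero, sub_zero, sub_sub_cancel_left, abs_neg, ← Real.norm_eq_abs]
  refine (norm_integral_le_of_norm_le (i1.mul_const 2)
    ((ae_restrict_mem measurableSet_Ioi).mono hbd)).trans (le_of_eq ?_)
  rw [integral_mul_const, i2]; field_simp

/-! ### Decay of the spectral integrals -/

lemma van_of_forall {f : ℝ × ℝ → ℂ}
    (h : ∀ ε, 0 < ε → ∃ N, ∀ Z Y, N ≤ |Z| ∨ N ≤ |Y| → ‖f (Z, Y)‖ ≤ ε) : Van f := by
  unfold Van
  rw [tendsto_zero_iff_norm_tendsto_zero, Metric.tendsto_nhds]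
  intro ε hε
  obtain ⟨N, hN⟩ := h (ε / 2) (by positivity)
  have h1 : ∀ᶠ p in cocompact (ℝ × ℝ), N ≤ ‖p‖ := by
    rw [← Metric.cobounded_eq_cocompact, ← comap_norm_atTop, eventually_comap]
    filter_upwards [eventually_ge_atTop N] with a ha p hp
    rwa [hp]
  filter_upwards [h1] with p hp
  rw [dist_zero_right, norm_norm]
  have h2 : N ≤ |p.1| ∨ N ≤ |p.2| := by
    rw [Prod.norm_def] at hp
    exact le_max_iff.1 hp
  exact (hN p.1 p.2 h2).trans_lt (by linarith)

lemma van_of_bounds {f : ℝ × ℝ → ℂ} {C : ℝ} (hZ : ∀ Z Y, Z ≠ 0 → ‖f (Z, Y)‖ ≤ C / |Z|)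
    (hY : ∀ Z Y, Y ≠ 0 → ‖f (Z, Y)‖ ≤ C * |Y| ^ (-(1 / 2) : ℝ)) : Van f := by
  refine van_of_forall fun ε hε => ?_
  have t1 : Tendsto (fun a : ℝ => C / a) atTop (𝓝 0) := tendsto_const_nhds.div_atTop tendsto_id
  have t2 : Tendsto (fun a : ℝ => C * a ^ (-(1 / 2) : ℝ)) atTop (𝓝 0) := by
    simpa using (tendsto_rpow_neg_atTop (y := 1 / 2) (by norm_num)).const_mul C
  obtain ⟨N1, h1⟩ := eventually_atTop.1 (t1.eventually_lt_const hε)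
  obtain ⟨N2, h2⟩ := eventually_atTop.1 (t2.eventually_lt_const hε)
  refine ⟨max 1 (max N1 N2), fun Z Y h => ?_⟩
  rcases h with h | h
  · have hpos : 0 < |Z| := zero_lt_one.trans_le ((le_max_left _ _).trans h)
    exact (hZ Z Y (abs_pos.1 hpos)).trans
      (h1 _ (((le_max_left _ _).trans (le_max_right _ _)).trans h)).le
  · have hpos : 0 < |Y| := zero_lt_one.trans_le ((le_max_left _ _).trans h)
    exact (hY Z Y (abs_pos.1 hpos)).trans
      (h2 _ (((le_max_right _ _).trans (le_max_right _ _)).trans h)).le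

lemma measurable_osc (r : ℝ) {φ : ℝ → ℝ → ℂ} (hφ : Measurable (Function.uncurry φ)) :
    Measurable fun p : ℝ × ℝ => osc r p.2 (φ p.1) := by
  have e : (fun p : ℝ × ℝ => osc r p.2 (φ p.1)) = fun p => (SignType.sign p.2 : ℂ) *
      ∫ t, Set.indicator (reg r p.2) (fun t => (wt r p.2 t : ℂ) * φ p.1 t) t := by
    ext p; rw [osc, integral_indicator (measurableSet_reg r p.2)]
  rw [e]
  have hsign : Measurable fun p : ℝ × ℝ => ((SignType.sign p.2 : SignType) : ℂ) := by
    have : (fun p : ℝ × ℝ => ((SignType.sign p.2 : SignType) : ℂ)) =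
        fun p => if 0 < p.2 then 1 else if p.2 < 0 then -1 else 0 := by
      ext p
      rcases lt_trichotomy p.2 0 with h | h | h
      · simp [h, h.not_gt]
      · simp [h]
      · simp [h]
    rw [this]
    exact Measurable.ite (measurableSet_lt measurable_const measurable_snd) measurable_const
      (Measurable.ite (measurableSet_lt measurable_snd measurable_const) measurable_const
        measurable_const)
  refine hsign.mul ?_
  have hset : MeasurableSet {z : (ℝ × ℝ) × ℝ | z.2 ∈ reg r z.1.2} := by
    have : {z : (ℝ × ℝ) × ℝ | z.2 ∈ reg r z.1.2} =
        ({z | 0 < z.1.2} ∩ {z | r < z.2}) ∪ ({z | 0 < z.1.2}ᶜ ∩ {z | 0 < z.2 ∧ z.2 < r}) := by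
      ext z
      by_cases h : 0 < z.1.2 <;> simp [reg, h]
    rw [this]
    have m1 : MeasurableSet {z : (ℝ × ℝ) × ℝ | 0 < z.1.2} :=
      measurableSet_lt measurable_const (by fun_prop)
    exact (m1.inter (measurableSet_lt measurable_const measurable_snd)).union
      (m1.compl.inter ((measurableSet_lt measurable_const measurable_snd).inter
        (measurableSet_lt measurable_snd measurable_const)))
  have hm : Measurable fun z : (ℝ × ℝ) × ℝ => (wt r z.1.2 z.2 : ℂ) * φ z.1.1 z.2 := by
    refine Measurable.mul ?_ (hφ.comp (by fun_prop : Measurable fun z : (ℝ × ℝ) × ℝ => (z.1.1, z.2)))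
    unfold wt; fun_prop
  have := (hm.indicator hset).stronglyMeasurable.integral_prod_right' (ν := volume)
  exact this.measurable

section

variable {r : ℝ} {m : ℝ}

lemma van_osc_cos (hr : 0 ≤ r) :
    Van fun p => osc r p.2 fun t => (Real.cos (t * p.1) : ℂ) := by
  refine van_of_bounds (C := 2) (fun Z Y hZ => ?_) fun Z Y hY => ?_
  · exact norm_osc_le hr (by fun_prop) (by positivity) fun a b _ hab => norm_integral_cos_le hZ hab
  · refine (norm_osc_le_mass hr (C := 1) fun t _ => ?_).trans ?_
    · rw [Complex.norm_real]; exact Real.abs_cos_le_one _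
    · rw [one_mul]; exact integral_wt_le hr hY

lemma norm_evenM_le (hm : m ≠ 0) (Z t : ℝ) : ‖evenM m Z t‖ ≤ |m|⁻¹ := by
  have hm' := abs_pos.2 hm
  rw [evenM, Complex.norm_real, norm_div, norm_mul, Real.norm_eq_abs, Real.norm_eq_abs,
    Real.norm_of_nonneg (by positivity : 0 ≤ t ^ 2 + m ^ 2), div_le_iff₀ (by positivity),
    ← sq_abs m, mul_add, sq |m|, inv_mul_cancel_left₀ hm'.ne']
  have := mul_le_of_le_one_right hm'.le (Real.abs_cos_le_one (t * Z))
  have h2 : 0 ≤ |m|⁻¹ * t ^ 2 := by positivity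
  linarith

lemma norm_oddM_le (hm : m ≠ 0) {t : ℝ} (Z : ℝ) : ‖oddM m Z t‖ ≤ |m|⁻¹ := by
  have hm' := abs_pos.2 hm
  rw [oddM, Complex.norm_real, norm_div, norm_mul, Real.norm_eq_abs, Real.norm_eq_abs,
    Real.norm_of_nonneg (by positivity : 0 ≤ t ^ 2 + m ^ 2), div_le_iff₀ (by positivity)]
  have h1 := mul_le_of_le_one_right (abs_nonneg t) (Real.abs_sin_le_one (t * Z))
  refine h1.trans ?_
  rw [le_inv_mul_iff₀ hm', ← sq_abs m, ← sq_abs t]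
  nlinarith [sq_nonneg (|t| - |m|), sq_nonneg |t|, sq_nonneg |m|]

lemma norm_oddM_le_abs {t : ℝ} (ht : 0 < t) (Z : ℝ) : ‖oddM m Z t‖ ≤ |Z| := by
  rw [oddM, Complex.norm_real, norm_div, norm_mul, Real.norm_eq_abs, Real.norm_eq_abs, abs_of_pos ht,
    Real.norm_of_nonneg (by positivity : 0 ≤ t ^ 2 + m ^ 2), div_le_iff₀ (by positivity)]
  have h1 : |Real.sin (t * Z)| ≤ t * |Z| := by
    refine Real.abs_sin_le_abs.trans (le_of_eq ?_)
    rw [abs_mul, abs_of_pos ht]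
  have h2 := abs_nonneg Z
  nlinarith [mul_nonneg h2 (sq_nonneg m), mul_le_mul_of_nonneg_left h1 ht.le]

lemma measurable_evenM_apply (m Z : ℝ) : Measurable (evenM m Z) := by unfold evenM; fun_prop

lemma measurable_oddM_apply (m Z : ℝ) : Measurable (oddM m Z) := by unfold oddM; fun_prop

lemma measurable_evenM : Measurable (Function.uncurry (evenM m)) := by
  unfold evenM Function.uncurry; fun_prop

lemma measurable_oddM : Measurable (Function.uncurry (oddM m)) := by
  unfold oddM Function.uncurry; fun_prop

lemma van_osc_evenM (hr : 0 ≤ r) (hm : m ≠ 0) : Van fun p => osc r p.2 (evenM m p.1) := by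
  have hm' := abs_pos.2 hm
  refine van_of_bounds (C := 2 * |m|⁻¹) (fun Z Y hZ => ?_) fun Z Y hY => ?_
  · refine norm_osc_le hr (measurable_evenM_apply m Z)
      (by positivity) fun a b ha hab => ?_
    have e : ∀ t : ℝ, evenM m Z t = ((m / |m| : ℝ) : ℂ) *
        (((|m| / (t ^ 2 + m ^ 2) : ℝ) : ℂ) * (Real.cos (t * Z) : ℝ)) := by
      intro t
      have : 0 < t ^ 2 + m ^ 2 := by positivity
      rw [evenM, ← Complex.ofReal_mul, ← Complex.ofReal_mul]
      congr 1
      field_simp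
    simp only [e]
    rw [integral_const_mul, norm_mul]
    have hsgn : ‖((m / |m| : ℝ) : ℂ)‖ ≤ 1 := by
      rw [Complex.norm_real, norm_div, Real.norm_eq_abs, Real.norm_eq_abs, abs_abs,
        div_self hm'.ne']
    refine (mul_le_of_le_one_left (norm_nonneg _) hsgn).trans ?_
    refine (norm_integral_weight_le (I := Set.Ioo a b) (h := fun t => |m| / (t ^ 2 + m ^ 2))
      (φ := fun t : ℝ => (Real.cos (t * Z) : ℂ)) (H := |m|⁻¹) (M := 2 / |Z|) Set.ordConnected_Ioo
      (Or.inr ?_) (by fun_prop) (by fun_prop) (fun t _ => by positivity) (fun t _ => ?_)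
      (by positivity) (fun c _ => (Metric.isBounded_Ioo a b).subset fun t ht => ht.1)
      (by positivity) fun c d hcd _ => norm_integral_cos_le hZ hcd).trans (le_of_eq (by ring))
    · intro s hs t ht hst
      have h0 : 0 < s := ha.trans_lt hs.1
      simp only; gcongr
    · rw [div_le_iff₀ (by positivity), ← sq_abs m, mul_add, sq |m|, inv_mul_cancel_left₀ hm'.ne']
      have h2 : 0 ≤ |m|⁻¹ * t ^ 2 := by positivity
      linarith
  · refine (norm_osc_le_mass hr (C := |m|⁻¹) fun t _ => norm_evenM_le hm Z t).trans ?_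
    calc |m|⁻¹ * _ ≤ |m|⁻¹ * (2 * |Y| ^ (-(1 / 2) : ℝ)) :=
          mul_le_mul_of_nonneg_left (integral_wt_le hr hY) (by positivity)
      _ = _ := by ring

/-- The multiplier t/(t² + m²) increases up to |m| and decreases afterwards, with values at most
1/|m|. Abel's inequality on the two pieces gives decay in Z, and the mass of the weight gives decay
in Y. The case m = 0 behaves differently and is treated below. -/
lemma van_osc_oddM (hr : 0 ≤ r) (hm : m ≠ 0) : Van fun p => osc r p.2 (oddM m p.1) := by
  have hm' := abs_pos.2 hm
  refine van_of_bounds (C := 4 * |m|⁻¹) (fun Z Y hZ => ?_) fun Z Y hY => ?_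
  · have hmeas := measurable_oddM_apply m Z
    refine norm_osc_le hr hmeas (by positivity) fun a b ha hab => ?_
    have hi : IntegrableOn (oddM m Z) (Set.Ioo a b) := by
      refine Integrable.mono' (g := fun _ => |Z|) (by simp) hmeas.aestronglyMeasurable ?_
      filter_upwards [ae_restrict_mem measurableSet_Ioo] with t ht
      exact norm_oddM_le_abs (ha.trans_lt ht.1) Z
    have e : ∀ t : ℝ, oddM m Z t = ((t / (t ^ 2 + m ^ 2) : ℝ) : ℂ) * Real.sin (t * Z) := by
      intro t; rw [oddM]; push_cast; ring
    have hH : ∀ t, 0 < t → t / (t ^ 2 + m ^ 2) ≤ |m|⁻¹ := by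
      intro t ht
      rw [div_le_iff₀ (by positivity), le_inv_mul_iff₀ hm', ← sq_abs m]
      nlinarith [sq_nonneg (t - |m|), sq_nonneg t, sq_nonneg |m|]
    have hb : ∀ J : Set ℝ, J ⊆ Set.Ioo a b → J.OrdConnected →
        (MonotoneOn (fun t => t / (t ^ 2 + m ^ 2)) J ∨
          AntitoneOn (fun t => t / (t ^ 2 + m ^ 2)) J) →
        ‖∫ t in J, oddM m Z t‖ ≤ |m|⁻¹ * (2 / |Z|) := by
      intro J hJ hJc hmono
      simp only [e]
      exact norm_integral_weight_le (h := fun t => t / (t ^ 2 + m ^ 2))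
        (φ := fun t : ℝ => (Real.sin (t * Z) : ℂ)) hJc hmono (by fun_prop) (by fun_prop)
        (fun t ht => by have := ha.trans_lt (hJ ht).1; positivity)
        (fun t ht => hH t (ha.trans_lt (hJ ht).1)) (by positivity)
        (fun c _ => (Metric.isBounded_Ioo a b).subset fun t ht => hJ ht.1) (by positivity)
        fun c d hcd _ => norm_integral_sin_le hZ hcd
    have hmon : ∀ s t : ℝ, 0 < s → s ≤ t → (t / (t ^ 2 + m ^ 2) - s / (s ^ 2 + m ^ 2)) =
        (t - s) * (m ^ 2 - s * t) / ((t ^ 2 + m ^ 2) * (s ^ 2 + m ^ 2)) := by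
      intro s t hs hst
      have : 0 < t := hs.trans_le hst
      field_simp; ring
    rw [← integral_inter_add_sdiff (s := Set.Ioo a b) (t := Set.Iio |m|) measurableSet_Iio hi]
    refine (norm_add_le _ _).trans ((add_le_add (hb _ Set.inter_subset_left
      (Set.ordConnected_Ioo.inter Set.ordConnected_Iio) (Or.inl ?_)) (hb _ Set.sdiff_subset ?_
      (Or.inr ?_))).trans (le_of_eq (by ring)))
    · intro s hs t ht hst
      have h0 : 0 < s := ha.trans_lt hs.1.1
      have h1 : s < |m| := hs.2
      have h2 : t < |m| := ht.2
      simp only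
      rw [← sub_nonneg, hmon s t h0 hst]
      refine div_nonneg (mul_nonneg (sub_nonneg.2 hst) ?_) (by positivity)
      rw [← sq_abs]; nlinarith
    · rw [Set.sdiff_eq, Set.compl_Iio]; exact Set.ordConnected_Ioo.inter Set.ordConnected_Ici
    · intro s hs t ht hst
      have h0 : 0 < s := ha.trans_lt hs.1.1
      have h1 : |m| ≤ s := not_lt.1 hs.2
      simp only
      rw [← sub_nonpos, hmon s t h0 hst]
      refine div_nonpos_of_nonpos_of_nonneg
        (mul_nonpos_of_nonneg_of_nonpos (sub_nonneg.2 hst) ?_) (by positivity)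
      rw [← sq_abs]; nlinarith
  · refine (norm_osc_le_mass hr (C := |m|⁻¹) fun t _ => norm_oddM_le hm Z).trans ?_
    calc |m|⁻¹ * _ ≤ |m|⁻¹ * (2 * |Y| ^ (-(1 / 2) : ℝ)) :=
          mul_le_mul_of_nonneg_left (integral_wt_le hr hY) (by positivity)
      _ ≤ _ := by
          have : 0 ≤ |m|⁻¹ * |Y| ^ (-(1 / 2) : ℝ) := by positivity
          linarith

end

/-! ### The spectral integral with a pole on the real axis -/

section

variable {r : ℝ}

lemma oddM_zero {t : ℝ} (ht : t ≠ 0) (Z : ℝ) : oddM 0 Z t = (Real.sin (t * Z) / t : ℝ) := by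
  rw [oddM]; congr 1; field_simp; simp [mul_comm]

/-- Bernoulli's inequality with exponent (t/s)² gives e^{ct²} - 1 ≥ (t/s)²(e^{cs²} - 1), one power
of t/s more than needed. It supplies the monotone weight for Abel's inequality once the residue has
been split off. -/
lemma exp_sub_one_div_mono {c s t : ℝ} (hc : 0 ≤ c) (hs : 0 < s) (hst : s ≤ t) :
    (Real.exp (c * s ^ 2) - 1) / s ≤ (Real.exp (c * t ^ 2) - 1) / t := by
  have ht := hs.trans_le hst
  have h1 : 1 ≤ t / s := (one_le_div hs).2 hst
  have ha : 0 ≤ Real.exp (c * s ^ 2) - 1 := sub_nonneg.2 (Real.one_le_exp (by positivity))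
  have hb := one_add_mul_self_le_rpow_one_add (s := Real.exp (c * s ^ 2) - 1) (by linarith)
    (p := (t / s) ^ 2) (by nlinarith)
  rw [add_sub_cancel, ← Real.exp_mul, show c * s ^ 2 * (t / s) ^ 2 = c * t ^ 2 by field_simp] at hb
  rw [div_le_div_iff₀ hs ht]
  have h2 : t / s * (Real.exp (c * s ^ 2) - 1) ≤ Real.exp (c * t ^ 2) - 1 := by
    have := mul_le_mul_of_nonneg_right (show t / s ≤ (t / s) ^ 2 by nlinarith) ha
    linarith
  have h3 := mul_le_mul_of_nonneg_right h2 hs.le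
  have h4 : t / s * (Real.exp (c * s ^ 2) - 1) * s = (Real.exp (c * s ^ 2) - 1) * t := by field_simp
  linarith

/-- For Y > 0 the range t > r stays away from the pole, so the weight divided by t is decreasing and
at most 1/r. -/
lemma norm_osc_oddM_zero_le_of_pos (hr : 0 < r) {Z Y : ℝ} (hY : 0 < Y) (hZ : Z ≠ 0) :
    ‖osc r Y (oddM 0 Z)‖ ≤ 2 / (r * |Z|) := by
  have hreg : reg r Y = Set.Ioi r := if_pos hY
  rw [osc, sign_pos hY, hreg, SignType.coe_one, one_mul]
  have e : ∫ t in Set.Ioi r, (wt r Y t : ℂ) * oddM 0 Z t =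
      ∫ t in Set.Ioi r, ((wt r Y t * t⁻¹ : ℝ) : ℂ) * (Real.sin (t * Z) : ℝ) := by
    refine setIntegral_congr_fun measurableSet_Ioi fun t ht => ?_
    rw [oddM_zero (hr.trans ht).ne']; push_cast; ring
  rw [e]
  have hanti : AntitoneOn (fun t => wt r Y t * t⁻¹) (Set.Ioi r) := by
    intro s hs t ht hst
    have h0 : 0 < s := hr.trans hs
    have h1 : wt r Y t ≤ wt r Y s := by
      unfold wt
      refine Real.exp_le_exp.2 (neg_le_neg ?_)
      gcongr
    exact mul_le_mul h1 (inv_anti₀ h0 hst) (inv_nonneg.2 (h0.trans_le hst).le) (wt_pos _ _ _).le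
  have hone : ∀ t ∈ Set.Ioi r, wt r Y t ≤ 1 := fun t ht => wt_le_one hr.le (hreg ▸ ht)
  refine (norm_integral_weight_le (I := Set.Ioi r) (h := fun t => wt r Y t * t⁻¹)
    (φ := fun t : ℝ => ((Real.sin (t * Z) : ℝ) : ℂ)) (H := r⁻¹) (M := 2 / |Z|) Set.ordConnected_Ioi
    (Or.inr hanti) (by unfold wt; fun_prop) (by fun_prop) (fun t ht => ?_) (fun t ht => ?_)
    (by positivity) (fun c hc => ?_) (by positivity)
    fun a b hab _ => norm_integral_sin_le hZ hab).trans (le_of_eq (by field_simp))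
  · exact mul_nonneg (wt_pos _ _ _).le (inv_nonneg.2 (hr.trans ht).le)
  · have h2 : t⁻¹ ≤ r⁻¹ := inv_anti₀ hr (le_of_lt ht)
    calc wt r Y t * t⁻¹ ≤ 1 * r⁻¹ :=
          mul_le_mul (hone t ht) h2 (inv_nonneg.2 (hr.trans ht).le) zero_le_one
      _ = r⁻¹ := one_mul _
  · refine (Metric.isBounded_Icc 0 c⁻¹).subset fun t ht => ?_
    have h0 : 0 < t := hr.trans ht.1
    refine ⟨h0.le, ?_⟩
    rw [le_inv_comm₀ h0 hc]
    have h3 := ht.2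
    have h4 := mul_le_of_le_one_left (inv_nonneg.2 h0.le) (hone t ht.1)
    exact (lt_of_lt_of_le h3 h4).le

/-- The range is split at r/2. Below it the weight is at most e^{-3r²|Y|/4}, increasing, and meets
the uniform bound 6. Above it 1/t ≤ 2/r and the mass of the weight is at most 1/(r|Y|). The
constants add up to 8 + 2. -/
lemma norm_osc_oddM_zero_le_of_neg (hr : 0 < r) {Z Y : ℝ} (hY : Y < 0) :
    ‖osc r Y (oddM 0 Z)‖ ≤ 10 / (r ^ 2 * |Y|) := by
  have hreg : reg r Y = Set.Ioo 0 r := if_neg hY.not_gt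
  have hY' : 0 < |Y| := abs_pos.2 hY.ne
  have hm := measurable_oddM_apply 0 Z
  rw [osc, norm_mul]
  refine (mul_le_of_le_one_left (norm_nonneg _) (norm_sign_le Y)).trans ?_
  have hone : ∀ t ∈ Set.Ioo 0 r, wt r Y t ≤ 1 := fun t ht => wt_le_one hr.le (hreg ▸ ht)
  have hi : IntegrableOn (fun t => (wt r Y t : ℂ) * oddM 0 Z t) (Set.Ioo 0 r) := by
    refine Integrable.mono' (g := fun _ => |Z|) (by simp) (by unfold wt; fun_prop) ?_
    filter_upwards [ae_restrict_mem measurableSet_Ioo] with t ht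
    rw [norm_mul, Complex.norm_real, Real.norm_of_nonneg (wt_pos _ _ _).le]
    exact (mul_le_of_le_one_left (norm_nonneg _) (hone t ht)).trans (norm_oddM_le_abs ht.1 Z)
  rw [hreg, ← integral_inter_add_sdiff (s := Set.Ioo 0 r) (t := Set.Iio (r / 2)) measurableSet_Iio hi]
  have b1 : ‖∫ t in Set.Ioo 0 r ∩ Set.Iio (r / 2), (wt r Y t : ℂ) * oddM 0 Z t‖ ≤
      8 / (r ^ 2 * |Y|) := by
    have hx : 0 < 3 / 4 * (r ^ 2 * |Y|) := by positivity
    refine (norm_integral_weight_le (I := Set.Ioo 0 r ∩ Set.Iio (r / 2)) (h := wt r Y)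
      (φ := oddM 0 Z) (H := Real.exp (-(3 / 4 * (r ^ 2 * |Y|)))) (M := 6)
      (Set.ordConnected_Ioo.inter Set.ordConnected_Iio) (Or.inl fun s hs t ht hst => ?_)
      (by unfold wt; fun_prop) hm (fun t _ => (wt_pos _ _ _).le) (fun t ht => ?_)
      (Real.exp_nonneg _) (fun c _ => (Metric.isBounded_Ioo 0 r).subset fun t ht => ht.1.1)
      (by norm_num) fun a b hab hsub => ?_).trans ?_
    · have h0 : 0 < s := hs.1.1
      unfold wt
      refine Real.exp_le_exp.2 (neg_le_neg (mul_le_mul_of_nonpos_right ?_ hY.le))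
      gcongr
    · have h0 : 0 < t := ht.1.1
      have h1 : t < r / 2 := ht.2
      unfold wt
      refine Real.exp_le_exp.2 ?_
      rw [abs_of_neg hY]
      have : t ^ 2 ≤ (r / 2) ^ 2 := by gcongr
      nlinarith
    · rcases hab.eq_or_lt with rfl | hlt
      · simp
      · refine norm_integral_oddM_le 0 Z ?_
        by_contra hcon
        rw [not_le] at hcon
        obtain ⟨t, ht⟩ := exists_between (lt_min hlt hcon)
        exact (hsub ⟨ht.1, ht.2.trans_le (min_le_left _ _)⟩).1.1.not_gt
          (ht.2.trans_le (min_le_right _ _))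
    · have h3 : Real.exp (-(3 / 4 * (r ^ 2 * |Y|))) ≤ (3 / 4 * (r ^ 2 * |Y|))⁻¹ := by
        rw [Real.exp_neg]
        exact inv_anti₀ hx ((le_add_of_nonneg_right zero_le_one).trans (Real.add_one_le_exp _))
      calc _ ≤ (3 / 4 * (r ^ 2 * |Y|))⁻¹ * 6 := by gcongr
        _ = 8 / (r ^ 2 * |Y|) := by field_simp; norm_num
  have b2 : ‖∫ t in Set.Ioo 0 r \ Set.Iio (r / 2), (wt r Y t : ℂ) * oddM 0 Z t‖ ≤
      2 / (r ^ 2 * |Y|) := by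
    have hwi : IntegrableOn (wt r Y) (Set.Ioo 0 r) := hreg ▸ integrableOn_wt r Y
    have hw := integral_wt_le_inv hr hY.ne
    rw [hreg] at hw
    calc _ ≤ ∫ t in Set.Ioo 0 r \ Set.Iio (r / 2), 2 / r * wt r Y t := by
          refine norm_integral_le_of_norm_le ((hwi.mono_set Set.sdiff_subset).const_mul _) ?_
          filter_upwards [ae_restrict_mem (measurableSet_Ioo.diff measurableSet_Iio)] with t ht
          have h0 : 0 < t := ht.1.1
          have h1 : r / 2 ≤ t := not_lt.1 ht.2
          rw [norm_mul, Complex.norm_real, Real.norm_of_nonneg (wt_pos _ _ _).le, mul_comm,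
            oddM_zero h0.ne', Complex.norm_real, norm_div, Real.norm_eq_abs, Real.norm_of_nonneg h0.le]
          refine mul_le_mul_of_nonneg_right ?_ (wt_pos _ _ _).le
          rw [div_le_div_iff₀ h0 hr]
          have := mul_le_mul_of_nonneg_right (Real.abs_sin_le_one (t * Z)) hr.le
          linarith
      _ ≤ ∫ t in Set.Ioo 0 r, 2 / r * wt r Y t :=
          setIntegral_mono_set (hwi.const_mul _)
            (ae_of_all _ fun t => mul_nonneg (by positivity) (wt_pos _ _ _).le)
            (LE.le.eventuallyLE Set.sdiff_subset)
      _ ≤ 2 / r * (r * |Y|)⁻¹ := by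
          rw [integral_const_mul]; gcongr
      _ = 2 / (r ^ 2 * |Y|) := by field_simp
  refine (norm_add_le _ _).trans ((add_le_add b1 b2).trans (le_of_eq ?_))
  ring

lemma integral_sinc_scaled (hr : 0 < r) {A : ℝ} (hA : 0 < A) :
    ∫ t in Set.Ioo 0 r, Real.sin (t * A) / t = ∫ t in Set.Ioo 0 (r * A), Real.sin t / t := by
  have e : ∀ t : ℝ, Real.sin (t * A) / t = A * (Real.sin (t * A) / (t * A)) := by
    intro t
    rcases eq_or_ne t 0 with rfl | ht
    · simp
    · field_simp
  have h0 : 0 ≤ r * A := by positivity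
  simp only [e]
  rw [← integral_Ioc_eq_integral_Ioo, ← integral_Ioc_eq_integral_Ioo,
    ← intervalIntegral.integral_of_le hr.le, ← intervalIntegral.integral_of_le h0,
    intervalIntegral.integral_const_mul,
    intervalIntegral.integral_comp_mul_right (fun u => Real.sin u / u) hA.ne', smul_eq_mul,
    ← mul_assoc, mul_inv_cancel₀ hA.ne', one_mul, zero_mul]

/-- For Y < 0 the range reaches the pole at t = 0, where the weight has the value E = e^{r²Y}. The
part E sin(tZ)/t is a Dirichlet integral tending to Eπ/2 in absolute value, with a positive sign
because both sign Y and Z are negative. The rest has the increasing weight E(e^{|Y|t²} - 1)/t ≤ 1/r.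
Each error is at most 2/(r|Z|). -/
lemma norm_osc_oddM_zero_sub_le (hr : 0 < r) {Z Y : ℝ} (hY : Y < 0) (hZ : Z < 0) :
    ‖osc r Y (oddM 0 Z) - (Real.pi / 2 * Real.exp (r ^ 2 * Y) : ℝ)‖ ≤ 4 / (r * |Z|) := by
  have hreg : reg r Y = Set.Ioo 0 r := if_neg hY.not_gt
  set c := -Y with hc
  have hc0 : 0 < c := neg_pos.2 hY
  set A := -Z with hA
  have hA0 : 0 < A := neg_pos.2 hZ
  set E := Real.exp (r ^ 2 * Y) with hE
  have hE0 : 0 < E := Real.exp_pos _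
  have hE1 : E ≤ 1 := Real.exp_le_one_iff.2 (mul_nonpos_of_nonneg_of_nonpos (by positivity) hY.le)
  let h : ℝ → ℝ := fun t => E * ((Real.exp (c * t ^ 2) - 1) / t)
  have hmono : ∀ s t, 0 < s → s ≤ t → h s ≤ h t := fun s t hs hst =>
    mul_le_mul_of_nonneg_left (exp_sub_one_div_mono hc0.le hs hst) hE0.le
  have hh0 : ∀ t, 0 < t → 0 ≤ h t := fun t ht => mul_nonneg hE0.le
    (div_nonneg (sub_nonneg.2 (Real.one_le_exp (by positivity))) ht.le)
  have hhr : h r ≤ r⁻¹ := by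
    have : E * Real.exp (c * r ^ 2) = 1 := by
      rw [hE, ← Real.exp_add, hc]; ring_nf; exact Real.exp_zero
    calc h r = (E * Real.exp (c * r ^ 2) - E) / r := by simp only [h]; ring
      _ ≤ 1 / r := by rw [this]; gcongr; linarith
      _ = r⁻¹ := one_div r
  have hhm : Measurable h := by fun_prop
  have hb : ‖∫ t in Set.Ioo 0 r, (h t : ℂ) * (Real.sin (t * Z) : ℝ)‖ ≤ r⁻¹ * (2 / |Z|) :=
    norm_integral_weight_le (I := Set.Ioo 0 r) (h := h)
      (φ := fun t : ℝ => ((Real.sin (t * Z) : ℝ) : ℂ)) Set.ordConnected_Ioo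
      (Or.inl fun s hs t _ hst => hmono s t hs.1 hst) hhm (by fun_prop) (fun t ht => hh0 t ht.1)
      (fun t ht => (hmono t r ht.1 ht.2.le).trans hhr) (by positivity)
      (fun _ _ => (Metric.isBounded_Ioo 0 r).subset fun t ht => ht.1) (by positivity)
      fun a b hab _ => norm_integral_sin_le hZ.ne hab
  have hi1 : IntegrableOn (fun t => (h t : ℂ) * (Real.sin (t * Z) : ℝ)) (Set.Ioo 0 r) := by
    refine Integrable.mono' (g := fun _ => r⁻¹) (by simp) (by fun_prop) ?_
    filter_upwards [ae_restrict_mem measurableSet_Ioo] with t ht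
    rw [norm_mul, Complex.norm_real, Complex.norm_real, Real.norm_of_nonneg (hh0 t ht.1)]
    exact (mul_le_of_le_one_right (hh0 t ht.1) (Real.abs_sin_le_one _)).trans
      ((hmono t r ht.1 ht.2.le).trans hhr)
  have hi2 : IntegrableOn (fun t => ((E * -(Real.sin (t * A) / t) : ℝ) : ℂ)) (Set.Ioo 0 r) := by
    refine Integrable.mono' (g := fun _ => A) (by simp)
      (by fun_prop : Measurable fun t : ℝ =>
        ((E * -(Real.sin (t * A) / t) : ℝ) : ℂ)).aestronglyMeasurable ?_
    filter_upwards [ae_restrict_mem measurableSet_Ioo] with t ht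
    rw [Complex.norm_real, norm_mul, norm_neg, norm_div, Real.norm_of_nonneg hE0.le,
      Real.norm_of_nonneg ht.1.le, Real.norm_eq_abs]
    have h1 : |Real.sin (t * A)| / t ≤ A := by
      rw [div_le_iff₀ ht.1]
      refine Real.abs_sin_le_abs.trans (le_of_eq ?_)
      rw [abs_mul, abs_of_pos ht.1, abs_of_pos hA0, mul_comm]
    exact (mul_le_of_le_one_left (div_nonneg (abs_nonneg _) ht.1.le) hE1).trans h1
  have hS : ∫ t in Set.Ioo 0 r, (wt r Y t : ℂ) * oddM 0 Z t =
      (∫ t in Set.Ioo 0 r, (h t : ℂ) * (Real.sin (t * Z) : ℝ)) +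
      ((E * -(∫ t in Set.Ioo 0 r, Real.sin (t * A) / t) : ℝ) : ℂ) := by
    rw [← integral_neg, ← integral_const_mul, ← integral_complex_ofReal, ← integral_add hi1 hi2]
    refine setIntegral_congr_fun measurableSet_Ioo fun t ht => ?_
    have hw : wt r Y t = E * Real.exp (c * t ^ 2) := by
      rw [wt, hE, ← Real.exp_add]; congr 1; rw [hc]; ring
    have hsin : Real.sin (t * A) = -Real.sin (t * Z) := by rw [hA, mul_neg, Real.sin_neg]
    simp only [h]
    rw [oddM_zero ht.1.ne', hw, hsin, ← Complex.ofReal_mul, ← Complex.ofReal_mul, ← Complex.ofReal_add]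
    congr 1
    ring
  have hD := abs_integral_sinc_sub_le (show 0 < r * A by positivity)
  rw [← integral_sinc_scaled hr hA0] at hD
  rw [osc, hreg, sign_neg hY, SignType.coe_neg_one, hS]
  have hfin : (-1 : ℂ) * ((∫ t in Set.Ioo 0 r, (h t : ℂ) * (Real.sin (t * Z) : ℝ)) +
      ((E * -(∫ t in Set.Ioo 0 r, Real.sin (t * A) / t) : ℝ) : ℂ)) -
      ((Real.pi / 2 * E : ℝ) : ℂ) = -(∫ t in Set.Ioo 0 r, (h t : ℂ) * (Real.sin (t * Z) : ℝ)) +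
      ((E * ((∫ t in Set.Ioo 0 r, Real.sin (t * A) / t) - Real.pi / 2) : ℝ) : ℂ) := by
    push_cast; ring
  rw [hfin]
  refine (norm_add_le _ _).trans ?_
  rw [norm_neg, Complex.norm_real, norm_mul, Real.norm_of_nonneg hE0.le, Real.norm_eq_abs]
  have hZA : |Z| = A := by rw [abs_of_neg hZ]
  have h5 := mul_le_of_le_one_left (abs_nonneg ((∫ t in Set.Ioo 0 r, Real.sin (t * A) / t) - Real.pi / 2)) hE1
  rw [hZA] at hb ⊢
  calc _ ≤ r⁻¹ * (2 / A) + 2 / (r * A) := add_le_add hb (h5.trans hD)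
    _ = 4 / (r * A) := by field_simp; norm_num

end

/-! ### Fourier integrals with a simple pole -/

/-- The Fourier integral on the line. -/
def lineF (φ : ℝ → ℂ) (t : ℝ) : ℂ := ∫ x : ℝ, Complex.exp (-Complex.I * t * x) * φ x

/-- The contribution of the pole of the Green kernel on one side of the real axis. -/
def dc (m : ℝ) : ℝ := if 0 < m then 0 else if m < 0 then 1 else 1 / 2

/-- The value of the Fourier integral with a simple pole at `- i m`. -/
def poleL (m : ℝ) (φ : ℝ → ℂ) : ℂ := 2 * Real.pi * Complex.I *
  (dc m * (∫ x : ℝ, Real.exp (-m * x) * φ x) - ∫ x in Set.Ioi (0 : ℝ), Real.exp (-m * x) * φ x)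

section

variable {φ : ℝ → ℂ} {m : ℝ}

lemma integrable_exp_mul_test (hφ : ContDiff ℝ ∞ φ) (hs : HasCompactSupport φ) (m : ℝ) :
    Integrable fun x : ℝ => (Real.exp (-m * x) : ℂ) * φ x := by
  refine Continuous.integrable_of_hasCompactSupport ?_ hs.mul_left
  have := hφ.continuous
  fun_prop

/-- For m > 0, 1/(t + im) is -i times the integral of e^{i(t+im)x} over x > 0. Fubini and Fourier
inversion do the rest. -/
lemma pole_of_pos (hφ : ContDiff ℝ ∞ φ) (hs : HasCompactSupport φ) (hm : 0 < m) :
    ∫ t : ℝ, (t + Complex.I * m)⁻¹ * lineF φ t =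
      -(2 * Real.pi * Complex.I) * ∫ x in Set.Ioi (0 : ℝ), Real.exp (-m * x) * φ x := by
  obtain ⟨hF, hinv⟩ := fourier_line hφ hs
  have hre : ∀ t : ℝ, (Complex.I * t - m : ℂ).re < 0 := fun t => by simpa using hm
  have hlap : ∀ t : ℝ, ((t : ℂ) + Complex.I * m)⁻¹ =
      -Complex.I * ∫ x in Set.Ioi (0 : ℝ), Complex.exp ((Complex.I * t - m) * x) := by
    intro t
    have hne : (Complex.I * t - m : ℂ) ≠ 0 := fun h => by have := hre t; rw [h] at this; simp at this
    have hne2 : ((t : ℂ) + Complex.I * m) ≠ 0 := by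
      intro h
      apply hne
      linear_combination Complex.I * h - m * Complex.I_sq
    rw [integral_exp_mul_complex_Ioi (hre t)]
    simp only [Complex.ofReal_zero, mul_zero, Complex.exp_zero]
    have h1 : (Complex.I * t - m : ℂ) = Complex.I * (t + Complex.I * m) := by
      linear_combination (-m : ℂ) * Complex.I_sq
    rw [h1, neg_mul, neg_div, mul_neg, neg_neg, one_div, mul_inv, ← mul_assoc,
      mul_inv_cancel₀ Complex.I_ne_zero, one_mul]
  have hexp : Integrable (fun x : ℝ => (Real.exp (-m * x) : ℂ)) (volume.restrict (Set.Ioi 0)) :=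
    (integrableOn_exp_mul_Ioi (neg_lt_zero.2 hm) 0).ofReal
  have hprod : Integrable (Function.uncurry fun t x : ℝ =>
      lineF φ t * Complex.exp ((Complex.I * t - m) * x)) (volume.prod (volume.restrict (Set.Ioi 0))) := by
    have h1 := Integrable.mul_prod (f := lineF φ) hF hexp
    have h2 : Measurable fun z : ℝ × ℝ => Complex.exp (Complex.I * z.1 * z.2) := by fun_prop
    refine (Integrable.bdd_mul (c := 1) h1 h2.aestronglyMeasurable (ae_of_all _ fun z => ?_)).congr
      (ae_of_all _ fun z => ?_)
    · rw [norm_exp_I_mul]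
    · simp only [Function.uncurry]
      rw [mul_left_comm, Complex.ofReal_exp, ← Complex.exp_add]
      congr 2; push_cast; ring
  have e1 : ∀ t : ℝ, ((t : ℂ) + Complex.I * m)⁻¹ * lineF φ t = -Complex.I *
      ∫ x in Set.Ioi (0 : ℝ), lineF φ t * Complex.exp ((Complex.I * t - m) * x) := by
    intro t; rw [hlap, integral_const_mul]; ring
  simp only [e1]
  rw [integral_const_mul, integral_integral_swap hprod, ← integral_const_mul, ← integral_const_mul]
  refine setIntegral_congr_fun measurableSet_Ioi fun x _ => ?_
  have e2 : ∫ t : ℝ, lineF φ t * Complex.exp ((Complex.I * t - m) * x) =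
      Real.exp (-m * x) * (2 * Real.pi * φ x) := by
    rw [← hinv x, ← integral_const_mul]
    refine integral_congr_ae (ae_of_all _ fun t => ?_)
    simp only [lineF]
    rw [← mul_assoc, mul_comm (∫ x : ℝ, _), Complex.ofReal_exp, ← Complex.exp_add]
    congr 2; push_cast; ring
  simp only [e2]; ring

lemma pole_of_neg (hφ : ContDiff ℝ ∞ φ) (hs : HasCompactSupport φ) (hm : m < 0) :
    ∫ t : ℝ, (t + Complex.I * m)⁻¹ * lineF φ t =
      (2 * Real.pi * Complex.I) * ∫ x in Set.Iio (0 : ℝ), Real.exp (-m * x) * φ x := by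
  have h := pole_of_pos (φ := fun x => φ (-x)) (hφ.comp contDiff_neg)
    (hs.comp_homeomorph (Homeomorph.neg ℝ)) (neg_pos.2 hm)
  have e1 : ∀ t, lineF (fun x => φ (-x)) t = lineF φ (-t) := by
    intro t
    rw [lineF, ← integral_neg_eq_self]
    refine integral_congr_ae (ae_of_all _ fun x => ?_)
    simp
  have e2 : ∫ x in Set.Ioi (0 : ℝ), (Real.exp (-(-m) * x) : ℂ) * φ (-x) =
      ∫ x in Set.Iio (0 : ℝ), (Real.exp (-m * x) : ℂ) * φ x := by
    have := integral_comp_neg_Ioi 0 (fun x : ℝ => (Real.exp (-m * x) : ℂ) * φ x)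
    rw [neg_zero, integral_Iic_eq_integral_Iio] at this
    rw [← this]
    refine setIntegral_congr_fun measurableSet_Ioi fun x _ => ?_
    simp
  rw [e2] at h
  rw [← integral_neg_eq_self]
  simp only [e1] at h
  rw [← neg_inj, ← integral_neg, ← neg_mul, ← h]
  refine integral_congr_ae (ae_of_all _ fun t => ?_)
  simp only
  rw [← neg_mul, ← inv_neg]
  push_cast
  congr 2; ring

lemma integral_Iio_eq {f : ℝ → ℂ} (hf : Integrable f) :
    ∫ x in Set.Iio (0 : ℝ), f x = (∫ x, f x) - ∫ x in Set.Ioi (0 : ℝ), f x := by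
  have h := integral_add_compl (s := Set.Ioi (0 : ℝ)) measurableSet_Ioi hf
  rw [Set.compl_Ioi, integral_Iic_eq_integral_Iio] at h
  rw [← h]; ring

lemma pole_of_ne (hφ : ContDiff ℝ ∞ φ) (hs : HasCompactSupport φ) (hm : m ≠ 0) :
    ∫ t : ℝ, (t + Complex.I * m)⁻¹ * lineF φ t = poleL m φ := by
  rcases lt_or_gt_of_ne hm with h | h
  · rw [pole_of_neg hφ hs h, integral_Iio_eq (integrable_exp_mul_test hφ hs m), poleL, dc,
      if_neg h.not_gt, if_pos h]
    simp
  · rw [pole_of_pos hφ hs h, poleL, dc, if_pos h]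
    simp

/-- The regularized multiplier. -/
def chi (n : ℕ) (t : ℝ) : ℝ := t ^ 2 / (t ^ 2 + ((n : ℝ) + 1)⁻¹ ^ 2)

lemma chi_nonneg (n : ℕ) (t : ℝ) : 0 ≤ chi n t := by unfold chi; positivity

lemma chi_le_one (n : ℕ) (t : ℝ) : chi n t ≤ 1 := by
  have : (0 : ℝ) < ((n : ℝ) + 1)⁻¹ ^ 2 := by positivity
  rw [chi, div_le_one (by positivity)]; linarith

lemma norm_chi_le (n : ℕ) (t : ℝ) : ‖(chi n t : ℂ)‖ ≤ 1 := by
  rw [Complex.norm_real, Real.norm_of_nonneg (chi_nonneg n t)]; exact chi_le_one n t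

lemma measurable_chi (n : ℕ) : Measurable (chi n) := by unfold chi; fun_prop

lemma chi_neg (n : ℕ) (t : ℝ) : chi n (-t) = chi n t := by simp [chi]

lemma tendsto_eps : Tendsto (fun n : ℕ => ((n : ℝ) + 1)⁻¹) atTop (𝓝 0) :=
  tendsto_inv_atTop_zero.comp (tendsto_atTop_add_const_right _ _ tendsto_natCast_atTop_atTop)

lemma tendsto_chi {t : ℝ} (ht : t ≠ 0) : Tendsto (fun n => (chi n t : ℂ)) atTop (𝓝 1) := by
  have h1 : Tendsto (fun n : ℕ => t ^ 2 / (t ^ 2 + ((n : ℝ) + 1)⁻¹ ^ 2)) atTop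
      (𝓝 (t ^ 2 / (t ^ 2 + 0 ^ 2))) :=
    tendsto_const_nhds.div (tendsto_const_nhds.add (tendsto_eps.pow 2)) (by positivity)
  have h2 : t ^ 2 / (t ^ 2 + 0 ^ 2) = 1 := by field_simp; simp
  rw [h2] at h1
  have h3 := (Complex.continuous_ofReal.tendsto 1).comp h1
  rw [Complex.ofReal_one] at h3
  exact h3

lemma ae_ne_zero : ∀ᵐ t : ℝ, t ≠ 0 := by
  have : volume ({0} : Set ℝ) = 0 := by simp
  filter_upwards [measure_eq_zero_iff_ae_notMem.1 this] with t ht using ht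

lemma tendsto_integral_chi_mul {g : ℝ → ℂ} (hg : Integrable g) :
    Tendsto (fun n => ∫ t, (chi n t : ℂ) * g t) atTop (𝓝 (∫ t, g t)) := by
  refine tendsto_integral_of_dominated_convergence (fun t => ‖g t‖) (fun n => ?_) hg.norm
    (fun n => ae_of_all _ fun t => ?_) ?_
  · have := measurable_chi n
    exact (by fun_prop : Measurable fun t => (chi n t : ℂ)).aestronglyMeasurable.mul hg.1
  · rw [norm_mul]; exact mul_le_of_le_one_left (norm_nonneg _) (norm_chi_le n t)
  · filter_upwards [ae_ne_zero] with t ht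
    simpa using (tendsto_chi ht).mul_const (g t)

lemma norm_inv_add_le (m t : ℝ) : ‖((t : ℂ) + Complex.I * m)⁻¹‖ ≤ |m|⁻¹ ∨ m = 0 := by
  rcases eq_or_ne m 0 with h | h
  · exact Or.inr h
  · left
    rw [norm_inv]
    refine inv_anti₀ (abs_pos.2 h) ?_
    have := Complex.abs_im_le_norm ((t : ℂ) + Complex.I * m)
    simpa using this

/-- With ε = 1/(n + 1) and |t + im| ≥ |t|, the product is at most |t|/(t² + ε²) ≤ 1/ε, whatever m
is. -/
lemma norm_chi_mul_inv_le (n : ℕ) (m t : ℝ) :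
    ‖(chi n t : ℂ) * ((t : ℂ) + Complex.I * m)⁻¹‖ ≤ (n : ℝ) + 1 := by
  rcases eq_or_ne t 0 with rfl | ht
  · simp [chi]; positivity
  have ht' := abs_pos.2 ht
  have h1 : ‖((t : ℂ) + Complex.I * m)⁻¹‖ ≤ |t|⁻¹ := by
    rw [norm_inv]
    refine inv_anti₀ ht' ?_
    have := Complex.abs_re_le_norm ((t : ℂ) + Complex.I * m)
    simpa using this
  rw [norm_mul, Complex.norm_real, Real.norm_of_nonneg (chi_nonneg n t)]
  refine (mul_le_mul_of_nonneg_left h1 (chi_nonneg n t)).trans ?_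
  set ε := ((n : ℝ) + 1)⁻¹ with hε
  have hε0 : 0 < ε := by positivity
  have hn : (n : ℝ) + 1 = ε⁻¹ := by rw [hε, inv_inv]
  rw [hn, chi, ← hε, ← sq_abs t, div_mul_eq_mul_div, div_le_iff₀ (by positivity),
    le_inv_mul_iff₀ hε0]
  have : |t| ^ 2 * |t|⁻¹ = |t| := by field_simp
  rw [this]
  nlinarith [sq_nonneg (|t| - ε), sq_nonneg |t|, sq_nonneg ε]

/-- This holds even at a pole on the line: there t = 0 and the regularized multiplier vanishes. It
is the only property of the inverse that the mode equation uses. -/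
lemma mul_chi_mul_inv (n : ℕ) (m t : ℝ) :
    ((t : ℂ) + Complex.I * m) * ((chi n t : ℂ) * ((t : ℂ) + Complex.I * m)⁻¹) = chi n t := by
  by_cases h : (t : ℂ) + Complex.I * m = 0
  · have : t = 0 := by simpa using congrArg Complex.re h
    simp [this, chi]
  · field_simp

/-- Regularized Fourier integrals with a simple pole. -/
lemma tendsto_pole (hφ : ContDiff ℝ ∞ φ) (hs : HasCompactSupport φ) (m : ℝ) :
    Tendsto (fun n => ∫ t : ℝ, (chi n t : ℂ) * (t + Complex.I * m)⁻¹ * lineF φ t) atTop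
      (𝓝 (poleL m φ)) := by
  obtain ⟨hF, -⟩ := fourier_line hφ hs
  have hint : ∀ {m : ℝ}, m ≠ 0 → Integrable fun t : ℝ => ((t : ℂ) + Complex.I * m)⁻¹ * lineF φ t := by
    intro m hm
    refine Integrable.bdd_mul (c := |m|⁻¹) hF (by fun_prop) (ae_of_all _ fun t => ?_)
    exact (norm_inv_add_le m t).resolve_right hm
  rcases eq_or_ne m 0 with rfl | hm
  · have hφi := integrable_exp_mul_test hφ hs 0
    -- For a pole on the line the regularization is exactly the average t/(t² + ε²) of 1/(t + iε)
    -- and 1/(t - iε), that is, a principal value. Hence the weight 1/2 in `dc`.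
    have e : ∀ n : ℕ, ∫ t : ℝ, (chi n t : ℂ) * (t + Complex.I * (0 : ℝ))⁻¹ * lineF φ t =
        (1 / 2 : ℂ) * (poleL ((n : ℝ) + 1)⁻¹ φ + poleL (-((n : ℝ) + 1)⁻¹) φ) := by
      intro n
      have hε : (0 : ℝ) < ((n : ℝ) + 1)⁻¹ := by positivity
      rw [← pole_of_ne hφ hs hε.ne', ← pole_of_ne hφ hs (neg_ne_zero.2 hε.ne'),
        ← integral_add (hint hε.ne') (hint (neg_ne_zero.2 hε.ne')), ← integral_const_mul]
      refine integral_congr_ae ?_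
      filter_upwards [ae_ne_zero] with t ht
      set ε := ((n : ℝ) + 1)⁻¹
      have h1 : (t : ℂ) ≠ 0 := by exact_mod_cast ht
      have h2 : ((t : ℂ) ^ 2 + (ε : ℂ) ^ 2) ≠ 0 := by
        have : t ^ 2 + ε ^ 2 ≠ 0 := by positivity
        exact_mod_cast this
      have h3 : (t : ℂ) + Complex.I * ε ≠ 0 := by
        intro h; exact ht (by simpa using congrArg Complex.re h)
      have h4 : (t : ℂ) - Complex.I * ε ≠ 0 := by
        intro h; exact ht (by simpa using congrArg Complex.re h)
      have h5 : (t : ℂ) + Complex.I * (-ε : ℝ) = t - Complex.I * ε := by push_cast; ring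
      rw [h5]
      have h6 : ((t : ℂ) + Complex.I * ε)⁻¹ + ((t : ℂ) - Complex.I * ε)⁻¹ =
          2 * t / (t ^ 2 + (ε : ℂ) ^ 2) := by
        rw [inv_add_inv h3 h4]
        congr 1
        · ring
        · linear_combination (-(ε : ℂ) ^ 2) * Complex.I_sq
      rw [← add_mul, h6]
      have hchi : (chi n t : ℂ) = t ^ 2 / (t ^ 2 + (ε : ℂ) ^ 2) := by
        have : chi n t = t ^ 2 / (t ^ 2 + ε ^ 2) := rfl
        rw [this, Complex.ofReal_div, Complex.ofReal_add, Complex.ofReal_pow, Complex.ofReal_pow]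
      rw [hchi]
      simp only [Complex.ofReal_zero, mul_zero, add_zero]
      clear_value ε
      field_simp
    simp only [e]
    have hlim : ∀ (s : ℝ), Tendsto (fun n : ℕ => ∫ x in Set.Ioi (0 : ℝ),
        (Real.exp (-(s * ((n : ℝ) + 1)⁻¹) * x) : ℂ) * φ x) atTop
        (𝓝 (∫ x in Set.Ioi (0 : ℝ), φ x)) ∧ Tendsto (fun n : ℕ => ∫ x : ℝ,
        (Real.exp (-(s * ((n : ℝ) + 1)⁻¹) * x) : ℂ) * φ x) atTop (𝓝 (∫ x : ℝ, φ x)) := by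
      intro s
      have hdom : Integrable fun x : ℝ => Real.exp (|s| * |x|) * ‖φ x‖ := by
        refine Continuous.integrable_of_hasCompactSupport ?_ hs.norm.mul_left
        have := hφ.continuous
        fun_prop
      have hle : ∀ (n : ℕ) (x : ℝ), ‖(Real.exp (-(s * ((n : ℝ) + 1)⁻¹) * x) : ℂ) * φ x‖ ≤
          Real.exp (|s| * |x|) * ‖φ x‖ := by
        intro n x
        rw [norm_mul, Complex.norm_real, Real.norm_of_nonneg (Real.exp_nonneg _)]
        refine mul_le_mul_of_nonneg_right (Real.exp_le_exp.2 ?_) (norm_nonneg _)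
        have h1 : ((n : ℝ) + 1)⁻¹ ≤ 1 := inv_le_one_of_one_le₀ (by simp)
        have h0 : 0 < ((n : ℝ) + 1)⁻¹ := by positivity
        refine (le_abs_self _).trans ?_
        rw [abs_mul, abs_neg, abs_mul, abs_of_pos h0]
        gcongr
        exact mul_le_of_le_one_right (abs_nonneg _) h1
      have hpt : ∀ x : ℝ, Tendsto (fun n : ℕ => (Real.exp (-(s * ((n : ℝ) + 1)⁻¹) * x) : ℂ) * φ x)
          atTop (𝓝 (φ x)) := by
        intro x
        have h1 : Tendsto (fun n : ℕ => (Real.exp (-(s * ((n : ℝ) + 1)⁻¹) * x) : ℂ)) atTop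
            (𝓝 (Real.exp (-(s * 0) * x) : ℝ)) :=
          (Complex.continuous_ofReal.tendsto _).comp ((Real.continuous_exp.tendsto _).comp
            (((tendsto_eps.const_mul s).neg).mul_const x))
        have h2 := h1.mul_const (φ x)
        simpa using h2
      have hmeas : ∀ n : ℕ, Measurable fun x : ℝ =>
          (Real.exp (-(s * ((n : ℝ) + 1)⁻¹) * x) : ℂ) * φ x := by
        intro n
        have := hφ.continuous.measurable
        fun_prop
      exact ⟨tendsto_integral_of_dominated_convergence _ (fun n => (hmeas n).aestronglyMeasurable)
        hdom.integrableOn (fun n => ae_of_all _ (hle n)) (ae_of_all _ hpt),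
        tendsto_integral_of_dominated_convergence _ (fun n => (hmeas n).aestronglyMeasurable)
        hdom (fun n => ae_of_all _ (hle n)) (ae_of_all _ hpt)⟩
    have hp := (hlim 1).1
    have hq := (hlim (-1)).1
    have hq' := (hlim (-1)).2
    have hfin := ((hq'.sub hq).sub hp).const_mul (Real.pi * Complex.I)
    refine (hfin.congr fun n => ?_).trans (le_of_eq (congrArg _ ?_))
    · have hε : (0 : ℝ) < ((n : ℝ) + 1)⁻¹ := by positivity
      simp only [poleL, dc, hε, hε.not_gt, if_true, if_false, neg_pos, neg_lt_zero, one_mul, neg_one_mul]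
      push_cast
      ring
    · simp only [poleL, dc, lt_irrefl, if_false]
      simp
      ring
  · simp only [mul_assoc]
    rw [← pole_of_ne hφ hs hm]
    exact tendsto_integral_chi_mul (hint hm)

end

/-! ### Continuous spectrum of the soliton operator -/

/-- The coefficient of the pole at `μ = Im lam - κ`. -/
def al (κ x' x : ℝ) : ℂ := Complex.I * κ / 2 * (1 - th κ x) * (1 + th κ x')

/-- The coefficient of the pole at `μ' = Im lam + κ`. -/
def be (κ x' x : ℝ) : ℂ := Complex.I * κ / 2 * (1 + th κ x) * (1 - th κ x')

lemma norm_al_le {κ : ℝ} (hκ : 0 ≤ κ) (x' x : ℝ) : ‖al κ x' x‖ ≤ 2 * κ := by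
  have h1 := abs_le.1 (abs_th_le κ x)
  have h2 := abs_le.1 (abs_th_le κ x')
  have e : al κ x' x = Complex.I * ((κ / 2 * (1 - th κ x) * (1 + th κ x') : ℝ) : ℂ) := by
    rw [al]; push_cast; ring
  rw [e, norm_mul, Complex.norm_I, one_mul, Complex.norm_real, Real.norm_of_nonneg
    (mul_nonneg (mul_nonneg (by positivity) (by linarith)) (by linarith))]
  nlinarith [mul_nonneg hκ (sub_nonneg.2 h1.2), mul_nonneg hκ (sub_nonneg.2 h2.2),
    mul_nonneg (mul_nonneg hκ (sub_nonneg.2 h1.2)) (sub_nonneg.2 h2.2),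
    mul_nonneg hκ (sub_nonneg.2 h1.1)]

lemma norm_be_le {κ : ℝ} (hκ : 0 ≤ κ) (x' x : ℝ) : ‖be κ x' x‖ ≤ 2 * κ := by
  have e : be κ x' x = al κ x x' := by rw [al, be]; ring
  rw [e]; exact norm_al_le hκ x x'

lemma hasDerivAt_al (κ x' x : ℝ) : HasDerivAt (al κ x')
    (-(Complex.I * κ ^ 2 / 2 * (1 - (th κ x : ℂ) ^ 2) * (1 + th κ x'))) x :=
  ((((hasDerivAt_thc κ x).const_sub 1).const_mul (Complex.I * κ / 2)).mul_const
    (1 + th κ x' : ℂ)).congr_deriv (by ring)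

lemma hasDerivAt_be (κ x' x : ℝ) : HasDerivAt (be κ x')
    (Complex.I * κ ^ 2 / 2 * (1 - (th κ x : ℂ) ^ 2) * (1 - th κ x')) x :=
  ((((hasDerivAt_thc κ x).const_add 1).const_mul (Complex.I * κ / 2)).mul_const
    (1 - th κ x' : ℂ)).congr_deriv (by ring)

lemma hasDerivAt_one_sub_thc_sq (κ x : ℝ) : HasDerivAt (fun x => 1 - (th κ x : ℂ) ^ 2)
    (-2 * κ * th κ x * (1 - (th κ x : ℂ) ^ 2)) x :=
  (((hasDerivAt_thc κ x).pow 2).const_sub 1).congr_deriv (by push_cast; ring)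

lemma contDiff_thc (κ : ℝ) : ContDiff ℝ ∞ fun x : ℝ => (th κ x : ℂ) :=
  (contDiff_tc κ).comp (contDiff_id.prodMk (contDiff_const (c := (0 : ℝ))))

lemma contDiff_al (κ x' : ℝ) : ContDiff ℝ ∞ (al κ x') := by
  have := contDiff_thc κ
  unfold al; fun_prop

lemma contDiff_be (κ x' : ℝ) : ContDiff ℝ ∞ (be κ x') := by
  have := contDiff_thc κ
  unfold be; fun_prop

/-! ### Regularized soliton modes, their equation and their completeness. -/

section

variable (κ : ℝ) (lam : ℂ) (x' : ℝ)

/-- The regularized amplitude of the modes of the soliton operator. -/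
def amp (n : ℕ) (x t : ℝ) : ℂ := chi n t +
  al κ x' x * (chi n t * (t + Complex.I * (lam.im - κ : ℝ))⁻¹) -
  be κ x' x * (chi n t * (t + Complex.I * (lam.im + κ : ℝ))⁻¹)

/-- The derivative in `x` of the amplitude. -/
def ampD (n : ℕ) (x t : ℝ) : ℂ :=
  -(Complex.I * κ ^ 2 / 2 * (1 - (th κ x : ℂ) ^ 2)) *
  ((1 + th κ x') * (chi n t * (t + Complex.I * (lam.im - κ : ℝ))⁻¹) +
  (1 - th κ x') * (chi n t * (t + Complex.I * (lam.im + κ : ℝ))⁻¹))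

/-- The regularized modes of the soliton operator. -/
def mode (n : ℕ) (t x : ℝ) : ℂ := freeMode lam t (x - x') * amp κ lam x' n x t

lemma hasDerivAt_amp (n : ℕ) (x t : ℝ) :
    HasDerivAt (fun x => amp κ lam x' n x t) (ampD κ lam x' n x t) x :=
  ((((hasDerivAt_al κ x' x).mul_const _).const_add _).sub
    ((hasDerivAt_be κ x' x).mul_const _)).congr_deriv (by rw [ampD]; ring)

lemma hasDerivAt_ampD (n : ℕ) (x t : ℝ) : HasDerivAt (fun x => ampD κ lam x' n x t)
    (-2 * κ * th κ x * ampD κ lam x' n x t) x :=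
  ((((hasDerivAt_one_sub_thc_sq κ x).const_mul (Complex.I * κ ^ 2 / 2)).neg).mul_const _).congr_deriv
    (by rw [ampD]; ring)

lemma hasDerivAt_freeMode_sub (t x : ℝ) : HasDerivAt (fun x => freeMode lam t (x - x'))
    (-Complex.I * (t - lam.re) * freeMode lam t (x - x')) x := by
  have := (freeMode_hasDerivAt lam t (x - x')).comp_sub_const x x'
  exact this

lemma mode_derivs (n : ℕ) (t x : ℝ) :
    HasDerivAt (mode κ lam x' n t) (freeMode lam t (x - x') *
      (-Complex.I * (t - lam.re) * amp κ lam x' n x t + ampD κ lam x' n x t)) x ∧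
    HasDerivAt (fun x => freeMode lam t (x - x') *
      (-Complex.I * (t - lam.re) * amp κ lam x' n x t + ampD κ lam x' n x t))
      (freeMode lam t (x - x') * ((-Complex.I * (t - lam.re)) *
        (-Complex.I * (t - lam.re) * amp κ lam x' n x t + ampD κ lam x' n x t) +
        (-Complex.I * (t - lam.re) * ampD κ lam x' n x t +
          -2 * κ * th κ x * ampD κ lam x' n x t))) x :=
  ⟨((hasDerivAt_freeMode_sub lam x' t x).mul (hasDerivAt_amp κ lam x' n x t)).congr_deriv (by ring),
  ((hasDerivAt_freeMode_sub lam x' t x).mul (((hasDerivAt_amp κ lam x' n x t).const_mul _).add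
    (hasDerivAt_ampD κ lam x' n x t))).congr_deriv (by simp only [Pi.add_apply]; ring)⟩

/-- Without the regularization, and with p = t + i Im λ, the amplitude is (p - iκ tanh κx)(p + iκ
tanh κx')/(p² + κ²), the normalized product of an eigenfunction at x and its dual at x'; `al` and
`-be` are its residues at p = iκ and p = -iκ. The factor `chi n t` does not depend on x, so it
preserves the equation. -/
lemma mode_ode (n : ℕ) (t x : ℝ) : -(freeMode lam t (x - x') * ((-Complex.I * (t - lam.re)) *
        (-Complex.I * (t - lam.re) * amp κ lam x' n x t + ampD κ lam x' n x t) +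
        (-Complex.I * (t - lam.re) * ampD κ lam x' n x t +
          -2 * κ * th κ x * ampD κ lam x' n x t))) +
    2 * Complex.I * lam * (freeMode lam t (x - x') *
      (-Complex.I * (t - lam.re) * amp κ lam x' n x t + ampD κ lam x' n x t)) +
    uc κ x * mode κ lam x' n t x = disp lam 0 t * mode κ lam x' n t x := by
  have h1 := mul_chi_mul_inv n (lam.im - κ) t
  have h2 := mul_chi_mul_inv n (lam.im + κ) t
  have ho := freeMode_ode lam 0 t
  rw [Complex.ofReal_zero, add_zero] at ho
  have hl := (Complex.re_add_im lam).symm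
  set F := freeMode lam t (x - x')
  rw [mode, ← ho, uc, amp, ampD, al, be]
  set ψ := (chi n t : ℂ) * (t + Complex.I * (lam.im - κ : ℝ))⁻¹
  set ψ' := (chi n t : ℂ) * (t + Complex.I * (lam.im + κ : ℝ))⁻¹
  set T := (th κ x : ℂ)
  set T' := (th κ x' : ℂ)
  set p := (t : ℂ) + Complex.I * lam.im with hp
  have hc : 2 * Complex.I * lam + 2 * Complex.I * (t - lam.re) = 2 * Complex.I * p := by
    rw [hp]; linear_combination (2 * Complex.I) * hl
  have e1 : (t : ℂ) + Complex.I * (lam.im - κ : ℝ) = p - Complex.I * κ := by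
    rw [hp]; push_cast; ring
  have e2 : (t : ℂ) + Complex.I * (lam.im + κ : ℝ) = p + Complex.I * κ := by
    rw [hp]; push_cast; ring
  rw [e1] at h1
  rw [e2] at h2
  clear_value ψ ψ' p
  linear_combination (-F * (Complex.I * κ ^ 2 / 2 * (1 - T ^ 2)) * ((1 + T') * ψ + (1 - T') * ψ')) * hc
    - (κ ^ 2 * (1 - T ^ 2) * F * p * ((1 + T') * ψ + (1 - T') * ψ')) * Complex.I_sq
    + (κ ^ 2 * (1 - T ^ 2) * F * (1 + T')) * h1 + (κ ^ 2 * (1 - T ^ 2) * F * (1 - T')) * h2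

lemma measurable_mode (n : ℕ) : Measurable (Function.uncurry (mode κ lam x' n)) := by
  have h1 := measurable_chi n
  have h2 := (continuous_freeMode lam).measurable
  have h3 := (contDiff_al κ x').continuous.measurable
  have h4 := (contDiff_be κ x').continuous.measurable
  have h5 : Measurable fun z : ℝ × ℝ => freeMode lam z.1 (z.2 - x') :=
    h2.comp (measurable_fst.prodMk (measurable_snd.sub_const x'))
  unfold mode Function.uncurry amp
  fun_prop

lemma measurable_amp (n : ℕ) (x : ℝ) : Measurable (amp κ lam x' n x) := by
  have h1 := measurable_chi n
  unfold amp
  fun_prop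

variable {κ}

lemma norm_amp_le (hκ : 0 ≤ κ) (n : ℕ) (x t : ℝ) :
    ‖amp κ lam x' n x t‖ ≤ 1 + 2 * κ * (n + 1) + 2 * κ * (n + 1) := by
  rw [amp]
  refine (norm_sub_le _ _).trans (add_le_add ((norm_add_le _ _).trans
    (add_le_add (norm_chi_le n t) ?_)) ?_) <;> rw [norm_mul]
  · exact mul_le_mul (norm_al_le hκ _ _) (norm_chi_mul_inv_le n _ t) (norm_nonneg _) (by positivity)
  · exact mul_le_mul (norm_be_le hκ _ _) (norm_chi_mul_inv_le n _ t) (norm_nonneg _) (by positivity)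

lemma mode_identity (hκ : 0 ≤ κ) (n : ℕ) {Φ : ℝ × ℝ → ℂ} (hΦ : CTest Φ) :
    ∫ p, specKer (fwd lam) (disp lam 0) (mode κ lam x' n) p * (Lst lam Φ p + uc κ p.1 * Φ p) =
      ∫ t, ∫ x, mode κ lam x' n t x * Φ (x, 0) :=
  fundamental_identity (continuous_uc κ) (measurableSet_fwd lam) (fwd_compl lam)
    (continuous_disp lam 0).measurable (disp_re lam 0) (measurable_mode κ lam x' n)
    (fun t x => by rw [mode, norm_mul, norm_freeMode, one_mul]; exact norm_amp_le lam x' hκ n x t)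
    (fun t x => (mode_derivs κ lam x' n t x).1) (fun t x => (mode_derivs κ lam x' n t x).2)
    (mode_ode κ lam x' n) hΦ

/-- The trace of a test function entering the completeness relation. -/
def trace (lam : ℂ) (x' : ℝ) (Φ : ℝ × ℝ → ℂ) (c : ℝ → ℂ) (X : ℝ) : ℂ :=
  Complex.exp (Complex.I * lam.re * X) * (c (x' + X) * Φ (x' + X, 0))

lemma trace_smooth {Φ : ℝ × ℝ → ℂ} (hΦ : CTest Φ) {c : ℝ → ℂ} (hc : ContDiff ℝ ∞ c) :
    ContDiff ℝ ∞ (trace lam x' Φ c) ∧ HasCompactSupport (trace lam x' Φ c) := by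
  have h1 : ContDiff ℝ ∞ fun X : ℝ => Φ (x' + X, 0) :=
    hΦ.smooth.comp ((contDiff_const.add contDiff_id).prodMk contDiff_const)
  have h2 : ContDiff ℝ ∞ fun X : ℝ => c (x' + X) := hc.comp (contDiff_const.add contDiff_id)
  have h3 : ContDiff ℝ ∞ fun X : ℝ => Complex.exp (Complex.I * lam.re * X) :=
    (contDiff_exp_fst (Complex.I * lam.re)).comp (contDiff_id.prodMk (contDiff_const (c := (0 : ℝ))))
  refine ⟨h3.mul (h2.mul h1), ?_⟩
  obtain ⟨N, _, hN⟩ := hΦ.eq_zero_of_large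
  refine HasCompactSupport.intro (isCompact_Icc (a := -N - x') (b := N - x')) fun X hX => ?_
  rw [trace, hN (x' + X) 0 (Or.inl ?_)]
  · simp
  · by_contra hcon
    rw [not_le, abs_lt] at hcon
    exact hX ⟨by linarith [hcon.1], by linarith [hcon.2]⟩

lemma integral_mode (n : ℕ) (t : ℝ) {Φ : ℝ × ℝ → ℂ} (hΦ : CTest Φ) :
    ∫ x, mode κ lam x' n t x * Φ (x, 0) =
      chi n t * lineF (trace lam x' Φ fun _ => 1) t +
      chi n t * (t + Complex.I * (lam.im - κ : ℝ))⁻¹ * lineF (trace lam x' Φ (al κ x')) t -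
      chi n t * (t + Complex.I * (lam.im + κ : ℝ))⁻¹ * lineF (trace lam x' Φ (be κ x')) t := by
  have hI : ∀ c : ℝ → ℂ, ContDiff ℝ ∞ c → Integrable fun X : ℝ =>
      Complex.exp (-Complex.I * t * X) * trace lam x' Φ c X := by
    intro c hc
    obtain ⟨h1, h2⟩ := trace_smooth lam x' hΦ hc
    refine Continuous.integrable_of_hasCompactSupport ?_ h2.mul_left
    have := h1.continuous
    fun_prop
  have i1 := (hI (fun _ => 1) contDiff_const).const_mul (chi n t : ℂ)
  have i2 := (hI _ (contDiff_al κ x')).const_mul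
    ((chi n t : ℂ) * (t + Complex.I * (lam.im - κ : ℝ))⁻¹)
  have i3 := (hI _ (contDiff_be κ x')).const_mul
    ((chi n t : ℂ) * (t + Complex.I * (lam.im + κ : ℝ))⁻¹)
  simp only [lineF]
  rw [← integral_const_mul, ← integral_const_mul, ← integral_const_mul, ← integral_add i1 i2,
    ← integral_sub (f := fun X => _ + _) (i1.add i2) i3, ← integral_add_left_eq_self _ x']
  refine integral_congr_ae (ae_of_all _ fun X => ?_)
  simp only [mode, amp, trace, add_sub_cancel_left, freeMode]
  have e : Complex.exp (-Complex.I * (t - lam.re) * X) =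
      Complex.exp (-Complex.I * t * X) * Complex.exp (Complex.I * lam.re * X) := by
    rw [← Complex.exp_add]; congr 1; ring
  rw [e]; ring

/-- The completeness relation: the constant part of the amplitude yields the delta function at x' by
Fourier inversion, and the two poles yield residue terms. These are removed later by the bound
state. -/
lemma tendsto_integral_mode {Φ : ℝ × ℝ → ℂ} (hΦ : CTest Φ) :
    Tendsto (fun n => ∫ t, ∫ x, mode κ lam x' n t x * Φ (x, 0)) atTop
      (𝓝 (2 * Real.pi * Φ (x', 0) + poleL (lam.im - κ) (trace lam x' Φ (al κ x')) -
        poleL (lam.im + κ) (trace lam x' Φ (be κ x')))) := by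
  obtain ⟨a1, a2⟩ := trace_smooth lam x' hΦ (contDiff_const (c := (1 : ℂ)))
  obtain ⟨b1, b2⟩ := trace_smooth lam x' hΦ (contDiff_al κ x')
  obtain ⟨c1, c2⟩ := trace_smooth lam x' hΦ (contDiff_be κ x')
  have hone := tendsto_integral_chi_mul (fourier_line a1 a2).1
  have hval := (fourier_line a1 a2).2 0
  have e1 : ∫ t, lineF (trace lam x' Φ fun _ => 1) t = 2 * Real.pi * Φ (x', 0) := by
    simpa [trace, lineF] using hval
  have hone' : Tendsto (fun n => ∫ t, (chi n t : ℂ) * lineF (trace lam x' Φ fun _ => 1) t) atTop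
      (𝓝 (2 * Real.pi * Φ (x', 0))) := by
    rw [← e1]; exact hone
  refine ((hone'.add (tendsto_pole b1 b2 (lam.im - κ))).sub
    (tendsto_pole c1 c2 (lam.im + κ))).congr fun n => ?_
  have hm := measurable_chi n
  have hint : ∀ {φ : ℝ → ℂ} (m : ℝ), ContDiff ℝ ∞ φ → HasCompactSupport φ → Integrable fun t : ℝ =>
      (chi n t : ℂ) * (t + Complex.I * m)⁻¹ * lineF φ t := fun m h1 h2 =>
    Integrable.bdd_mul (fourier_line h1 h2).1 (by fun_prop)
      (ae_of_all _ fun t => norm_chi_mul_inv_le n m t)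
  have i1 : Integrable fun t => (chi n t : ℂ) * lineF (trace lam x' Φ fun _ => 1) t :=
    Integrable.bdd_mul (fourier_line a1 a2).1 (by fun_prop) (ae_of_all _ fun t => norm_chi_le n t)
  have i2 := hint (lam.im - κ) b1 b2
  have i3 := hint (lam.im + κ) c1 c2
  simp only [integral_mode lam x' n _ hΦ]
  rw [integral_sub (f := fun t => _ + _) (i1.add i2) i3, integral_add i1 i2]

end

/-! ### Linearity and regularization of the folded integrals. -/

section

variable {r Y C D : ℝ} {φ ψ : ℝ → ℂ}

lemma integrableOn_wt_mul (hr : 0 ≤ r) (hφ : Measurable φ) (hC : ∀ t, 0 < t → ‖φ t‖ ≤ C) :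
    IntegrableOn (fun t => (wt r Y t : ℂ) * φ t) (reg r Y) := by
  refine Integrable.mono' ((integrableOn_wt r Y).mul_const C) ?_ ?_
  · have : Measurable (wt r Y) := by unfold wt; fun_prop
    exact (by fun_prop : Measurable fun t => (wt r Y t : ℂ) * φ t).aestronglyMeasurable
  · refine (ae_restrict_iff' (measurableSet_reg r Y)).2 (ae_of_all _ fun t ht => ?_)
    rw [norm_mul, Complex.norm_real, Real.norm_of_nonneg (wt_pos r Y t).le]
    exact mul_le_mul_of_nonneg_left (hC t (pos_of_mem_reg hr ht)) (wt_pos r Y t).le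

lemma osc_add (hr : 0 ≤ r) (hφ : Measurable φ) (hC : ∀ t, 0 < t → ‖φ t‖ ≤ C) (hψ : Measurable ψ)
    (hD : ∀ t, 0 < t → ‖ψ t‖ ≤ D) : osc r Y (fun t => φ t + ψ t) = osc r Y φ + osc r Y ψ := by
  simp only [osc, mul_add]
  rw [integral_add (integrableOn_wt_mul hr hφ hC) (integrableOn_wt_mul hr hψ hD), mul_add]

lemma osc_congr (hr : 0 ≤ r) (h : ∀ t, 0 < t → φ t = ψ t) : osc r Y φ = osc r Y ψ := by
  rw [osc, osc, setIntegral_congr_fun (measurableSet_reg r Y)]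
  intro t ht
  simp only [h t (pos_of_mem_reg hr ht)]

lemma tendsto_osc_chi (hr : 0 ≤ r) (hφ : Measurable φ) (hC : ∀ t, 0 < t → ‖φ t‖ ≤ C) :
    Tendsto (fun n => osc r Y fun t => chi n t * φ t) atTop (𝓝 (osc r Y φ)) := by
  refine Tendsto.const_mul _ ?_
  have hi := integrableOn_wt_mul (Y := Y) hr hφ hC
  refine tendsto_integral_of_dominated_convergence (fun t => ‖(wt r Y t : ℂ) * φ t‖) (fun n => ?_)
    hi.norm (fun n => ae_of_all _ fun t => ?_) ?_
  · have : Measurable (wt r Y) := by unfold wt; fun_prop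
    have := measurable_chi n
    exact (by fun_prop : Measurable fun t => (wt r Y t : ℂ) * (chi n t * φ t)).aestronglyMeasurable
  · rw [mul_left_comm, norm_mul (chi n t : ℂ)]
    exact mul_le_of_le_one_left (norm_nonneg _) (norm_chi_le n t)
  · refine (ae_restrict_iff' (measurableSet_reg r Y)).2 (ae_of_all _ fun t ht => ?_)
    simpa using ((tendsto_chi (pos_of_mem_reg hr ht).ne').mul_const (φ t)).const_mul (wt r Y t : ℂ)

end

lemma norm_evenM_le_inv (m Z t : ℝ) : ‖evenM m Z t‖ ≤ |m|⁻¹ := by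
  rcases eq_or_ne m 0 with rfl | hm
  · simp [evenM]
  · exact norm_evenM_le hm Z t

/-- Since 1/(t + im) = (t - im)/(t² + m²), the odd part pairs with the sine and the even part with
the cosine. -/
lemma fold_inv (m Z : ℝ) {t : ℝ} (ht : 0 < t) :
    Complex.exp (-Complex.I * t * Z) * (t + Complex.I * m)⁻¹ +
      Complex.exp (Complex.I * t * Z) * ((-t : ℝ) + Complex.I * m)⁻¹ =
      -2 * Complex.I * (oddM m Z t + evenM m Z t) := by
  have h1 : (t : ℂ) + Complex.I * m ≠ 0 := fun h => ht.ne' (by simpa using congrArg Complex.re h)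
  have h2 : ((-t : ℝ) : ℂ) + Complex.I * m ≠ 0 := fun h =>
    ht.ne' (by simpa using congrArg Complex.re h)
  have h3 : (t : ℂ) ^ 2 + (m : ℂ) ^ 2 ≠ 0 := by
    have : t ^ 2 + m ^ 2 ≠ 0 := by positivity
    exact_mod_cast this
  have e1 : ((t : ℂ) + Complex.I * m)⁻¹ = (t - Complex.I * m) / (t ^ 2 + m ^ 2) := by
    rw [inv_eq_one_div, div_eq_div_iff h1 h3]; linear_combination (m : ℂ) ^ 2 * Complex.I_sq
  have e2 : (((-t : ℝ) : ℂ) + Complex.I * m)⁻¹ = (-t - Complex.I * m) / (t ^ 2 + m ^ 2) := by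
    rw [inv_eq_one_div, div_eq_div_iff h2 h3]; push_cast
    linear_combination (m : ℂ) ^ 2 * Complex.I_sq
  have hp := exp_add_exp_neg t Z
  have hm := exp_sub_exp_neg t Z
  rw [e1, e2, oddM, evenM, Complex.ofReal_div, Complex.ofReal_div]
  rw [Complex.ofReal_mul, Complex.ofReal_mul, Complex.ofReal_add, Complex.ofReal_pow,
    Complex.ofReal_pow]
  rw [mul_div_assoc', mul_div_assoc', ← add_div, ← add_div, mul_div_assoc']
  congr 1
  linear_combination (t : ℂ) * hm - (Complex.I * m) * hp

/-! ### The continuous part of the Green kernel. -/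

section

variable (κ : ℝ) (lam : ℂ) (x' : ℝ)

/-- The folded amplitude of the soliton kernel. -/
def ampF (x Z t : ℝ) : ℂ := (Real.cos (t * Z) : ℂ) +
  (-Complex.I * al κ x' x * (oddM (lam.im - κ) Z t + evenM (lam.im - κ) Z t) +
    Complex.I * be κ x' x * (oddM (lam.im + κ) Z t + evenM (lam.im + κ) Z t))

/-- The continuous part of the Green kernel of the soliton operator. -/
def greenC (p : ℝ × ℝ) : ℂ := Complex.exp (Complex.I * lam.re * zed lam (p.1 - x') p.2) *
  ((Real.pi : ℂ)⁻¹ * osc |lam.re| p.2 (ampF κ lam x' p.1 (zed lam (p.1 - x') p.2)))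

lemma measurable_ampF (x Z : ℝ) : Measurable (ampF κ lam x' x Z) := by
  have h1 := fun m => measurable_oddM_apply m Z
  have h2 := fun m => measurable_evenM_apply m Z
  have h3 := h1 (lam.im - κ)
  have h4 := h1 (lam.im + κ)
  have h5 := h2 (lam.im - κ)
  have h6 := h2 (lam.im + κ)
  unfold ampF; fun_prop

variable {κ}

lemma norm_ampF_le (hκ : 0 ≤ κ) (x Z : ℝ) {t : ℝ} (ht : 0 < t) : ‖ampF κ lam x' x Z t‖ ≤
    1 + (2 * κ * (|Z| + |lam.im - κ|⁻¹) + 2 * κ * (|Z| + |lam.im + κ|⁻¹)) := by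
  have h : ∀ m, ‖oddM m Z t + evenM m Z t‖ ≤ |Z| + |m|⁻¹ := fun m =>
    (norm_add_le _ _).trans (add_le_add (norm_oddM_le_abs ht Z) (norm_evenM_le_inv m Z t))
  rw [ampF]
  refine (norm_add_le _ _).trans (add_le_add ?_ ((norm_add_le _ _).trans (add_le_add ?_ ?_)))
  · rw [Complex.norm_real]; exact Real.abs_cos_le_one _
  · rw [norm_mul]
    refine mul_le_mul ?_ (h _) (norm_nonneg _) (by positivity)
    simpa using norm_al_le hκ x' x
  · rw [norm_mul]
    refine mul_le_mul ?_ (h _) (norm_nonneg _) (by positivity)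
    simpa using norm_be_le hκ x' x

lemma specKer_mode (hκ : 0 ≤ κ) (n : ℕ) (p : ℝ × ℝ) :
    (2 * Real.pi : ℂ)⁻¹ * specKer (fwd lam) (disp lam 0) (mode κ lam x' n) p =
      Complex.exp (Complex.I * lam.re * zed lam (p.1 - x') p.2) *
      ((Real.pi : ℂ)⁻¹ * osc |lam.re| p.2 fun t =>
        chi n t * ampF κ lam x' p.1 (zed lam (p.1 - x') p.2) t) := by
  obtain ⟨x, y⟩ := p
  rw [specKer_fold lam (f := amp κ lam x' n x) (X := x - x') (measurable_amp κ lam x' n x)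
    (fun t => norm_amp_le lam x' hκ n x t) fun t => rfl]
  have e : osc |lam.re| y (fun t => Complex.exp (-Complex.I * t * zed lam (x - x') y) *
      amp κ lam x' n x t + Complex.exp (Complex.I * t * zed lam (x - x') y) *
      amp κ lam x' n x (-t)) = 2 * osc |lam.re| y fun t =>
        chi n t * ampF κ lam x' x (zed lam (x - x') y) t := by
    rw [← osc_const_mul]
    refine osc_congr (abs_nonneg _) fun t ht => ?_
    simp only [amp, ampF, chi_neg]
    linear_combination (chi n t : ℂ) * exp_add_exp_neg t (zed lam (x - x') y) +
      (chi n t : ℂ) * al κ x' x * fold_inv (lam.im - κ) (zed lam (x - x') y) ht -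
      (chi n t : ℂ) * be κ x' x * fold_inv (lam.im + κ) (zed lam (x - x') y) ht
  rw [e, mul_inv]
  ring

/-- The amplitudes themselves are bounded only by multiples of n + 1, but after folding the
singularity at t = 0 cancels: |`oddM`| ≤ |Z| for every m. On the bounded support of θ the kernels
are then dominated by a constant times |y|^{-1/2}, uniformly in n. -/
lemma tendsto_integral_specKer_mode (hκ : 0 ≤ κ) {θ : ℝ × ℝ → ℂ} (hθ : Continuous θ)
    (hs : HasCompactSupport θ) :
    Tendsto (fun n => ∫ p, (2 * Real.pi : ℂ)⁻¹ * specKer (fwd lam) (disp lam 0) (mode κ lam x' n) p *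
      θ p) atTop (𝓝 (∫ p, greenC κ lam x' p * θ p)) := by
  obtain ⟨Cθ, hCθ⟩ := hθ.bounded_above_of_compact_support hs
  have hCθ0 : 0 ≤ Cθ := (norm_nonneg _).trans (hCθ 0)
  obtain ⟨N, hN⟩ := hs.isCompact.isBounded.exists_norm_le
  set M := max N 0 + 1 with hM
  have hM0 : 0 < M := by positivity
  have hout : ∀ p : ℝ × ℝ, ¬ (|p.1| < M ∧ |p.2| < M) → θ p = 0 := by
    intro p hp
    by_contra hne
    have h1 := hN p (subset_closure hne)
    have h2 : ‖p‖ < M := by rw [hM]; linarith [le_max_left N 0]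
    exact hp ⟨(norm_fst_le p).trans_lt h2, (norm_snd_le p).trans_lt h2⟩
  set B := M + |x'| + 2 * |lam.im| * M with hB
  set C := 1 + (2 * κ * (B + |lam.im - κ|⁻¹) + 2 * κ * (B + |lam.im + κ|⁻¹)) with hC
  have hC0 : 0 ≤ C := by positivity
  have hamp : ∀ p : ℝ × ℝ, |p.1| < M → |p.2| < M → ∀ t, 0 < t →
      ‖ampF κ lam x' p.1 (zed lam (p.1 - x') p.2) t‖ ≤ C := by
    intro p h1 h2 t ht
    refine (norm_ampF_le lam x' hκ _ _ ht).trans ?_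
    have : |zed lam (p.1 - x') p.2| ≤ B := by
      refine (abs_add_le _ _).trans (add_le_add ((abs_sub _ _).trans (by gcongr)) ?_)
      rw [abs_mul, abs_mul, abs_two]; gcongr
    rw [hC]; gcongr
  have hdom : Integrable fun p : ℝ × ℝ => (2 * C * Cθ) *
      (Set.indicator (Set.Ioo (-M) M) (fun _ => (1 : ℝ)) p.1 *
        Set.indicator (Set.Ioo (-M) M) (fun z : ℝ => |z| ^ (-(1 / 2) : ℝ)) p.2) := by
    refine Integrable.const_mul (Integrable.mul_prod (f := Set.indicator (Set.Ioo (-M) M)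
      fun _ => (1 : ℝ)) ?_ (integral_inv_sqrt_abs hM0.le).1) _
    exact (integrable_indicator_iff measurableSet_Ioo).2 (by simp)
  have hpi : ‖(Real.pi : ℂ)⁻¹‖ ≤ 1 := by
    rw [norm_inv, Complex.norm_real, Real.norm_of_nonneg Real.pi_pos.le]
    exact inv_le_one_of_one_le₀ (by linarith [Real.pi_gt_three])
  refine tendsto_integral_of_dominated_convergence _ (fun n => ?_) hdom
    (fun n => ae_of_all _ fun p => ?_) (ae_of_all _ fun p => ?_)
  · have hm := measurable_specMode (measurableSet_fwd lam) (continuous_disp lam 0).measurable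
      (measurable_mode κ lam x' n)
    have h := hm.stronglyMeasurable.integral_prod_left' (μ := volume)
    exact ((measurable_const.mul h.measurable).mul hθ.measurable).aestronglyMeasurable
  · by_cases hp : |p.1| < M ∧ |p.2| < M
    · rw [specKer_mode lam x' hκ]
      rw [Set.indicator_of_mem (Set.mem_Ioo.2 (abs_lt.1 hp.1)), Set.indicator_of_mem (Set.mem_Ioo.2 (abs_lt.1 hp.2)), norm_mul,
        norm_mul, norm_exp_I_mul, one_mul, one_mul, norm_mul]
      have h1 := norm_osc_le_mass (r := |lam.re|) (Y := p.2) (abs_nonneg _) (C := C)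
        (φ := fun t => chi n t * ampF κ lam x' p.1 (zed lam (p.1 - x') p.2) t) fun t ht => by
          rw [norm_mul]
          exact (mul_le_of_le_one_left (norm_nonneg _) (norm_chi_le n t)).trans (hamp p hp.1 hp.2 t ht)
      rcases eq_or_ne p.2 0 with h0 | h0
      · rw [h0, osc_zero, norm_zero]; simp
      · have h2 := integral_wt_le (abs_nonneg lam.re) h0
        calc _ ≤ 1 * (C * (2 * |p.2| ^ (-(1 / 2) : ℝ))) * Cθ := by
              gcongr
              · exact h1.trans (by gcongr)
              · exact hCθ p
          _ = _ := by ring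
    · rw [hout p hp, mul_zero, norm_zero]
      have h1 : 0 ≤ Set.indicator (Set.Ioo (-M) M) (fun _ => (1 : ℝ)) p.1 :=
        Set.indicator_nonneg (fun _ _ => zero_le_one) _
      have h2 : 0 ≤ Set.indicator (Set.Ioo (-M) M) (fun z : ℝ => |z| ^ (-(1 / 2) : ℝ)) p.2 :=
        Set.indicator_nonneg (fun _ _ => by positivity) _
      positivity
  · by_cases hp : |p.1| < M ∧ |p.2| < M
    · simp only [specKer_mode lam x' hκ]
      exact (((tendsto_osc_chi (abs_nonneg _) (measurable_ampF κ lam x' _ _)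
        (hamp p hp.1 hp.2)).const_mul _).const_mul _).mul_const _
    · simp only [hout p hp, mul_zero]; exact tendsto_const_nhds

/-- The limit n → ∞ of `mode_identity`, computed on the left through the kernels and on the right
through the completeness relation. -/
theorem integral_greenC (hκ : 0 ≤ κ) {Φ : ℝ × ℝ → ℂ} (hΦ : CTest Φ) :
    ∫ p, greenC κ lam x' p * (Lst lam Φ p + uc κ p.1 * Φ p) = Φ (x', 0) +
      (2 * Real.pi : ℂ)⁻¹ * (poleL (lam.im - κ) (trace lam x' Φ (al κ x')) -
        poleL (lam.im + κ) (trace lam x' Φ (be κ x'))) := by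
  have hcont : Continuous fun p : ℝ × ℝ => Lst lam Φ p + uc κ p.1 * Φ p :=
    (hΦ.lst lam).continuous.add (((continuous_uc κ).comp continuous_fst).mul hΦ.continuous)
  have hsupp : HasCompactSupport fun p : ℝ × ℝ => Lst lam Φ p + uc κ p.1 * Φ p :=
    (hΦ.lst lam).supp.add hΦ.supp.mul_left
  have h1 := tendsto_integral_specKer_mode lam x' hκ hcont hsupp
  simp only [mul_assoc, integral_const_mul, mode_identity lam x' hκ _ hΦ] at h1
  have h2 := (tendsto_integral_mode (κ := κ) lam x' hΦ).const_mul (2 * Real.pi : ℂ)⁻¹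
  have h3 := tendsto_nhds_unique h1 h2
  rw [h3]
  have : (Real.pi : ℂ) ≠ 0 := by exact_mod_cast Real.pi_ne_zero
  field_simp
  ring

end

/-! ### The Green kernel of the soliton operator in the upper half plane -/

lemma one_sub_th (κ x : ℝ) : 1 - th κ x = (1 + th κ x) * Real.exp (-(2 * κ * x)) := by
  have hc : Real.cosh (κ * x) ≠ 0 := (Real.cosh_pos _).ne'
  have e1 : 1 - th κ x = Real.exp (-(κ * x)) / Real.cosh (κ * x) := by
    rw [← Real.cosh_sub_sinh, th, Real.tanh_eq_sinh_div_cosh]; field_simp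
  have e2 : 1 + th κ x = Real.exp (κ * x) / Real.cosh (κ * x) := by
    rw [← Real.cosh_add_sinh, th, Real.tanh_eq_sinh_div_cosh]; field_simp
  rw [e1, e2, div_mul_eq_mul_div, ← Real.exp_add]
  congr 2; ring

lemma one_sub_th_nonneg (κ x : ℝ) : 0 ≤ 1 - th κ x := by linarith [(abs_le.1 (abs_th_le κ x)).2]

lemma one_add_th_nonneg (κ x : ℝ) : 0 ≤ 1 + th κ x := by linarith [(abs_le.1 (abs_th_le κ x)).1]

lemma one_sub_th_le (κ x : ℝ) : 1 - th κ x ≤ 2 := by linarith [(abs_le.1 (abs_th_le κ x)).1]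

lemma one_add_th_le (κ x : ℝ) : 1 + th κ x ≤ 2 := by linarith [(abs_le.1 (abs_th_le κ x)).2]

lemma one_sub_th_le_exp (κ x : ℝ) : 1 - th κ x ≤ 2 * Real.exp (-(2 * κ * x)) := by
  rw [one_sub_th]; exact mul_le_mul_of_nonneg_right (one_add_th_le κ x) (Real.exp_nonneg _)

/-- This exponential relation between the two residue coefficients makes the residues at ±iκ
multiples of the same bound-state function, and makes that function decay on both sides. -/
lemma th_weights (κ x' x : ℝ) : (1 + th κ x') * (1 - th κ x) =
    (1 - th κ x') * (1 + th κ x) * Real.exp (-(2 * κ * (x - x'))) := by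
  rw [one_sub_th κ x, one_sub_th κ x', show -(2 * κ * (x - x')) = -(2 * κ * x) - -(2 * κ * x') by ring,
    Real.exp_sub]
  field_simp

section

variable (κ : ℝ) (lam : ℂ) (x' : ℝ)

/-- The mode of the discrete spectrum. -/
def dm (x : ℝ) : ℂ := (1 + th κ x') * (1 - th κ x) *
  Complex.exp ((Complex.I * lam.re - (lam.im - κ : ℝ)) * (x - x' : ℝ))

lemma norm_dm (x : ℝ) : ‖dm κ lam x' x‖ =
    (1 + th κ x') * (1 - th κ x) * Real.exp (-((lam.im - κ) * (x - x'))) := by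
  have e : (1 + th κ x' : ℂ) * (1 - th κ x) = ((1 + th κ x') * (1 - th κ x) : ℝ) := by push_cast; ring
  rw [dm, e, norm_mul, Complex.norm_real, Real.norm_of_nonneg
    (mul_nonneg (one_add_th_nonneg _ _) (one_sub_th_nonneg _ _)), Complex.norm_exp,
    Complex.re_mul_ofReal]
  congr 2
  simp
  ring

lemma norm_dm_le (x : ℝ) : ‖dm κ lam x' x‖ ≤ 4 * Real.exp (-((lam.im - κ) * (x - x'))) ∧
    ‖dm κ lam x' x‖ ≤ 4 * Real.exp (-((lam.im + κ) * (x - x'))) := by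
  have h1 := one_sub_th_nonneg κ x
  have h2 := one_sub_th_nonneg κ x'
  have h3 := one_add_th_nonneg κ x
  have h4 := one_add_th_nonneg κ x'
  have g1 := one_sub_th_le κ x
  have g2 := one_sub_th_le κ x'
  have g3 := one_add_th_le κ x
  have g4 := one_add_th_le κ x'
  rw [norm_dm]
  constructor
  · refine mul_le_mul_of_nonneg_right ?_ (Real.exp_nonneg _)
    calc _ ≤ (2 : ℝ) * 2 := by gcongr
      _ = 4 := by norm_num
  · rw [th_weights, mul_assoc _ (Real.exp _), ← Real.exp_add]
    rw [show -(2 * κ * (x - x')) + -((lam.im - κ) * (x - x')) = -((lam.im + κ) * (x - x')) by ring]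
    refine mul_le_mul_of_nonneg_right ?_ (Real.exp_nonneg _)
    calc _ ≤ (2 : ℝ) * 2 := by gcongr
      _ = 4 := by norm_num

/-- The discrete mode decays on both sides. -/
lemma norm_dm_le_exp_abs {a : ℝ} (ha : a ≤ κ - lam.im) (ha' : a ≤ lam.im + κ) (x : ℝ) :
    ‖dm κ lam x' x‖ ≤ 4 * Real.exp (-(a * |x - x'|)) := by
  rcases le_total 0 (x - x') with h | h
  · refine (norm_dm_le κ lam x' x).2.trans ?_
    rw [abs_of_nonneg h]; gcongr
  · refine (norm_dm_le κ lam x' x).1.trans ?_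
    rw [abs_of_nonpos h]
    refine mul_le_mul_of_nonneg_left (Real.exp_le_exp.2 ?_) (by norm_num)
    nlinarith

lemma hasDerivAt_dm (x : ℝ) :
    HasDerivAt (dm κ lam x') ((Complex.I * lam - κ * th κ x) * dm κ lam x' x) x := by
  set c := Complex.I * lam.re - (lam.im - κ : ℝ) with hc
  have hcl : c = Complex.I * lam + κ := by
    rw [hc]; push_cast
    linear_combination (-Complex.I) * (Complex.re_add_im lam).symm - lam.im * Complex.I_sq
  have h1 : HasDerivAt (fun x : ℝ => Complex.exp (c * (x - x' : ℝ)))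
      (c * Complex.exp (c * (x - x' : ℝ))) x := (hasDerivAt_cexp_mul c (x - x')).comp_sub_const x x'
  have h2 := (((hasDerivAt_thc κ x).const_sub 1).const_mul (1 + th κ x' : ℂ)).mul h1
  refine h2.congr_deriv ?_
  rw [dm, ← hc]
  linear_combination ((1 + th κ x') * (1 - th κ x) * Complex.exp (c * (x - x' : ℝ))) * hcl

lemma hasDerivAt_dm' (x : ℝ) : HasDerivAt (fun x => (Complex.I * lam - κ * th κ x) * dm κ lam x' x)
    (((Complex.I * lam - κ * th κ x) ^ 2 - κ ^ 2 * (1 - (th κ x : ℂ) ^ 2)) * dm κ lam x' x) x :=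
  ((((hasDerivAt_thc κ x).const_mul (κ : ℂ)).const_sub (Complex.I * lam)).mul
    (hasDerivAt_dm κ lam x' x)).congr_deriv (by ring)

/-- The discrete part of the Green kernel of the soliton operator. -/
def greenD (p : ℝ × ℝ) : ℂ := (dc (lam.im - κ) * (κ / 2) : ℝ) *
  specMode ∅ (fun _ => -(lam ^ 2 + κ ^ 2)) (dm κ lam) x' p

variable {κ lam}

lemma integral_greenD (hl : 0 ≤ lam.im) {Φ : ℝ × ℝ → ℂ} (hΦ : CTest Φ) :
    ∫ p, greenD κ lam x' p * (Lst lam Φ p + uc κ p.1 * Φ p) =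
      (dc (lam.im - κ) * (κ / 2) : ℝ) * ∫ x, dm κ lam x' x * Φ (x, 0) := by
  simp only [greenD, mul_assoc, integral_const_mul]
  by_cases h : 0 < lam.im - κ
  · simp [dc, h]
  congr 1
  refine integral_specMode (continuous_uc κ) (C := 4) (fun t x => ?_)
    (hasDerivAt_dm κ lam) (hasDerivAt_dm' κ lam) (fun t x => ?_) hΦ x'
  · refine (norm_dm_le_exp_abs κ lam t (a := 0) (by linarith) (by linarith) x).trans ?_
    simp
  · rw [uc]; linear_combination (lam ^ 2 * dm κ lam t x) * Complex.I_sq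

/-- By `th_weights` the half-line integrals of the two poles coincide and cancel. For Im λ ≥ 0 the
lower pole gives no full-line term, so only the one from the pole at iκ remains, with weight `dc`.
-/
lemma poleL_sub (hκ : 0 < κ) (hl : 0 ≤ lam.im) (Φ : ℝ × ℝ → ℂ) :
    poleL (lam.im - κ) (trace lam x' Φ (al κ x')) - poleL (lam.im + κ) (trace lam x' Φ (be κ x')) =
      -(Real.pi * κ * dc (lam.im - κ) * ∫ x, dm κ lam x' x * Φ (x, 0)) := by
  have hd : dc (lam.im + κ) = 0 := if_pos (by positivity)
  have e1 : ∀ X : ℝ, (Real.exp (-(lam.im - κ) * X) : ℂ) * trace lam x' Φ (al κ x') X =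
      (Real.exp (-(lam.im + κ) * X) : ℂ) * trace lam x' Φ (be κ x') X := by
    intro X
    have h := congrArg Complex.ofReal (th_weights κ x' (x' + X))
    have h2 : Real.exp (-(lam.im + κ) * X) =
        Real.exp (-(2 * κ * (x' + X - x'))) * Real.exp (-(lam.im - κ) * X) := by
      rw [← Real.exp_add]; congr 1; ring
    rw [h2]
    simp only [trace, al, be]
    push_cast at h ⊢
    linear_combination (Complex.exp (-(lam.im - κ) * X) * Complex.exp (Complex.I * lam.re * X) *
      (Complex.I * κ / 2) * Φ (x' + X, 0)) * h
  have e2 : ∫ X : ℝ, (Real.exp (-(lam.im - κ) * X) : ℂ) * trace lam x' Φ (al κ x') X =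
      Complex.I * κ / 2 * ∫ x, dm κ lam x' x * Φ (x, 0) := by
    rw [← integral_const_mul, ← integral_add_left_eq_self
      (fun x => Complex.I * κ / 2 * (dm κ lam x' x * Φ (x, 0))) x']
    refine integral_congr_ae (ae_of_all _ fun X => ?_)
    simp only [trace, al, dm, add_sub_cancel_left]
    have : Complex.exp ((Complex.I * lam.re - (lam.im - κ : ℝ)) * X) =
        Real.exp (-(lam.im - κ) * X) * Complex.exp (Complex.I * lam.re * X) := by
      rw [Complex.ofReal_exp, ← Complex.exp_add]; congr 1; push_cast; ring
    rw [this]; ring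
  rw [poleL, poleL, hd, setIntegral_congr_fun measurableSet_Ioi fun X _ => e1 X, e2]
  push_cast
  linear_combination (Real.pi * dc (lam.im - κ) * κ * ∫ x, dm κ lam x' x * Φ (x, 0)) * Complex.I_sq

variable (κ lam) in
lemma measurable_dm : Measurable (Function.uncurry (dm κ lam)) := by
  have := (continuous_th κ).measurable
  unfold Function.uncurry dm; fun_prop

variable (κ lam) in
lemma measurable_greenD : Measurable (Function.uncurry (greenD κ lam)) := by
  have h := measurable_specMode (S := ∅) MeasurableSet.empty
    (measurable_const (a := -(lam ^ 2 + (κ : ℂ) ^ 2)) (β := ℝ)) (measurable_dm κ lam)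
  exact h.const_mul _

lemma dc_nonneg (m : ℝ) : 0 ≤ dc m := by unfold dc; split_ifs <;> norm_num

lemma dc_le_one (m : ℝ) : dc m ≤ 1 := by unfold dc; split_ifs <;> norm_num

/-- The rate in y is Re(λ² + κ²) = (Re λ)² + (κ - Im λ)(κ + Im λ). The first condition on a is
required only when the bound state is present. -/
lemma norm_greenD_le (hκ : 0 < κ) (p : ℝ × ℝ) {a : ℝ}
    (ha : dc (lam.im - κ) ≠ 0 → a ≤ κ - lam.im) (ha' : a ≤ lam.im + κ) :
    ‖greenD κ lam x' p‖ ≤ 2 * κ * (Real.exp (-(a * |p.1 - x'|)) *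
      Real.exp (-((lam.re ^ 2 + (κ - lam.im) * (lam.im + κ)) * |p.2|))) := by
  by_cases hd : dc (lam.im - κ) = 0
  · rw [greenD, hd]; simp; positivity
  rw [greenD, specMode]
  simp only [Set.mem_empty_iff_false, if_false]
  split_ifs with hp
  · have h1 := norm_dm_le_exp_abs κ lam x' (ha hd) ha' p.1
    have h2 : ‖Complex.exp (- -(lam ^ 2 + κ ^ 2) * p.2)‖ =
        Real.exp (-((lam.re ^ 2 + (κ - lam.im) * (lam.im + κ)) * |p.2|)) := by
      have h3 : (lam ^ 2 + (κ : ℂ) ^ 2).re = lam.re ^ 2 + (κ - lam.im) * (lam.im + κ) := by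
        simp [sq]; ring
      rw [Complex.norm_exp, Complex.re_mul_ofReal, abs_of_neg hp, neg_neg, h3]
      congr 1
      ring
    rw [norm_mul, norm_neg, norm_mul, h2, Complex.norm_real, Real.norm_of_nonneg
      (mul_nonneg (dc_nonneg _) (by positivity))]
    calc _ ≤ (1 * (κ / 2)) * (Real.exp (-((lam.re ^ 2 + (κ - lam.im) * (lam.im + κ)) * |p.2|)) *
          (4 * Real.exp (-(a * |p.1 - x'|)))) := by
          gcongr
          exact dc_le_one _
      _ = _ := by ring
  · rw [mul_zero, norm_zero]; positivity

lemma norm_greenD_le_const (hκ : 0 < κ) (hl : 0 ≤ lam.im) (p : ℝ × ℝ) :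
    ‖greenD κ lam x' p‖ ≤ 2 * κ := by
  by_cases hd : dc (lam.im - κ) = 0
  · rw [greenD, hd]; simp; positivity
  have hm : lam.im ≤ κ := by
    by_contra hcon
    exact hd (if_pos (by linarith))
  refine (norm_greenD_le x' hκ p (a := 0) (fun _ => by linarith) (by linarith)).trans ?_
  refine mul_le_of_le_one_right (by positivity) ?_
  rw [zero_mul, neg_zero, Real.exp_zero, one_mul, Real.exp_le_one_iff, neg_nonpos]
  exact mul_nonneg (add_nonneg (sq_nonneg _) (mul_nonneg (by linarith) (by linarith))) (abs_nonneg _)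

variable (κ lam) in
lemma osc_ampF (x Z Y : ℝ) : osc |lam.re| Y (ampF κ lam x' x Z) =
    osc |lam.re| Y (fun t => (Real.cos (t * Z) : ℂ)) +
    (-Complex.I * al κ x' x * (osc |lam.re| Y (oddM (lam.im - κ) Z) + osc |lam.re| Y (evenM (lam.im - κ) Z))
    + Complex.I * be κ x' x * (osc |lam.re| Y (oddM (lam.im + κ) Z) + osc |lam.re| Y (evenM (lam.im + κ) Z))) := by
  have hr := abs_nonneg lam.re
  have hS : ∀ m, ∀ t, 0 < t → ‖oddM m Z t + evenM m Z t‖ ≤ |Z| + |m|⁻¹ := fun m t ht =>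
    (norm_add_le _ _).trans (add_le_add (norm_oddM_le_abs ht Z) (norm_evenM_le_inv m Z t))
  have mS : ∀ m, Measurable fun t => oddM m Z t + evenM m Z t := fun m =>
    (measurable_oddM_apply m Z).add (measurable_evenM_apply m Z)
  have hc : ∀ (c : ℂ) m, ∀ t, 0 < t → ‖c * (oddM m Z t + evenM m Z t)‖ ≤ ‖c‖ * (|Z| + |m|⁻¹) := by
    intro c m t ht
    rw [norm_mul]; exact mul_le_mul_of_nonneg_left (hS m t ht) (norm_nonneg _)
  have mc : ∀ (c : ℂ) m, Measurable fun t => c * (oddM m Z t + evenM m Z t) := fun c m =>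
    (mS m).const_mul c
  have e : ∀ m, osc |lam.re| Y (fun t => oddM m Z t + evenM m Z t) =
      osc |lam.re| Y (oddM m Z) + osc |lam.re| Y (evenM m Z) := fun m =>
    osc_add hr (measurable_oddM_apply m Z) (fun t ht => norm_oddM_le_abs ht Z)
      (measurable_evenM_apply m Z) fun t _ => norm_evenM_le_inv m Z t
  unfold ampF
  rw [osc_add hr (by fun_prop) (C := 1) (fun t _ => by
      rw [Complex.norm_real]; exact Real.abs_cos_le_one _) (ψ := fun t => _ + _) ((mc _ _).add (mc _ _))
      (fun t ht => (norm_add_le _ _).trans (add_le_add (hc _ _ t ht) (hc _ _ t ht))),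
    osc_add hr (mc _ _) (hc _ _) (mc _ _) (hc _ _), osc_const_mul, osc_const_mul, e, e]

/-- The cosine contributes 2 and the singularity; each of the two poles contributes its coefficient,
at most 2κ, times 6 + 2 from the odd and even multipliers. No constant involves λ. -/
lemma norm_greenC_le (hκ : 0 ≤ κ) (p : ℝ × ℝ) :
    ‖greenC κ lam x' p‖ ≤ 2 + 32 * κ + sing (zed lam (p.1 - x') p.2) p.2 := by
  have hr := abs_nonneg lam.re
  rw [greenC, norm_mul, norm_exp_I_mul, one_mul, norm_mul, norm_inv, Complex.norm_real,
    Real.norm_of_nonneg Real.pi_pos.le]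
  refine (mul_le_of_le_one_left (norm_nonneg _)
    (inv_le_one_of_one_le₀ (by linarith [Real.pi_gt_three]))).trans ?_
  rw [osc_ampF κ lam x' _ _ _]
  set Z := zed lam (p.1 - x') p.2
  have hm : ∀ m, ‖osc |lam.re| p.2 (oddM m Z) + osc |lam.re| p.2 (evenM m Z)‖ ≤ 8 := fun m =>
    (norm_add_le _ _).trans ((add_le_add (norm_osc_oddM_le hr m Z _)
      (norm_osc_evenM_le hr m Z _)).trans (by norm_num))
  have h1 : ∀ (c : ℂ) (m : ℝ), ‖c‖ ≤ 2 * κ →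
      ‖c * (osc |lam.re| p.2 (oddM m Z) + osc |lam.re| p.2 (evenM m Z))‖ ≤ 2 * κ * 8 := by
    intro c m hc
    rw [norm_mul]; exact mul_le_mul hc (hm m) (norm_nonneg _) (by positivity)
  have a1 := h1 (-Complex.I * al κ x' p.1) (lam.im - κ) (by simpa using norm_al_le hκ x' p.1)
  have a2 := h1 (Complex.I * be κ x' p.1) (lam.im + κ) (by simpa using norm_be_le hκ x' p.1)
  have a3 := norm_osc_cos_le hr Z p.2
  refine (norm_add_le _ _).trans ((add_le_add a3 ((norm_add_le _ _).trans
    (add_le_add a1 a2))).trans (le_of_eq ?_))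
  ring

variable (κ lam) in
lemma measurable_greenC : Measurable (Function.uncurry (greenC κ lam)) := by
  have hA : Measurable fun z : ℝ × (ℝ × ℝ) => ((zed lam (z.2.1 - z.1) z.2.2, z.2.2) : ℝ × ℝ) := by
    unfold zed; fun_prop
  have h1 := (measurable_osc |lam.re| (φ := fun Z t => (Real.cos (t * Z) : ℂ))
      (by unfold Function.uncurry; fun_prop)).comp hA
  have h2 := fun m => (measurable_osc |lam.re| (measurable_oddM (m := m))).comp hA
  have h3 := fun m => (measurable_osc |lam.re| (measurable_evenM (m := m))).comp hA
  simp only [Function.comp_def] at h1 h2 h3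
  have hT : Measurable (th κ) := (continuous_th κ).measurable
  have hP : Measurable fun z : ℝ × (ℝ × ℝ) =>
      Complex.exp (Complex.I * lam.re * zed lam (z.2.1 - z.1) z.2.2) := by
    unfold zed; fun_prop
  have hal : Measurable fun z : ℝ × (ℝ × ℝ) => al κ z.1 z.2.1 := by unfold al; fun_prop
  have hbe : Measurable fun z : ℝ × (ℝ × ℝ) => be κ z.1 z.2.1 := by unfold be; fun_prop
  have hsum := h1.add (((hal.const_mul (-Complex.I)).mul ((h2 (lam.im - κ)).add (h3 (lam.im - κ)))).add
    ((hbe.const_mul Complex.I).mul ((h2 (lam.im + κ)).add (h3 (lam.im + κ)))))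
  have := hP.mul (hsum.const_mul (Real.pi : ℂ)⁻¹)
  convert this using 1
  ext z
  simp only [Function.uncurry, greenC, osc_ampF]
  rfl

/-- The Green kernel of the soliton operator. -/
def green (κ : ℝ) (lam : ℂ) (x' : ℝ) (p : ℝ × ℝ) : ℂ := greenC κ lam x' p + greenD κ lam x' p

lemma measurable_sing : Measurable (Function.uncurry sing) := by
  unfold Function.uncurry sing
  refine Measurable.ite ?_ (by fun_prop) measurable_const
  exact (measurableSet_lt (f := fun z : ℝ × ℝ => |z.1|) (by fun_prop) measurable_const).inter
    (measurableSet_lt (f := fun z : ℝ × ℝ => |z.2|) (by fun_prop) measurable_const)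

/-- The profile of the singularity of the Green kernel. -/
def prof (lam : ℂ) (p : ℝ × ℝ) : ℝ := sing (zed lam p.1 p.2) p.2

lemma prof_nonneg (lam : ℂ) (p : ℝ × ℝ) : 0 ≤ prof lam p := sing_nonneg _ _

lemma measurable_prof (lam : ℂ) : Measurable (prof lam) := by
  have h : Measurable fun p : ℝ × ℝ => ((zed lam p.1 p.2, p.2) : ℝ × ℝ) := by unfold zed; fun_prop
  exact measurable_sing.comp h

/-- In the sheared variables (Z, Y) the function is a product with integral 2 · 2 · 4. The shear
preserves area, so the value does not depend on λ. -/
lemma integral_prof (lam : ℂ) : Integrable (prof lam) ∧ ∫ p, prof lam p = 16 := by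
  have hf : Integrable (Set.indicator (Set.Ioo (-1) 1) fun _ : ℝ => (1 : ℝ)) :=
    (integrable_indicator_iff measurableSet_Ioo).2 (by simp)
  have hfm : Measurable (Set.indicator (Set.Ioo (-1) 1) fun _ : ℝ => (1 : ℝ)) :=
    measurable_const.indicator measurableSet_Ioo
  obtain ⟨hg, hg'⟩ := integral_inv_sqrt_abs zero_le_one
  have hgm : Measurable (Set.indicator (Set.Ioo (-1) 1) fun z : ℝ => |z| ^ (-(1 / 2) : ℝ)) :=
    (by fun_prop : Measurable fun z : ℝ => |z| ^ (-(1 / 2) : ℝ)).indicator measurableSet_Ioo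
  obtain ⟨h1, h2⟩ := integral_shear hfm hgm hf hg (2 * lam.im)
  have e : prof lam = fun p => 2 * (Set.indicator (Set.Ioo (-1) 1) (fun _ : ℝ => (1 : ℝ))
      (p.1 + 2 * lam.im * p.2) *
      Set.indicator (Set.Ioo (-1) 1) (fun z : ℝ => |z| ^ (-(1 / 2) : ℝ)) p.2) := by
    ext p
    simp only [prof, sing, Set.indicator, Set.mem_Ioo, ← abs_lt]
    by_cases ha : |zed lam p.1 p.2| < 1 <;> by_cases hb : |p.2| < 1 <;> simp [ha, hb]
  rw [e]
  refine ⟨h1.const_mul 2, ?_⟩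
  rw [integral_const_mul, h2, hg', integral_indicator measurableSet_Ioo]
  simp
  norm_num

/-- The key estimate: the only λ-dependence is in the slope of the strip carrying the singularity,
whose mass is fixed. The smallness constant of the theorem can thus be chosen independently of λ. -/
lemma norm_green_le (hκ : 0 < κ) (hl : 0 ≤ lam.im) (p : ℝ × ℝ) :
    ‖green κ lam x' p‖ ≤ 2 + 34 * κ + prof lam (p.1 - x', p.2) := by
  have h1 := norm_greenC_le (lam := lam) x' hκ.le p
  have h2 := norm_greenD_le_const x' hκ hl p
  rw [green, prof]
  exact (norm_add_le _ _).trans (by linarith)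

variable (κ lam) in
lemma measurable_green : Measurable (Function.uncurry (green κ lam)) :=
  (measurable_greenC κ lam).add (measurable_greenD κ lam)

lemma integrable_mul_of_prof {K θ : ℝ × ℝ → ℂ} (hK : Measurable K) {C : ℝ}
    (hb : ∀ p, ‖K p‖ ≤ C + prof lam (p.1 - x', p.2)) (hθ : BM θ) (hi : Integrable θ) :
    Integrable fun p => K p * θ p := by
  obtain ⟨D, hD0, hD⟩ := hθ.nonneg_bound
  have h1 : Integrable fun p : ℝ × ℝ => prof lam (p.1 - x', p.2) := by
    have e : (fun p : ℝ × ℝ => prof lam (p.1 - x', p.2)) = fun p => prof lam (p - (x', 0)) := by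
      ext p; congr 1; ext <;> simp
    rw [e]
    exact (integral_prof lam).1.comp_sub_right (x', 0)
  refine Integrable.mono' ((hi.norm.const_mul C).add (h1.const_mul D))
    (hK.mul hθ.meas).aestronglyMeasurable (ae_of_all _ fun p => ?_)
  rw [norm_mul]
  refine (mul_le_mul_of_nonneg_right (hb p) (norm_nonneg _)).trans ?_
  rw [add_mul]
  refine add_le_add le_rfl ?_
  rw [mul_comm]
  exact mul_le_mul_of_nonneg_right (hD p) (prof_nonneg lam _)

/-- The residue terms left over by the continuous part are exactly cancelled by the bound-state
part. -/
theorem integral_green (hκ : 0 < κ) (hl : 0 ≤ lam.im) {Φ : ℝ × ℝ → ℂ} (hΦ : CTest Φ) :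
    ∫ p, green κ lam x' p * (Lst lam Φ p + uc κ p.1 * Φ p) = Φ (x', 0) := by
  have hθ : BM fun p : ℝ × ℝ => Lst lam Φ p + uc κ p.1 * Φ p :=
    (hΦ.lst lam).bm.add ((bm_uc κ).mul hΦ.bm)
  have hi : Integrable fun p : ℝ × ℝ => Lst lam Φ p + uc κ p.1 * Φ p :=
    (hΦ.lst lam).integrable.add ((bm_uc κ).integrable_mul hΦ.integrable)
  have i1 := integrable_mul_of_prof (K := greenC κ lam x') x' (measurable_greenC κ lam).of_uncurry_left
    (fun p => norm_greenC_le (lam := lam) x' hκ.le p) hθ hi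
  have i2 := integrable_mul_of_prof (lam := lam) (K := greenD κ lam x') x'
    (measurable_greenD κ lam).of_uncurry_left (C := 2 * κ)
    (fun p => (norm_greenD_le_const x' hκ hl p).trans (le_add_of_nonneg_right (prof_nonneg _ _))) hθ hi
  simp only [green, add_mul]
  rw [integral_add i1 i2, integral_greenC lam x' hκ.le hΦ, integral_greenD x' hl hΦ,
    poleL_sub x' hκ hl Φ]
  have : (Real.pi : ℂ) ≠ 0 := by exact_mod_cast Real.pi_ne_zero
  push_cast
  field_simp
  ring

end

/-! ### Decay of the Green kernel -/

lemma Van.of_le {f g : ℝ × ℝ → ℂ} (hg : Van g) (h : ∀ p, ‖f p‖ ≤ ‖g p‖) : Van f :=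
  squeeze_zero_norm h (by simpa using hg.norm)

/-- The homeomorphism to the coordinates of the kernels. -/
def shear (a b : ℝ) : (ℝ × ℝ) ≃ₜ (ℝ × ℝ) where
  toFun p := (p.1 - a + b * p.2, p.2)
  invFun p := (p.1 + a - b * p.2, p.2)
  left_inv p := Prod.ext (show p.1 - a + b * p.2 + a - b * p.2 = p.1 by ring) rfl
  right_inv p := Prod.ext (show p.1 + a - b * p.2 - a + b * p.2 = p.1 by ring) rfl
  continuous_toFun := by fun_prop
  continuous_invFun := by fun_prop

lemma Van.comp_shear {g : ℝ × ℝ → ℂ} (hg : Van g) (a b : ℝ) :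
    Van fun p => g (p.1 - a + b * p.2, p.2) :=
  hg.comp (shear a b).isClosedEmbedding.tendsto_cocompact

lemma van_exp {a b : ℝ} (ha : 0 < a) (hb : 0 < b) :
    Van fun p => (Real.exp (-(a * |p.1|)) * Real.exp (-(b * |p.2|)) : ℝ) := by
  refine van_of_forall fun ε hε => ?_
  have h : ∀ c : ℝ, 0 < c → ∀ᶠ s in atTop, Real.exp (-(c * s)) < ε := fun c hc =>
    (Real.tendsto_exp_neg_atTop_nhds_zero.comp (tendsto_id.const_mul_atTop hc)).eventually_lt_const hε
  obtain ⟨N, hN⟩ := ((h a ha).and (h b hb)).exists_forall_of_atTop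
  refine ⟨N, fun Z Y hZY => ?_⟩
  rw [Complex.norm_real, Real.norm_of_nonneg (by positivity)]
  have h1 : Real.exp (-(a * |Z|)) ≤ 1 := Real.exp_le_one_iff.2 (by simp; positivity)
  have h2 : Real.exp (-(b * |Y|)) ≤ 1 := Real.exp_le_one_iff.2 (by simp; positivity)
  rcases hZY with h | h
  · exact (mul_le_of_le_one_right (Real.exp_nonneg _) h2).trans (hN _ h).1.le
  · exact (mul_le_of_le_one_left (Real.exp_nonneg _) h1).trans (hN _ h).2.le

/-- The folded kernel of a pole on the real axis, with its residue. -/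
def poleZ (r : ℝ) (q : ℝ × ℝ) : ℂ :=
  osc r q.2 (oddM 0 q.1) - if q.2 < 0 then (Real.pi / 2 * Real.exp (r ^ 2 * q.2) : ℝ) else 0

/-- For Y > 0 the integral decays in Z by oscillation, and in Y by its mass while Z stays bounded.
For Y < 0 it decays in Y by the estimate near the pole. As Z → -∞ it tends to (π/2)e^{r²Y}, which
`poleZ` subtracts, and as Z → +∞ it need not decay but the factor 1 - tanh does. -/
lemma van_poleZ {κ r : ℝ} (hκ : 0 < κ) (hr : 0 < r) (x' : ℝ) :
    Van fun q => (1 - th κ (q.1 + x' - 2 * κ * q.2) : ℝ) * poleZ r q := by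
  refine van_of_forall fun ε hε => ?_
  have hlim : ∀ c : ℝ, ∀ᶠ s : ℝ in atTop, 2 * (c / s) < ε := fun c => by
    have : Tendsto (fun s : ℝ => 2 * (c / s)) atTop (𝓝 (2 * 0)) :=
      (tendsto_const_nhds.div_atTop tendsto_id).const_mul 2
    rw [mul_zero] at this
    exact this.eventually_lt_const hε
  have hexp : ∀ᶠ s : ℝ in atTop, 2 * Real.exp (-(2 * κ * (s + x'))) * 8 < ε := by
    have : Tendsto (fun s : ℝ => 2 * Real.exp (-(2 * κ * (s + x'))) * 8) atTop (𝓝 (2 * 0 * 8)) :=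
      ((Real.tendsto_exp_neg_atTop_nhds_zero.comp ((tendsto_atTop_add_const_right _ x'
        tendsto_id).const_mul_atTop (by positivity : 0 < 2 * κ))).const_mul 2).mul_const 8
    rw [mul_zero, zero_mul] at this
    exact this.eventually_lt_const hε
  obtain ⟨N₀, hN₀⟩ := ((hlim (2 / r)).and ((hlim (4 / r)).and ((hlim (12 / r ^ 2)).and
    hexp))).exists_forall_of_atTop
  set N₁ := max N₀ 1
  have hN₁ : 0 < N₁ := lt_of_lt_of_le one_pos (le_max_right _ _)
  -- For Y > 0 and |Z| < N₁ the available bound is N₁/(r|Y|), so the threshold for Y is chosen after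
  -- the one for Z.
  obtain ⟨N₂, hN₂⟩ := (hlim (N₁ / r)).exists_forall_of_atTop
  refine ⟨max N₁ N₂, fun Z Y hZY => ?_⟩
  have hT0 := one_sub_th_nonneg κ (Z + x' - 2 * κ * Y)
  have hT2 := one_sub_th_le κ (Z + x' - 2 * κ * Y)
  simp only [norm_mul, Complex.norm_real, Real.norm_of_nonneg hT0]
  have key : ∀ B : ℝ, ‖poleZ r (Z, Y)‖ ≤ B → 2 * B < ε →
      (1 - th κ (Z + x' - 2 * κ * Y)) * ‖poleZ r (Z, Y)‖ ≤ ε := fun B h1 h2 =>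
    (mul_le_mul hT2 h1 (norm_nonneg _) (by norm_num)).trans h2.le
  rcases lt_trichotomy Y 0 with hY | hY | hY
  · have e : poleZ r (Z, Y) = osc r Y (oddM 0 Z) - (Real.pi / 2 * Real.exp (r ^ 2 * Y) : ℝ) := by
      simp only [poleZ]; rw [if_pos hY]
    have hres : ‖((Real.pi / 2 * Real.exp (r ^ 2 * Y) : ℝ) : ℂ)‖ ≤ 2 * Real.exp (r ^ 2 * Y) := by
      rw [Complex.norm_real, Real.norm_of_nonneg (by positivity)]
      gcongr; linarith [Real.pi_lt_four]
    by_cases hZ : N₁ ≤ |Z|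
    · have hf := hN₀ |Z| ((le_max_left _ _).trans hZ)
      rcases lt_or_ge Z 0 with hZ0 | hZ0
      · refine key (4 / r / |Z|) ?_ hf.2.1
        rw [e, div_div]; exact norm_osc_oddM_zero_sub_le hr hY hZ0
      -- As Y < 0, the argument of tanh is at least κ(|Z| + x').
      · have h1 : 1 - th κ (Z + x' - 2 * κ * Y) ≤ 2 * Real.exp (-(2 * κ * (|Z| + x'))) := by
          refine (one_sub_th_le_exp _ _).trans ?_
          rw [abs_of_nonneg hZ0]
          gcongr
          nlinarith
        have h2 : ‖poleZ r (Z, Y)‖ ≤ 8 := by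
          rw [e]
          refine (norm_sub_le _ _).trans ?_
          have h3 := norm_osc_oddM_le hr.le 0 Z Y
          have h4 : Real.exp (r ^ 2 * Y) ≤ 1 := Real.exp_le_one_iff.2 (by nlinarith [sq_nonneg r])
          linarith
        exact (mul_le_mul h1 h2 (norm_nonneg _) (by positivity)).trans hf.2.2.2.le
    · have hYN : N₁ ≤ |Y| := by
        rcases hZY with h | h
        · exact absurd ((le_max_left _ _).trans h) hZ
        · exact (le_max_left _ _).trans h
      have hf := hN₀ |Y| ((le_max_left _ _).trans hYN)
      refine key (12 / r ^ 2 / |Y|) ?_ hf.2.2.1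
      rw [e]
      refine (norm_sub_le _ _).trans ?_
      have h3 := norm_osc_oddM_zero_le_of_neg hr (Z := Z) hY
      have hs : 0 < r ^ 2 * |Y| := mul_pos (by positivity) (abs_pos.2 hY.ne)
      have h4 : Real.exp (r ^ 2 * Y) ≤ 1 / (r ^ 2 * |Y|) := by
        rw [le_div_iff₀ hs, abs_of_neg hY]
        have h5 := Real.add_one_le_exp (-(r ^ 2 * Y))
        have h6 : Real.exp (r ^ 2 * Y) * Real.exp (-(r ^ 2 * Y)) = 1 := by
          rw [← Real.exp_add]; simp
        nlinarith [Real.exp_pos (r ^ 2 * Y)]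
      calc _ ≤ 10 / (r ^ 2 * |Y|) + 2 * (1 / (r ^ 2 * |Y|)) := by linarith
        _ = 12 / r ^ 2 / |Y| := by rw [div_div]; ring
  · subst hY
    simp [poleZ, osc_zero, hε.le]
  · have e : poleZ r (Z, Y) = osc r Y (oddM 0 Z) := by
      simp [poleZ, hY.not_gt]
    by_cases hZ : N₁ ≤ |Z|
    · have hf := hN₀ |Z| ((le_max_left _ _).trans hZ)
      refine key (2 / r / |Z|) ?_ hf.1
      rw [e, div_div]; exact norm_osc_oddM_zero_le_of_pos hr hY (abs_pos.1 (hN₁.trans_le hZ))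
    · have hYN : N₂ ≤ |Y| := by
        rcases hZY with h | h
        · exact absurd ((le_max_left _ _).trans h) hZ
        · exact (le_max_right _ _).trans h
      refine key (N₁ / r / |Y|) ?_ (hN₂ _ hYN)
      rw [e]
      refine (norm_osc_le_mass hr.le (C := |Z|) fun t ht => norm_oddM_le_abs ht Z).trans ?_
      calc _ ≤ N₁ * (r * |Y|)⁻¹ :=
            mul_le_mul (not_le.1 hZ).le (integral_wt_le_inv hr hY.ne')
              (setIntegral_nonneg (measurableSet_reg r Y) fun t _ => (wt_pos r Y t).le) hN₁.le
        _ = N₁ / r / |Y| := by rw [div_div]; rfl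

section

variable {κ : ℝ} {lam : ℂ} (x' : ℝ)

lemma bm_al (κ x' : ℝ) : BM fun p : ℝ × ℝ => al κ x' p.1 :=
  ((((BM.const 1).sub (bm_tc κ)).const_mul (Complex.I * κ / 2)).mul (BM.const (1 + th κ x')))

lemma bm_be (κ x' : ℝ) : BM fun p : ℝ × ℝ => be κ x' p.1 :=
  ((((BM.const 1).add (bm_tc κ)).const_mul (Complex.I * κ / 2)).mul (BM.const (1 - th κ x')))

lemma bm_phase (lam : ℂ) (x' : ℝ) : BM fun p : ℝ × ℝ =>
    Complex.exp (Complex.I * lam.re * zed lam (p.1 - x') p.2) * (Real.pi : ℂ)⁻¹ :=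
  (⟨by unfold zed; fun_prop, 1, fun p => (norm_exp_I_mul _ _).le⟩ : BM fun p : ℝ × ℝ =>
    Complex.exp (Complex.I * lam.re * zed lam (p.1 - x') p.2)).mul (BM.const _)

lemma van_greenC_of_ne (hm : lam.im - κ ≠ 0) (hm' : lam.im + κ ≠ 0) : Van (greenC κ lam x') := by
  have hr := abs_nonneg lam.re
  have h0 := (van_osc_cos hr).comp_shear x' (2 * lam.im)
  have h1 := (van_osc_oddM hr hm).comp_shear x' (2 * lam.im)
  have h2 := (van_osc_evenM hr hm).comp_shear x' (2 * lam.im)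
  have h3 := (van_osc_oddM hr hm').comp_shear x' (2 * lam.im)
  have h4 := (van_osc_evenM hr hm').comp_shear x' (2 * lam.im)
  have h := Van.bm_mul (bm_phase lam x') (h0.add ((Van.bm_mul ((bm_al κ x').const_mul (-Complex.I))
    (h1.add h2)).add (Van.bm_mul ((bm_be κ x').const_mul Complex.I) (h3.add h4))))
  refine h.of_le fun p => le_of_eq ?_
  simp only [greenC, osc_ampF, zed, mul_assoc]

lemma van_greenD_of_ne (hκ : 0 < κ) (hl : 0 ≤ lam.im) (hm : lam.im - κ ≠ 0) :
    Van (greenD κ lam x') := by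
  by_cases hd : dc (lam.im - κ) = 0
  · refine (tendsto_const_nhds (x := (0 : ℂ))).congr fun p => ?_
    simp [greenD, hd]
  have hlt : lam.im < κ := by
    by_contra hcon
    exact hd (if_pos (lt_of_le_of_ne (by linarith) hm.symm))
  have h1 : 0 < κ - lam.im := by linarith
  have h2 : 0 < lam.im + κ := by linarith
  have h := (van_exp (lt_min h1 h2) (by positivity :
    0 < lam.re ^ 2 + (κ - lam.im) * (lam.im + κ))).comp_shear x' 0
  refine (Van.bm_mul (BM.const (2 * κ)) h).of_le fun p => ?_
  refine (norm_greenD_le x' hκ p (fun _ => min_le_left _ _) (min_le_right _ _)).trans (le_of_eq ?_)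
  rw [norm_mul, Complex.norm_real, Real.norm_of_nonneg (by positivity)]
  simp [abs_of_pos hκ]

/-- With Im λ = κ the bound state does not decay by itself as x → -∞. Its half weight matches the
limit of the odd integral with pole at distance 0, and the two combine into `poleZ`; the even
integral at distance 0 is identically zero. -/
lemma van_green_of_eq (hκ : 0 < κ) (hm : lam.im = κ) (hr : lam.re ≠ 0) : Van (green κ lam x') := by
  have hr0 := abs_pos.2 hr
  have hm' : lam.im + κ ≠ 0 := by rw [hm]; positivity
  have h0 := (van_osc_cos hr0.le).comp_shear x' (2 * lam.im)
  have h3 := (van_osc_oddM hr0.le hm').comp_shear x' (2 * lam.im)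
  have h4 := (van_osc_evenM hr0.le hm').comp_shear x' (2 * lam.im)
  have h5 := (van_poleZ hκ hr0 x').comp_shear x' (2 * lam.im)
  have h := Van.bm_mul (bm_phase lam x') (h0.add ((Van.bm_mul (BM.const (κ / 2 * (1 + th κ x'))) h5).add
    (Van.bm_mul ((bm_be κ x').const_mul Complex.I) (h3.add h4))))
  refine h.of_le fun p => le_of_eq (congrArg _ ?_)
  obtain ⟨x, y⟩ := p
  have hdc : dc (lam.im - κ) = 1 / 2 := by rw [hm, sub_self]; simp [dc]
  have he : ∀ Z, osc |lam.re| y (evenM 0 Z) = 0 := fun Z => by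
    simp [osc, evenM]
  have hx : x - x' + 2 * lam.im * y + x' - 2 * κ * y = x := by rw [hm]; ring
  rw [green, greenC, osc_ampF]
  simp only [poleZ, hx, greenD, specMode, hdc]
  rw [hm, sub_self, he]
  simp only [Set.mem_empty_iff_false, if_false, zed, hm]
  set O := osc |lam.re| y (oddM 0 (x - x' + 2 * κ * y))
  have hpi : (Real.pi : ℂ) ≠ 0 := by exact_mod_cast Real.pi_ne_zero
  split_ifs with hy
  · have e : Complex.exp (- -(lam ^ 2 + (κ : ℂ) ^ 2) * y) * dm κ lam x' x =
        (1 + th κ x') * (1 - th κ x) * (Complex.exp (Complex.I * lam.re * (x - x' + 2 * κ * y : ℝ)) *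
        Real.exp (|lam.re| ^ 2 * y)) := by
      rw [dm, Complex.ofReal_exp, mul_left_comm, ← Complex.exp_add, ← Complex.exp_add]
      congr 2
      have hl := (Complex.re_add_im lam).symm
      rw [hm] at hl
      rw [hm, sub_self, sq_abs]
      push_cast
      linear_combination ((lam + lam.re + κ * Complex.I) * y) * hl + (κ : ℂ) ^ 2 * y * Complex.I_sq
    rw [e, al]
    generalize Complex.exp (Complex.I * lam.re * (x - x' + 2 * κ * y : ℝ)) = P
    generalize (osc |lam.re| y fun t => (Real.cos (t * (x - x' + 2 * κ * y)) : ℂ)) = O1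
    generalize osc |lam.re| y (oddM (κ + κ) (x - x' + 2 * κ * y)) = O2
    generalize osc |lam.re| y (evenM (κ + κ) (x - x' + 2 * κ * y)) = O3
    push_cast
    generalize Complex.exp (|lam.re| ^ 2 * y) = E
    field_simp
    linear_combination (-2 * P * κ * (1 - th κ x) * (1 + th κ x') * O) * Complex.I_sq
  · rw [al]
    push_cast
    linear_combination (- Complex.exp (Complex.I * lam.re * (x - x' + 2 * κ * y)) * (Real.pi : ℂ)⁻¹ *
      (κ / 2 * (1 - th κ x) * (1 + th κ x') * O)) * Complex.I_sq

theorem van_green (hκ : 0 < κ) (hl : 0 ≤ lam.im) (hne : lam ≠ Complex.I * κ) :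
    Van (green κ lam x') := by
  by_cases hm : lam.im - κ = 0
  · refine van_green_of_eq x' hκ (sub_eq_zero.1 hm) fun hre => hne ?_
    apply Complex.ext
    · simpa using hre
    · simpa using sub_eq_zero.1 hm
  · exact (van_greenC_of_ne x' hm (by positivity)).add (van_greenD_of_ne x' hκ hl hm)

end

/-! ### Green kernels for all spectral parameters -/

/-- `K` is a Green kernel for the soliton operator, vanishing at infinity. -/
structure IsGreen (κ : ℝ) (lam : ℂ) (K : ℝ × ℝ → ℝ × ℝ → ℂ) : Prop where
  meas : Measurable (Function.uncurry K)
  bound : ∀ p p', ‖K p p'‖ ≤ 2 + 34 * κ + prof lam (p - p')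
  van : ∀ p', Van fun p => K p p'
  fund : ∀ p' Φ, CTest Φ → ∫ p, K p p' * (Lst lam Φ p + uc κ p.1 * Φ p) = Φ p'

lemma measurable_green_shift (κ : ℝ) (lam : ℂ) : Measurable (Function.uncurry
    fun p p' : ℝ × ℝ => green κ lam p'.1 (p.1, p.2 - p'.2)) := by
  have h : Measurable fun z : (ℝ × ℝ) × (ℝ × ℝ) => ((z.2.1, (z.1.1, z.1.2 - z.2.2)) : ℝ × (ℝ × ℝ)) := by
    fun_prop
  have := (measurable_green κ lam).comp h
  simpa only [Function.comp_def, Function.uncurry_def] using this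

lemma van_green_shift {κ : ℝ} {lam : ℂ} (hκ : 0 < κ) (hl : 0 ≤ lam.im)
    (hne : lam ≠ Complex.I * κ) (x' y' : ℝ) : Van fun p : ℝ × ℝ => green κ lam x' (p.1, p.2 - y') := by
  have h := (van_green x' hκ hl hne).comp
    (Homeomorph.subRight ((0, y') : ℝ × ℝ)).isClosedEmbedding.tendsto_cocompact
  have e : (fun p : ℝ × ℝ => green κ lam x' (p.1, p.2 - y')) =
      green κ lam x' ∘ Homeomorph.subRight ((0, y') : ℝ × ℝ) := by
    ext p
    have : Homeomorph.subRight ((0, y') : ℝ × ℝ) p = (p.1, p.2 - y') := by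
      ext <;> simp
    rw [Function.comp_apply, this]
  rw [e]; exact h

lemma integral_green_shift {κ : ℝ} {lam : ℂ} (hκ : 0 < κ) (hl : 0 ≤ lam.im) (x' y' : ℝ)
    {Φ : ℝ × ℝ → ℂ} (hΦ : CTest Φ) :
    ∫ p : ℝ × ℝ, green κ lam x' (p.1, p.2 - y') * (Lst lam Φ p + uc κ p.1 * Φ p) = Φ (x', y') := by
  have h := integral_green (lam := lam) x' hκ hl (hΦ.comp_add (0, y'))
  rw [Lst_comp_add] at h
  have e2 : ((x', 0) : ℝ × ℝ) + (0, y') = (x', y') := by ext <;> simp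
  rw [e2] at h
  rw [← h, ← integral_add_right_eq_self _ ((0, y') : ℝ × ℝ)]
  refine integral_congr_ae (ae_of_all _ fun p => ?_)
  have e1 : ((p + (0, y')).1, (p + (0, y')).2 - y') = p := by ext <;> simp
  simp only [e1]
  simp

lemma isGreen_green {κ : ℝ} {lam : ℂ} (hκ : 0 < κ) (hl : 0 ≤ lam.im) (hne : lam ≠ Complex.I * κ) :
    IsGreen κ lam fun p p' => green κ lam p'.1 (p.1, p.2 - p'.2) where
  meas := measurable_green_shift κ lam
  bound _ p' := norm_green_le p'.1 hκ hl _
  van p' := van_green_shift hκ hl hne p'.1 p'.2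
  fund p' _ hΦ := integral_green_shift hκ hl p'.1 p'.2 hΦ

/-- Reflection in the first variable. -/
def rfl1 : (ℝ × ℝ) ≃L[ℝ] (ℝ × ℝ) :=
  (ContinuousLinearEquiv.neg ℝ).prodCongr (ContinuousLinearEquiv.refl ℝ ℝ)

lemma rfl1_apply (p : ℝ × ℝ) : rfl1 p = (-p.1, p.2) := rfl

lemma rfl1_rfl1 (p : ℝ × ℝ) : rfl1 (rfl1 p) = p := by simp [rfl1_apply]

lemma integral_rfl1 (f : ℝ × ℝ → ℂ) : ∫ p, f (rfl1 p) = ∫ p, f p := by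
  have h : MeasurePreserving (fun p : ℝ × ℝ => (-p.1, p.2)) volume volume :=
    (Measure.measurePreserving_neg volume).prod (MeasurePreserving.id volume)
  exact h.integral_comp rfl1.toHomeomorph.measurableEmbedding f

lemma pd_rfl1 (e : ℝ × ℝ) (Φ : ℝ × ℝ → ℂ) (p : ℝ × ℝ) :
    pd e (fun p => Φ (rfl1 p)) p = pd (rfl1 e) Φ (rfl1 p) := by
  change fderiv ℝ (Φ ∘ rfl1) p e = _
  rw [ContinuousLinearEquiv.comp_right_fderiv]
  rfl

lemma CTest.rfl1 {Φ : ℝ × ℝ → ℂ} (h : CTest Φ) : CTest fun p => Φ (rfl1 p) :=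
  ⟨h.smooth.comp KPII.rfl1.contDiff, h.supp.comp_homeomorph KPII.rfl1.toHomeomorph⟩

lemma pd_neg_ex (Φ : ℝ × ℝ → ℂ) : pd (rfl1 ex) Φ = fun p => -pd ex Φ p := by
  ext p
  have : rfl1 ex = -ex := by ext <;> simp [rfl1_apply, ex]
  rw [pd, this, map_neg]; rfl

lemma pd_neg_ey (Φ : ℝ × ℝ → ℂ) : pd (rfl1 ey) Φ = pd ey Φ := by
  have : rfl1 ey = ey := by ext <;> simp [rfl1_apply, ey]
  rw [this]

lemma Lst_rfl1 (lam : ℂ) {Φ : ℝ × ℝ → ℂ} (hΦ : CTest Φ) (p : ℝ × ℝ) :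
    Lst (-lam) (fun p => Φ (rfl1 p)) p = Lst lam Φ (rfl1 p) := by
  have e1 : pd ex (fun p => Φ (rfl1 p)) = fun p => -1 * pd ex Φ (rfl1 p) := by
    ext p; rw [pd_rfl1, pd_neg_ex, neg_one_mul]
  have e2 : pd ex (fun p => -1 * pd ex Φ (rfl1 p)) p = pd ex (pd ex Φ) (rfl1 p) := by
    rw [pd_const_mul _ (hΦ.pd ex).rfl1.differentiable]
    simp only [pd_rfl1, pd_neg_ex]; ring
  simp only [Lst]
  rw [e1, e2, pd_rfl1, pd_neg_ey]; ring

lemma th_neg (κ x : ℝ) : th κ (-x) = -th κ x := by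
  rw [th, th, mul_neg, Real.tanh_neg]

lemma prof_rfl1 (lam : ℂ) (p : ℝ × ℝ) : prof (-lam) (rfl1 p) = prof lam p := by
  have : zed (-lam) (-p.1) p.2 = -zed lam p.1 p.2 := by simp [zed]; ring
  simp only [prof, rfl1_apply, this, sing, abs_neg]

/-- The soliton is even, and x ↦ -x changes the sign of the term 2iλ∂_x. This reduces Im λ ≤ 0 to Im
λ ≥ 0. -/
lemma IsGreen.reflect {κ : ℝ} {lam : ℂ} {K : ℝ × ℝ → ℝ × ℝ → ℂ} (h : IsGreen κ (-lam) K) :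
    IsGreen κ lam fun p p' => K (rfl1 p) (rfl1 p') where
  meas := by
    have hm : Measurable fun z : (ℝ × ℝ) × (ℝ × ℝ) => (rfl1 z.1, rfl1 z.2) := by fun_prop
    exact h.meas.comp hm
  bound p p' := by
    refine (h.bound _ _).trans (le_of_eq ?_)
    rw [← map_sub, prof_rfl1]
  van p' := (h.van (rfl1 p')).comp rfl1.toHomeomorph.isClosedEmbedding.tendsto_cocompact
  fund p' Φ hΦ := by
    have h1 := h.fund (rfl1 p') _ hΦ.rfl1
    rw [rfl1_rfl1] at h1
    rw [← h1, ← integral_rfl1 fun p => K p (rfl1 p') * _]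
    refine integral_congr_ae (ae_of_all _ fun p => ?_)
    simp only [Lst_rfl1 lam hΦ, rfl1_rfl1]
    congr 3
    simp [uc, rfl1_apply, th_neg]

theorem exists_isGreen {κ : ℝ} {lam : ℂ} (hκ : 0 < κ) (hne : lam ≠ Complex.I * κ)
    (hne' : lam ≠ -(Complex.I * κ)) : ∃ K, IsGreen κ lam K := by
  rcases le_total 0 lam.im with h | h
  · exact ⟨_, isGreen_green hκ h hne⟩
  · exact ⟨_, (isGreen_green (lam := -lam) hκ (by simpa using h)
      fun h => hne' (by rw [← h, neg_neg])).reflect⟩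

/-! ### The Green operator -/

/-- The integral operator with kernel `K`. -/
def gop (K : ℝ × ℝ → ℝ × ℝ → ℂ) (f : ℝ × ℝ → ℂ) (p : ℝ × ℝ) : ℂ := ∫ p', K p p' * f p'

lemma integrable_prof_sub (lam : ℂ) (p : ℝ × ℝ) :
    Integrable (fun p' => prof lam (p - p')) ∧ ∫ p', prof lam (p - p') = 16 :=
  ⟨(integral_prof lam).1.comp_sub_left p,
    by rw [integral_sub_left_eq_self (prof lam) volume p]; exact (integral_prof lam).2⟩

section

variable {κ : ℝ} {lam : ℂ} {K : ℝ × ℝ → ℝ × ℝ → ℂ} {f : ℝ × ℝ → ℂ} {D : ℝ}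

namespace IsGreen

/-- The bounded part of the kernel is paired with the L¹ norm of f and the singular part, of mass
16, with its L^∞ norm. -/
lemma integrable_mul (hG : IsGreen κ lam K) (hfm : Measurable f) (hf : Integrable f)
    (hD : ∀ᵐ p, ‖f p‖ ≤ D) (p : ℝ × ℝ) : Integrable (fun p' => K p p' * f p') ∧
      ∫ p', ‖K p p' * f p'‖ ≤ (2 + 34 * κ) * (∫ p, ‖f p‖) + 16 * D := by
  obtain ⟨h1, h2⟩ := integrable_prof_sub lam p
  have hd : Integrable fun p' => (2 + 34 * κ) * ‖f p'‖ + prof lam (p - p') * D :=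
    (hf.norm.const_mul _).add (h1.mul_const D)
  have hle : ∀ᵐ p', ‖K p p' * f p'‖ ≤ (2 + 34 * κ) * ‖f p'‖ + prof lam (p - p') * D := by
    filter_upwards [hD] with p' hp
    rw [norm_mul]
    refine (mul_le_mul_of_nonneg_right (hG.bound p p') (norm_nonneg _)).trans ?_
    rw [add_mul]
    exact add_le_add le_rfl (mul_le_mul_of_nonneg_left hp (prof_nonneg _ _))
  have hi : Integrable fun p' => K p p' * f p' :=
    hd.mono' (hG.meas.of_uncurry_left.mul hfm).aestronglyMeasurable hle
  refine ⟨hi, (integral_mono_ae hi.norm hd hle).trans (le_of_eq ?_)⟩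
  rw [integral_add (hf.norm.const_mul _) (h1.mul_const D), integral_const_mul, integral_mul_const, h2]

lemma measurable_gop (hG : IsGreen κ lam K) (hfm : Measurable f) : Measurable (gop K f) := by
  have h : Measurable (Function.uncurry fun p p' => K p p' * f p') :=
    hG.meas.mul (hfm.comp measurable_snd)
  exact h.stronglyMeasurable.integral_prod_right.measurable

lemma norm_gop_le (hG : IsGreen κ lam K) (hfm : Measurable f) (hf : Integrable f)
    (hD : ∀ᵐ p, ‖f p‖ ≤ D) (p : ℝ × ℝ) :
    ‖gop K f p‖ ≤ (2 + 34 * κ) * (∫ p, ‖f p‖) + 16 * D :=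
  (norm_integral_le_integral_norm _).trans (hG.integrable_mul hfm hf hD p).2

lemma bm_gop (hG : IsGreen κ lam K) (hf : Integrable f) (hb : BM f) : BM (gop K f) := by
  obtain ⟨D, hD⟩ := hb.bdd
  exact ⟨hG.measurable_gop hb.meas, _, hG.norm_gop_le hb.meas hf (ae_of_all _ hD)⟩

lemma tendsto_prof_tail (lam : ℂ) : Tendsto (fun n : ℕ =>
    ∫ p, Set.indicator {p | (n : ℝ) < prof lam p} (prof lam) p) atTop (𝓝 0) := by
  have h0 : (0 : ℝ) = ∫ _ : ℝ × ℝ, (0 : ℝ) := by simp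
  rw [h0]
  refine tendsto_integral_of_dominated_convergence (prof lam) (fun n => ?_) (integral_prof lam).1
    (fun n => ae_of_all _ fun p => ?_) (ae_of_all _ fun p => ?_)
  · exact ((measurable_prof lam).indicator
      (measurableSet_lt measurable_const (measurable_prof lam))).aestronglyMeasurable
  · rw [Real.norm_of_nonneg (Set.indicator_nonneg (fun _ _ => prof_nonneg _ _) _)]
    exact Set.indicator_le_self' (fun _ _ => prof_nonneg _ _) _
  · obtain ⟨N, hN⟩ := exists_nat_ge (prof lam p)
    refine tendsto_const_nhds.congr' ?_
    filter_upwards [eventually_ge_atTop N] with n hn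
    rw [Set.indicator_of_notMem]
    have : (N : ℝ) ≤ n := by exact_mod_cast hn
    exact fun h : (n : ℝ) < prof lam p => by linarith

/-- The kernel decays in p for each fixed p', but its singularity moves with p and prevents
domination. Truncating where `prof` exceeds n leaves a dominated kernel, and the removed part is at
most 2D times the tail of an integrable function. -/
lemma van_gop (hκ : 0 ≤ κ) (hG : IsGreen κ lam K) (hf : Integrable f) (hb : BM f) :
    Van (gop K f) := by
  obtain ⟨D, hD0, hD⟩ := hb.nonneg_bound
  have hC : 0 ≤ 2 + 34 * κ := by positivity
  unfold Van
  rw [tendsto_zero_iff_norm_tendsto_zero, Metric.tendsto_nhds]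
  intro ε hε
  have hlim : ∀ᶠ n : ℕ in atTop, 2 * D *
      ∫ p, Set.indicator {p | (n : ℝ) < prof lam p} (prof lam) p < ε / 2 := by
    have h := (tendsto_prof_tail lam).const_mul (2 * D)
    rw [mul_zero] at h
    exact h.eventually_lt_const (by positivity)
  obtain ⟨n, hn, hnC⟩ := (hlim.and (eventually_ge_atTop ⌈2 + 34 * κ⌉₊)).exists
  -- With n at least 2 + 34κ, the whole kernel bound is at most 2 `prof` on the region removed.
  have hCn : 2 + 34 * κ ≤ n := (Nat.le_ceil _).trans (by exact_mod_cast hnC)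
  set τ : ℝ × ℝ → ℝ := Set.indicator {p | (n : ℝ) < prof lam p} (prof lam) with hτ
  have hτm : Measurable τ := (measurable_prof lam).indicator
    (measurableSet_lt measurable_const (measurable_prof lam))
  have hτi : Integrable τ := (integral_prof lam).1.indicator
    (measurableSet_lt measurable_const (measurable_prof lam))
  let k : ℝ × ℝ → ℝ × ℝ → ℂ := fun p p' => if (n : ℝ) < prof lam (p - p') then 0 else K p p' * f p'
  have hkm : ∀ p, Measurable (k p) := fun p => by
    refine Measurable.ite ?_ measurable_const (hG.meas.of_uncurry_left.mul hb.meas)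
    exact measurableSet_lt measurable_const
      ((measurable_prof lam).comp (measurable_const.sub measurable_id))
  have hk1 : ∀ p p', ‖k p p'‖ ≤ (2 + 34 * κ + n) * ‖f p'‖ := by
    intro p p'
    simp only [k]
    split_ifs with h
    · rw [norm_zero]; positivity
    · rw [norm_mul]
      exact mul_le_mul_of_nonneg_right ((hG.bound p p').trans (by linarith)) (norm_nonneg _)
  have hk2 : ∀ p p', ‖K p p' * f p' - k p p'‖ ≤ 2 * D * τ (p - p') := by
    intro p p'
    simp only [k]
    split_ifs with h
    · rw [sub_zero, norm_mul, hτ, Set.indicator_of_mem (show p - p' ∈ {p | (n : ℝ) < prof lam p} from h)]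
      calc _ ≤ (2 * prof lam (p - p')) * D :=
            mul_le_mul ((hG.bound p p').trans (by linarith)) (hD p') (norm_nonneg _)
              (by linarith [prof_nonneg lam (p - p')])
        _ = _ := by ring
    · rw [sub_self, norm_zero]
      exact mul_nonneg (by positivity) (Set.indicator_nonneg (fun _ _ => prof_nonneg _ _) _)
  have hki : ∀ p, Integrable (k p) := fun p =>
    Integrable.mono' (hf.norm.const_mul _) (hkm p).aestronglyMeasurable (ae_of_all _ (hk1 p))
  have hkt : Tendsto (fun p => ∫ p', k p p') (cocompact (ℝ × ℝ)) (𝓝 0) := by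
    have h0 : (0 : ℂ) = ∫ _ : ℝ × ℝ, (0 : ℂ) := by simp
    rw [h0]
    refine tendsto_integral_filter_of_dominated_convergence _
      (Eventually.of_forall fun p => (hkm p).aestronglyMeasurable)
      (Eventually.of_forall fun p => ae_of_all _ (hk1 p)) (hf.norm.const_mul _)
      (ae_of_all _ fun p' => ?_)
    have h1 : Tendsto (fun p => K p p' * f p') (cocompact (ℝ × ℝ)) (𝓝 0) := by
      simpa using (hG.van p').mul_const (f p')
    refine squeeze_zero_norm (a := fun p => ‖K p p' * f p'‖) (fun p => ?_) (by simpa using h1.norm)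
    simp only [k]
    split_ifs
    · rw [norm_zero]; positivity
    · exact le_rfl
  have hkt' : Tendsto (fun p => ‖∫ p', k p p'‖) (cocompact (ℝ × ℝ)) (𝓝 0) := by
    simpa using hkt.norm
  have hev := hkt'.eventually_lt_const (half_pos hε)
  filter_upwards [hev] with p hp
  rw [dist_zero_right, norm_norm]
  have hKi := (hG.integrable_mul hb.meas hf (ae_of_all _ hD) p).1
  have e : gop K f p = (∫ p', k p p') + ∫ p', (K p p' * f p' - k p p') := by
    rw [integral_sub hKi (hki p), gop]; ring
  have h2 : ‖∫ p', (K p p' * f p' - k p p')‖ ≤ 2 * D * ∫ p', τ p' := by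
    rw [← integral_sub_left_eq_self τ volume p, ← integral_const_mul]
    exact norm_integral_le_of_norm_le ((hτi.comp_sub_left p).const_mul _) (ae_of_all _ (hk2 p))
  rw [e]
  refine (norm_add_le _ _).trans_lt ?_
  linarith

/-- Fubini moves the test function onto the kernel, where the fundamental identity reproduces it. -/
lemma sol_gop (hG : IsGreen κ lam K) (hf : Integrable f) (hb : BM f) :
    Sol lam (gop K f) fun p => f p - uc κ p.1 * gop K f p := by
  intro Φ hΦ
  obtain ⟨D, hD⟩ := hb.bdd
  have hg := hG.bm_gop hf hb
  set θ : ℝ × ℝ → ℂ := fun p => Lst lam Φ p + uc κ p.1 * Φ p with hθ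
  have hθi : Integrable θ := (hΦ.lst lam).integrable.add ((bm_uc κ).integrable_mul hΦ.integrable)
  have hθm : Measurable θ := ((hΦ.lst lam).bm.add ((bm_uc κ).mul hΦ.bm)).meas
  have hprod : Integrable (Function.uncurry fun p p' => K p p' * f p' * θ p)
      (volume.prod volume) := by
    have hm : Measurable (Function.uncurry fun p p' => K p p' * f p' * θ p) :=
      (hG.meas.mul (hb.meas.comp measurable_snd)).mul (hθm.comp measurable_fst)
    rw [integrable_prod_iff hm.aestronglyMeasurable]
    have hK := hG.integrable_mul hb.meas hf (ae_of_all _ hD)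
    refine ⟨ae_of_all _ fun p => (hK p).1.mul_const (θ p), ?_⟩
    refine (hθi.norm.const_mul ((2 + 34 * κ) * (∫ p, ‖f p‖) + 16 * D)).mono'
      (hm.norm.stronglyMeasurable.integral_prod_right'.aestronglyMeasurable) (ae_of_all _ fun p => ?_)
    simp only [Function.uncurry, norm_mul _ (θ p), integral_mul_const]
    rw [norm_mul, norm_norm]
    refine mul_le_mul_of_nonneg_right ?_ (norm_nonneg _)
    rw [Real.norm_of_nonneg (integral_nonneg fun _ => norm_nonneg _)]
    exact (hK p).2
  have h1 : ∫ p, gop K f p * θ p = ∫ p', f p' * Φ p' := by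
    have e1 : ∀ p, gop K f p * θ p = ∫ p', K p p' * f p' * θ p := fun p => by
      rw [gop, integral_mul_const]
    simp only [e1]
    rw [integral_integral_swap hprod]
    refine integral_congr_ae (ae_of_all _ fun p' => ?_)
    have e2 : ∀ p, K p p' * f p' * θ p = f p' * (K p p' * θ p) := fun p => by ring
    simp only [e2]
    rw [integral_const_mul, hG.fund p' Φ hΦ]
  have i1 : Integrable fun p => gop K f p * Lst lam Φ p := hg.integrable_mul (hΦ.lst lam).integrable
  have i2 : Integrable fun p => gop K f p * (uc κ p.1 * Φ p) :=
    hg.integrable_mul ((bm_uc κ).integrable_mul hΦ.integrable)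
  have i3 : Integrable fun p => f p * Φ p := hb.integrable_mul hΦ.integrable
  simp only [hθ, mul_add] at h1
  rw [integral_add i1 i2] at h1
  have e3 : ∀ p : ℝ × ℝ, (f p - uc κ p.1 * gop K f p) * Φ p =
      f p * Φ p - gop K f p * (uc κ p.1 * Φ p) := fun p => by ring
  simp only [e3]
  rw [integral_sub i3 i2, ← h1]
  ring

end IsGreen

end

/-! ### The soliton eigenfunction -/

lemma Sol.of_smooth (lam : ℂ) {f : ℝ × ℝ → ℂ} (hf : ContDiff ℝ ∞ f) :
    Sol lam f fun p => pd ey f p - pd ex (pd ex f) p + 2 * Complex.I * lam * pd ex f p := by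
  intro Φ hΦ
  have hx := contDiff_pd hf ex
  have h1 := integral_mul_pd hf hΦ ey
  have h2 := integral_mul_pd hf hΦ ex
  have h3 := integral_mul_pd hf (hΦ.pd ex) ex
  have h4 := integral_mul_pd hx hΦ ex
  have i1 := ((hΦ.pd ey).smooth_mul hf).integrable
  have i2 := (((hΦ.pd ex).pd ex).smooth_mul hf).integrable
  have i3 := ((hΦ.pd ex).smooth_mul hf).integrable
  have j1 := (hΦ.smooth_mul (contDiff_pd hf ey)).integrable
  have j2 := (hΦ.smooth_mul (contDiff_pd hx ex)).integrable
  have j3 := (hΦ.smooth_mul hx).integrable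
  have e1 : ∀ p, f p * Lst lam Φ p = -(f p * pd ey Φ p) - f p * pd ex (pd ex Φ) p -
      2 * Complex.I * lam * (f p * pd ex Φ p) := fun p => by rw [Lst]; ring
  have e2 : ∀ p, (pd ey f p - pd ex (pd ex f) p + 2 * Complex.I * lam * pd ex f p) * Φ p =
      pd ey f p * Φ p - pd ex (pd ex f) p * Φ p + 2 * Complex.I * lam * (pd ex f p * Φ p) :=
    fun p => by ring
  simp only [e1, e2]
  rw [integral_sub (f := fun p => -(f p * pd ey Φ p) - f p * pd ex (pd ex Φ) p)
      (i1.neg.sub i2) (i3.const_mul (2 * Complex.I * lam)),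
    integral_sub (f := fun p => -(f p * pd ey Φ p)) i1.neg i2, integral_neg, integral_const_mul,
    integral_add (f := fun p => pd ey f p * Φ p - pd ex (pd ex f) p * Φ p)
      (j1.sub j2) (j3.const_mul (2 * Complex.I * lam)),
    integral_sub j1 j2, integral_const_mul, h1, h2, h3, h4]
  ring

lemma thetaMinus_eq (κ x : ℝ) (lam : ℂ) :
    thetaMinus κ x lam = 1 + Complex.I * κ / (lam - Complex.I * κ) * (1 - th κ x) := by
  have h := one_sub_th κ x
  have h2 : (1 - th κ x) * (1 + Real.exp (2 * κ * x)) = 2 := by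
    have : Real.exp (-(2 * κ * x)) * Real.exp (2 * κ * x) = 1 := by rw [← Real.exp_add]; simp
    linear_combination Real.exp (2 * κ * x) * h + (1 + th κ x) * this
  have h3 : (1 - th κ x : ℂ) * (1 + Complex.exp (2 * κ * x)) = 2 := by
    have := congrArg Complex.ofReal h2
    push_cast at this
    exact this
  have h4 : (1 + Complex.exp (2 * κ * x)) ≠ 0 := by
    intro h0; rw [h0, mul_zero] at h3; norm_num at h3
  have h5 : 1 / (1 + Complex.exp (2 * κ * x)) = (1 - th κ x) / 2 := by
    rw [div_eq_div_iff h4 two_ne_zero, h3, one_mul]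
  rw [thetaMinus, h5]; ring

lemma bm_theta (κ : ℝ) (lam : ℂ) : BM fun p => thetaMinus κ p.1 lam := by
  simp only [thetaMinus_eq]
  exact (BM.const 1).add (((BM.const 1).sub (bm_tc κ)).const_mul _)

lemma sol_theta {κ : ℝ} {lam : ℂ} (hne : lam ≠ Complex.I * κ) :
    Sol lam (fun p => thetaMinus κ p.1 lam) fun p => -(uc κ p.1 * thetaMinus κ p.1 lam) := by
  have hd : lam - Complex.I * κ ≠ 0 := sub_ne_zero.2 hne
  set c := Complex.I * κ / (lam - Complex.I * κ) with hc
  have hf : ContDiff ℝ ∞ fun p : ℝ × ℝ => thetaMinus κ p.1 lam := by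
    have := contDiff_tc κ
    simp only [thetaMinus_eq]
    exact contDiff_const.add (contDiff_const.mul (contDiff_const.sub this))
  have hx : pd ex (fun p : ℝ × ℝ => thetaMinus κ p.1 lam) =
      fun p => -(c * κ) * (1 - (th κ p.1 : ℂ) ^ 2) := by
    ext p
    refine pd_ex_of_hasDerivAt (hf.differentiable (by simp)) ?_
    simp only [thetaMinus_eq]
    exact ((((hasDerivAt_thc κ p.1).const_sub 1).const_mul c).const_add 1).congr_deriv (by ring)
  have hxx : pd ex (pd ex fun p : ℝ × ℝ => thetaMinus κ p.1 lam) =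
      fun p => 2 * (c * κ ^ 2) * th κ p.1 * (1 - (th κ p.1 : ℂ) ^ 2) := by
    ext p
    refine pd_ex_of_hasDerivAt ((contDiff_pd hf ex).differentiable (by simp)) ?_
    rw [hx]
    exact ((hasDerivAt_one_sub_thc_sq κ p.1).const_mul _).congr_deriv (by ring)
  have hy : pd ey (fun p : ℝ × ℝ => thetaMinus κ p.1 lam) = fun _ => 0 := by
    ext p
    exact pd_ey_of_hasDerivAt (hf.differentiable (by simp)) (hasDerivAt_const p.2 (thetaMinus κ p.1 lam))
  have h := Sol.of_smooth lam hf
  rw [hxx, hx, hy] at h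
  refine h.congr (ae_of_all _ fun _ => rfl) (ae_of_all _ fun p => ?_)
  have hcm : c * (lam - Complex.I * κ) = Complex.I * κ := by rw [hc]; field_simp
  simp only [thetaMinus_eq, uc, ← hc]
  linear_combination (-2 * Complex.I * κ * (1 - (th κ p.1 : ℂ) ^ 2)) * hcm -
    (2 * κ ^ 2 * (1 - (th κ p.1 : ℂ) ^ 2) * (c + 1)) * Complex.I_sq

/-! ### The perturbation series and uniqueness -/

section

variable {κ : ℝ} {lam : ℂ} {K : ℝ × ℝ → ℝ × ℝ → ℂ} {V : ℝ × ℝ → ℂ} {D : ℝ}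

namespace IsGreen

/-- The integral operator f ↦ G(Vf) has norm at most 1/2 on bounded functions. The bounds are kept
on the integrals of absolute values so that series can be integrated term by term. -/
lemma norm_gop_mul_le (hκ : 0 ≤ κ) (hG : IsGreen κ lam K) (hV : BM V) (hVi : Integrable V)
    (hD : ∀ᵐ p, ‖V p‖ ≤ D) (hD0 : 0 ≤ D) (hs : (2 + 34 * κ) * (∫ p, ‖V p‖) + 16 * D ≤ 1 / 2)
    {f : ℝ × ℝ → ℂ} (hf : BM f) {A : ℝ} (hA0 : 0 ≤ A) (hA : ∀ᵐ p, ‖f p‖ ≤ A) (p : ℝ × ℝ) :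
    Integrable (fun p' => K p p' * (V p' * f p')) ∧
      ∫ p', ‖K p p' * (V p' * f p')‖ ≤ A / 2 := by
  have hi : Integrable fun p => V p * f p := by
    simpa only [mul_comm] using hf.integrable_mul hVi
  have hb : ∀ᵐ p, ‖V p * f p‖ ≤ D * A := by
    filter_upwards [hD, hA] with p h1 h2
    rw [norm_mul]; exact mul_le_mul h1 h2 (norm_nonneg _) hD0
  have hI : ∫ p, ‖V p * f p‖ ≤ (∫ p, ‖V p‖) * A := by
    rw [← integral_mul_const]
    refine integral_mono_ae hi.norm (hVi.norm.mul_const A) ?_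
    filter_upwards [hA] with p h2
    rw [norm_mul]; exact mul_le_mul_of_nonneg_left h2 (norm_nonneg _)
  obtain ⟨h1, h2⟩ := hG.integrable_mul (hV.mul hf).meas hi hb p
  refine ⟨h1, h2.trans ?_⟩
  have h3 : (2 + 34 * κ) * (∫ p, ‖V p * f p‖) ≤ (2 + 34 * κ) * ((∫ p, ‖V p‖) * A) :=
    mul_le_mul_of_nonneg_left hI (by positivity)
  nlinarith

/-- The integral equation has a bounded solution for small potentials. -/
theorem exists_solution (hκ : 0 ≤ κ) (hG : IsGreen κ lam K) (hV : BM V) (hVi : Integrable V)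
    (hD : ∀ᵐ p, ‖V p‖ ≤ D) (hD0 : 0 ≤ D) (hs : (2 + 34 * κ) * (∫ p, ‖V p‖) + 16 * D ≤ 1 / 2)
    {g : ℝ × ℝ → ℂ} (hg : BM g) :
    ∃ m, BM m ∧ ∀ p, m p = g p - gop K (fun p => V p * m p) p := by
  obtain ⟨A, hA0, hA⟩ := hg.nonneg_bound
  -- The terms (-GV)ⁿg of the Neumann series, dominated pointwise by A/2ⁿ.
  let d : ℕ → ℝ × ℝ → ℂ := fun n => Nat.rec g (fun _ f p => -gop K (fun p => V p * f p) p) n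
  have hsucc : ∀ n p, d (n + 1) p = -gop K (fun p => V p * d n p) p := fun _ _ => rfl
  have hd : ∀ n, BM (d n) ∧ ∀ p, ‖d n p‖ ≤ A * (1 / 2) ^ n := by
    intro n
    induction n with
    | zero => exact ⟨hg, fun p => by rw [pow_zero, mul_one]; exact hA p⟩
    | succ n ih =>
      have hi : Integrable fun p => V p * d n p := by
        simpa only [mul_comm] using ih.1.integrable_mul hVi
      refine ⟨(hG.bm_gop hi (hV.mul ih.1)).neg, fun p => ?_⟩
      rw [hsucc, norm_neg]
      refine (norm_integral_le_integral_norm _).trans ?_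
      refine (hG.norm_gop_mul_le hκ hV hVi hD hD0 hs ih.1 (by positivity) (ae_of_all _ ih.2) p).2.trans
        (le_of_eq ?_)
      rw [pow_succ]; ring
  have hgeo : Summable fun n : ℕ => A * (1 / 2 : ℝ) ^ n :=
    (summable_geometric_of_lt_one (by norm_num) (by norm_num)).mul_left A
  have hsum : ∀ p, Summable fun n => d n p := fun p =>
    Summable.of_norm_bounded hgeo fun n => (hd n).2 p
  have hm : BM fun p => ∑' n, d n p := by
    refine ⟨?_, ∑' n : ℕ, A * (1 / 2 : ℝ) ^ n, fun p => tsum_of_norm_bounded hgeo.hasSum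
      fun n => (hd n).2 p⟩
    refine measurable_of_tendsto_metrizable (f := fun N p => ∑ n ∈ Finset.range N, d n p)
      (fun N => Finset.measurable_fun_sum _ fun n _ => (hd n).1.meas) ?_
    exact tendsto_pi_nhds.2 fun p => (hsum p).hasSum.tendsto_sum_nat
  refine ⟨_, hm, fun p => ?_⟩
  have hF := fun n => hG.norm_gop_mul_le hκ hV hVi hD hD0 hs (hd n).1 (by positivity)
    (ae_of_all _ (hd n).2) p
  have h1 := hasSum_integral_of_summable_integral_norm (fun n => (hF n).1)
    (Summable.of_nonneg_of_le (fun n => integral_nonneg fun _ => norm_nonneg _) (fun n => (hF n).2)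
      (hgeo.div_const 2))
  have e : gop K (fun p => V p * ∑' n, d n p) p = ∑' n, gop K (fun p => V p * d n p) p := by
    have h2 := h1.tsum_eq
    simp only [tsum_mul_left] at h2
    exact h2.symm
  rw [e, (hsum p).tsum_eq_zero_add]
  simp only [hsucc]
  rw [tsum_neg, sub_eq_add_neg]
  rfl

/-- The homogeneous equation has no nontrivial solution for small potentials. -/
theorem eq_zero (hκ : 0 ≤ κ) (hG : IsGreen κ lam K) (hV : BM V) (hVi : Integrable V)
    (hD : ∀ᵐ p, ‖V p‖ ≤ D) (hD0 : 0 ≤ D) (hs : (2 + 34 * κ) * (∫ p, ‖V p‖) + 16 * D ≤ 1 / 2)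
    {w : ℝ × ℝ → ℂ} (hw : BM w) (hv : Van w)
    (h : Sol lam w fun p => -((uc κ p.1 + V p) * w p)) : w =ᵐ[volume] 0 := by
  have hi : Integrable fun p => V p * w p := by
    simpa only [mul_comm] using hw.integrable_mul hVi
  have hVw := hV.mul hw
  have hb := hG.bm_gop hi hVw
  have hu := bm_uc κ
  have hsol := Sol.add hw.locallyIntegrable ((hu.add hV).mul hw).neg.locallyIntegrable
    hb.locallyIntegrable (hVw.sub (hu.mul hb)).locallyIntegrable h (hG.sol_gop hi hVw)
  -- The sum w + G(Vw) solves the soliton equation, because the source terms Vw cancel, and it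
  -- vanishes at infinity.
  have h0 := Sol.eq_zero_of_soliton κ (hw.add hb) (hv.add (hG.van_gop hκ hi hVw))
    (hsol.congr (ae_of_all _ fun _ => rfl) (ae_of_all _ fun p => by ring))
  have hfix : ∀ᵐ p, w p = -gop K (fun p => V p * w p) p := by
    filter_upwards [h0] with p hp
    exact eq_neg_of_add_eq_zero_left hp
  obtain ⟨A, hA0, hA⟩ := hw.nonneg_bound
  -- The fixed point equation halves any almost everywhere bound, so w vanishes almost everywhere.
  have hn : ∀ n : ℕ, ∀ᵐ p, ‖w p‖ ≤ A * (1 / 2) ^ n := by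
    intro n
    induction n with
    | zero => exact ae_of_all _ fun p => by simpa using hA p
    | succ n ih =>
      filter_upwards [hfix] with p hp
      rw [hp, norm_neg]
      refine (norm_integral_le_integral_norm _).trans ?_
      refine (hG.norm_gop_mul_le hκ hV hVi hD hD0 hs hw (by positivity) ih p).2.trans (le_of_eq ?_)
      rw [pow_succ]; ring
  filter_upwards [ae_all_iff.2 hn] with p hp
  have hlim : Tendsto (fun n : ℕ => A * (1 / 2 : ℝ) ^ n) atTop (𝓝 (A * 0)) :=
    (tendsto_pow_atTop_nhds_zero_of_lt_one (by norm_num) (by norm_num)).const_mul A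
  rw [mul_zero] at hlim
  have : ‖w p‖ ≤ 0 := ge_of_tendsto' hlim hp
  simpa using this

end IsGreen

end

/-! ### Gauging away the plane wave -/

section

variable (lam : ℂ)

lemma contDiff_planeWave : ContDiff ℝ ∞ (planeWave lam) := by
  have e : planeWave lam = fun p : ℝ × ℝ => Complex.exp (-Complex.I * lam * p.1) *
      Complex.exp ((-Complex.I * lam) ^ 2 * p.2) := by
    ext p; rw [planeWave, Complex.exp_add]
  rw [e]
  exact (contDiff_exp_fst _).mul (contDiff_exp_snd _)

lemma pd_planeWave : pd ex (planeWave lam) = (fun p => -Complex.I * lam * planeWave lam p) ∧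
    pd ey (planeWave lam) = fun p => (-Complex.I * lam) ^ 2 * planeWave lam p := by
  have hd := (contDiff_planeWave lam).differentiable (by simp)
  have e : ∀ p : ℝ × ℝ, planeWave lam p = Complex.exp (-Complex.I * lam * p.1) *
      Complex.exp ((-Complex.I * lam) ^ 2 * p.2) := fun p => by
    rw [planeWave, Complex.exp_add]
  constructor <;> ext p
  · refine pd_ex_of_hasDerivAt hd ?_
    simp only [e]
    exact ((hasDerivAt_cexp_mul (-Complex.I * lam) p.1).mul_const _).congr_deriv (by ring)
  · refine pd_ey_of_hasDerivAt hd ?_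
    simp only [e]
    exact ((hasDerivAt_cexp_mul ((-Complex.I * lam) ^ 2) p.2).const_mul _).congr_deriv (by ring)

lemma planeWave_ne_zero (p : ℝ × ℝ) : planeWave lam p ≠ 0 := Complex.exp_ne_zero _

lemma contDiff_planeWave_inv : ContDiff ℝ ∞ fun p => (planeWave lam p)⁻¹ :=
  (contDiff_planeWave lam).inv (planeWave_ne_zero lam)

/-- The plane wave satisfies the heat equation, so conjugating by it changes -∂_y - ∂_x² only by the
drift term contained in `Lst`. -/
lemma Lst_planeWave_mul {Θ : ℝ × ℝ → ℂ} (hΘ : CTest Θ) (p : ℝ × ℝ) :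
    Lst lam (fun p => planeWave lam p * Θ p) p =
      planeWave lam p * (-pd ey Θ p - pd ex (pd ex Θ) p) := by
  have he := contDiff_planeWave lam
  have hd := he.differentiable (by simp)
  obtain ⟨e1, e2⟩ := pd_planeWave lam
  have hx : ∀ Ψ : ℝ × ℝ → ℂ, CTest Ψ → pd ex (fun p => planeWave lam p * Ψ p) =
      fun p => planeWave lam p * (-Complex.I * lam * Ψ p + pd ex Ψ p) := by
    intro Ψ hΨ
    rw [pd_mul ex hd hΨ.differentiable, e1]
    ext p; ring
  have hxx := hx _ ((hΘ.const_mul (-Complex.I * lam)).add (hΘ.pd ex))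
  rw [pd_add ex (hΘ.const_mul _).differentiable (hΘ.pd ex).differentiable,
    pd_const_mul ex hΘ.differentiable] at hxx
  simp only [Lst]
  rw [hx Θ hΘ, hxx, pd_mul ey hd hΘ.differentiable, e2]
  ring

variable {lam} {κ : ℝ} {V m Ψ : ℝ × ℝ → ℂ}

lemma integrable_spectral (hV : BM V) (hΨ : LocallyIntegrable Ψ) {Θ : ℝ × ℝ → ℂ} (hΘ : CTest Θ) :
    Integrable fun p => (-pd ey Θ p - pd ex (pd ex Θ) p + (uc κ p.1 + V p) * Θ p) * Ψ p := by
  have h1 := (((hΘ.pd ey).neg.sub ((hΘ.pd ex).pd ex))).integrable_locInt_mul hΨ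
  have h2 := ((bm_uc κ).add hV).integrable_mul (hΘ.integrable_locInt_mul hΨ)
  refine (h1.add h2).congr (ae_of_all _ fun p => ?_)
  simp only [Pi.add_apply]; ring

/-- Multiplication by the smooth nowhere vanishing plane wave is a bijection of the test functions,
hence the two weak formulations agree. -/
lemma sol_iff_spectral (hV : BM V) (hm : LocallyIntegrable m) :
    Sol lam m (fun p => -((uc κ p.1 + V p) * m p)) ↔ ∀ Θ, CTest Θ →
      ∫ p, (-pd ey Θ p - pd ex (pd ex Θ) p + (uc κ p.1 + V p) * Θ p) * (m p * planeWave lam p) = 0 := by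
  have key : ∀ Θ, CTest Θ →
      ∫ p, (-pd ey Θ p - pd ex (pd ex Θ) p + (uc κ p.1 + V p) * Θ p) * (m p * planeWave lam p) =
      (∫ p, m p * Lst lam (fun p => planeWave lam p * Θ p) p) -
        ∫ p, -((uc κ p.1 + V p) * m p) * (planeWave lam p * Θ p) := by
    intro Θ hΘ
    have hE := hΘ.smooth_mul (contDiff_planeWave lam)
    have i1 := (hE.lst lam).integrable_locInt_mul hm
    have i2 := ((bm_uc κ).add hV).integrable_mul (hE.integrable_locInt_mul hm)
    have j1 : Integrable fun p => m p * Lst lam (fun p => planeWave lam p * Θ p) p :=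
      i1.congr (ae_of_all _ fun p => by ring)
    have j2 : Integrable fun p => -((uc κ p.1 + V p) * m p) * (planeWave lam p * Θ p) :=
      i2.neg.congr (ae_of_all _ fun p => by simp only [Pi.neg_apply]; ring)
    rw [← integral_sub j1 j2]
    refine integral_congr_ae (ae_of_all _ fun p => ?_)
    simp only [Lst_planeWave_mul lam hΘ]; ring
  constructor
  · intro h Θ hΘ
    rw [key Θ hΘ, h _ (hΘ.smooth_mul (contDiff_planeWave lam)), sub_self]
  · intro h Φ hΦ
    have hΘ := hΦ.smooth_mul (contDiff_planeWave_inv lam)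
    have h1 := h _ hΘ
    rw [key _ hΘ] at h1
    have e : (fun p => planeWave lam p * ((planeWave lam p)⁻¹ * Φ p)) = Φ := by
      ext p; rw [mul_inv_cancel_left₀ (planeWave_ne_zero lam p)]
    have e' : ∀ p, planeWave lam p * ((planeWave lam p)⁻¹ * Φ p) = Φ p := congrFun e
    rw [e] at h1
    simp only [e'] at h1
    exact sub_eq_zero.1 h1

variable {v₀ : ℝ × ℝ → ℝ}

lemma spectral_real (hv : (fun p => (v₀ p : ℂ)) =ᵐ[volume] V) {φ : ℝ × ℝ → ℝ} (hφ : IsTest φ) :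
    ∫ p, (-dy φ p - dx (dx φ) p + (u0 κ p.1 + v₀ p) * φ p) • Ψ p =
    ∫ p, (-pd ey (fun p => (φ p : ℂ)) p - pd ex (pd ex fun p => (φ p : ℂ)) p +
      (uc κ p.1 + V p) * φ p) * Ψ p := by
  refine integral_congr_ae ?_
  filter_upwards [hv] with p hp
  have e : pd ex (fun p => (φ p : ℂ)) = fun p => (dx φ p : ℂ) := by
    ext p; exact (ofReal_dx hφ p).symm
  rw [Complex.real_smul, ← hp, ← ofReal_u0, e, ← ofReal_dx hφ.dx, ← ofReal_dy hφ]
  push_cast; ring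

lemma solves_iff_spectral (hV : BM V) (hv : (fun p => (v₀ p : ℂ)) =ᵐ[volume] V)
    (hΨ : LocallyIntegrable Ψ) :
    (∀ φ : ℝ × ℝ → ℝ, IsTest φ →
      ∫ p, (-dy φ p - dx (dx φ) p + (u0 κ p.1 + v₀ p) * φ p) • Ψ p = 0) ↔
    ∀ Θ, CTest Θ →
      ∫ p, (-pd ey Θ p - pd ex (pd ex Θ) p + (uc κ p.1 + V p) * Θ p) * Ψ p = 0 := by
  constructor
  · intro h Θ hΘ
    have t1 := CTest.ofReal hΘ.re
    have t2 := CTest.ofReal hΘ.im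
    have h1 := h _ hΘ.re
    have h2 := h _ hΘ.im
    rw [spectral_real hv hΘ.re] at h1
    rw [spectral_real hv hΘ.im] at h2
    have i1 := integrable_spectral (κ := κ) hV hΨ t1
    have i2 := (integrable_spectral (κ := κ) hV hΨ t2).const_mul Complex.I
    have e0 : ∀ (e : ℝ × ℝ) {f g : ℝ × ℝ → ℂ}, CTest f → CTest g →
        pd e (fun p => f p + Complex.I * g p) = fun p => pd e f p + Complex.I * pd e g p := by
      intro e f g hf hg
      rw [pd_add e hf.differentiable (hg.const_mul _).differentiable, pd_const_mul e hg.differentiable]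
    calc _ = ∫ p, ((-pd ey (fun p => ((Θ p).re : ℂ)) p - pd ex (pd ex fun p => ((Θ p).re : ℂ)) p +
          (uc κ p.1 + V p) * (Θ p).re) * Ψ p + Complex.I *
          ((-pd ey (fun p => ((Θ p).im : ℂ)) p - pd ex (pd ex fun p => ((Θ p).im : ℂ)) p +
          (uc κ p.1 + V p) * (Θ p).im) * Ψ p)) := by
          refine integral_congr_ae (ae_of_all _ fun p => ?_)
          conv_lhs => rw [eq_re_add_im Θ]
          simp only [e0 _ t1 t2, e0 _ (t1.pd ex) (t2.pd ex)]
          ring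
      _ = 0 := by rw [integral_add i1 i2, integral_const_mul, h1, h2]; simp
  · intro h φ hφ
    rw [spectral_real hv hφ]
    exact h _ (CTest.ofReal hφ)

/-- Eigenfunctions in terms of the gauged equation. -/
lemma isEigenfunction_iff (hV : BM V) (hv : (fun p => (v₀ p : ℂ)) =ᵐ[volume] V) :
    IsEigenfunction κ v₀ lam m ↔ LocallyIntegrable m ∧
      Sol lam m (fun p => -((uc κ p.1 + V p) * m p)) ∧ BoundaryCondition κ lam m := by
  have hE := (contDiff_planeWave lam).continuous
  have hE' := (contDiff_planeWave_inv lam).continuous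
  have hloc : LocallyIntegrable (fun p => m p * planeWave lam p) ↔ LocallyIntegrable m := by
    constructor
    · intro h
      refine (h.mul_continuous hE').congr (ae_of_all _ fun p => ?_)
      simp only [mul_assoc, mul_inv_cancel₀ (planeWave_ne_zero lam p), mul_one]
    · exact fun h => h.mul_continuous hE
  constructor
  · rintro ⟨h1, h2⟩
    have hm := hloc.1 h1.locInt
    exact ⟨hm, (sol_iff_spectral hV hm).2
      ((solves_iff_spectral hV hv h1.locInt).1 h1.integral_eq_zero), h2⟩
  · rintro ⟨hm, h1, h2⟩
    exact ⟨⟨hloc.2 hm, (solves_iff_spectral hV hv (hloc.2 hm)).2 ((sol_iff_spectral hV hm).1 h1)⟩, h2⟩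

end

/-! ### Regularity and conclusion -/

/-- The product of a bounded measurable and a locally integrable function is locally integrable. -/
lemma BM.locallyIntegrable_mul {f g : ℝ × ℝ → ℂ} (hf : BM f) (hg : LocallyIntegrable g) :
    LocallyIntegrable fun p => f p * g p := fun p => by
  obtain ⟨U, hU, hi⟩ := hg p
  obtain ⟨C, hC⟩ := hf.bdd
  exact ⟨U, hU, Integrable.bdd_mul (c := C) hi hf.meas.aestronglyMeasurable (ae_of_all _ hC)⟩

/-- The mixed partial derivatives of the soliton. -/
def ucGrid (κ : ℝ) (j k : ℕ) : ℝ × ℝ → ℂ :=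
  match j, k with
  | 0, 0 => fun p => uc κ p.1
  | 0, 1 => fun p => 4 * κ ^ 3 * tc κ p * (1 - tc κ p ^ 2)
  | 0, _ => fun p => 4 * κ ^ 4 * (1 - tc κ p ^ 2) * (1 - 3 * tc κ p ^ 2)
  | _, _ => fun _ => 0

lemma grid_ucGrid (κ : ℝ) : Grid (ucGrid κ) := by
  have ht := bm_tc κ
  have htt : BM fun p => tc κ p ^ 2 := by simpa only [sq] using ht.mul ht
  have h1 : BM fun p => 1 - tc κ p ^ 2 := (BM.const 1).sub htt
  have b1 : BM fun p => 4 * (κ : ℂ) ^ 3 * tc κ p * (1 - tc κ p ^ 2) := (ht.const_mul _).mul h1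
  have b2 : BM fun p => 4 * (κ : ℂ) ^ 4 * (1 - tc κ p ^ 2) * (1 - 3 * tc κ p ^ 2) :=
    (h1.const_mul _).mul ((BM.const 1).sub (htt.const_mul 3))
  have s0 := contDiff_uc κ
  have st := contDiff_tc κ
  have s1 : ContDiff ℝ ∞ fun p => 4 * (κ : ℂ) ^ 3 * tc κ p * (1 - tc κ p ^ 2) := by fun_prop
  have s2 : ContDiff ℝ ∞ fun p => 4 * (κ : ℂ) ^ 4 * (1 - tc κ p ^ 2) * (1 - 3 * tc κ p ^ 2) := by
    fun_prop
  have hx1 : WD ex (fun p => uc κ p.1) fun p => 4 * (κ : ℂ) ^ 3 * tc κ p * (1 - tc κ p ^ 2) := by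
    rw [← pd_ex_uc]; exact WD.of_smooth s0
  have hx2 : WD ex (fun p => 4 * (κ : ℂ) ^ 3 * tc κ p * (1 - tc κ p ^ 2))
      fun p => 4 * (κ : ℂ) ^ 4 * (1 - tc κ p ^ 2) * (1 - 3 * tc κ p ^ 2) := by
    have e : pd ex (fun p => 4 * (κ : ℂ) ^ 3 * tc κ p * (1 - tc κ p ^ 2)) =
        fun p => 4 * (κ : ℂ) ^ 4 * (1 - tc κ p ^ 2) * (1 - 3 * tc κ p ^ 2) := by
      ext p
      refine pd_ex_of_hasDerivAt (s1.differentiable (by simp)) ?_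
      exact (((hasDerivAt_thc κ p.1).const_mul (4 * (κ : ℂ) ^ 3)).mul
        (hasDerivAt_one_sub_thc_sq κ p.1)).congr_deriv (by simp only [tc]; ring)
    rw [← e]; exact WD.of_smooth s1
  have hy : ∀ f : ℝ → ℂ, ContDiff ℝ ∞ (fun p : ℝ × ℝ => f p.1) → WD ey (fun p => f p.1) fun _ => 0 := by
    intro f hf
    have e : pd ey (fun p : ℝ × ℝ => f p.1) = fun _ => 0 := by
      ext p
      exact pd_ey_of_hasDerivAt (hf.differentiable (by simp)) (hasDerivAt_const p.2 (f p.1))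
    rw [← e]; exact WD.of_smooth hf
  have h0 : ∀ e, WD e (fun _ => 0) fun _ => 0 := fun e Φ _ => by simp
  have z := BM.const 0
  have y0 := hy (uc κ) s0
  have y1 := hy (fun x => 4 * (κ : ℂ) ^ 3 * th κ x * (1 - (th κ x : ℂ) ^ 2)) s1
  have y2 := hy (fun x => 4 * (κ : ℂ) ^ 4 * (1 - (th κ x : ℂ) ^ 2) * (1 - 3 * (th κ x : ℂ) ^ 2)) s2
  refine ⟨fun j k hj hk => ?_, fun j k hj hk => ?_, fun j k hj hk => ?_⟩
  · have := bm_uc κ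
    interval_cases j <;> interval_cases k <;> assumption
  · have := h0 ex
    interval_cases j <;> interval_cases k <;> assumption
  · have := h0 ey
    interval_cases j <;> interval_cases k <;> assumption

lemma Grid.add {f g : ℕ → ℕ → ℝ × ℝ → ℂ} (hf : Grid f) (hg : Grid g) :
    Grid fun j k p => f j k p + g j k p where
  bm j k hj hk := (hf.bm j k hj hk).add (hg.bm j k hj hk)
  wx j k hj hk := (hf.wx j k hj hk).add_bm (hg.wx j k hj hk) (hf.bm j k hj hk.le)
    (hf.bm j (k + 1) hj hk) (hg.bm j k hj hk.le) (hg.bm j (k + 1) hj hk)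
  wy j k hj hk := (hf.wy j k hj hk).add_bm (hg.wy j k hj hk) (hf.bm j k hj.le hk)
    (hf.bm (j + 1) k hj hk) (hg.bm j k hj.le hk) (hg.bm (j + 1) k hj hk)

/-- Bounded solutions have bounded mixed weak derivatives up to order two in each variable. -/
theorem Sol.hasWeakPartial {lam : ℂ} {m : ℝ × ℝ → ℂ} {V : ℕ → ℕ → ℝ × ℝ → ℂ} (hV : Grid V)
    (hm : BM m) (h : Sol lam m fun p => -(V 0 0 p * m p)) (j k : ℕ) (hj : j ≤ 2) (hk : k ≤ 2) :
    ∃ g : ℝ × ℝ → ℂ, HasWeakPartial j k m g ∧ MemLp g ⊤ volume := by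
  obtain ⟨M, h0, hb, hx, hy⟩ := h.regularity hV hm
  have h1 : ∀ j ≤ 2, HasWeakPartial j 0 m (M j 0) := by
    intro j
    induction j with
    | zero => intro _; rw [h0]; exact HasWeakPartial.refl hm
    | succ j ih => exact fun hj => (ih (by omega)).step_y (hb _ _ hj (by norm_num)) (hy j (by omega))
  have h2 : ∀ k ≤ 2, HasWeakPartial j k m (M j k) := by
    intro k
    induction k with
    | zero => exact fun _ => h1 j hj
    | succ k ih => exact fun hk => (ih (by omega)).step_x (hb _ _ hj hk) (hx j k hj (by omega))
  exact ⟨M j k, h2 k hk, (hb j k hj hk).memLp_top⟩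

lemma small_of_eLpNorm {v₀ : ℝ × ℝ → ℝ} {V : ℝ × ℝ → ℂ} {ε : ℝ} (hε : 0 ≤ ε) (hV : BM V)
    (hv : (fun p => (v₀ p : ℂ)) =ᵐ[volume] V)
    (h : eLpNorm v₀ 1 volume + eLpNorm v₀ ⊤ volume ≤ ENNReal.ofReal ε) :
    Integrable V ∧ (∫ p, ‖V p‖ ≤ ε) ∧ ∀ᵐ p, ‖V p‖ ≤ ε := by
  have hn : ∀ q, eLpNorm V q volume = eLpNorm v₀ q volume := fun q => by
    rw [← eLpNorm_congr_ae hv]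
    exact eLpNorm_congr_norm_ae (ae_of_all _ fun p => by simp)
  have h1 : eLpNorm V 1 volume ≤ ENNReal.ofReal ε := by rw [hn]; exact le_self_add.trans h
  have h2 : eLpNorm V ⊤ volume ≤ ENNReal.ofReal ε := by rw [hn]; exact le_add_self.trans h
  have hi : Integrable V := memLp_one_iff_integrable.1
    ⟨hV.meas.aestronglyMeasurable, h1.trans_lt ENNReal.ofReal_lt_top⟩
  refine ⟨hi, ?_, ?_⟩
  · rw [integral_norm_eq_lintegral_enorm hi.1, ← eLpNorm_one_eq_lintegral_enorm]
    exact ENNReal.toReal_le_of_le_ofReal hε h1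
  · rw [eLpNorm_exponent_top] at h2
    filter_upwards [ae_le_eLpNormEssSup (f := V) (μ := volume)] with p hp
    rw [← toReal_enorm]
    exact ENNReal.toReal_le_of_le_ofReal hε (hp.trans h2)

end KPII

end

theorem theoremT (κ : ℝ) (hκ : 0 < κ) :
    ∃ ε : ℝ, 0 < ε ∧ ∀ v₀ : ℝ × ℝ → ℝ,
      (∀ j k : ℕ, j ≤ 2 → k ≤ 2 → ∃ g : ℝ × ℝ → ℝ, KPII.HasWeakPartial j k v₀ g ∧
        MeasureTheory.MemLp g 1 MeasureTheory.volume ∧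
        MeasureTheory.MemLp g ⊤ MeasureTheory.volume) →
      MeasureTheory.eLpNorm v₀ 1 MeasureTheory.volume
        + MeasureTheory.eLpNorm v₀ ⊤ MeasureTheory.volume ≤ ENNReal.ofReal ε →
      ∀ lam : ℂ, lam ≠ Complex.I * κ → lam ≠ -(Complex.I * κ) →
        ∃ m : ℝ × ℝ → ℂ,
          KPII.IsEigenfunction κ v₀ lam m ∧
          (∀ m' : ℝ × ℝ → ℂ, KPII.IsEigenfunction κ v₀ lam m' →
            m' =ᵐ[MeasureTheory.volume] m) ∧
          (∀ j k : ℕ, j ≤ 2 → k ≤ 2 → ∃ g : ℝ × ℝ → ℂ, KPII.HasWeakPartial j k m g ∧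
            MeasureTheory.MemLp g ⊤ MeasureTheory.volume) := by
  -- Chosen so that (2 + 34κ)ε + 16ε = 1/2, the contraction constant required of the Green operator.
  refine ⟨1 / (2 * (18 + 34 * κ)), by positivity, fun v₀ hv₀ hsmall lam hne hne' => ?_⟩
  set ε := 1 / (2 * (18 + 34 * κ)) with hε
  have hε0 : 0 ≤ ε := by positivity
  have hεκ : (18 + 34 * κ) * ε = 1 / 2 := by rw [hε]; field_simp
  obtain ⟨V, hV, hv⟩ := KPII.exists_grid (v := v₀) fun j k hj hk => by
    obtain ⟨g, h1, -, h2⟩ := hv₀ j k hj hk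
    exact ⟨g, h1, h2⟩
  have hVb := hV.bm 0 0 (by norm_num) (by norm_num)
  obtain ⟨hVi, hV1, hVD⟩ := KPII.small_of_eLpNorm hε0 hVb hv hsmall
  have hs : (2 + 34 * κ) * (∫ p, ‖V 0 0 p‖) + 16 * ε ≤ 1 / 2 := by
    have := mul_le_mul_of_nonneg_left hV1 (by positivity : 0 ≤ 2 + 34 * κ)
    linarith
  obtain ⟨K, hK⟩ := KPII.exists_isGreen hκ hne hne'
  have hθ := KPII.bm_theta κ lam
  obtain ⟨m, hm, hmeq⟩ := hK.exists_solution hκ.le hVb hVi hVD hε0 hs hθ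
  have hVm : Integrable fun p => V 0 0 p * m p := by
    simpa only [mul_comm] using hm.integrable_mul hVi
  have hVmb := hVb.mul hm
  have hG := hK.bm_gop hVm hVmb
  have hu := KPII.bm_uc κ
  have hF := (hVmb.sub (hu.mul hG)).const_mul (-1)
  -- The soliton operator annihilates ϑ₋ and maps -G(Vm) to -Vm, so m = ϑ₋ - G(Vm) solves the
  -- perturbed equation.
  have hsol : KPII.Sol lam m fun p => -((KPII.uc κ p.1 + V 0 0 p) * m p) := by
    refine (KPII.Sol.add hθ.locallyIntegrable (hu.mul hθ).neg.locallyIntegrable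
      (hG.const_mul (-1)).locallyIntegrable hF.locallyIntegrable (KPII.sol_theta hne)
      ((hK.sol_gop hVm hVmb).const_mul (-1))).congr (ae_of_all _ fun p => ?_)
      (ae_of_all _ fun p => ?_)
    · rw [hmeq]; ring
    · have := hmeq p
      linear_combination (KPII.uc κ p.1) * this
  have hbc : KPII.BoundaryCondition κ lam m := by
    have h1 := (hK.van_gop hκ.le hVm hVmb).neg
    rw [neg_zero] at h1
    refine (h1.mono_left inf_le_left).congr fun p => ?_
    rw [hmeq]; ring
  refine ⟨m, (KPII.isEigenfunction_iff hVb hv).2 ⟨hm.locallyIntegrable, hsol, hbc⟩,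
    fun m' hm' => ?_, fun j k hj hk => ?_⟩
  · obtain ⟨hl', hsol', hbc'⟩ := (KPII.isEigenfunction_iff hVb hv).1 hm'
    have hW := hu.add hVb
    have hlw : LocallyIntegrable fun p => m' p + -1 * m p :=
      hl'.add (hm.const_mul (-1)).locallyIntegrable
    have hlF' : LocallyIntegrable fun p => -((KPII.uc κ p.1 + V 0 0 p) * m' p) :=
      (hW.locallyIntegrable_mul hl').neg
    have hsw : KPII.Sol lam (fun p => m' p + -1 * m p)
        fun p => -((KPII.uc κ p.1 + V 0 0 p) * (m' p + -1 * m p)) :=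
      (KPII.Sol.add hl' hlF' (hm.const_mul (-1)).locallyIntegrable
        ((hW.mul hm).neg.const_mul (-1)).locallyIntegrable hsol' (hsol.const_mul (-1))).congr
        (ae_of_all _ fun _ => rfl) (ae_of_all _ fun p => by ring)
    have hvw : Tendsto (fun p => m' p + -1 * m p) (cocompact (ℝ × ℝ) ⊓ ae volume) (𝓝 0) := by
      have h1 := Tendsto.sub hbc' hbc
      rw [sub_zero] at h1
      exact h1.congr fun p => by ring
    -- The competing solution is only locally integrable, so the difference has to be replaced by a
    -- bounded vanishing representative before the contraction argument applies.
    obtain ⟨w, hwb, hwv, hww⟩ := KPII.Sol.exists_bounded_rep hlw hvw hW hsw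
    have h0 := hK.eq_zero hκ.le hVb hVi hVD hε0 hs hwb hwv
      (hsw.congr hww (hww.mono fun p hp => by simp only [hp]))
    filter_upwards [hww, h0] with p h1 h2
    have h3 : m' p + -1 * m p = 0 := by rw [h1, h2]; rfl
    linear_combination h3
  · exact KPII.Sol.hasWeakPartial ((KPII.grid_ucGrid κ).add hV) hm hsol j k hj hk
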